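/- **Algebra.** Let $k$ be a field and $C$ a coalgebra over $k$, with $\Delta(c)=c_{(1)}\otimes c_{(2)}$; $C^{cop}$ is $C$ with coproduct $c\mapsto c_{(2)}\otimes c_{(1)}$. The dual $C^*$ is an algebra with product $(fg)(c)=f(c_{(1)})g(c_{(2)})$ and unit $\epsilon$, and $f\rightharpoonup c=c_{(1)}f(c_{(2)})$, $c\leftharpoonup f=f(c_{(1)})c_{(2)}$. A *strict oriented quantum coalgebra* $(C,b,T_d,T_u)$ consists of $C$, a bilinear form $b:C\times C\to k$ with an inverse $b^{-1}$ (that is, $b^{-1}(c_{(1)},d_{(1)})b(c_{(2)},d_{(2)})=\epsilon(c)\epsilon(d)=b(c_{(1)},d_{(1)})b^{-1}(c_{(2)},d_{(2)})$) and commuting coalgebra automorphisms $T_d,T_u$ of $C$ such that for all $c,d,e\in C$: * $b(c_{(1)},T_u(d_{(2)}))\,b^{-1}(T_d(c_{(2)}),d_{(1)})=\epsilon(c)\epsilon(d)=b^{-1}(T_d(c_{(1)}),d_{(2)})\,b(c_{(2)},T_u(d_{(1)}))$, * $b(c,d)=b(T_d(c),T_d(d))=b(T_u(c),T_u(d))$,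 * $b(c_{(1)},d_{(1)})b(c_{(2)},e_{(1)})b(d_{(2)},e_{(2)})=b(c_{(2)},d_{(2)})b(c_{(1)},e_{(2)})b(d_{(1)},e_{(1)})$. A *twist oriented quantum coalgebra* $(C,b,T_d,T_u,G)$ is a strict oriented quantum coalgebra with an invertible $G\in C^*$ such that $G\circ T_d=G\circ T_u=G$ and $T_d\circ T_u(c)=G^{-1}\rightharpoonup c\leftharpoonup G$ for all $c$. Then $(C^{cop},b,T_d,T_u,G^{-1})$ is one as well. **Diagrams.** Oriented link diagrams are taken with respect to the vertical direction: they are built from crossings (two transverse lines, each going up or down), local maxima, local minima and vertical lines. A knot diagram is a non-empty link diagram with one component. A 1–1 tangle diagram has one component, an arc with one end at the bottom and the other at the top, oriented upward or downward; its closure $K(T)$ joins the two ends by a maximum, a line passing on the left of $T$, and a minimum. Regular isotopy is the equivalence relation generated by planar isotopy respecting the vertical direction (interchanging the heights of distant parts) and the following local moves, with all orientations: straightening a zigzag formed by a maximum and a minimum; cancelling two successive opposite crossings of two strands; the braid relation for three crossings of the same type (the same one of the two lines, $/$ or $\backslash$, being over at each); sliding a strand, over or under, across a maximum or a minimum. The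 Whitney degree $d$ of a knot diagram is half the number of its local extrema with clockwise orientation minus half the number of those with counterclockwise orientation. **The functional.** Traverse a 1–1 tangle diagram from its base point to its end point, or a knot diagram from a chosen starting point $P$ once around back to $P$, in the direction of the orientation, and label the crossing lines $1,\dots,2n$ in the order encountered. For a crossing line $i$ let $u_d(i)$ be the number of maxima traversed from right to left minus the number of minima traversed from right to left, and $u_u(i)$ the number of minima traversed from left to right minus the number of maxima traversed from left to right, between line $i$ and the end of the traversal. Put $X_i=T_d^{u_d(i)}T_u^{u_u(i)}(c_{(i)})$, where $\Delta^{(2n-1)}(c)=c_{(1)}\otimes\dots\otimes c_{(2n)}$. A crossing with over line $i$ and under line $j$ contributes the following factor. If the over line runs between lower left and upper right: * $b(X_i,X_j)$ if both lines go up or both go down; * $b^{-1}(T_u(X_i),X_j)$ if both go to the right; * $b^{-1}(T_d(X_i),X_j)$ if both go to the left. If the over line runs between lower right and upper left: * $b^{-1}(X_i,X_j)$ if both lines go up or both go down; * $b(X_i,T_u(X_j))$ if both go to the right; * $b(X_i,T_d(X_j))$ if both go to the left. The sum (over the components of $\Delta^{(2n-1)}(c)$) of the products of these factors is the value at $c$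 of a functional in $C^*$ (it is $\epsilon$ if there are no crossings), written $\mathrm{Inv}_C(T)$ for a 1–1 tangle diagram $T$ and $\mathbf f=\mathbf f_{K,P}$ for a knot diagram $K$ with starting point $P$. **Theorem.** Let $(C,b,T_d,T_u,G)$ be a twist oriented quantum coalgebra over $k$ and let $\mathsf c\in C$ be cocommutative ($\Delta(\mathsf c)=\mathsf c_{(2)}\otimes\mathsf c_{(1)}$) with $T_d(T_u(\mathsf c))=\mathsf c$. For an oriented knot diagram $K$ of Whitney degree $d$ put $\mathbf f_{C,\mathsf c}(K)=(G^d\,\mathbf f_{K,P})(\mathsf c)$. 0. $(G^d\,\mathbf f_{K,P})(\mathsf c)$ does not depend on the starting point $P$. 1. If $K$ and $K'$ are regularly isotopic oriented knot diagrams, then $\mathbf f_{C,\mathsf c}(K)=\mathbf f_{C,\mathsf c}(K')$. 2. If $K$ is regularly isotopic to $K(T)$ for an oriented 1–1 tangle diagram $T$, then $\mathbf f_{C,\mathsf c}(K)=(G^d\,\mathrm{Inv}_C(T))(\mathsf c)$, where $d$ is the Whitney degree of $K$. 3. $\mathbf f_{C,\mathsf c}(K^{op})=\mathbf f_{C^{cop},\mathsf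 c}(K)$ for every oriented knot diagram $K$, where $K^{op}$ is $K$ with the opposite orientation and $C^{cop}$ stands for the twist oriented quantum coalgebra $(C^{cop},b,T_d,T_u,G^{-1})$. -/

import Mathlib

open scoped TensorProduct

/-! ## Twist oriented quantum coalgebras -/

section Coalgebras

open Coalgebra

universe u v

/-- The underlying space of a coalgebra, to be given the opposite coproduct. -/
def Cop (C : Type v) : Type v := C

instance Cop.instAddCommGroup (C : Type v) [AddCommGroup C] : AddCommGroup (Cop C) :=
  inferInstanceAs (AddCommGroup C)

instance Cop.instModule (k : Type u) (C : Type v) [Field k] [AddCommGroup C] [Module k C] :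
    Module k (Cop C) :=
  inferInstanceAs (Module k C)

/-- The identity map from a coalgebra to its opposite coalgebra. -/
def Cop.equiv (k : Type u) (C : Type v) [Field k] [AddCommGroup C] [Module k C] :
    C ≃ₗ[k] Cop C :=
  LinearEquiv.refl k C

variable {k : Type u} {C : Type v} [Field k] [AddCommGroup C] [Module k C] [Coalgebra k C]

/-- The coalgebra `C^cop`: its coproduct is `c ↦ c₍₂₎ ⊗ c₍₁₎` and its counit is that of `C`. -/
noncomputable instance Cop.instCoalgebraStruct : CoalgebraStruct k (Cop C) where
  comul := ((TensorProduct.comm k C C).toLinearMap ∘ₗ (comul : C →ₗ[k] C ⊗[k] C) :)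
  counit := (counit : C →ₗ[k] k)

/-- Interchanging the legs of a Sweedler representation. -/
noncomputable def Cop.repr {c : C} {ι : Type*} (x : Coalgebra.Repr k c ι) :
    Coalgebra.Repr k (Cop.equiv k C c) ι where
  index := x.index
  left := x.right
  right := x.left
  eq := by
    change _ = TensorProduct.comm k C C (comul c)
    rw [← x.eq, map_sum]
    rfl

/-- Interchanging the legs of a Sweedler representation. -/
noncomputable def Cop.unrepr {c : C} {ι : Type*} (x : Coalgebra.Repr k (Cop.equiv k C c) ι) :
    Coalgebra.Repr k c ι where
  index := x.index
  left := x.right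
  right := x.left
  eq := by
    have h : ∑ i ∈ x.index, (show C from x.left i) ⊗ₜ[k] (show C from x.right i)
        = TensorProduct.comm k C C (comul c) := x.eq
    have h2 := congrArg (TensorProduct.comm k C C) h
    rw [map_sum] at h2
    rw [TensorProduct.comm_comm] at h2
    rw [← h2]
    exact Finset.sum_congr rfl fun i _ => rfl

theorem Cop.coassoc_aux :
    (TensorProduct.assoc k C C C).toLinearMap ∘ₗ
      ((TensorProduct.comm k C C).toLinearMap ∘ₗ (comul : C →ₗ[k] C ⊗[k] C)).rTensor C ∘ₗ
      ((TensorProduct.comm k C C).toLinearMap ∘ₗ (comul : C →ₗ[k] C ⊗[k] C)) =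
    ((TensorProduct.comm k C C).toLinearMap ∘ₗ (comul : C →ₗ[k] C ⊗[k] C)).lTensor C ∘ₗ
      ((TensorProduct.comm k C C).toLinearMap ∘ₗ (comul : C →ₗ[k] C ⊗[k] C)) := by
  let σ : C ⊗[k] (C ⊗[k] C) →ₗ[k] C ⊗[k] (C ⊗[k] C) :=
    (TensorProduct.assoc k C C C).toLinearMap ∘ₗ
      (TensorProduct.comm k C (C ⊗[k] C)).toLinearMap ∘ₗ
      (TensorProduct.comm k C C).toLinearMap.lTensor C
  have h1 : (TensorProduct.assoc k C C C).toLinearMap ∘ₗ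
      ((TensorProduct.comm k C C).toLinearMap ∘ₗ (comul : C →ₗ[k] C ⊗[k] C)).rTensor C ∘ₗ
      (TensorProduct.comm k C C).toLinearMap = σ ∘ₗ (comul : C →ₗ[k] C ⊗[k] C).lTensor C := by
    refine TensorProduct.ext' fun x y => ?_
    simp [σ]
  have h2 : ((TensorProduct.comm k C C).toLinearMap ∘ₗ (comul : C →ₗ[k] C ⊗[k] C)).lTensor C ∘ₗ
      (TensorProduct.comm k C C).toLinearMap =
      σ ∘ₗ (TensorProduct.assoc k C C C).toLinearMap ∘ₗ
        (comul : C →ₗ[k] C ⊗[k] C).rTensor C := by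
    refine TensorProduct.ext' fun x y => ?_
    have h3 : ∀ u : C ⊗[k] C, y ⊗ₜ[k] (TensorProduct.comm k C C) u =
        σ ((TensorProduct.assoc k C C C) (u ⊗ₜ[k] y)) := by
      intro u
      induction u with
      | zero => simp
      | tmul a b => simp [σ]
      | add a b ha hb => simp [TensorProduct.tmul_add, TensorProduct.add_tmul, ha, hb]
    simpa using h3 (comul x)
  ext c
  have e1 := LinearMap.congr_fun h1 (comul c)
  have e2 := LinearMap.congr_fun h2 (comul c)
  simp only [LinearMap.comp_apply, LinearEquiv.coe_coe] at e1 e2 ⊢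
  rw [e1, e2, coassoc_apply]

noncomputable instance Cop.instCoalgebra : Coalgebra k (Cop C) where
  coassoc := Cop.coassoc_aux (k := k) (C := C)
  rTensor_counit_comp_comul := by
    have h : (counit : C →ₗ[k] k).rTensor C ∘ₗ
        ((TensorProduct.comm k C C).toLinearMap ∘ₗ (comul : C →ₗ[k] C ⊗[k] C)) =
        TensorProduct.mk k k C 1 := by
      ext c
      have e := congrArg (TensorProduct.comm k C k) (sum_tmul_counit_eq (ℛ k c))
      rw [map_sum] at e
      simpa only [← (ℛ k c).eq, LinearMap.comp_apply, LinearEquiv.coe_coe, map_sum,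
        TensorProduct.comm_tmul, LinearMap.rTensor_tmul, TensorProduct.mk_apply] using e
    exact h
  lTensor_counit_comp_comul := by
    have h : (counit : C →ₗ[k] k).lTensor C ∘ₗ
        ((TensorProduct.comm k C C).toLinearMap ∘ₗ (comul : C →ₗ[k] C ⊗[k] C)) =
        (TensorProduct.mk k C k).flip 1 := by
      ext c
      have e := congrArg (TensorProduct.comm k k C) (sum_counit_tmul_eq (ℛ k c))
      rw [map_sum] at e
      simpa only [← (ℛ k c).eq, LinearMap.comp_apply, LinearEquiv.coe_coe, map_sum,
        TensorProduct.comm_tmul, LinearMap.lTensor_tmul, TensorProduct.mk_apply,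
        LinearMap.flip_apply] using e
    exact h

/-- A coalgebra automorphism, seen as a coalgebra automorphism of the opposite coalgebra. -/
noncomputable def Cop.mapEquiv (T : C ≃ₗc[k] C) : Cop C ≃ₗc[k] Cop C :=
  { ((Cop.equiv k C).symm.trans (T : C ≃ₗ[k] C)).trans (Cop.equiv k C) with
    counit_comp := (CoalgHomClass.counit_comp T :)
    map_comp_comul := by
      have h : TensorProduct.map (T : C →ₗ[k] C) (T : C →ₗ[k] C) ∘ₗ
          ((TensorProduct.comm k C C).toLinearMap ∘ₗ (comul : C →ₗ[k] C ⊗[k] C)) =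
          ((TensorProduct.comm k C C).toLinearMap ∘ₗ (comul : C →ₗ[k] C ⊗[k] C)) ∘ₗ
            (T : C →ₗ[k] C) := by
        have e := CoalgHomClass.map_comp_comul T
        rw [LinearMap.comp_assoc]
        refine Eq.trans ?_ (congrArg (fun g => (TensorProduct.comm k C C).toLinearMap ∘ₗ g) e)
        rw [← LinearMap.comp_assoc, ← LinearMap.comp_assoc, TensorProduct.map_comp_comm_eq]
        rfl
      exact h }

/-- A linear form on `C`, seen as a linear form on the opposite coalgebra. -/
noncomputable def Cop.form (f : WithConv (C →ₗ[k] k)) : WithConv (Cop C →ₗ[k] k) :=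
  WithConv.toConv (f.ofConv ∘ₗ (Cop.equiv k C).symm.toLinearMap)

/-- An element is cocommutative if its coproduct is invariant under interchanging the factors. -/
def IsCocommutativeElement (k : Type u) {C : Type v} [Field k] [AddCommGroup C] [Module k C]
    [Coalgebra k C] (c : C) : Prop :=
  TensorProduct.comm k C C (comul c) = comul c

/-- The left action `f ⇀ c = c₍₁₎ f(c₍₂₎)` of the dual algebra on `C`. -/
noncomputable def hitLeft (f : WithConv (C →ₗ[k] k)) (c : C) : C :=
  TensorProduct.rid k C (f.ofConv.lTensor C (comul c))

/-- The right action `c ↼ f = f(c₍₁₎) c₍₂₎` of the dual algebra on `C`. -/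
noncomputable def hitRight (c : C) (f : WithConv (C →ₗ[k] k)) : C :=
  TensorProduct.lid k C (f.ofConv.rTensor C (comul c))

/-- A strict oriented quantum coalgebra `(C, b, T_d, T_u)`. The inverse of the bilinear form `b`
is unique, and is recorded as `bInv`. Sweedler sums are written through arbitrary
representations of the coproducts of the elements involved. -/
structure StrictOrientedQuantumCoalgebra (k : Type u) (C : Type v) [Field k] [AddCommGroup C]
    [Module k C] [Coalgebra k C] where
  /-- the bilinear form `b` -/
  b : C →ₗ[k] C →ₗ[k] k
  /-- the inverse of the bilinear form `b` -/
  bInv : C →ₗ[k] C →ₗ[k] k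
  /-- the coalgebra automorphism `T_d` -/
  Td : C ≃ₗc[k] C
  /-- the coalgebra automorphism `T_u` -/
  Tu : C ≃ₗc[k] C
  Td_Tu_comm : ∀ c, Td (Tu c) = Tu (Td c)
  bInv_mul_b : ∀ (c d : C) {ι κ : Type v} (x : Coalgebra.Repr k c ι) (y : Coalgebra.Repr k d κ),
    ∑ i ∈ x.index, ∑ j ∈ y.index, bInv (x.left i) (y.left j) * b (x.right i) (y.right j) =
      counit (R := k) c * counit (R := k) d
  b_mul_bInv : ∀ (c d : C) {ι κ : Type v} (x : Coalgebra.Repr k c ι) (y : Coalgebra.Repr k d κ),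
    ∑ i ∈ x.index, ∑ j ∈ y.index, b (x.left i) (y.left j) * bInv (x.right i) (y.right j) =
      counit (R := k) c * counit (R := k) d
  qc1 : ∀ (c d : C) {ι κ : Type v} (x : Coalgebra.Repr k c ι) (y : Coalgebra.Repr k d κ),
    ∑ i ∈ x.index, ∑ j ∈ y.index,
        b (x.left i) (Tu (y.right j)) * bInv (Td (x.right i)) (y.left j) =
      counit (R := k) c * counit (R := k) d
  qc1' : ∀ (c d : C) {ι κ : Type v} (x : Coalgebra.Repr k c ι) (y : Coalgebra.Repr k d κ),
    ∑ i ∈ x.index, ∑ j ∈ y.index,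
        bInv (Td (x.left i)) (y.right j) * b (x.right i) (Tu (y.left j)) =
      counit (R := k) c * counit (R := k) d
  qc2_d : ∀ c d, b (Td c) (Td d) = b c d
  qc2_u : ∀ c d, b (Tu c) (Tu d) = b c d
  qc3 : ∀ (c d e : C) {ι κ τ : Type v} (x : Coalgebra.Repr k c ι) (y : Coalgebra.Repr k d κ)
      (z : Coalgebra.Repr k e τ),
    ∑ i ∈ x.index, ∑ j ∈ y.index, ∑ l ∈ z.index,
        b (x.left i) (y.left j) * b (x.right i) (z.left l) * b (y.right j) (z.right l) =
    ∑ i ∈ x.index, ∑ j ∈ y.index, ∑ l ∈ z.index,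
        b (x.right i) (y.right j) * b (x.left i) (z.right l) * b (y.left j) (z.left l)

/-- A twist oriented quantum coalgebra `(C, b, T_d, T_u, G)`. The element `G` is a unit of the dual
algebra of `C`, that is, of the space of linear forms on `C` with the convolution product. -/
structure TwistOrientedQuantumCoalgebra (k : Type u) (C : Type v) [Field k] [AddCommGroup C]
    [Module k C] [Coalgebra k C] extends StrictOrientedQuantumCoalgebra k C where
  /-- the invertible functional `G` -/
  G : (WithConv (C →ₗ[k] k))ˣ
  G_Td : ∀ c, (G : WithConv (C →ₗ[k] k)) (Td c) = (G : WithConv (C →ₗ[k] k)) c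
  G_Tu : ∀ c, (G : WithConv (C →ₗ[k] k)) (Tu c) = (G : WithConv (C →ₗ[k] k)) c
  twist : ∀ c, Td (Tu c) =
    hitLeft ((G⁻¹ : (WithConv (C →ₗ[k] k))ˣ) : WithConv (C →ₗ[k] k)) 
      (hitRight (k := k) c (G : WithConv (C →ₗ[k] k)))

theorem Cop.form_mul (f g : WithConv (C →ₗ[k] k)) :
    Cop.form f * Cop.form g = Cop.form (g * f) := by
  ext c
  obtain ⟨c, rfl⟩ := (Cop.equiv k C).surjective c
  rw [(Cop.repr (ℛ k c)).convMul_apply]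
  refine Eq.trans ?_ ((ℛ k c).convMul_apply g f).symm
  exact Finset.sum_congr rfl fun i _ => mul_comm _ _

theorem Cop.form_one : Cop.form (1 : WithConv (C →ₗ[k] k)) = 1 := rfl

theorem hitRight_eq_sum (f : WithConv (C →ₗ[k] k)) {c : C} {ι : Type*}
    (x : Coalgebra.Repr k c ι) : hitRight c f = ∑ i ∈ x.index, f (x.left i) • x.right i := by
  simp [hitRight, ← x.eq]

theorem hitLeft_eq_sum (f : WithConv (C →ₗ[k] k)) {c : C} {ι : Type*}
    (x : Coalgebra.Repr k c ι) : hitLeft f c = ∑ i ∈ x.index, f (x.right i) • x.left i := by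
  simp [hitLeft, ← x.eq]

theorem hitLeft_hitRight_comm (f g : WithConv (C →ₗ[k] k)) (c : C) :
    hitLeft f (hitRight c g) = hitRight (hitLeft f c) g := by
  have h1 : ∀ t : C ⊗[k] C,
      TensorProduct.rid k C (f.ofConv.lTensor C
        (comul (TensorProduct.lid k C (g.ofConv.rTensor C t)))) =
      TensorProduct.lid k C (LinearMap.rTensor C g.ofConv (LinearMap.lTensor C
        ((TensorProduct.rid k C).toLinearMap ∘ₗ f.ofConv.lTensor C)
          ((comul : C →ₗ[k] C ⊗[k] C).lTensor C t))) := by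
    intro t
    induction t with
    | zero => simp
    | tmul a b => simp
    | add a b ha hb => simp only [map_add, ha, hb]
  have h2 : ∀ t : C ⊗[k] C,
      TensorProduct.lid k C (g.ofConv.rTensor C
        (comul (TensorProduct.rid k C (f.ofConv.lTensor C t)))) =
      TensorProduct.lid k C (LinearMap.rTensor C g.ofConv (LinearMap.lTensor C
        ((TensorProduct.rid k C).toLinearMap ∘ₗ f.ofConv.lTensor C)
          (TensorProduct.assoc k C C C ((comul : C →ₗ[k] C ⊗[k] C).rTensor C t)))) := by
    intro t
    induction t with
    | zero => simp
    | tmul a b =>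
      have h3 : ∀ u : C ⊗[k] C, f b • TensorProduct.lid k C (g.ofConv.rTensor C u) =
          TensorProduct.lid k C (LinearMap.rTensor C g.ofConv (LinearMap.lTensor C
            ((TensorProduct.rid k C).toLinearMap ∘ₗ f.ofConv.lTensor C)
              (TensorProduct.assoc k C C C (u ⊗ₜ[k] b)))) := by
        intro u
        induction u with
        | zero => simp
        | tmul x y => simp [smul_smul]
        | add x y hx hy => simp only [map_add, smul_add, TensorProduct.add_tmul, hx, hy]
      simpa using h3 (comul a)
    | add a b ha hb => simp only [map_add, ha, hb]
  rw [hitLeft, hitRight, hitRight, hitLeft, h1, h2, coassoc_apply]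

theorem Cop.hitRight_form (f : WithConv (C →ₗ[k] k)) (c : C) :
    hitRight (Cop.equiv k C c) (Cop.form f) = Cop.equiv k C (hitLeft f c) := by
  rw [hitLeft_eq_sum f (ℛ k c), hitRight_eq_sum _ (Cop.repr (ℛ k c)), map_sum]
  rfl

theorem Cop.hitLeft_form (f : WithConv (C →ₗ[k] k)) (c : C) :
    hitLeft (Cop.form f) (Cop.equiv k C c) = Cop.equiv k C (hitRight c f) := by
  rw [hitRight_eq_sum f (ℛ k c), hitLeft_eq_sum _ (Cop.repr (ℛ k c)), map_sum]
  rfl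

theorem TwistOrientedQuantumCoalgebra.inv_G_comp (Q : TwistOrientedQuantumCoalgebra k C)
    (T : C ≃ₗc[k] C)
    (hT : ∀ c, (Q.G : WithConv (C →ₗ[k] k)) (T c) = (Q.G : WithConv (C →ₗ[k] k)) c) (c : C) :
    ((Q.G⁻¹ : (WithConv (C →ₗ[k] k))ˣ) : WithConv (C →ₗ[k] k)) (T c) =
      ((Q.G⁻¹ : (WithConv (C →ₗ[k] k))ˣ) : WithConv (C →ₗ[k] k)) c := by
  let H : WithConv (C →ₗ[k] k) := WithConv.toConv
    (((Q.G⁻¹ : (WithConv (C →ₗ[k] k))ˣ) : WithConv (C →ₗ[k] k)).ofConv ∘ₗ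
      ((T : C →ₗc[k] C) : C →ₗ[k] C))
  have hG : (Q.G : WithConv (C →ₗ[k] k)) = WithConv.toConv
      ((Q.G : WithConv (C →ₗ[k] k)).ofConv ∘ₗ ((T : C →ₗc[k] C) : C →ₗ[k] C)) := by
    ext c
    exact (hT c).symm
  have h1 : H * (Q.G : WithConv (C →ₗ[k] k)) = 1 := by
    rw [hG]
    have e := LinearMap.convMul_comp_coalgHom_distrib
      (((Q.G⁻¹ : (WithConv (C →ₗ[k] k))ˣ) : WithConv (C →ₗ[k] k)))
      (Q.G : WithConv (C →ₗ[k] k)) (T : C →ₗc[k] C)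
    rw [Units.inv_mul] at e
    ext c
    refine (LinearMap.congr_fun e c).symm.trans ?_
    exact LinearMap.congr_fun (CoalgHomClass.counit_comp T) c
  have h2 : H = ((Q.G⁻¹ : (WithConv (C →ₗ[k] k))ˣ) : WithConv (C →ₗ[k] k)) :=
    by
    rw [← mul_one H, ← Q.G.mul_inv, ← mul_assoc, h1, one_mul]
  exact LinearMap.congr_fun (congrArg WithConv.ofConv h2) c

/-- The opposite twist oriented quantum coalgebra `(C^cop, b, T_d, T_u, G⁻¹)`. -/
noncomputable def TwistOrientedQuantumCoalgebra.cop (Q : TwistOrientedQuantumCoalgebra k C) :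
    TwistOrientedQuantumCoalgebra k (Cop C) where
  b := Q.b.compl₁₂ (Cop.equiv k C).symm.toLinearMap (Cop.equiv k C).symm.toLinearMap
  bInv := Q.bInv.compl₁₂ (Cop.equiv k C).symm.toLinearMap (Cop.equiv k C).symm.toLinearMap
  Td := Cop.mapEquiv Q.Td
  Tu := Cop.mapEquiv Q.Tu
  Td_Tu_comm := Q.Td_Tu_comm
  bInv_mul_b c d _ _ x y := by
    refine Eq.trans ?_ (Q.b_mul_bInv c d (Cop.unrepr x) (Cop.unrepr y))
    exact Finset.sum_congr rfl fun i _ => Finset.sum_congr rfl fun j _ => mul_comm _ _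
  b_mul_bInv c d _ _ x y := by
    refine Eq.trans ?_ (Q.bInv_mul_b c d (Cop.unrepr x) (Cop.unrepr y))
    exact Finset.sum_congr rfl fun i _ => Finset.sum_congr rfl fun j _ => mul_comm _ _
  qc1 c d _ _ x y := by
    refine Eq.trans ?_ (Q.qc1' c d (Cop.unrepr x) (Cop.unrepr y))
    exact Finset.sum_congr rfl fun i _ => Finset.sum_congr rfl fun j _ => mul_comm _ _
  qc1' c d _ _ x y := by
    refine Eq.trans ?_ (Q.qc1 c d (Cop.unrepr x) (Cop.unrepr y))
    exact Finset.sum_congr rfl fun i _ => Finset.sum_congr rfl fun j _ => mul_comm _ _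
  qc2_d := Q.qc2_d
  qc2_u := Q.qc2_u
  qc3 c d e _ _ _ x y z :=
    (Q.qc3 c d e (Cop.unrepr x) (Cop.unrepr y) (Cop.unrepr z)).symm
  G :=
    { val := Cop.form ((Q.G⁻¹ : (WithConv (C →ₗ[k] k))ˣ) : WithConv (C →ₗ[k] k))
      inv := Cop.form (Q.G : WithConv (C →ₗ[k] k))
      val_inv := by rw [Cop.form_mul, Units.mul_inv, Cop.form_one]
      inv_val := by rw [Cop.form_mul, Units.inv_mul, Cop.form_one] }
  G_Td := Q.inv_G_comp Q.Td Q.G_Td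
  G_Tu := Q.inv_G_comp Q.Tu Q.G_Tu
  twist c := by
    obtain ⟨c, rfl⟩ := (Cop.equiv k C).surjective c
    have h := (Q.twist c).trans (hitLeft_hitRight_comm _ _ _)
    refine (congrArg (Cop.equiv k C) h).trans ?_
    rw [← Cop.hitLeft_form, ← Cop.hitRight_form]
    rfl

end Coalgebras

/-! ## Oriented diagrams with respect to the vertical direction -/

namespace Diag

/-- The non-vertical parts of an oriented diagram. Orientations of strands at a horizontal line are
recorded by `true` (upward) and `false` (downward).
* `cross a b s`: a crossing; the line from lower left to upper right is oriented according to `a`,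
  the line from lower right to upper left according to `b`; the former is the over crossing line
  exactly when `s = true`.
* `max a`: a local maximum whose left end is oriented according to `a`.
* `min a`: a local minimum whose left end is oriented according to `a`. -/
inductive Piece : Type
  | cross (a b s : Bool) : Piece
  | max (a : Bool) : Piece
  | min (a : Bool) : Piece

namespace Piece

/-- Orientations of the strands at the lower end of a piece, from left to right. -/
def lower : Piece → List Bool
  | cross a b _ => [a, b]
  | max a => [a, !a]
  | min _ => []

/-- Orientations of the strands at the upper end of a piece, from left to right. -/
def upper : Piece → List Bool
  | cross a b _ => [b, a]
  | max _ => []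
  | min a => [a, !a]

/-- Is the piece a crossing? -/
def isCross : Piece → Bool
  | cross _ _ _ => true
  | max _ => false
  | min _ => false

/-- Reversal of orientations. -/
def op : Piece → Piece
  | cross a b s => cross (!a) (!b) s
  | max a => max (!a)
  | min a => min (!a)

end Piece

/-- A horizontal slice of a diagram: one piece, with vertical lines to its left and right. -/
structure Slice where
  /-- orientations of the vertical lines to the left of the piece -/
  left : List Bool
  /-- the piece -/
  piece : Piece
  /-- orientations of the vertical lines to the right of the piece -/
  right : List Bool

/-- Orientations of the strands at the bottom of a slice. -/
def Slice.lower (s : Slice) : List Bool := s.left ++ s.piece.lower ++ s.right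

/-- Orientations of the strands at the top of a slice. -/
def Slice.upper (s : Slice) : List Bool := s.left ++ s.piece.upper ++ s.right

/-- `Composable s D t`: the slices `D`, listed from bottom to top, fit together to an oriented
diagram whose strands at the bottom and at the top are oriented according to `s` and `t`. -/
def Composable : List Bool → List Slice → List Bool → Prop
  | s, [], t => s = t
  | s, x :: D, t => s = x.lower ∧ Composable x.upper D t

/-! ### Arcs and traversals -/

/-- The kinds of oriented arcs which a slice consists of: vertical lines, lines of the crossing in
the slice with a given number (`isOver` tells whether it is the over crossing line), and local
extrema, with the information whether they are traversed from left to right. -/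
inductive ArcKind : Type
  | vertical : ArcKind
  | cross (n : ℕ) (isOver : Bool) : ArcKind
  | max (leftToRight : Bool) : ArcKind
  | min (leftToRight : Bool) : ArcKind

/-- The points of the diagram on the horizontal lines which separate its slices:
`(n, p)` is point number `p` from the left on line number `n` from the bottom. -/
abbrev Point : Type := ℕ × ℕ

/-- An oriented arc of a diagram, leading from one point to another. -/
structure Arc where
  /-- where the arc starts -/
  src : Point
  /-- where the arc ends -/
  tgt : Point
  /-- the kind of the arc -/
  kind : ArcKind

/-- The arc from `P` to `Q` if `a = true`, and from `Q` to `P` otherwise. -/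
def orient (a : Bool) (P Q : Point) (t : ArcKind) : Arc :=
  if a then ⟨P, Q, t⟩ else ⟨Q, P, t⟩

/-- The arcs of a piece in slice number `n` with `p` vertical lines to the left of the piece. -/
def Piece.arcs (n p : ℕ) : Piece → List Arc
  | .cross a b s =>
      [orient a (n, p) (n + 1, p + 1) (.cross n s), orient b (n, p + 1) (n + 1, p) (.cross n !s)]
  | .max a => [orient a (n, p) (n, p + 1) (.max a)]
  | .min a => [orient (!a) (n + 1, p) (n + 1, p + 1) (.min !a)]

/-- The vertical lines of slice number `n`, starting with number `p` on its bottom line and with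
number `q` on its top line, with prescribed orientations. -/
def verticals (n p q : ℕ) : List Bool → List Arc
  | [] => []
  | a :: l => orient a (n, p) (n + 1, q) .vertical :: verticals n (p + 1) (q + 1) l

/-- The arcs of slice number `n`. -/
def Slice.arcs (n : ℕ) (s : Slice) : List Arc :=
  verticals n 0 0 s.left ++ s.piece.arcs n s.left.length ++
    verticals n (s.left.length + s.piece.lower.length) (s.left.length + s.piece.upper.length)
      s.right

/-- The arcs of a list of slices, the numbering of which starts with `n`. -/
def arcsFrom : ℕ → List Slice → List Arc
  | _, [] => []
  | n, x :: D => x.arcs n ++ arcsFrom (n + 1) D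

/-- All arcs of a diagram. -/
def arcs (D : List Slice) : List Arc := arcsFrom 0 D

/-- The arcs in the list lead, one after the other, from `P` to `Q`. -/
def IsPath : Point → List Arc → Point → Prop
  | P, [], Q => P = Q
  | P, x :: l, Q => x.src = P ∧ IsPath x.tgt l Q

/-- A traversal of a diagram from `P` to `Q` in the direction of the orientation: it passes exactly
once through every arc of the diagram. -/
structure Traversal (D : List Slice) (P Q : Point) where
  /-- the arcs in the order in which they are encountered -/
  path : List Arc
  perm : path.Perm (arcs D)
  isPath : IsPath P path Q

/-! ### Link diagrams, knot diagrams and 1-1 tangle diagrams -/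

/-- Oriented link diagrams with respect to the vertical direction. -/
structure LinkDiagram where
  /-- the slices, from bottom to top -/
  slices : List Slice
  composable : Composable [] slices []

/-- Oriented knot diagrams: non-empty link diagrams which can be traversed in one closed path. -/
structure KnotDiagram extends LinkDiagram where
  ne_nil : slices ≠ []
  connected : ∃ P, Nonempty (Traversal slices P P)

/-- The lower end of a diagram with `N` slices if `a = true`, and its upper end otherwise. -/
def endPoint (a : Bool) (N : ℕ) : Point := if a then (0, 0) else (N, 0)

/-- Oriented 1-1 tangle diagrams. The strand enters at the bottom and leaves at the top if
`up = true`; it enters at the top and leaves at the bottom otherwise. -/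
structure TangleDiagram where
  /-- the slices, from bottom to top -/
  slices : List Slice
  /-- the orientation -/
  up : Bool
  composable : Composable [up] slices [up]
  /-- the traversal from the base point to the end point; it is unique -/
  traversal : Traversal slices (endPoint up slices.length) (endPoint (!up) slices.length)

/-- A slice with an additional vertical line on its left side. -/
def Slice.addLeft (a : Bool) (s : Slice) : Slice := { s with left := a :: s.left }

theorem Composable.append {s t u : List Bool} {D E : List Slice} (h : Composable s D t)
    (h' : Composable t E u) : Composable s (D ++ E) u := by
  induction D generalizing s with
  | nil => cases h; exact h'
  | cons x D ih => exact ⟨h.1, ih h.2⟩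

theorem Composable.addLeft (a : Bool) {s t : List Bool} {D : List Slice} (h : Composable s D t) :
    Composable (a :: s) (D.map (Slice.addLeft a)) (a :: t) := by
  induction D generalizing s with
  | nil => exact congrArg (a :: ·) h
  | cons x D ih => exact ⟨by rw [h.1]; rfl, ih h.2⟩

/-- The closure `K(T)` of a 1-1 tangle diagram `T`: the ends of `T` are joined by a line which
passes on the left side of `T`. -/
def TangleDiagram.closure (T : TangleDiagram) : LinkDiagram where
  slices := ⟨[], .min (!T.up), []⟩ :: (T.slices.map (Slice.addLeft (!T.up)) ++
    [⟨[], .max (!T.up), []⟩])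
  composable := by
    refine ⟨rfl, ?_⟩
    have h := T.composable.addLeft (!T.up)
    refine Composable.append (t := [!T.up, T.up]) ?_ ⟨by simp [Slice.lower, Piece.lower], rfl⟩
    simpa [Slice.upper, Piece.upper] using h

/-! ### Reversing the orientation -/

/-- Reversal of the orientation of a slice. -/
def Slice.op (s : Slice) : Slice := ⟨s.left.map (!·), s.piece.op, s.right.map (!·)⟩

/-- The same kind of arc traversed in the opposite direction. -/
def ArcKind.op : ArcKind → ArcKind
  | vertical => vertical
  | cross n o => cross n o
  | max t => max (!t)
  | min t => min (!t)

/-- The same arc traversed in the opposite direction. -/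
def Arc.op (x : Arc) : Arc := ⟨x.tgt, x.src, x.kind.op⟩

theorem orient_op (a : Bool) (P Q : Point) (t : ArcKind) :
    (orient a P Q t).op = orient (!a) P Q t.op := by
  cases a <;> rfl

theorem Piece.arcs_op (n p : ℕ) (x : Piece) : x.op.arcs n p = (x.arcs n p).map Arc.op := by
  cases x <;> simp [Piece.op, Piece.arcs, orient_op, ArcKind.op]

theorem verticals_op (n p q : ℕ) (l : List Bool) :
    verticals n p q (l.map (!·)) = (verticals n p q l).map Arc.op := by
  induction l generalizing p q with
  | nil => rfl
  | cons a l ih => simp [verticals, orient_op, ArcKind.op, ih]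

theorem Slice.arcs_op (n : ℕ) (s : Slice) : s.op.arcs n = (s.arcs n).map Arc.op := by
  have h1 : s.piece.op.lower.length = s.piece.lower.length := by cases s.piece <;> rfl
  have h2 : s.piece.op.upper.length = s.piece.upper.length := by cases s.piece <;> rfl
  simp [Slice.arcs, Slice.op, verticals_op, Piece.arcs_op, h1, h2]

theorem arcsFrom_op (n : ℕ) (D : List Slice) :
    arcsFrom n (D.map Slice.op) = (arcsFrom n D).map Arc.op := by
  induction D generalizing n with
  | nil => rfl
  | cons x D ih => simp [arcsFrom, Slice.arcs_op, ih]

theorem Composable.op {s t : List Bool} {D : List Slice} (h : Composable s D t) :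
    Composable (s.map (!·)) (D.map Slice.op) (t.map (!·)) := by
  induction D generalizing s with
  | nil => exact congrArg (List.map (!·)) h
  | cons x D ih =>
    have h1 : x.op.lower = x.lower.map (!·) := by
      rcases x with ⟨l, p, r⟩
      cases p <;> simp [Slice.op, Slice.lower, Piece.op, Piece.lower]
    have h2 : x.op.upper = x.upper.map (!·) := by
      rcases x with ⟨l, p, r⟩
      cases p <;> simp [Slice.op, Slice.upper, Piece.op, Piece.upper]
    refine ⟨by rw [h1, h.1], ?_⟩
    have := ih h.2
    rwa [← h2] at this

theorem IsPath.append {P Q R : Point} {l m : List Arc} (h : IsPath P l Q) (h' : IsPath Q m R) :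
    IsPath P (l ++ m) R := by
  induction l generalizing P with
  | nil => cases h; exact h'
  | cons x l ih => exact ⟨h.1, ih h.2⟩

theorem IsPath.op {P Q : Point} {l : List Arc} (h : IsPath P l Q) :
    IsPath Q (l.map Arc.op).reverse P := by
  induction l generalizing P with
  | nil => exact Eq.symm h
  | cons x l ih =>
    rw [List.map_cons, List.reverse_cons]
    exact (ih h.2).append ⟨rfl, h.1⟩

/-- The traversal in the opposite direction. -/
def Traversal.op {D : List Slice} {P Q : Point} (τ : Traversal D P Q) :
    Traversal (D.map Slice.op) Q P where
  path := (τ.path.map Arc.op).reverse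
  perm := by
    rw [arcs, arcsFrom_op]
    exact (List.reverse_perm _).trans (τ.perm.map _)
  isPath := τ.isPath.op

/-- The oriented knot diagram `K^op`, the underlying diagram of `K` with the opposite
orientation. -/
def KnotDiagram.op (K : KnotDiagram) : KnotDiagram where
  slices := K.slices.map Slice.op
  composable := K.composable.op
  ne_nil := by simpa using K.ne_nil
  connected := by
    obtain ⟨P, ⟨τ⟩⟩ := K.connected
    exact ⟨P, ⟨τ.op⟩⟩

/-! ### Regular isotopy -/

/-- The local equivalences which generate regular isotopy, in all possible orientations, with
vertical lines `l` on the left and `r` on the right: straightening of a strand, cancellation of two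
crossings, the braid relation, sliding a strand across a local extremum, and interchanging the
heights of two distant pieces. -/
inductive LocalMove : List Slice → List Slice → Prop
  | straighten_right (l r : List Bool) (a : Bool) :
      LocalMove [⟨l ++ [a], .min (!a), r⟩, ⟨l, .max a, a :: r⟩] []
  | straighten_left (l r : List Bool) (a : Bool) :
      LocalMove [⟨l, .min a, a :: r⟩, ⟨l ++ [a], .max (!a), r⟩] []
  | cancel (l r : List Bool) (a b s : Bool) :
      LocalMove [⟨l, .cross a b s, r⟩, ⟨l, .cross b a (!s), r⟩] []
  | braid (l r : List Bool) (a b c s : Bool) :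
      LocalMove
        [⟨l, .cross a b s, c :: r⟩, ⟨l ++ [b], .cross a c s, r⟩, ⟨l, .cross b c s, a :: r⟩]
        [⟨l ++ [a], .cross b c s, r⟩, ⟨l, .cross a c s, b :: r⟩, ⟨l ++ [c], .cross a b s, r⟩]
  | slide_max (l r : List Bool) (a b s : Bool) :
      LocalMove
        [⟨l, .cross a b s, (!a) :: r⟩, ⟨l ++ [b], .max a, r⟩]
        [⟨l ++ [a], .cross b (!a) (!s), r⟩, ⟨l, .max a, b :: r⟩]
  | slide_min (l r : List Bool) (a b s : Bool) :
      LocalMove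
        [⟨l ++ [b], .min a, r⟩, ⟨l, .cross b a (!s), (!a) :: r⟩]
        [⟨l, .min a, b :: r⟩, ⟨l ++ [a], .cross (!a) b s, r⟩]
  | interchange (l m r : List Bool) (x y : Piece) :
      LocalMove
        [⟨l, x, m ++ y.lower ++ r⟩, ⟨l ++ x.upper ++ m, y, r⟩]
        [⟨l ++ x.lower ++ m, y, r⟩, ⟨l, x, m ++ y.upper ++ r⟩]

/-- One link diagram is obtained from another by replacing a local part by its equivalent. -/
def Move (L L' : LinkDiagram) : Prop :=
  ∃ (A B X Y : List Slice), LocalMove X Y ∧ L.slices = A ++ X ++ B ∧ L'.slices = A ++ Y ++ B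

/-- Regular isotopy of oriented link diagrams. -/
def RegularlyIsotopic (L L' : LinkDiagram) : Prop := Relation.EqvGen Move L L'

/-! ### The Whitney degree -/

/-- `1` for a local extremum with clockwise orientation, `-1` for a local extremum with
counterclockwise orientation, `0` for other arcs. -/
def ArcKind.clockwise : ArcKind → ℤ
  | vertical => 0
  | cross _ _ => 0
  | max leftToRight => if leftToRight then 1 else -1
  | min leftToRight => if leftToRight then -1 else 1

theorem ArcKind.clockwise_vertical : vertical.clockwise = 0 := rfl

theorem ArcKind.clockwise_cross (n : ℕ) (o : Bool) : (cross n o).clockwise = 0 := rfl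

theorem ArcKind.clockwise_max (t : Bool) : (max t).clockwise = if t then 1 else -1 := rfl

theorem ArcKind.clockwise_min (t : Bool) : (min t).clockwise = if t then -1 else 1 := rfl

/-- The number of local extrema with clockwise orientation minus the number of local extrema with
counterclockwise orientation. -/
def clockwiseSum (D : List Slice) : ℤ := ((arcs D).map fun x => x.kind.clockwise).sum

/-- The Whitney degree `d`; it is determined by `2 * d = clockwiseSum`, see
`LinkDiagram.two_mul_whitneyDegree`. -/
def LinkDiagram.whitneyDegree (L : LinkDiagram) : ℤ := clockwiseSum L.slices / 2

theorem orient_kind (a : Bool) (P Q : Point) (t : ArcKind) : (orient a P Q t).kind = t := by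
  cases a <;> rfl

theorem sum_clockwise_verticals (n p q : ℕ) (l : List Bool) :
    ((verticals n p q l).map fun x => x.kind.clockwise).sum = 0 := by
  induction l generalizing p q with
  | nil => rfl
  | cons a l ih => simp [verticals, orient_kind, ArcKind.clockwise_vertical, ih]

theorem parity_aux (n : ℕ) (D : List Slice) (s t : List Bool) (h : Composable s D t) :
    ∃ z : ℤ, 2 * ((arcsFrom n D).map fun x => x.kind.clockwise).sum + s.length =
      t.length + 4 * z := by
  induction D generalizing n s with
  | nil => exact ⟨0, by cases h; simp [arcsFrom]⟩
  | cons x D ih =>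
    obtain ⟨z, hz⟩ := ih (n + 1) x.upper h.2
    rw [h.1]
    rcases x with ⟨l, p, r⟩
    cases p with
    | cross a b s =>
      refine ⟨z, ?_⟩
      simp [arcsFrom, Slice.arcs, sum_clockwise_verticals, Piece.arcs, orient_kind,
        ArcKind.clockwise_cross, Slice.lower, Slice.upper, Piece.lower, Piece.upper] at hz ⊢
      linarith
    | max a =>
      refine ⟨z + if a then 1 else 0, ?_⟩
      simp [arcsFrom, Slice.arcs, sum_clockwise_verticals, Piece.arcs, orient_kind,
        ArcKind.clockwise_max, Slice.lower, Slice.upper, Piece.lower, Piece.upper] at hz ⊢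
      cases a <;> simp <;> linarith
    | min a =>
      refine ⟨z - if a then 0 else 1, ?_⟩
      simp [arcsFrom, Slice.arcs, sum_clockwise_verticals, Piece.arcs, orient_kind,
        ArcKind.clockwise_min, Slice.lower, Slice.upper, Piece.lower, Piece.upper] at hz ⊢
      cases a <;> simp <;> linarith

theorem LinkDiagram.two_mul_whitneyDegree (L : LinkDiagram) :
    2 * L.whitneyDegree = clockwiseSum L.slices := by
  obtain ⟨z, hz⟩ := parity_aux 0 L.slices [] [] L.composable
  simp only [whitneyDegree, clockwiseSum, arcs, List.length_nil] at hz ⊢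
  omega

/-! ### Crossing lines -/

/-- `1` for an extremum of type `(d₊)`, a maximum traversed from right to left; `-1` for one of type
`(d₋)`, a minimum traversed from right to left; `0` for other arcs. -/
def ArcKind.countD : ArcKind → ℤ
  | max false => 1
  | min false => -1
  | _ => 0

/-- `1` for an extremum of type `(u₊)`, a minimum traversed from left to right; `-1` for one of type
`(u₋)`, a maximum traversed from left to right; `0` for other arcs. -/
def ArcKind.countU : ArcKind → ℤ
  | min true => 1
  | max true => -1
  | _ => 0

/-- The name of a crossing line: the number of the slice of its crossing, and whether it is the
over crossing line. -/
def ArcKind.line : ArcKind → Option (ℕ × Bool)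
  | cross n o => some (n, o)
  | _ => none

theorem ArcKind.line_cross (n : ℕ) (o : Bool) : (cross n o).line = some (n, o) := rfl

theorem ArcKind.line_max (t : Bool) : (max t).line = none := rfl

theorem ArcKind.line_min (t : Bool) : (min t).line = none := rfl

/-- The crossing lines in the order in which they are encountered. -/
def crossingLines (l : List Arc) : List (ℕ × Bool) := l.filterMap fun x => x.kind.line

/-- The pairs of exponents `(u_d, u_u)` of the crossing lines in the order in which they are
encountered: `u_d` is the number of local extrema of type `(d₊)` minus the number of those of type
`(d₋)` from the crossing line to the end of the traversal, and `u_u` likewise for `(u₊)`, `(u₋)`. -/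
def exponents : List Arc → List (ℤ × ℤ)
  | [] => []
  | x :: l =>
    if x.kind.line.isSome then
      ((l.map fun y => y.kind.countD).sum, (l.map fun y => y.kind.countU).sum) :: exponents l
    else exponents l

theorem length_exponents (l : List Arc) : (exponents l).length = (crossingLines l).length := by
  induction l with
  | nil => rfl
  | cons x l ih =>
    rcases x with ⟨P, Q, t⟩
    cases t <;> simpa [exponents, crossingLines, ArcKind.line] using ih

theorem crossingLines_verticals (n p q : ℕ) (l : List Bool) :
    crossingLines (verticals n p q l) = [] := by
  induction l generalizing p q with
  | nil => rfl
  | cons a l ih =>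
    have := ih (p + 1) (q + 1)
    rw [crossingLines] at this ⊢
    rw [verticals, List.filterMap_cons, orient_kind, this]
    rfl

theorem crossingLines_slice (n : ℕ) (s : Slice) : crossingLines (s.arcs n) =
    match s.piece with
    | .cross _ _ o => [(n, o), (n, !o)]
    | _ => [] := by
  rcases s with ⟨l, p, r⟩
  have h := crossingLines_verticals
  simp only [crossingLines] at h
  cases p <;> simp [crossingLines, Slice.arcs, h, Piece.arcs, orient_kind, ArcKind.line_cross,
    ArcKind.line_max, ArcKind.line_min]

theorem crossingLines_arcsFrom_cons (n : ℕ) (s : Slice) (D : List Slice) :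
    crossingLines (arcsFrom n (s :: D)) =
      crossingLines (s.arcs n) ++ crossingLines (arcsFrom (n + 1) D) :=
  List.filterMap_append

theorem mem_crossingLines_slice (n m : ℕ) (o : Bool) (s : Slice) :
    (m, o) ∈ crossingLines (s.arcs n) ↔ m = n ∧ s.piece.isCross = true := by
  rw [crossingLines_slice]
  rcases s with ⟨l, p, r⟩
  rcases p with ⟨a, b, t⟩ | a | a <;> simp [Piece.isCross]
  cases t <;> cases o <;> simp

theorem mem_crossingLines_arcsFrom (n m : ℕ) (o : Bool) (D : List Slice) :
    (m, o) ∈ crossingLines (arcsFrom n D) ↔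
      ∃ i : Fin D.length, m = n + i ∧ D[i].piece.isCross = true := by
  induction D generalizing n with
  | nil => simp [arcsFrom, crossingLines]
  | cons s D ih =>
    rw [crossingLines_arcsFrom_cons, List.mem_append, mem_crossingLines_slice, ih]
    constructor
    · rintro (⟨h1, h2⟩ | ⟨i, h1, h2⟩)
      · exact ⟨⟨0, by simp⟩, by simpa using h1, h2⟩
      · exact ⟨i.succ, by rw [h1, Fin.val_succ]; omega, h2⟩
    · rintro ⟨⟨i, hi⟩, h1, h2⟩
      cases i with
      | zero => exact Or.inl ⟨by simpa using h1, h2⟩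
      | succ i =>
        exact Or.inr ⟨⟨i, by simpa using hi⟩, by simp only [h1]; omega, h2⟩

theorem nodup_crossingLines_arcsFrom (n : ℕ) (D : List Slice) :
    (crossingLines (arcsFrom n D)).Nodup := by
  induction D generalizing n with
  | nil => simp [arcsFrom, crossingLines]
  | cons s D ih =>
    rw [crossingLines_arcsFrom_cons, List.nodup_append]
    refine ⟨?_, ih _, ?_⟩
    · rw [crossingLines_slice]
      rcases s with ⟨l, p, r⟩
      cases p <;> simp
    · rintro ⟨m, o⟩ h1 ⟨m', o'⟩ h2 h3
      rw [mem_crossingLines_slice] at h1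
      rw [mem_crossingLines_arcsFrom] at h2
      obtain ⟨i, h2, -⟩ := h2
      have : m = m' := congrArg Prod.fst h3
      omega

/-- The crossings of a diagram, given by the numbers of their slices. -/
def Crossing (D : List Slice) : Type := {n : Fin D.length // D[n].piece.isCross = true}

instance (D : List Slice) : Fintype (Crossing D) :=
  inferInstanceAs (Fintype {n : Fin D.length // D[n].piece.isCross = true})

instance (D : List Slice) : DecidableEq (Crossing D) :=
  inferInstanceAs (DecidableEq {n : Fin D.length // D[n].piece.isCross = true})

section Labels

variable {D : List Slice} {P Q : Point} (τ : Traversal D P Q)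

/-- The number of crossing lines. -/
def Traversal.size : ℕ := (crossingLines τ.path).length

theorem Traversal.nodup : (crossingLines τ.path).Nodup :=
  (τ.perm.filterMap _).nodup_iff.2 (nodup_crossingLines_arcsFrom 0 D)

theorem Traversal.mem_iff (m : ℕ) (o : Bool) : (m, o) ∈ crossingLines τ.path ↔
    ∃ i : Fin D.length, m = i ∧ D[i].piece.isCross = true := by
  have h : (crossingLines τ.path).Perm (crossingLines (arcs D)) := τ.perm.filterMap _
  rw [h.mem_iff]
  have h2 := mem_crossingLines_arcsFrom 0 m o D
  simp only [Nat.zero_add] at h2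
  exact h2

/-- The label of a crossing line: its position, counted from zero, in the order in which the
crossing lines are encountered. The over crossing line of the crossing `χ` is `(χ, true)`, its under
crossing line is `(χ, false)`. -/
noncomputable def Traversal.label : Crossing D × Bool ≃ Fin τ.size :=
  Equiv.ofBijective
    (fun x => ⟨(crossingLines τ.path).idxOf ((x.1.1 : ℕ), x.2),
      List.idxOf_lt_length_iff.2 ((τ.mem_iff _ _).2 ⟨x.1.1, rfl, x.1.2⟩)⟩) (by
    constructor
    · rintro ⟨⟨x, hx⟩, o⟩ ⟨⟨y, hy⟩, o'⟩ h
      have h' := (List.idxOf_inj ((τ.mem_iff _ o).2 ⟨x, rfl, hx⟩)).1 (Fin.mk.inj_iff.1 h)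
      obtain ⟨h1, h2⟩ := Prod.mk.inj h'
      have h3 : x = y := Fin.ext h1
      subst h3
      have h4 : o = o' := h2
      subst h4
      rfl
    · intro i
      obtain ⟨j, h1, h2⟩ := (τ.mem_iff _ _).1
        (List.getElem_mem (l := crossingLines τ.path) (n := i) i.2)
      refine ⟨(⟨j, h2⟩, ((crossingLines τ.path)[(i : ℕ)]'i.2).2), Fin.ext ?_⟩
      refine Eq.trans ?_ (List.Nodup.idxOf_getElem τ.nodup i i.2)
      exact congrArg (fun z => (crossingLines τ.path).idxOf z) (Prod.ext h1.symm rfl))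

/-- The pair of exponents `(u_d, u_u)` of the crossing line with a given label. -/
def Traversal.exponent (i : Fin τ.size) : ℤ × ℤ :=
  (exponents τ.path)[(i : ℕ)]'(by rw [length_exponents]; exact i.2)

end Labels

end Diag

/-! ## The functionals and the invariants -/

section Invariants

open Coalgebra Diag

universe u v

variable {k : Type u} {C : Type v} [Field k] [AddCommGroup C] [Module k C] [Coalgebra k C]

/-- For a multilinear form `M` in `m` variables, the linear form
`c ↦ M (c₍₁₎, …, c₍ₘ₎)`; for `m = 0` it is the multiple `M () ε` of the counit. -/
noncomputable def sweedler : (m : ℕ) → MultilinearMap k (fun _ : Fin m => C) k →ₗ[k] (C →ₗ[k] k)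
  | 0 =>
    { toFun := fun M => M ![] • counit
      map_add' := fun M N => by rw [add_apply, add_smul]
      map_smul' := fun a M => by rw [smul_apply, smul_assoc]; rfl }
  | m + 1 =>
    { toFun := fun M => TensorProduct.lift (sweedler m ∘ₗ M.curryLeft) ∘ₗ comul
      map_add' := fun M N => by
        have h : (M + N).curryLeft = M.curryLeft + N.curryLeft := rfl
        ext c
        simp [← (ℛ k c).eq, h, Finset.sum_add_distrib]
      map_smul' := fun a M => by
        have h : (a • M).curryLeft = a • M.curryLeft := rfl
        ext c
        simp [← (ℛ k c).eq, h, Finset.mul_sum] }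

/-- The multilinear form `x ↦ ∏ χ, B χ (x (χ, true)) (x (χ, false))`. -/
noncomputable def pairProduct {X : Type*} [Fintype X] (B : X → C →ₗ[k] C →ₗ[k] k) :
    MultilinearMap k (fun _ : X × Bool => C) k where
  toFun x := ∏ χ, B χ (x (χ, true)) (x (χ, false))
  map_update_add' := by
    intro _ m i x y
    obtain ⟨χ, o⟩ := i
    classical
    have h : ∀ (z : C) (χ' : X), χ' ∈ Finset.univ.erase χ →
        B χ' (Function.update m (χ, o) z (χ', true)) (Function.update m (χ, o) z (χ', false)) =
        B χ' (m (χ', true)) (m (χ', false)) := by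
      intro z χ' hχ
      have hne := Finset.ne_of_mem_erase hχ
      rw [Function.update_of_ne, Function.update_of_ne] <;>
        exact fun e => hne (congrArg Prod.fst e)
    rw [← Finset.mul_prod_erase _ _ (Finset.mem_univ χ),
      ← Finset.mul_prod_erase _ _ (Finset.mem_univ χ),
      ← Finset.mul_prod_erase _ _ (Finset.mem_univ χ), Finset.prod_congr rfl (h (x + y)),
      Finset.prod_congr rfl (h x), Finset.prod_congr rfl (h y)]
    cases o <;> simp [add_mul]
  map_update_smul' := by
    intro _ m i a x
    obtain ⟨χ, o⟩ := i
    classical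
    have h : ∀ (z : C) (χ' : X), χ' ∈ Finset.univ.erase χ →
        B χ' (Function.update m (χ, o) z (χ', true)) (Function.update m (χ, o) z (χ', false)) =
        B χ' (m (χ', true)) (m (χ', false)) := by
      intro z χ' hχ
      have hne := Finset.ne_of_mem_erase hχ
      rw [Function.update_of_ne, Function.update_of_ne] <;>
        exact fun e => hne (congrArg Prod.fst e)
    rw [← Finset.mul_prod_erase _ _ (Finset.mem_univ χ),
      ← Finset.mul_prod_erase _ _ (Finset.mem_univ χ), Finset.prod_congr rfl (h (a • x)),
      Finset.prod_congr rfl (h x)]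
    cases o <;> simp [mul_assoc]

namespace StrictOrientedQuantumCoalgebra

variable (Q : StrictOrientedQuantumCoalgebra k C)

/-- The linear automorphism `T_d^p ∘ T_u^q`. -/
noncomputable def power (p q : ℤ) : C →ₗ[k] C :=
  (((Q.Td : C ≃ₗ[k] C) ^ p * (Q.Tu : C ≃ₗ[k] C) ^ q : C ≃ₗ[k] C) : C →ₗ[k] C)

/-- The factor contributed by a crossing, as a bilinear form in the components `c₍ᵢ₎` and `c₍ⱼ₎`,
where `i` and `j` are the labels of the over and the under crossing line and `e`, `f` are their pairs
of exponents `(u_d, u_u)`. (It is not used for pieces which are not crossings.) -/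
noncomputable def factor (e f : ℤ × ℤ) : Piece → C →ₗ[k] C →ₗ[k] k
  | .cross true true true => Q.b.compl₁₂ (Q.power e.1 e.2) (Q.power f.1 f.2)
  | .cross false false true => Q.b.compl₁₂ (Q.power e.1 e.2) (Q.power f.1 f.2)
  | .cross true false true => Q.bInv.compl₁₂ (Q.power e.1 (e.2 + 1)) (Q.power f.1 f.2)
  | .cross false true true => Q.bInv.compl₁₂ (Q.power (e.1 + 1) e.2) (Q.power f.1 f.2)
  | .cross true true false => Q.bInv.compl₁₂ (Q.power e.1 e.2) (Q.power f.1 f.2)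
  | .cross false false false => Q.bInv.compl₁₂ (Q.power e.1 e.2) (Q.power f.1 f.2)
  | .cross true false false => Q.b.compl₁₂ (Q.power e.1 e.2) (Q.power f.1 (f.2 + 1))
  | .cross false true false => Q.b.compl₁₂ (Q.power e.1 e.2) (Q.power (f.1 + 1) f.2)
  | .max _ => 0
  | .min _ => 0

/-- The functional attached to a traversal of a diagram: with `m` crossing lines, its value at `c`
is the sum, over the components of the iterated coproduct `c₍₁₎ ⊗ ⋯ ⊗ c₍ₘ₎`, of the products of the
factors of the crossings. It is the counit if there are no crossings. -/
noncomputable def functional {D : List Slice} {P P' : Point} (τ : Traversal D P P') : C →ₗ[k] k :=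
  sweedler τ.size ((pairProduct fun χ : Crossing D =>
    Q.factor (τ.exponent (τ.label (χ, true))) (τ.exponent (τ.label (χ, false)))
      D[χ.1].piece).domDomCongr τ.label)

/-- The functional `Inv_C(T)` of a 1-1 tangle diagram `T`. -/
noncomputable def inv (T : TangleDiagram) : WithConv (C →ₗ[k] k) :=
  WithConv.toConv (Q.functional T.traversal)

end StrictOrientedQuantumCoalgebra

namespace TwistOrientedQuantumCoalgebra

variable (Q : TwistOrientedQuantumCoalgebra k C)

/-- The power `G^d` in the dual algebra. -/
noncomputable def Gpow (d : ℤ) : WithConv (C →ₗ[k] k) := ((Q.G ^ d : (WithConv (C →ₗ[k] k))ˣ) : _)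

/-- The scalar `(G^d f)(c)`, where `f` is the functional constructed from the starting point `P`
and `d` is the Whitney degree of `K`. -/
noncomputable def knotValue (c : C) (K : KnotDiagram) {P : Point} (τ : Traversal K.slices P P) : k :=
  (Q.Gpow K.whitneyDegree * WithConv.toConv (Q.functional τ)) c

/-- The function `f_{C,c}` on oriented knot diagrams, defined through some starting point. -/
noncomputable def knotInvariant (c : C) (K : KnotDiagram) : k :=
  Q.knotValue c K (Classical.choice (Classical.choose_spec K.connected))

end TwistOrientedQuantumCoalgebra

end Invariants

/-! ## Sweedler sums -/

section SweedlerSums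

open Coalgebra

universe u v

variable {k : Type u} {C : Type v} [Field k] [AddCommGroup C] [Module k C] [Coalgebra k C]

/-! A path through a diagram meets the crossing lines one after the other; it spells a word, and the
functional feeds the iterated coproduct of c into the letters of the word and evaluates the product
of the crossing forms (`ev`, `pathForm`, `functional_eq_pathForm`). Two facts make this flexible. By
coassociativity a word may be cut into subwords, each of which receives one component of a shorter
iterated coproduct (`ev_flatMap`). The powers of T_d and T_u are coalgebra automorphisms which
preserve b and b⁻¹; hence a power common to a subword can be moved onto the component which this
subword receives, and a power common to all crossing lines has no effect at all (`prodFrom_pw`).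

Starting point. In a closed traversal of a diagram of Whitney degree d both counts of extrema equal
-d (`cnt_closed`): their sum is -2d, and their difference vanishes, because it measures the change
of the vertical direction along the path. Moving the first arc of the path to its end changes all
exponents alike if the arc is not a crossing line. If it is one, its exponents change from (-d, -d)
to zero, and its letter from the first to the last one. The twist axiom gives T_d^(-d) T_u^(-d)(z) =
G^d ⇀ z ↼ G^(-d), so that G^d, standing in front, jumps over this letter; cocommutativity allows the
letter to be carried cyclically to the end (`pathValue_rotate_some`). Since every point of a closed
diagram is the start of exactly one arc, two closed traversals differ only by such a rotation.

Regular isotopy. For a local move, both diagrams are cut into corresponding chains of arcs: single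
arcs outside of the move, strands inside. Corresponding chains contain the same numbers of extrema,
hence the part of the exponents coming from behind a chain is the same in both diagrams and can be
moved onto the component of the chain. What remains is an identity between the products of the
crossing forms inside the move, where every strand has its own element (`pathForm_eq_of_bigev_eq`,
`bigev_chainCorr`). Interchanging heights only renames letters, straightening involves no crossing,
sliding over an extremum is the invariance of b under T_d and T_u, and cancellation says that two
crossing forms are convolution inverse. The intermediate diagrams of an isotopy are merely link
diagrams, so the existence of a closed traversal has to be carried along in both directions
(`SameValue`).

Braid relation. A strand which goes down reads its components in the opposite order, so the form of
a crossing belongs to the dual algebra of a tensor product of copies of C and C^cop. There the axiom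
on three elements is the Yang-Baxter equation F₁₂ G₁₃ H₂₃ = H₂₃ G₁₃ F₁₂. Passing to inverses yields
the other type of crossing, and reversing one strand amounts to inverting the two forms which
contain it with respect to the opposite coproduct; the remaining compatibility of b, b⁻¹, T_d and
T_u says that these inverses are the prescribed forms (`braidRel_crossForm`).

Closure and reversal. The line which closes a 1-1 tangle adds the same pair (e, e) to all exponents,
and this has no effect. Reversing a closed path reverses its word, which is the passage to C^cop,
and changes the exponents by a common pair and by a correction for upward lines; the correction
turns the form of each crossing into that of the reversed crossing (`expo_op`, `crossForm_op`). -/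

theorem IsLinearMap.sum' {E ι : Type*} [AddCommGroup E] [Module k E] (s : Finset ι)
    {f : ι → E → k} (h : ∀ i ∈ s, IsLinearMap k (f i)) :
    IsLinearMap k fun x => ∑ i ∈ s, f i x :=
  ⟨fun x y => by
    rw [← Finset.sum_add_distrib]; exact Finset.sum_congr rfl fun i hi => (h i hi).map_add x y,
   fun a x => by
    rw [Finset.smul_sum]; exact Finset.sum_congr rfl fun i hi => (h i hi).map_smul a x⟩

theorem IsLinearMap.const_mul {E : Type*} [AddCommGroup E] [Module k E] {f : E → k}
    (h : IsLinearMap k f) (r : k) : IsLinearMap k fun x => r * f x :=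
  ⟨fun x y => by rw [h.map_add, mul_add], fun a x => by simp [h.map_smul, mul_left_comm]⟩

theorem IsLinearMap.mul_const {E : Type*} [AddCommGroup E] [Module k E] {f : E → k}
    (h : IsLinearMap k f) (r : k) : IsLinearMap k fun x => f x * r :=
  ⟨fun x y => by rw [h.map_add, add_mul], fun a x => by simp [h.map_smul, mul_assoc]⟩

theorem IsLinearMap.comp' {E F : Type*} [AddCommGroup E] [Module k E] [AddCommGroup F] [Module k F]
    {f : F → k} (h : IsLinearMap k f) (g : E →ₗ[k] F) : IsLinearMap k fun x => f (g x) :=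
  ⟨fun x y => by rw [g.map_add]; exact h.map_add _ _,
   fun a x => by rw [g.map_smul]; exact h.map_smul _ _⟩

theorem LinearMap.isLinearMap' {E F : Type*} [AddCommGroup E] [Module k E] [AddCommGroup F]
    [Module k F] (g : E →ₗ[k] F) : IsLinearMap k fun x => g x :=
  ⟨g.map_add, g.map_smul⟩

/-- A function of two variables which is linear in each of them. -/
structure IsBilin (k : Type u) {E F : Type*} [Field k] [AddCommGroup E] [Module k E]
    [AddCommGroup F] [Module k F] (f : E → F → k) : Prop where
  left : ∀ y, IsLinearMap k fun x => f x y
  right : ∀ x, IsLinearMap k fun y => f x y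

/-- The bilinear map given by a function which is linear in each variable. -/
def IsBilin.toLin {E F : Type*} [AddCommGroup E] [Module k E] [AddCommGroup F] [Module k F]
    {f : E → F → k} (h : IsBilin k f) : E →ₗ[k] F →ₗ[k] k :=
  LinearMap.mk₂ k f (fun x x' y => (h.left y).map_add x x') (fun a x y => (h.left y).map_smul a x)
    (fun x y y' => (h.right x).map_add y y') (fun a x y => (h.right x).map_smul a y)

theorem IsBilin.flip {E F : Type*} [AddCommGroup E] [Module k E] [AddCommGroup F] [Module k F]
    {f : E → F → k} (h : IsBilin k f) : IsBilin k fun x y => f y x := ⟨h.right, h.left⟩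

variable (k) in
/-- The Sweedler sum `f (c₍₁₎, c₍₂₎)`. -/
noncomputable def dsum (f : C → C → k) (c : C) : k :=
  ∑ i ∈ (ℛ k c).index, f ((ℛ k c).left i) ((ℛ k c).right i)

/-- A bilinear f factors through the tensor product, so the sum depends only on Δ(c) and not on the
representation chosen by `ℛ`. -/
theorem dsum_eq_lift {f : C → C → k} (h : IsBilin k f) (c : C) :
    dsum k f c = TensorProduct.lift h.toLin (comul c) := by
  rw [← (ℛ k c).eq, map_sum]
  rfl

theorem dsum_eq_sum {f : C → C → k} (h : IsBilin k f) {c : C} {ι : Type*}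
    (x : Coalgebra.Repr k c ι) : dsum k f c = ∑ i ∈ x.index, f (x.left i) (x.right i) := by
  rw [dsum_eq_lift h, ← x.eq, map_sum]
  rfl

theorem dsum_isLinearMap {f : C → C → k} (h : IsBilin k f) : IsLinearMap k (dsum k f) := by
  have e : dsum k f = fun c => (TensorProduct.lift h.toLin ∘ₗ comul) c :=
    funext fun c => dsum_eq_lift h c
  rw [e]
  exact LinearMap.isLinearMap' _

theorem dsum_isLinearMap_param {E : Type*} [AddCommGroup E] [Module k E] {f : E → C → C → k}
    (h : ∀ x y, IsLinearMap k fun t => f t x y) (c : C) : IsLinearMap k fun t => dsum k (f t) c :=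
  IsLinearMap.sum' _ fun _ _ => h _ _

theorem dsum_congr {f g : C → C → k} (h : ∀ x y, f x y = g x y) (c : C) :
    dsum k f c = dsum k g c := by
  rw [show f = g from funext fun x => funext (h x)]

theorem dsum_const_mul (r : k) (f : C → C → k) (c : C) :
    dsum k (fun x y => r * f x y) c = r * dsum k f c := (Finset.mul_sum _ _ _).symm

theorem dsum_mul_const (r : k) (f : C → C → k) (c : C) :
    dsum k (fun x y => f x y * r) c = dsum k f c * r := (Finset.sum_mul _ _ _).symm

theorem dsum_comm {C' : Type*} [AddCommGroup C'] [Module k C'] [Coalgebra k C']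
    (f : C → C → C' → C' → k) (c : C) (d : C') :
    dsum k (fun x y => dsum k (fun x' y' => f x y x' y') d) c =
      dsum k (fun x' y' => dsum k (fun x y => f x y x' y') c) d := Finset.sum_comm

theorem dsum_counit_left {h : C → k} (hh : IsLinearMap k h) (c : C) :
    dsum k (fun x y => counit (R := k) x * h y) c = h c := by
  have e := congrArg hh.mk' (sum_counit_smul (ℛ k c))
  rw [map_sum] at e
  refine Eq.trans (Finset.sum_congr rfl fun i _ => ?_) e
  rw [map_smul]
  rfl

theorem dsum_counit_right {h : C → k} (hh : IsLinearMap k h) (c : C) :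
    dsum k (fun x y => h x * counit (R := k) y) c = h c := by
  have hB : IsBilin k (fun x y : C => h x * counit (R := k) y) :=
    ⟨fun y => hh.mul_const _, fun x => (LinearMap.isLinearMap' (counit (R := k) (A := C))).const_mul _⟩
  have e := congrArg ((TensorProduct.rid k k).toLinearMap ∘ₗ hh.mk'.rTensor k)
    (lTensor_counit_comul (R := k) c)
  rw [dsum]
  rw [← (ℛ k c).eq, map_sum, map_sum] at e
  simp only [LinearMap.lTensor_tmul, LinearMap.comp_apply, LinearMap.rTensor_tmul,
    LinearEquiv.coe_coe, TensorProduct.rid_tmul, one_smul] at e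
  refine Eq.trans (Finset.sum_congr rfl fun i _ => ?_) e
  rw [smul_eq_mul, mul_comm]
  rfl

/-- Coassociativity: g is linear in each variable and therefore defines a linear form on C ⊗ (C ⊗
C), which is applied to the two expressions for the twofold coproduct. -/
theorem dsum_assoc {g : C → C → C → k} (h1 : ∀ y z, IsLinearMap k fun x => g x y z)
    (h2 : ∀ x z, IsLinearMap k fun y => g x y z) (h3 : ∀ x y, IsLinearMap k fun z => g x y z)
    (c : C) :
    dsum k (fun a z => dsum k (fun x y => g x y z) a) c =
      dsum k (fun x a => dsum k (fun y z => g x y z) a) c := by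
  have hB : ∀ z, IsBilin k fun x y => g x y z := fun z => ⟨fun y => h1 y z, fun x => h2 x z⟩
  have hB' : ∀ x, IsBilin k fun y z => g x y z := fun x => ⟨fun z => h2 x z, fun y => h3 x y⟩
  let G : C →ₗ[k] (C ⊗[k] C) →ₗ[k] k := 
    { toFun := fun x => TensorProduct.lift (hB' x).toLin
      map_add' := fun x x' => TensorProduct.ext' fun y z => (h1 y z).map_add x x'
      map_smul' := fun a x => TensorProduct.ext' fun y z => (h1 y z).map_smul a x }
  have e := congrArg (TensorProduct.lift G) (coassoc_apply (R := k) c)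
  rw [← (ℛ k c).eq] at e
  simp only [map_sum, LinearMap.rTensor_tmul, LinearMap.lTensor_tmul] at e
  refine Eq.trans (Finset.sum_congr rfl fun i _ => ?_)
    (e.trans (Finset.sum_congr rfl fun i _ => ?_))
  · dsimp only
    rw [← (ℛ k ((ℛ k c).left i)).eq, TensorProduct.sum_tmul, map_sum, map_sum]
    rfl
  · exact (dsum_eq_lift (hB' _) _).symm

theorem IsCocommutativeElement.dsum_comm {c : C} (hc : IsCocommutativeElement k c) {f : C → C → k}
    (h : IsBilin k f) : dsum k f c = dsum k (fun x y => f y x) c := by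
  rw [dsum_eq_lift h, ← hc, ← (ℛ k c).eq, map_sum, map_sum]
  rfl

/-- Maps which are compatible with Sweedler sums and counits. -/
structure IsCoalgMap (τ : C →ₗ[k] C) : Prop where
  counit_apply : ∀ c, counit (R := k) (τ c) = counit (R := k) c
  comul_apply : ∀ c, comul (R := k) (τ c) = TensorProduct.map τ τ (comul c)

theorem IsCoalgMap.dsum {τ : C →ₗ[k] C} (hτ : IsCoalgMap τ) {f : C → C → k} (h : IsBilin k f)
    (c : C) : dsum k f (τ c) = dsum k (fun x y => f (τ x) (τ y)) c := by
  rw [dsum_eq_lift h, hτ.comul_apply, ← (ℛ k c).eq, map_sum, map_sum]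
  rfl

theorem IsCoalgMap.id : IsCoalgMap (LinearMap.id : C →ₗ[k] C) :=
  ⟨fun _ => rfl, fun c => by rw [TensorProduct.map_id]; rfl⟩

/-! ### Evaluation of words -/

/-- The sum, over the components of the iterated coproduct of `c`, of the values of `M` at the
family obtained from `y` by giving the letters of a word the components as values. -/
noncomputable def ev {α : Type*} [DecidableEq α] :
    List α → ((α → C) → k) → (α → C) → C → k
  | [], M, y, c => counit (R := k) c * M y
  | a :: w, M, y, c => dsum k (fun x c' => ev w M (Function.update y a x) c') c

/-- Linearity in the variable with index `a`. -/
def LinearAt {α : Type*} [DecidableEq α] (M : (α → C) → k) (a : α) : Prop :=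
  ∀ y, IsLinearMap k fun x => M (Function.update y a x)

/-- Independence of the variable with index `a`. -/
def IndepAt {α : Type*} [DecidableEq α] (M : (α → C) → k) (a : α) : Prop :=
  ∀ y x, M (Function.update y a x) = M y

section Words

variable {α β : Type*} [DecidableEq α] [DecidableEq β]

theorem ev_congr {M N : (α → C) → k} (h : ∀ y, M y = N y) (w : List α) (y : α → C) (c : C) :
    ev w M y c = ev w N y c := by
  rw [show M = N from funext h]

theorem ev_param {E : Type*} [AddCommGroup E] [Module k E] (w : List α) {M : E → (α → C) → k}
    (h : ∀ y, IsLinearMap k fun t => M t y) (y : α → C) (c : C) :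
    IsLinearMap k fun t => ev w (M t) y c := by
  induction w generalizing y c with
  | nil => exact (h y).const_mul _
  | cons a w ih => exact dsum_isLinearMap_param (fun _ _ => ih _ _) c

/-- The evaluation overwrites only the letters of w; a value prescribed at another letter survives
and may as well be built into M. -/
theorem ev_update (w : List α) (M : (α → C) → k) {a : α} (ha : a ∉ w) (y : α → C) (x c : C) :
    ev w M (Function.update y a x) c = ev w (fun z => M (Function.update z a x)) y c := by
  induction w generalizing y c with
  | nil => rfl
  | cons b w ih =>
    simp only [List.mem_cons, not_or] at ha
    refine dsum_congr (fun x' c' => ?_) c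
    rw [← ih ha.2, Function.update_comm ha.1]

theorem LinearAt.ev {w : List α} {M : (α → C) → k} {a : α} (h : LinearAt M a) (ha : a ∉ w) (c : C) :
    LinearAt (fun y => ev w M y c) a := fun y => by
  simp only [ev_update w M ha]
  exact ev_param w (fun z => h z) y c

theorem ev_isLinearMap {w : List α} (hw : w.Nodup) {M : (α → C) → k} (h : ∀ a ∈ w, LinearAt M a)
    (y : α → C) : IsLinearMap k fun c => ev w M y c := by
  induction w generalizing y with
  | nil => exact (LinearMap.isLinearMap' (counit (R := k) (A := C))).mul_const _
  | cons a w ih =>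
    rw [List.nodup_cons] at hw
    rw [List.forall_mem_cons] at h
    exact dsum_isLinearMap ⟨fun c => h.1.ev hw.1 c y, fun x => ih hw.2 h.2 _⟩

theorem ev_mul_left {w : List α} {M N : (α → C) → k} (h : ∀ a ∈ w, IndepAt N a) (y : α → C)
    (c : C) : ev w (fun z => N z * M z) y c = N y * ev w M y c := by
  induction w generalizing y c with
  | nil => simp only [ev]; ring
  | cons a w ih =>
    rw [List.forall_mem_cons] at h
    simp only [ev, ih h.2, h.1 _ _, dsum_const_mul]

theorem ev_const_mul (w : List α) (M : (α → C) → k) (r : k) (y : α → C) (c : C) :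
    ev w (fun z => r * M z) y c = r * ev w M y c :=
  ev_mul_left (N := fun _ => r) (fun _ _ _ _ => rfl) y c

theorem ev_dsum (w : List α) (H : C → C → (α → C) → k) (y : α → C) (c d : C) :
    ev w (fun z => dsum k (fun x x' => H x x' z) d) y c =
      dsum k (fun x x' => ev w (H x x') y c) d := by
  induction w generalizing y c with
  | nil => simp only [ev, dsum_const_mul]
  | cons b w ih => simp only [ev, ih]; exact dsum_comm _ _ _

theorem ev_fubini (u : List α) (w : List β) (M : (α → C) → (β → C) → k) (y : α → C) (z : β → C)
    (c d : C) : ev u (fun y => ev w (fun z => M y z) z d) y c =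
      ev w (fun z => ev u (fun y => M y z) y c) z d := by
  induction u generalizing y c with
  | nil => simp only [ev, ev_const_mul]
  | cons a u ih => simp only [ev, ih, ev_dsum]

/-- Disjointness ensures that neither evaluation overwrites letters set by the other one; the double
sum can then be rearranged. -/
theorem ev_fubini' {u w : List α} (h : u.Disjoint w) (M : (α → C) → k) (y : α → C) (c d : C) :
    ev u (fun y => ev w M y d) y c = ev w (fun y => ev u M y c) y d := by
  induction w generalizing y d with
  | nil => simp only [ev, ev_const_mul]
  | cons b w ih =>
    rw [List.disjoint_cons_right] at h
    simp only [ev, ev_dsum, ev_update _ _ h.1, ← ih h.2]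

/-- Coassociativity: splitting off the components of u one at a time is the same as first splitting
c in two and distributing the halves to u and w. -/
theorem ev_append {u w : List α} (h : (u ++ w).Nodup) {M : (α → C) → k}
    (hM : ∀ a ∈ u ++ w, LinearAt M a) (y : α → C) (c : C) :
    ev (u ++ w) M y c = dsum k (fun c1 c2 => ev u (fun y => ev w M y c2) y c1) c := by
  induction u generalizing y c with
  | nil =>
    simp only [List.nil_append] at h hM ⊢
    exact (dsum_counit_left (ev_isLinearMap h hM y) c).symm
  | cons a u ih =>
    rw [List.cons_append, List.nodup_cons] at h
    rw [List.cons_append, List.forall_mem_cons] at hM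
    simp only [List.cons_append, ev]
    rw [dsum_assoc]
    · exact dsum_congr (fun x c' => ih h.2 hM.2 _ _) c
    · intro y' z
      have h1 : a ∉ u := fun h' => h.1 (List.mem_append_left _ h')
      have h2 : a ∉ w := fun h' => h.1 (List.mem_append_right _ h')
      exact (hM.1.ev h2 z).ev h1 y' y
    · intro x z
      refine ev_isLinearMap (List.nodup_append.1 h.2).1 (fun b hb => ?_) _
      refine (hM.2 b (List.mem_append_left _ hb)).ev (fun hb' => ?_) _
      exact (List.nodup_append.1 h.2).2.2 b hb b hb' rfl
    · intro x y'
      exact ev_param u (fun z => ev_isLinearMap (List.nodup_append.1 h.2).2.1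
        (fun b hb => hM.2 b (List.mem_append_right _ hb)) z) _ _

/-- Words evaluated at an element give the same values if the letters are renamed and transformed
by coalgebra maps. -/
theorem ev_sim {ρ : β → α} (hρ : Function.Injective ρ) {g : β → C →ₗ[k] C} {τ : C →ₗ[k] C}
    (hτ : IsCoalgMap τ) {M : (β → C) → k} {N : (α → C) → k}
    {w : List β} (hw : w.Nodup) (hM : ∀ b ∈ w, LinearAt M b) (hg : ∀ b ∈ w, g b = τ)
    (hN : ∀ y z, (∀ b, z b = g b (y (ρ b))) → N y = M z) (y : α → C) (z : β → C)
    (hyz : ∀ b, z b = g b (y (ρ b))) (c : C) : ev (w.map ρ) N y c = ev w M z (τ c) := by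
  induction w generalizing y z c with
  | nil => simp only [List.map_nil, ev, hτ.counit_apply, hN y z hyz]
  | cons b w ih =>
    rw [List.nodup_cons] at hw
    rw [List.forall_mem_cons] at hM hg
    simp only [List.map_cons, ev]
    rw [hτ.dsum ⟨fun c => hM.1.ev hw.1 c z, fun x => ev_isLinearMap hw.2 hM.2 _⟩]
    refine dsum_congr (fun x c' => ?_) c
    -- The relation between y and z persists if y receives x at ρ b and z receives τ x at b, since ρ
    -- is injective.
    refine ih hw.2 hM.2 hg.2 _ _ (fun b' => ?_) c'
    by_cases hb : b' = b
    · subst hb; simp [hg.1]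
    · rw [Function.update_of_ne hb, Function.update_of_ne (fun e => hb (hρ e)), hyz]

/-! ### Evaluation of words of words -/

/-- Evaluation of a family of words, each at its own element. -/
noncomputable def bigev {σ : Type*} (W : σ → List α) :
    List σ → ((α → C) → k) → (α → C) → (σ → C) → k
  | [], M, y, _ => M y
  | t :: l, M, y, s => ev (W t) (fun y => bigev W l M y s) y (s t)

variable {σ : Type*} (W : σ → List α)

theorem bigev_update [DecidableEq σ] {l : List σ} {t : σ} (ht : t ∉ l) (M : (α → C) → k) (y : α → C) (s : σ → C)
    (x : C) : bigev W l M y (Function.update s t x) = bigev W l M y s := by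
  induction l generalizing y with
  | nil => rfl
  | cons t' l ih =>
    simp only [List.mem_cons, not_or] at ht
    simp only [bigev, ih ht.2, Function.update_of_ne (Ne.symm ht.1)]

theorem LinearAt.bigev {l : List σ} {M : (α → C) → k} {a : α} (h : LinearAt M a)
    (ha : a ∉ l.flatMap W) (s : σ → C) : LinearAt (fun y => bigev W l M y s) a := by
  induction l with
  | nil => exact h
  | cons t l ih =>
    rw [List.flatMap_cons, List.mem_append, not_or] at ha
    exact (ih ha.2).ev ha.1 _

/-- Iterated form of `ev_append`: a path cut into chains is evaluated by distributing c to the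
chains, which then distribute their elements to their own letters. -/
theorem ev_flatMap [DecidableEq σ] {l : List σ} (hl : l.Nodup) (h : (l.flatMap W).Nodup) {M : (α → C) → k}
    (hM : ∀ a ∈ l.flatMap W, LinearAt M a) (y : α → C) (s : σ → C) (c : C) :
    ev (l.flatMap W) M y c = ev l (fun s => bigev W l M y s) s c := by
  induction l generalizing y s c with
  | nil => rfl
  | cons t l ih =>
    rw [List.nodup_cons] at hl
    have h' := h
    have hM' := hM
    rw [List.flatMap_cons] at h hM ⊢
    rw [ev_append h hM]
    simp only [ev]
    refine dsum_congr (fun c1 c2 => ?_) c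
    rw [ev_update _ _ hl.1]
    simp only [bigev, Function.update_self, bigev_update W hl.1]
    rw [← ev_fubini]
    exact ev_congr (fun y => ih hl.2 (List.nodup_append.1 h).2.1
      (fun a ha => hM a (List.mem_append_right _ ha)) y s c2) _ _ _

/-- Once every word has its own element, the words are independent sums over disjoint sets of
letters. The order of the chains along a path thus matters only for the outer distribution of c. -/
theorem bigev_perm {l l' : List σ} (hl : l.Perm l') (h : (l.flatMap W).Nodup) (M : (α → C) → k)
    (y : α → C) (s : σ → C) : bigev W l M y s = bigev W l' M y s := by
  induction hl generalizing y with
  | nil => rfl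
  | cons t hl ih =>
    rw [List.flatMap_cons] at h
    exact ev_congr (fun y => ih (List.nodup_append.1 h).2.1 y) _ _ _
  | swap t t' l =>
    rw [List.flatMap_cons, List.flatMap_cons] at h
    refine ev_fubini' (fun a h1 h2 => ?_) _ _ _ _
    exact (List.nodup_append.1 h).2.2 a h1 a (List.mem_append_left _ h2) rfl
  | trans h1 _ ih1 ih2 =>
    exact (ih1 h y).trans (ih2 ((h1.flatMap_right W).nodup_iff.1 h) y)

theorem bigev_mul_left {l : List σ} {M N : (α → C) → k} (h : ∀ a ∈ l.flatMap W, IndepAt N a)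
    (y : α → C) (s : σ → C) :
    bigev W l (fun z => N z * M z) y s = N y * bigev W l M y s := by
  induction l generalizing y with
  | nil => rfl
  | cons t l ih =>
    rw [List.flatMap_cons] at h
    simp only [bigev, ih fun a ha => h a (List.mem_append_right _ ha)]
    exact ev_mul_left (fun a ha => h a (List.mem_append_left _ ha)) _ _

theorem ev_indep {w : List α} {M : (α → C) → k} {a : α} (h : IndepAt M a) (c : C) :
    IndepAt (fun y => ev w M y c) a := by
  intro y x
  show ev w M (Function.update y a x) c = ev w M y c
  induction w generalizing y c with
  | nil => simp only [ev, h y x]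
  | cons b w ih =>
    refine dsum_congr (fun x' c' => ?_) c
    by_cases hb : a = b
    · subst hb; rw [Function.update_idem]
    · rw [Function.update_comm hb, ih]

theorem bigev_indep {l : List σ} {M : (α → C) → k} {a : α} (h : IndepAt M a) (s : σ → C) :
    IndepAt (fun y => bigev W l M y s) a := by
  induction l with
  | nil => exact h
  | cons b w ih => exact ev_indep ih _

/-- Used to separate the crossings inside a local move from all others: sums over letters on which a
factor does not depend pass through this factor. -/
theorem bigev_append_mul {l l' : List σ} {M N : (α → C) → k}
    (h : ∀ a ∈ l.flatMap W, IndepAt N a) (h' : ∀ a ∈ l'.flatMap W, IndepAt M a) (y : α → C)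
    (s : σ → C) :
    bigev W (l ++ l') (fun z => M z * N z) y s = bigev W l M y s * bigev W l' N y s := by
  induction l generalizing y with
  | nil => exact bigev_mul_left W h' y s
  | cons t l ih =>
    rw [List.flatMap_cons] at h
    simp only [List.cons_append, bigev, ih fun a ha => h a (List.mem_append_right _ ha)]
    rw [mul_comm]
    refine Eq.trans (ev_congr (fun z => mul_comm _ _) _ _ _) ?_
    exact ev_mul_left (fun a ha => bigev_indep W (h a (List.mem_append_left _ ha)) s) _ _

/-- Version of `ev_sim` with a separate coalgebra map for each word. It serves both for moving
powers of T_d, T_u onto the elements of the chains and for renumbering crossings. -/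
theorem bigev_sim {W : σ → List α} {W' : σ → List β} {ρ : β → α} (hρ : Function.Injective ρ)
    {g : β → C →ₗ[k] C} {τ : σ → C →ₗ[k] C} {M : (β → C) → k} {N : (α → C) → k}
    {l : List σ} (hτ : ∀ t ∈ l, IsCoalgMap (τ t)) (hW : ∀ t ∈ l, W t = (W' t).map ρ)
    (hl : (l.flatMap W').Nodup) (hM : ∀ b ∈ l.flatMap W', LinearAt M b)
    (hg : ∀ t ∈ l, ∀ b ∈ W' t, g b = τ t)
    (hN : ∀ y z, (∀ b, z b = g b (y (ρ b))) → N y = M z) (y : α → C) (z : β → C)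
    (hyz : ∀ b, z b = g b (y (ρ b))) (s : σ → C) :
    bigev W l N y s = bigev W' l M z (fun t => τ t (s t)) := by
  induction l generalizing y z with
  | nil => exact hN y z hyz
  | cons t l ih =>
    rw [List.flatMap_cons] at hl hM
    rw [List.forall_mem_cons] at hτ hW hg
    simp only [bigev]
    rw [hW.1]
    refine ev_sim hρ hτ.1 (List.nodup_append.1 hl).1 (fun b hb => ?_) hg.1 ?_ y z hyz _
    · refine (hM b (List.mem_append_left _ hb)).bigev W' (fun hb' => ?_) _
      exact (List.nodup_append.1 hl).2.2 b hb b hb' rfl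
    · exact ih hτ.2 hW.2 (List.nodup_append.1 hl).2.1
        (fun b hb => hM b (List.mem_append_right _ hb)) hg.2

end Words

end SweedlerSums

/-! ## Convolution of bilinear and trilinear forms -/

section Convolution

open Coalgebra

universe u v

set_option linter.unusedSectionVars false

variable {k : Type u} [Field k]

section Three

variable {C₁ C₂ C₃ : Type*} [AddCommGroup C₁] [Module k C₁] [Coalgebra k C₁] [AddCommGroup C₂]
  [Module k C₂] [Coalgebra k C₂] [AddCommGroup C₃] [Module k C₃] [Coalgebra k C₃]

/-- Representations of the coproducts of two elements yield one of their tensor product. -/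
noncomputable def Coalgebra.Repr.tensor {x : C₁} {y : C₂} {ι κ : Type*} (r : Coalgebra.Repr k x ι)
    (s : Coalgebra.Repr k y κ) : Coalgebra.Repr k (x ⊗ₜ[k] y) (ι × κ) where
  index := r.index ×ˢ s.index
  left i := r.left i.1 ⊗ₜ s.left i.2
  right i := r.right i.1 ⊗ₜ s.right i.2
  eq := by
    rw [TensorProduct.comul_tmul, ← r.eq, ← s.eq, TensorProduct.sum_tmul, map_sum,
      Finset.sum_product]
    refine Finset.sum_congr rfl fun i _ => ?_
    rw [TensorProduct.tmul_sum, map_sum]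
    rfl

theorem convMul_tmul (f g : WithConv (C₁ ⊗[k] C₂ →ₗ[k] k)) (x : C₁) (y : C₂) :
    (f * g) (x ⊗ₜ y) = dsum k (fun x₁ x₂ => dsum k (fun y₁ y₂ =>
      f (x₁ ⊗ₜ y₁) * g (x₂ ⊗ₜ y₂)) y) x := by
  rw [((ℛ k x).tensor (ℛ k y)).convMul_apply]
  exact Finset.sum_product _ _ _

theorem convMul_tmul₃ (f g : WithConv (C₁ ⊗[k] (C₂ ⊗[k] C₃) →ₗ[k] k)) (x : C₁) (y : C₂) (z : C₃) :
    (f * g) (x ⊗ₜ (y ⊗ₜ z)) = dsum k (fun x₁ x₂ => dsum k (fun y₁ y₂ => dsum k (fun z₁ z₂ =>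
      f (x₁ ⊗ₜ (y₁ ⊗ₜ z₁)) * g (x₂ ⊗ₜ (y₂ ⊗ₜ z₂))) z) y) x := by
  rw [((ℛ k x).tensor ((ℛ k y).tensor (ℛ k z))).convMul_apply]
  refine (Finset.sum_product _ _ _).trans (Finset.sum_congr rfl fun i _ => ?_)
  exact Finset.sum_product _ _ _

theorem isLinearMap_tmul₁ (f : WithConv (C₁ ⊗[k] (C₂ ⊗[k] C₃) →ₗ[k] k)) (y : C₂) (z : C₃) :
    IsLinearMap k fun x => f (x ⊗ₜ (y ⊗ₜ z)) :=
  (LinearMap.isLinearMap' f.ofConv).comp' ((TensorProduct.mk k C₁ (C₂ ⊗[k] C₃)).flip (y ⊗ₜ z))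

theorem isLinearMap_tmul₂ (f : WithConv (C₁ ⊗[k] (C₂ ⊗[k] C₃) →ₗ[k] k)) (x : C₁) (z : C₃) :
    IsLinearMap k fun y => f (x ⊗ₜ (y ⊗ₜ z)) :=
  (LinearMap.isLinearMap' f.ofConv).comp'
    (TensorProduct.mk k C₁ (C₂ ⊗[k] C₃) x ∘ₗ (TensorProduct.mk k C₂ C₃).flip z)

theorem isLinearMap_tmul₃ (f : WithConv (C₁ ⊗[k] (C₂ ⊗[k] C₃) →ₗ[k] k)) (x : C₁) (y : C₂) :
    IsLinearMap k fun z => f (x ⊗ₜ (y ⊗ₜ z)) :=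
  (LinearMap.isLinearMap' f.ofConv).comp'
    (TensorProduct.mk k C₁ (C₂ ⊗[k] C₃) x ∘ₗ TensorProduct.mk k C₂ C₃ y)

/-- A bilinear form, seen as an element of the dual algebra of the tensor product. -/
noncomputable def form₂ {F : C₁ → C₂ → k} (h : IsBilin k F) : WithConv (C₁ ⊗[k] C₂ →ₗ[k] k) :=
  WithConv.toConv (TensorProduct.lift h.toLin)

theorem conv_ext {f g : WithConv (C₁ ⊗[k] C₂ →ₗ[k] k)} (h : ∀ x y, f (x ⊗ₜ y) = g (x ⊗ₜ y)) :
    f = g :=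
  congrArg WithConv.toConv (TensorProduct.ext' h : f.ofConv = g.ofConv)

theorem conv_ext₃ {f g : WithConv (C₁ ⊗[k] (C₂ ⊗[k] C₃) →ₗ[k] k)}
    (h : ∀ x y z, f (x ⊗ₜ (y ⊗ₜ z)) = g (x ⊗ₜ (y ⊗ₜ z))) : f = g :=
  congrArg WithConv.toConv (TensorProduct.ext_threefold' h : f.ofConv = g.ofConv)

variable (C₃) in
/-- The bilinear form on the first two factors. -/
noncomputable def form₁₂ {F : C₁ → C₂ → k} (h : IsBilin k F) :
    WithConv (C₁ ⊗[k] (C₂ ⊗[k] C₃) →ₗ[k] k) :=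
  WithConv.toConv ((TensorProduct.lid k k).toLinearMap ∘ₗ
    TensorProduct.map (TensorProduct.lift h.toLin) counit ∘ₗ
    (TensorProduct.assoc k C₁ C₂ C₃).symm.toLinearMap)

variable (C₂) in
/-- The bilinear form on the first and the third factor. -/
noncomputable def form₁₃ {F : C₁ → C₃ → k} (h : IsBilin k F) :
    WithConv (C₁ ⊗[k] (C₂ ⊗[k] C₃) →ₗ[k] k) :=
  WithConv.toConv (TensorProduct.lift h.toLin ∘ₗ
    ((TensorProduct.lid k C₃).toLinearMap ∘ₗ counit.rTensor C₃).lTensor C₁)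

variable (C₁) in
/-- The bilinear form on the last two factors. -/
noncomputable def form₂₃ {F : C₂ → C₃ → k} (h : IsBilin k F) :
    WithConv (C₁ ⊗[k] (C₂ ⊗[k] C₃) →ₗ[k] k) :=
  WithConv.toConv ((TensorProduct.lid k k).toLinearMap ∘ₗ
    TensorProduct.map counit (TensorProduct.lift h.toLin))

theorem form₁₂_tmul {F : C₁ → C₂ → k} (h : IsBilin k F) (x : C₁) (y : C₂) (z : C₃) :
    form₁₂ C₃ h (x ⊗ₜ (y ⊗ₜ z)) = F x y * counit (R := k) z := rfl

theorem form₁₃_tmul {F : C₁ → C₃ → k} (h : IsBilin k F) (x : C₁) (y : C₂) (z : C₃) :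
    form₁₃ C₂ h (x ⊗ₜ (y ⊗ₜ z)) = counit (R := k) y * F x z := (h.right x).map_smul _ _

theorem form₂₃_tmul {F : C₂ → C₃ → k} (h : IsBilin k F) (x : C₁) (y : C₂) (z : C₃) :
    form₂₃ C₁ h (x ⊗ₜ (y ⊗ₜ z)) = counit (R := k) x * F y z := rfl

/-- The counit in the third slot absorbs the corresponding Sweedler sum, so convolution with a form
on two factors involves only the coproducts of these two. -/
theorem form₁₂_mul {F : C₁ → C₂ → k} (h : IsBilin k F)
    (f : WithConv (C₁ ⊗[k] (C₂ ⊗[k] C₃) →ₗ[k] k)) (x : C₁) (y : C₂) (z : C₃) :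
    (form₁₂ C₃ h * f) (x ⊗ₜ (y ⊗ₜ z)) = dsum k (fun x₁ x₂ => dsum k (fun y₁ y₂ =>
      F x₁ y₁ * f (x₂ ⊗ₜ (y₂ ⊗ₜ z))) y) x := by
  rw [convMul_tmul₃]
  refine dsum_congr (fun x₁ x₂ => dsum_congr (fun y₁ y₂ => ?_) y) x
  simp only [form₁₂_tmul, mul_assoc, dsum_const_mul]
  rw [dsum_counit_left (isLinearMap_tmul₃ f x₂ y₂)]

theorem form₁₃_mul {F : C₁ → C₃ → k} (h : IsBilin k F)
    (f : WithConv (C₁ ⊗[k] (C₂ ⊗[k] C₃) →ₗ[k] k)) (x : C₁) (y : C₂) (z : C₃) :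
    (form₁₃ C₂ h * f) (x ⊗ₜ (y ⊗ₜ z)) = dsum k (fun x₁ x₂ => dsum k (fun z₁ z₂ =>
      F x₁ z₁ * f (x₂ ⊗ₜ (y ⊗ₜ z₂))) z) x := by
  rw [convMul_tmul₃]
  refine dsum_congr (fun x₁ x₂ => ?_) x
  rw [dsum_comm]
  refine dsum_congr (fun z₁ z₂ => ?_) z
  simp only [form₁₃_tmul, mul_assoc, mul_left_comm _ (F _ _), dsum_const_mul]
  rw [dsum_counit_left (isLinearMap_tmul₂ f x₂ z₂)]

theorem form₂₃_mul {F : C₂ → C₃ → k} (h : IsBilin k F)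
    (f : WithConv (C₁ ⊗[k] (C₂ ⊗[k] C₃) →ₗ[k] k)) (x : C₁) (y : C₂) (z : C₃) :
    (form₂₃ C₁ h * f) (x ⊗ₜ (y ⊗ₜ z)) = dsum k (fun y₁ y₂ => dsum k (fun z₁ z₂ =>
      F y₁ z₁ * f (x ⊗ₜ (y₂ ⊗ₜ z₂))) z) y := by
  rw [convMul_tmul₃, dsum_comm]
  refine dsum_congr (fun y₁ y₂ => ?_) y
  rw [dsum_comm]
  refine dsum_congr (fun z₁ z₂ => ?_) z
  simp only [form₂₃_tmul, mul_assoc, mul_left_comm _ (F _ _), dsum_const_mul]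
  rw [dsum_counit_left (isLinearMap_tmul₁ f y₂ z₂)]

theorem conv_one_tmul₃ (x : C₁) (y : C₂) (z : C₃) :
    (1 : WithConv (C₁ ⊗[k] (C₂ ⊗[k] C₃) →ₗ[k] k)) (x ⊗ₜ (y ⊗ₜ z)) =
      counit (R := k) x * (counit (R := k) y * counit (R := k) z) := by
  simp [LinearMap.convOne_apply]
  ring

theorem conv_one_tmul (x : C₁) (y : C₂) :
    (1 : WithConv (C₁ ⊗[k] C₂ →ₗ[k] k)) (x ⊗ₜ y) = counit (R := k) x * counit (R := k) y := by
  simp [LinearMap.convOne_apply]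
  ring

/-- Convolution inverses of bilinear forms. -/
def IsConvInv (F G : C₁ → C₂ → k) : Prop := ∀ x y,
  dsum k (fun x₁ x₂ => dsum k (fun y₁ y₂ => F x₁ y₁ * G x₂ y₂) y) x =
    counit (R := k) x * counit (R := k) y

theorem IsConvInv.form₂_mul {F G : C₁ → C₂ → k} (hF : IsBilin k F) (hG : IsBilin k G)
    (h : IsConvInv F G) : form₂ hF * form₂ hG = 1 :=
  conv_ext fun x y => by rw [convMul_tmul, conv_one_tmul]; exact h x y

theorem IsConvInv.form₁₂_mul {F G : C₁ → C₂ → k} (hF : IsBilin k F) (hG : IsBilin k G)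
    (h : IsConvInv F G) : form₁₂ C₃ hF * form₁₂ C₃ hG = 1 :=
  conv_ext₃ fun x y z => by
    rw [_root_.form₁₂_mul, conv_one_tmul₃]
    simp only [form₁₂_tmul, ← mul_assoc, dsum_mul_const]
    rw [h x y]

theorem IsConvInv.form₁₃_mul {F G : C₁ → C₃ → k} (hF : IsBilin k F) (hG : IsBilin k G)
    (h : IsConvInv F G) : form₁₃ C₂ hF * form₁₃ C₂ hG = 1 :=
  conv_ext₃ fun x y z => by
    rw [_root_.form₁₃_mul, conv_one_tmul₃]
    simp only [form₁₃_tmul, mul_left_comm (F _ _), dsum_const_mul]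
    rw [h x z]
    ring

theorem IsConvInv.form₂₃_mul {F G : C₂ → C₃ → k} (hF : IsBilin k F) (hG : IsBilin k G)
    (h : IsConvInv F G) : form₂₃ C₁ hF * form₂₃ C₁ hG = 1 :=
  conv_ext₃ fun x y z => by
    rw [_root_.form₂₃_mul, conv_one_tmul₃]
    simp only [form₂₃_tmul, mul_left_comm (F _ _), dsum_const_mul]
    rw [h y z]

section Products

variable {F : C₁ → C₂ → k} {G : C₁ → C₃ → k} {H : C₂ → C₃ → k} (hF : IsBilin k F)
  (hG : IsBilin k G) (hH : IsBilin k H) (x : C₁) (y : C₂) (z : C₃)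

theorem form₁₂_mul_form₁₃_mul_form₂₃ :
    (form₁₂ C₃ hF * (form₁₃ C₂ hG * form₂₃ C₁ hH)) (x ⊗ₜ (y ⊗ₜ z)) =
      dsum k (fun x₁ x₂ => dsum k (fun y₁ y₂ => dsum k (fun z₁ z₂ =>
        F x₁ y₁ * G x₂ z₁ * H y₂ z₂) z) y) x := by
  rw [form₁₂_mul]
  refine dsum_congr (fun x₁ x₂ => dsum_congr (fun y₁ y₂ => ?_) y) x
  rw [form₁₃_mul, dsum_comm, ← dsum_const_mul]
  refine dsum_congr (fun z₁ z₂ => ?_) z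
  simp only [form₂₃_tmul, ← mul_assoc, dsum_mul_const]
  rw [dsum_counit_right (hG.left z₁)]

theorem form₂₃_mul_form₁₃_mul_form₁₂ :
    (form₂₃ C₁ hH * (form₁₃ C₂ hG * form₁₂ C₃ hF)) (x ⊗ₜ (y ⊗ₜ z)) =
      dsum k (fun x₁ x₂ => dsum k (fun y₁ y₂ => dsum k (fun z₁ z₂ =>
        F x₂ y₂ * G x₁ z₂ * H y₁ z₁) z) y) x := by
  rw [form₂₃_mul, dsum_comm (C := C₁)]
  refine dsum_congr (fun y₁ y₂ => ?_) y
  rw [dsum_comm (C := C₁)]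
  refine dsum_congr (fun z₁ z₂ => ?_) z
  rw [form₁₃_mul, ← dsum_const_mul]
  refine dsum_congr (fun x₁ x₂ => ?_) x
  simp only [form₁₂_tmul, mul_left_comm _ (F _ _), dsum_const_mul]
  rw [dsum_counit_right (hG.right x₁)]
  ring

theorem form₁₂_mul_form₂₃_mul_form₁₃ :
    (form₁₂ C₃ hF * (form₂₃ C₁ hH * form₁₃ C₂ hG)) (x ⊗ₜ (y ⊗ₜ z)) =
      dsum k (fun x₁ x₂ => dsum k (fun y₁ y₂ => dsum k (fun z₁ z₂ =>
        F x₁ y₁ * G x₂ z₂ * H y₂ z₁) z) y) x := by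
  rw [form₁₂_mul]
  refine dsum_congr (fun x₁ x₂ => dsum_congr (fun y₁ y₂ => ?_) y) x
  rw [form₂₃_mul, dsum_comm, ← dsum_const_mul]
  refine dsum_congr (fun z₁ z₂ => ?_) z
  simp only [form₁₃_tmul, ← mul_assoc, dsum_mul_const]
  rw [dsum_counit_right (hH.left z₁)]
  ring

theorem form₁₃_mul_form₂₃_mul_form₁₂ :
    (form₁₃ C₂ hG * (form₂₃ C₁ hH * form₁₂ C₃ hF)) (x ⊗ₜ (y ⊗ₜ z)) =
      dsum k (fun x₁ x₂ => dsum k (fun y₁ y₂ => dsum k (fun z₁ z₂ =>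
        F x₂ y₂ * G x₁ z₁ * H y₁ z₂) z) y) x := by
  rw [form₁₃_mul]
  refine dsum_congr (fun x₁ x₂ => ?_) x
  rw [dsum_comm (C := C₂)]
  refine dsum_congr (fun z₁ z₂ => ?_) z
  rw [form₂₃_mul, ← dsum_const_mul]
  refine dsum_congr (fun y₁ y₂ => ?_) y
  simp only [form₁₂_tmul, mul_left_comm _ (F _ _), dsum_const_mul]
  rw [dsum_counit_right (hH.right y₁)]
  ring

end Products

end Three

/-! ### Forms on C and its opposite, and the braid relation -/

variable {C : Type v} [AddCommGroup C] [Module k C] [Coalgebra k C]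

/-- The inverse of a bilinear form is unique. -/
theorem IsConvInv.unique {F G G' : C → C → k} (hF : IsBilin k F) (hG : IsBilin k G)
    (hG' : IsBilin k G') (h : IsConvInv G F) (h' : IsConvInv F G') : G = G' := by
  have e := left_inv_eq_right_inv (h.form₂_mul hG hF) (h'.form₂_mul hF hG')
  funext x y
  exact congrArg (fun f : WithConv (C ⊗[k] C →ₗ[k] k) => f (x ⊗ₜ y)) e

/-- Sweedler sums in `C` if `a = true`, and in the opposite coalgebra if `a = false`. -/
noncomputable def dsumO (a : Bool) (f : C → C → k) (c : C) : k :=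
  if a then dsum k f c else dsum k (fun x y => f y x) c

theorem dsumO_not (a : Bool) (f : C → C → k) (c : C) :
    dsumO (!a) f c = dsumO a (fun x y => f y x) c := by
  cases a <;> rfl

theorem dsumO_congr (a : Bool) {f g : C → C → k} (h : ∀ x y, f x y = g x y) (c : C) :
    dsumO a f c = dsumO a g c := by
  rw [show f = g from funext fun x => funext (h x)]

theorem dsumO_comm (a b : Bool) (f : C → C → C → C → k) (c d : C) :
    dsumO a (fun x y => dsumO b (fun x' y' => f x y x' y') d) c =
      dsumO b (fun x' y' => dsumO a (fun x y => f x y x' y') c) d := by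
  cases a <;> cases b <;> exact Finset.sum_comm

theorem IsCoalgMap.dsumO {τ : C →ₗ[k] C} (hτ : IsCoalgMap τ) (a : Bool) {f : C → C → k}
    (h : IsBilin k f) (c : C) :
    dsumO a f (τ c) = dsumO a (fun x y => f (τ x) (τ y)) c := by
  cases a
  · exact hτ.dsum h.flip c
  · exact hτ.dsum h c

theorem dsumO_isLinearMap_param {E : Type*} [AddCommGroup E] [Module k E] (a : Bool)
    {f : E → C → C → k} (h : ∀ x y, IsLinearMap k fun t => f t x y) (c : C) :
    IsLinearMap k fun t => dsumO a (f t) c := by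
  cases a
  · exact dsum_isLinearMap_param (fun x y => h y x) c
  · exact dsum_isLinearMap_param h c

/-- The coalgebra `C` if `a = true`, and the opposite coalgebra if `a = false`. -/
def OC (_a : Bool) (C : Type v) : Type v := C

instance (a : Bool) : AddCommGroup (OC a C) := inferInstanceAs (AddCommGroup C)

instance (a : Bool) : Module k (OC a C) := inferInstanceAs (Module k C)

noncomputable instance OC.instCoalgebra : (a : Bool) → Coalgebra k (OC a C)
  | true => inferInstanceAs (Coalgebra k C)
  | false => inferInstanceAs (Coalgebra k (Cop C))

theorem dsum_cop {f : C → C → k} (h : IsBilin k f) (c : C) :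
    dsum k (C := Cop C) f (Cop.equiv k C c) = dsum k (fun x y => f y x) c := by
  have h' : IsBilin k (E := Cop C) (F := Cop C) f := ⟨fun y => ⟨(h.left y).1, (h.left y).2⟩,
    fun y => ⟨(h.right y).1, (h.right y).2⟩⟩
  exact dsum_eq_sum h' (Cop.repr (ℛ k c))

/-- The identity map from a coalgebra to `OC a C`. -/
def OC.mk (a : Bool) (c : C) : OC a C := c

/-- The identity map from `OC a C` to `C`. -/
def OC.un {a : Bool} (c : OC a C) : C := c

theorem dsum_OC (a : Bool) {f : C → C → k} (h : IsBilin k f) (c : C) :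
    dsum k (fun x y : OC a C => f x.un y.un) (OC.mk a c) = dsumO a f c := by
  cases a
  · exact dsum_cop h c
  · rfl

theorem counit_OC (a : Bool) (c : OC a C) : counit (R := k) c = counit (R := k) c.un := by
  cases a <;> rfl

theorem IsLinearMap.OC {f : C → k} (h : IsLinearMap k f) (a : Bool) :
    IsLinearMap k fun x : OC a C => f x.un := ⟨h.1, h.2⟩

theorem IsBilin.OC {f : C → C → k} (h : IsBilin k f) (a b : Bool) :
    IsBilin k fun (x : OC a C) (y : OC b C) => f x.un y.un :=
  ⟨fun y => (h.left y.un).OC a, fun x => (h.right x.un).OC b⟩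

/-- Convolution inverses of bilinear forms on `C` or the opposite coalgebra. -/
def IsConvInvO (a b : Bool) (F G : C → C → k) : Prop := ∀ x y,
  dsumO a (fun x₁ x₂ => dsumO b (fun y₁ y₂ => F x₁ y₁ * G x₂ y₂) y) x =
    counit (R := k) x * counit (R := k) y

theorem IsBilin.mul_right_right {f g : C → C → k} (hf : IsBilin k f) (hg : IsBilin k g) (x y : C) :
    IsBilin k fun x' y' => f x x' * g y y' :=
  ⟨fun _ => (hf.right x).mul_const _, fun _ => (hg.right y).const_mul _⟩

/-- Translates explicit Sweedler identities, with orders given by orientations, into honest inverses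
in a dual algebra. -/
theorem IsConvInvO.toOC {a b : Bool} {F G : C → C → k} (hF : IsBilin k F) (hG : IsBilin k G)
    (h : IsConvInvO a b F G) : IsConvInv (fun (x : OC a C) (y : OC b C) => F x.un y.un)
      (fun (x : OC a C) (y : OC b C) => G x.un y.un) := by
  intro x y
  rw [counit_OC, counit_OC]
  refine Eq.trans ?_ (h x.un y.un)
  rw [← dsum_OC]
  · refine dsum_congr (fun x₁ x₂ => ?_) _
    exact dsum_OC b (hF.mul_right_right hG x₁.un x₂.un) y.un
  · refine ⟨fun y => ?_, fun x => ?_⟩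
    · exact dsumO_isLinearMap_param b (fun _ _ => (hF.left _).mul_const _) _
    · exact dsumO_isLinearMap_param b (fun _ _ => (hG.left _).const_mul _) _

/-- The braid relation for three bilinear forms. -/
def BraidRel (a b c : Bool) (F G H : C → C → k) : Prop := ∀ x y z,
  dsumO a (fun x₁ x₂ => dsumO b (fun y₁ y₂ => dsumO c (fun z₁ z₂ =>
    F x₁ y₁ * G x₂ z₁ * H y₂ z₂) z) y) x =
  dsumO a (fun x₁ x₂ => dsumO b (fun y₁ y₂ => dsumO c (fun z₁ z₂ =>
    F x₂ y₂ * G x₁ z₂ * H y₁ z₁) z) y) x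

/-- The six linearity conditions are needed since the Sweedler sum over an opposite coalgebra uses
its own chosen representations. -/
theorem dsumO_three (a b c : Bool) {f : C → C → C → C → C → C → k}
    (h1 : ∀ x₂ y₁ y₂ z₁ z₂, IsLinearMap k fun x₁ => f x₁ x₂ y₁ y₂ z₁ z₂)
    (h2 : ∀ x₁ y₁ y₂ z₁ z₂, IsLinearMap k fun x₂ => f x₁ x₂ y₁ y₂ z₁ z₂)
    (h3 : ∀ x₁ x₂ y₂ z₁ z₂, IsLinearMap k fun y₁ => f x₁ x₂ y₁ y₂ z₁ z₂)
    (h4 : ∀ x₁ x₂ y₁ z₁ z₂, IsLinearMap k fun y₂ => f x₁ x₂ y₁ y₂ z₁ z₂)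
    (h5 : ∀ x₁ x₂ y₁ y₂ z₂, IsLinearMap k fun z₁ => f x₁ x₂ y₁ y₂ z₁ z₂)
    (h6 : ∀ x₁ x₂ y₁ y₂ z₁, IsLinearMap k fun z₂ => f x₁ x₂ y₁ y₂ z₁ z₂) (x y z : C) :
    dsum k (fun x₁ x₂ : OC a C => dsum k (fun y₁ y₂ : OC b C => dsum k (fun z₁ z₂ : OC c C =>
      f x₁.un x₂.un y₁.un y₂.un z₁.un z₂.un) (OC.mk c z)) (OC.mk b y)) (OC.mk a x) =
    dsumO a (fun x₁ x₂ => dsumO b (fun y₁ y₂ => dsumO c (fun z₁ z₂ =>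
      f x₁ x₂ y₁ y₂ z₁ z₂) z) y) x := by
  rw [← dsum_OC]
  · refine dsum_congr (fun x₁ x₂ => ?_) _
    rw [← dsum_OC]
    · refine dsum_congr (fun y₁ y₂ => ?_) _
      exact dsum_OC c ⟨fun _ => h5 _ _ _ _ _, fun _ => h6 _ _ _ _ _⟩ z
    · exact ⟨fun _ => dsumO_isLinearMap_param c (fun _ _ => h3 _ _ _ _ _) _,
        fun _ => dsumO_isLinearMap_param c (fun _ _ => h4 _ _ _ _ _) _⟩
  · exact ⟨fun _ => dsumO_isLinearMap_param b (fun _ _ => dsumO_isLinearMap_param c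
      (fun _ _ => h1 _ _ _ _ _) _) _, fun _ => dsumO_isLinearMap_param b
      (fun _ _ => dsumO_isLinearMap_param c (fun _ _ => h2 _ _ _ _ _) _) _⟩

/-- The braid relation is the Yang-Baxter equation in the dual algebra of the tensor product of C or
C^cop for the three strands; as an identity in an algebra it can be manipulated by inverting
factors. -/
theorem braidRel_iff {a b c : Bool} {F G H : C → C → k} (hF : IsBilin k F) (hG : IsBilin k G)
    (hH : IsBilin k H) : BraidRel a b c F G H ↔
      form₁₂ (OC c C) (hF.OC a b) * (form₁₃ (OC b C) (hG.OC a c) * form₂₃ (OC a C) (hH.OC b c)) =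
      form₂₃ (OC a C) (hH.OC b c) * (form₁₃ (OC b C) (hG.OC a c) *
        form₁₂ (OC c C) (hF.OC a b)) := by
  have key : ∀ x y z : C, _ ∧ _ := fun x y z =>
    ⟨dsumO_three a b c (f := fun x₁ x₂ y₁ y₂ z₁ z₂ => F x₁ y₁ * G x₂ z₁ * H y₂ z₂)
      ?_ ?_ ?_ ?_ ?_ ?_ x y z,
    dsumO_three a b c (f := fun x₁ x₂ y₁ y₂ z₁ z₂ => F x₂ y₂ * G x₁ z₂ * H y₁ z₁)
      ?_ ?_ ?_ ?_ ?_ ?_ x y z⟩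
  · constructor
    · intro h
      refine conv_ext₃ fun x y z => ?_
      rw [form₁₂_mul_form₁₃_mul_form₂₃, form₂₃_mul_form₁₃_mul_form₁₂]
      have h1 := key x.un y.un z.un
      exact h1.1.trans ((h x.un y.un z.un).trans h1.2.symm)
    · intro h x y z
      have e := congrArg (fun f : WithConv (OC a C ⊗[k] (OC b C ⊗[k] OC c C) →ₗ[k] k) =>
        f (OC.mk a x ⊗ₜ (OC.mk b y ⊗ₜ OC.mk c z))) h
      rw [form₁₂_mul_form₁₃_mul_form₂₃, form₂₃_mul_form₁₃_mul_form₁₂] at e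
      have h1 := key x y z
      exact h1.1.symm.trans (e.trans h1.2)
  all_goals intros
  all_goals first
    | exact ((hF.left _).mul_const _).mul_const _
    | exact ((hF.right _).mul_const _).mul_const _
    | exact ((hG.left _).const_mul _).mul_const _
    | exact ((hG.right _).const_mul _).mul_const _
    | exact (hH.left _).const_mul _
    | exact (hH.right _).const_mul _

/-- Bilinear forms which are inverse to each other. -/
def IsConvPair (a b : Bool) (F G : C → C → k) : Prop := IsConvInvO a b F G ∧ IsConvInvO a b G F

theorem IsConvPair.symm {a b : Bool} {F G : C → C → k} (h : IsConvPair a b F G) :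
    IsConvPair a b G F := ⟨h.2, h.1⟩

/-- Both sides of the new relation are inverse to the common value of the two sides of the old one,
because inverting a product reverses its order. -/
theorem BraidRel.inverse {a b c : Bool} {F G H F' G' H' : C → C → k} (hF : IsBilin k F)
    (hG : IsBilin k G) (hH : IsBilin k H) (hF' : IsBilin k F') (hG' : IsBilin k G')
    (hH' : IsBilin k H') (h : BraidRel a b c F G H) (f1 : IsConvPair a b F F')
    (g1 : IsConvPair a c G G') (h1 : IsConvPair b c H H') : BraidRel a b c F' G' H' := by
  rw [braidRel_iff hF hG hH] at h
  rw [braidRel_iff hF' hG' hH']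
  have f2 := (f1.2.toOC hF' hF).form₁₂_mul (C₃ := OC c C) (hF'.OC _ _) (hF.OC _ _)
  have f1 := (f1.1.toOC hF hF').form₁₂_mul (C₃ := OC c C) (hF.OC _ _) (hF'.OC _ _)
  have g2 := (g1.2.toOC hG' hG).form₁₃_mul (C₂ := OC b C) (hG'.OC _ _) (hG.OC _ _)
  have g1 := (g1.1.toOC hG hG').form₁₃_mul (C₂ := OC b C) (hG.OC _ _) (hG'.OC _ _)
  have h2 := (h1.2.toOC hH' hH).form₂₃_mul (C₁ := OC a C) (hH'.OC _ _) (hH.OC _ _)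
  have h1 := (h1.1.toOC hH hH').form₂₃_mul (C₁ := OC a C) (hH.OC _ _) (hH'.OC _ _)
  generalize form₁₂ (OC c C) (hF.OC a b) = f at *
  generalize form₁₂ (OC c C) (hF'.OC a b) = f' at *
  generalize form₁₃ (OC b C) (hG'.OC a c) = g' at *
  generalize form₁₃ (OC b C) (hG.OC a c) = g at *
  generalize form₂₃ (OC a C) (hH.OC b c) = r at *
  generalize form₂₃ (OC a C) (hH'.OC b c) = r' at *
  refine left_inv_eq_right_inv (a := r * (g * f)) ?_ ?_
  · rw [← h]
    calc f' * (g' * r') * (f * (g * r)) = f' * (g' * r') * (r * (g * f)) := by rw [h]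
      _ = f' * (g' * (r' * r) * g) * f := by simp only [mul_assoc]
      _ = 1 := by rw [h2, mul_one, g2, mul_one, f2]
  · rw [← h]
    calc f * (g * r) * (r' * (g' * f')) = f * (g * (r * r') * g') * f' := by simp only [mul_assoc]
      _ = 1 := by rw [h1, mul_one, g1, mul_one, f1]

/-- Reversing the third coproduct exchanges the two factors containing the third slot, so F G H = H
G F turns into F H G = G H F. Multiplying by the inverses of G H on the left and of H G on the right
gives F G' H' = H' G' F. -/
theorem BraidRel.reverse_right {a b c : Bool} {F G H G' H' : C → C → k} (hF : IsBilin k F)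
    (hG : IsBilin k G) (hH : IsBilin k H) (hG' : IsBilin k G') (hH' : IsBilin k H')
    (h : BraidRel a b c F G H) (g1 : IsConvPair a (!c) G G') (h1 : IsConvPair b (!c) H H') :
    BraidRel a b (!c) F G' H' := by
  have g2 := (g1.2.toOC hG' hG).form₁₃_mul (C₂ := OC b C) (hG'.OC _ _) (hG.OC _ _)
  have g1 := (g1.1.toOC hG hG').form₁₃_mul (C₂ := OC b C) (hG.OC _ _) (hG'.OC _ _)
  have h2 := (h1.2.toOC hH' hH).form₂₃_mul (C₁ := OC a C) (hH'.OC _ _) (hH.OC _ _)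
  have h1 := (h1.1.toOC hH hH').form₂₃_mul (C₁ := OC a C) (hH.OC _ _) (hH'.OC _ _)
  -- The old relation read in the algebra with reversed third factor; F does not involve this
  -- factor, and the order of G and H is exchanged.
  have e : form₁₂ (OC (!c) C) (hF.OC a b) * (form₂₃ (OC a C) (hH.OC b (!c)) *
      form₁₃ (OC b C) (hG.OC a (!c))) = form₁₃ (OC b C) (hG.OC a (!c)) *
        (form₂₃ (OC a C) (hH.OC b (!c)) * form₁₂ (OC (!c) C) (hF.OC a b)) := by
    refine conv_ext₃ fun x y z => ?_
    rw [form₁₂_mul_form₂₃_mul_form₁₃, form₁₃_mul_form₂₃_mul_form₁₂]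
    refine (dsumO_three a b (!c) (f := fun x₁ x₂ y₁ y₂ z₁ z₂ => F x₁ y₁ * G x₂ z₂ * H y₂ z₁)
      ?_ ?_ ?_ ?_ ?_ ?_ x.un y.un z.un).trans (Eq.trans ?main (dsumO_three a b (!c)
        (f := fun x₁ x₂ y₁ y₂ z₁ z₂ => F x₂ y₂ * G x₁ z₁ * H y₁ z₂) ?_ ?_ ?_ ?_ ?_ ?_
          x.un y.un z.un).symm)
    case main =>
      simp only [dsumO_not c]
      exact h x.un y.un z.un
    all_goals intros
    all_goals first
      | exact ((hF.left _).mul_const _).mul_const _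
      | exact ((hF.right _).mul_const _).mul_const _
      | exact ((hG.left _).const_mul _).mul_const _
      | exact ((hG.right _).const_mul _).mul_const _
      | exact (hH.left _).const_mul _
      | exact (hH.right _).const_mul _
  rw [braidRel_iff hF hG' hH']
  generalize form₁₂ (OC (!c) C) (hF.OC a b) = f at *
  generalize form₁₃ (OC b C) (hG'.OC a (!c)) = g' at *
  generalize form₁₃ (OC b C) (hG.OC a (!c)) = g at *
  generalize form₂₃ (OC a C) (hH.OC b (!c)) = h at *
  generalize form₂₃ (OC a C) (hH'.OC b (!c)) = h' at *
  calc f * (g' * h') = h' * ((g' * g) * h) * f * (g' * h') := by rw [g2, one_mul, h2, one_mul]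
    _ = h' * g' * (g * (h * f)) * (g' * h') := by simp only [mul_assoc]
    _ = h' * g' * f * (h * (g * g') * h') := by rw [← e]; simp only [mul_assoc]
    _ = h' * (g' * f) := by rw [g1, mul_one, h1, mul_one, mul_assoc]

/-- Reading the three tensor factors from right to left exchanges the two sides of the Yang-Baxter
equation. -/
theorem BraidRel.flip {a b c : Bool} {F G H : C → C → k} (h : BraidRel a b c F G H) :
    BraidRel c b a (fun x y => H y x) (fun x y => G y x) (fun x y => F y x) := by
  intro z y x
  have key : ∀ f : C → C → C → C → C → C → k,
      dsumO c (fun z₁ z₂ => dsumO b (fun y₁ y₂ => dsumO a (fun x₁ x₂ => f x₁ x₂ y₁ y₂ z₁ z₂) x) y) z =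
      dsumO a (fun x₁ x₂ => dsumO b (fun y₁ y₂ => dsumO c (fun z₁ z₂ => f x₁ x₂ y₁ y₂ z₁ z₂) z) y) x := by
    intro f
    rw [dsumO_comm]
    refine (dsumO_congr b (fun y₁ y₂ => dsumO_comm _ _ _ _ _) y).trans ?_
    rw [dsumO_comm]
  have e := h x y z
  rw [key, key]
  refine Eq.trans ?_ (e.symm.trans ?_) <;>
  · refine dsumO_congr _ (fun _ _ => dsumO_congr _ (fun _ _ => dsumO_congr _ (fun _ _ => ?_) _) _) _
    ring

theorem IsConvInvO.flip {a b : Bool} {F G : C → C → k} (h : IsConvInvO a b F G) :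
    IsConvInvO b a (fun x y => F y x) (fun x y => G y x) := by
  intro y x
  rw [dsumO_comm, h x y, mul_comm]

theorem IsConvPair.flip {a b : Bool} {F G : C → C → k} (h : IsConvPair a b F G) :
    IsConvPair b a (fun x y => F y x) (fun x y => G y x) := ⟨h.1.flip, h.2.flip⟩

theorem BraidRel.reverse_left {a b c : Bool} {F G H F' G' : C → C → k} (hF : IsBilin k F)
    (hG : IsBilin k G) (hH : IsBilin k H) (hF' : IsBilin k F') (hG' : IsBilin k G')
    (h : BraidRel a b c F G H) (g1 : IsConvPair (!a) c G G') (f1 : IsConvPair (!a) b F F') :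
    BraidRel (!a) b c F' G' H :=
  (h.flip.reverse_right hH.flip hG.flip hF.flip hG'.flip hF'.flip g1.flip f1.flip).flip

/-- Reversing all three coproducts reverses every product, hence exchanges the two sides. -/
theorem BraidRel.not {a b c : Bool} {F G H : C → C → k} (h : BraidRel a b c F G H) :
    BraidRel (!a) (!b) (!c) F G H := by
  intro x y z
  simp only [dsumO_not]
  exact (h x y z).symm

/-- With both coproducts reversed a convolution product is taken in the opposite order; left and
right inverses are interchanged. -/
theorem IsConvInvO.not {a b : Bool} {F G : C → C → k} (h : IsConvInvO a b F G) :
    IsConvInvO (!a) (!b) G F := by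
  intro x y
  simp only [dsumO_not]
  refine Eq.trans (dsumO_congr _ (fun _ _ => dsumO_congr _ (fun _ _ => mul_comm _ _) _) _) (h x y)

theorem IsConvPair.not {a b : Bool} {F G : C → C → k} (h : IsConvPair a b F G) :
    IsConvPair (!a) (!b) F G := ⟨h.2.not, h.1.not⟩

theorem IsConvInvO.comp {a b : Bool} {F G : C → C → k} (hF : IsBilin k F) (hG : IsBilin k G)
    (h : IsConvInvO a b F G) {σ τ : C →ₗ[k] C} (hσ : IsCoalgMap σ) (hτ : IsCoalgMap τ) :
    IsConvInvO a b (fun x y => F (σ x) (τ y)) (fun x y => G (σ x) (τ y)) := by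
  intro x y
  rw [← hσ.counit_apply x, ← hτ.counit_apply y, ← h, hσ.dsumO]
  · refine dsumO_congr a (fun x₁ x₂ => ?_) x
    rw [hτ.dsumO]
    exact hF.mul_right_right hG _ _
  · exact ⟨fun y => dsumO_isLinearMap_param b (fun _ _ => (hF.left _).mul_const _) _,
      fun x => dsumO_isLinearMap_param b (fun _ _ => (hG.left _).const_mul _) _⟩

theorem IsConvPair.comp {a b : Bool} {F G : C → C → k} (hF : IsBilin k F) (hG : IsBilin k G)
    (h : IsConvPair a b F G) {σ τ : C →ₗ[k] C} (hσ : IsCoalgMap σ) (hτ : IsCoalgMap τ) :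
    IsConvPair a b (fun x y => F (σ x) (τ y)) (fun x y => G (σ x) (τ y)) :=
  ⟨h.1.comp hF hG hσ hτ, h.2.comp hG hF hσ hτ⟩

/-- Substitution of τ(z) for z: a coalgebra map acts on both components of z in the same way, so
both forms containing z are twisted at once. -/
theorem BraidRel.twist_right {a b c : Bool} {F G H : C → C → k} (hG : IsBilin k G)
    (hH : IsBilin k H) (h : BraidRel a b c F G H) {τ : C →ₗ[k] C} (hτ : IsCoalgMap τ) :
    BraidRel a b c F (fun x z => G x (τ z)) (fun y z => H y (τ z)) := by
  intro x y z
  refine Eq.trans ?_ ((h x y (τ z)).trans ?_)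
  all_goals refine dsumO_congr _ (fun _ _ => dsumO_congr _ (fun _ _ => ?_) _) _
  all_goals rw [hτ.dsumO]
  all_goals constructor <;> intro
  all_goals first
    | exact ((hG.right _).const_mul _).mul_const _
    | exact (hH.right _).const_mul _

theorem BraidRel.twist_left {a b c : Bool} {F G H : C → C → k} (hF : IsBilin k F)
    (hG : IsBilin k G) (h : BraidRel a b c F G H) {τ : C →ₗ[k] C} (hτ : IsCoalgMap τ) :
    BraidRel a b c (fun x y => F (τ x) y) (fun x z => G (τ x) z) H :=
  (h.flip.twist_right hG.flip hF.flip hτ).flip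

end Convolution

/-! ## The bilinear forms of crossings -/

section Forms

open Coalgebra Diag

universe u v

set_option linter.unusedSectionVars false
set_option linter.unusedSimpArgs false

variable {k : Type u} {C : Type v} [Field k] [AddCommGroup C] [Module k C] [Coalgebra k C]

theorem IsCoalgMap.of_coalgEquiv (T : C ≃ₗc[k] C) : IsCoalgMap ((T : C ≃ₗ[k] C) : C →ₗ[k] C) where
  counit_apply c := LinearMap.congr_fun (CoalgHomClass.counit_comp T) c
  comul_apply c := (LinearMap.congr_fun (CoalgHomClass.map_comp_comul T) c).symm

theorem IsCoalgMap.comp {σ τ : C →ₗ[k] C} (hσ : IsCoalgMap σ) (hτ : IsCoalgMap τ) :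
    IsCoalgMap (σ ∘ₗ τ) where
  counit_apply c := (hσ.counit_apply _).trans (hτ.counit_apply c)
  comul_apply c := by
    rw [LinearMap.comp_apply, hσ.comul_apply, hτ.comul_apply, TensorProduct.map_comp]
    rfl

variable (k C) in
/-- The group of coalgebra automorphisms, as a subgroup of the group of linear automorphisms. -/
def coalgAut : Subgroup (C ≃ₗ[k] C) where
  carrier := {τ | IsCoalgMap (τ : C →ₗ[k] C)}
  mul_mem' h h' := h.comp h'
  one_mem' := IsCoalgMap.id
  inv_mem' {τ} h := by
    refine ⟨fun c => ?_, fun c => ?_⟩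
    · rw [← h.counit_apply]
      exact congrArg counit (τ.apply_symm_apply c)
    · have e : comul (R := k) c = TensorProduct.map (τ : C →ₗ[k] C) (τ : C →ₗ[k] C)
          (comul (τ.symm c)) := by
        rw [← h.comul_apply]
        exact congrArg comul (τ.apply_symm_apply c).symm
      rw [e, ← LinearMap.comp_apply (TensorProduct.map _ _), ← TensorProduct.map_comp]
      have e' : ((τ⁻¹ : C ≃ₗ[k] C) : C →ₗ[k] C) ∘ₗ (τ : C →ₗ[k] C) = LinearMap.id :=
        LinearMap.ext fun c => τ.symm_apply_apply c
      rw [e', TensorProduct.map_id]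
      rfl

/-- The group of linear automorphisms which preserve a bilinear form. -/
def formAut (b : C →ₗ[k] C →ₗ[k] k) : Subgroup (C ≃ₗ[k] C) where
  carrier := {τ | ∀ x y, b (τ x) (τ y) = b x y}
  mul_mem' h h' x y := (h _ _).trans (h' x y)
  one_mem' _ _ := rfl
  inv_mem' {τ} h x y := by
    rw [← h]
    exact congrArg₂ (fun x y => b x y) (τ.apply_symm_apply x) (τ.apply_symm_apply y)

theorem LinearMap.isBilin (b : C →ₗ[k] C →ₗ[k] k) : IsBilin k fun x y => b x y :=
  ⟨fun y => (b.flip y).isLinearMap', fun x => (b x).isLinearMap'⟩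

theorem IsBilin.comp {f : C → C → k} (h : IsBilin k f) (σ τ : C →ₗ[k] C) :
    IsBilin k fun x y => f (σ x) (τ y) :=
  ⟨fun y => (h.left (τ y)).comp' σ, fun x => (h.right (σ x)).comp' τ⟩

/-! ### Inverse pairs among the crossing forms -/

namespace StrictOrientedQuantumCoalgebra

variable (Q : StrictOrientedQuantumCoalgebra k C)

theorem power_eq (p q : ℤ) (x : C) :
    Q.power p q x = ((Q.Td : C ≃ₗ[k] C) ^ p * (Q.Tu : C ≃ₗ[k] C) ^ q : C ≃ₗ[k] C) x := rfl

theorem commute_Td_Tu : Commute (Q.Td : C ≃ₗ[k] C) (Q.Tu : C ≃ₗ[k] C) :=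
  LinearEquiv.ext Q.Td_Tu_comm

theorem power_add (p q p' q' : ℤ) (x : C) :
    Q.power (p + p') (q + q') x = Q.power p q (Q.power p' q' x) := by
  simp only [power_eq]
  rw [zpow_add, zpow_add, ← LinearEquiv.mul_apply]
  have h : Commute ((Q.Td : C ≃ₗ[k] C) ^ p') ((Q.Tu : C ≃ₗ[k] C) ^ q) :=
    (Q.commute_Td_Tu.zpow_left p').zpow_right q
  congr 1
  rw [mul_assoc, ← mul_assoc _ _ ((Q.Tu : C ≃ₗ[k] C) ^ q'), h.eq]
  simp only [mul_assoc]

/-- The linear automorphism `T_d^p ∘ T_u^q` for a pair of exponents. -/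
noncomputable def pw (e : ℤ × ℤ) : C →ₗ[k] C := Q.power e.1 e.2

theorem pw_add (e f : ℤ × ℤ) (x : C) : Q.pw (e + f) x = Q.pw e (Q.pw f x) := Q.power_add _ _ _ _ x

theorem pw_zero (x : C) : Q.pw 0 x = x := rfl

theorem pw_Td (x : C) : Q.pw (1, 0) x = Q.Td x := by
  simp [pw, power_eq]

theorem pw_Tu (x : C) : Q.pw (0, 1) x = Q.Tu x := by
  simp [pw, power_eq]

theorem pw_isCoalgMap (e : ℤ × ℤ) : IsCoalgMap (Q.pw e) :=
  Subgroup.mul_mem (coalgAut k C)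
    (Subgroup.zpow_mem (coalgAut k C) (IsCoalgMap.of_coalgEquiv Q.Td) _)
    (Subgroup.zpow_mem (coalgAut k C) (IsCoalgMap.of_coalgEquiv Q.Tu) _)

theorem b_pw (e : ℤ × ℤ) (x y : C) : Q.b (Q.pw e x) (Q.pw e y) = Q.b x y :=
  Subgroup.mul_mem (formAut Q.b)
    (Subgroup.zpow_mem (formAut Q.b) (x := (Q.Td : C ≃ₗ[k] C)) Q.qc2_d _)
    (Subgroup.zpow_mem (formAut Q.b) (x := (Q.Tu : C ≃ₗ[k] C)) Q.qc2_u _) x y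

theorem isConvPair_b : IsConvPair true true (fun x y => Q.b x y) (fun x y => Q.bInv x y) :=
  ⟨fun x y => Q.b_mul_bInv x y (ℛ k x) (ℛ k y), fun x y => Q.bInv_mul_b x y (ℛ k x) (ℛ k y)⟩

/-- The twisted form is another inverse of b, because b is invariant and the power is a coalgebra
map; inverses are unique. -/
theorem bInv_pw (e : ℤ × ℤ) (x y : C) : Q.bInv (Q.pw e x) (Q.pw e y) = Q.bInv x y := by
  have h := Q.isConvPair_b.2.comp Q.bInv.isBilin Q.b.isBilin (Q.pw_isCoalgMap e) (Q.pw_isCoalgMap e)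
  simp only [b_pw] at h
  exact congrFun (congrFun (IsConvInv.unique Q.b.isBilin (Q.bInv.isBilin.comp _ _) Q.bInv.isBilin
    h Q.isConvPair_b.1) x) y

/-- The form `b (T_d^p T_u^q x, y)`. -/
noncomputable def bp (e : ℤ × ℤ) (x y : C) : k := Q.b (Q.pw e x) y

/-- The form `b⁻¹ (T_d^p T_u^q x, y)`. -/
noncomputable def bn (e : ℤ × ℤ) (x y : C) : k := Q.bInv (Q.pw e x) y

theorem bp_pw_left (e f : ℤ × ℤ) (x y : C) : Q.bp e (Q.pw f x) y = Q.bp (e + f) x y := by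
  rw [bp, bp, ← pw_add]

theorem bn_pw_left (e f : ℤ × ℤ) (x y : C) : Q.bn e (Q.pw f x) y = Q.bn (e + f) x y := by
  rw [bn, bn, ← pw_add]

/-- By invariance of b all powers can be collected at the first variable. Thus every crossing form
is some `bp e` or `bn e`, up to the order of its variables. -/
theorem bp_pw_right (e f : ℤ × ℤ) (x y : C) : Q.bp e x (Q.pw f y) = Q.bp (e - f) x y := by
  rw [bp, bp, ← Q.b_pw f (Q.pw (e - f) x), ← pw_add, add_sub_cancel]

theorem bn_pw_right (e f : ℤ × ℤ) (x y : C) : Q.bn e x (Q.pw f y) = Q.bn (e - f) x y := by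
  rw [bn, bn, ← Q.bInv_pw f (Q.pw (e - f) x), ← pw_add, add_sub_cancel]

theorem isConvPair_bp_bn (a : Bool) (g : ℤ × ℤ) : IsConvPair a a (Q.bp g) (Q.bn g) := by
  have h := Q.isConvPair_b.comp Q.b.isBilin Q.bInv.isBilin (Q.pw_isCoalgMap g) IsCoalgMap.id
  cases a
  · exact h.not
  · exact h

/-- This is the axiom linking b, b⁻¹, T_d and T_u: with one coproduct reversed, b(x, T_u y) and
b⁻¹(T_d x, y) are inverse. Collecting the powers at x produces the shift by (1, 1). -/
theorem isConvPair_bp_bn_not (a : Bool) (g : ℤ × ℤ) :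
    IsConvPair a (!a) (Q.bp g) (Q.bn (g + (1, 1))) := by
  have h : IsConvPair true false (fun x y => Q.b x (Q.Tu y)) (fun x y => Q.bInv (Q.Td x) y) :=
    ⟨fun x y => Q.qc1 x y (ℛ k x) (ℛ k y), fun x y => Q.qc1' x y (ℛ k x) (ℛ k y)⟩
  have h1 : IsBilin k (fun x y => Q.b x (Q.Tu y)) :=
    Q.b.isBilin.comp LinearMap.id ((Q.Tu : C ≃ₗ[k] C) : C →ₗ[k] C)
  have h2 : IsBilin k (fun x y => Q.bInv (Q.Td x) y) :=
    Q.bInv.isBilin.comp ((Q.Td : C ≃ₗ[k] C) : C →ₗ[k] C) LinearMap.id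
  have h := h.comp h1 h2 (Q.pw_isCoalgMap (g + (0, 1))) IsCoalgMap.id
  have e1 : (fun x y => Q.b (Q.pw (g + (0, 1)) x) (Q.Tu (LinearMap.id (R := k) y))) = Q.bp g := by
    funext x y
    rw [LinearMap.id_apply, ← pw_Tu, add_comm, pw_add, b_pw]
    rfl
  have e2 : (fun x y => Q.bInv (Q.Td (Q.pw (g + (0, 1)) x)) (LinearMap.id (R := k) y)) =
      Q.bn (g + (1, 1)) := by
    funext x y
    rw [LinearMap.id_apply, ← pw_Td, ← pw_add, bn]
    congr 3
    rw [add_left_comm]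
    rfl
  rw [e1, e2] at h
  cases a
  · exact h.not
  · exact h

/-- The factor of a crossing without exponents. -/
noncomputable def base (p : Piece) (x y : C) : k := Q.factor 0 0 p x y

theorem base_isBilin (p : Piece) : IsBilin k (Q.base p) := (Q.factor 0 0 p).isBilin

theorem factor_eq_base (e f : ℤ × ℤ) (p : Piece) (x y : C) :
    Q.factor e f p x y = Q.base p (Q.pw e x) (Q.pw f y) := by
  have h1 : Q.power e.1 (e.2 + 1) x = Q.power 0 1 (Q.pw e x) := by
    rw [pw, ← power_add]; congr 2 <;> ring
  have h2 : Q.power (e.1 + 1) e.2 x = Q.power 1 0 (Q.pw e x) := by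
    rw [pw, ← power_add]; congr 2 <;> ring
  have h3 : Q.power f.1 (f.2 + 1) y = Q.power 0 1 (Q.pw f y) := by
    rw [pw, ← power_add]; congr 2 <;> ring
  have h4 : Q.power (f.1 + 1) f.2 y = Q.power 1 0 (Q.pw f y) := by
    rw [pw, ← power_add]; congr 2 <;> ring
  rcases p with ⟨_ | _, _ | _, _ | _⟩ | _ | _ <;>
    simp only [factor, base, LinearMap.compl₁₂_apply, h1, h2, h3, h4] <;> rfl

/-- The form of a crossing, with the lower left strand as first and the lower right strand as second
variable. -/
noncomputable def crossForm (a b s : Bool) (x y : C) : k :=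
  if s then Q.base (.cross a b s) x y else Q.base (.cross a b s) y x

theorem crossForm_isBilin (a b s : Bool) : IsBilin k (Q.crossForm a b s) := by
  cases s
  · exact (Q.base_isBilin _).flip
  · exact Q.base_isBilin _

theorem crossForm_true (a b : Bool) (x y : C) : Q.crossForm a b true x y =
    if a = b then Q.bp (0, 0) x y else Q.bn (if a then (0, 1) else (1, 0)) x y := by
  cases a <;> cases b <;> rfl

theorem crossForm_false (a b : Bool) (x y : C) : Q.crossForm a b false x y =
    if a = b then Q.bn (0, 0) y x else Q.bp (if a then (0, -1) else (-1, 0)) y x := by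
  have h1 := Q.bp_pw_right (0, 0) (0, 1) y x
  have h2 := Q.bp_pw_right (0, 0) (1, 0) y x
  simp only [Prod.mk_sub_mk, zero_sub, sub_zero] at h1 h2
  cases a <;> cases b
  · rfl
  · exact h2
  · exact h1
  · rfl

/-- Normal form for all verifications of inverses: the exponents must agree for parallel
orientations and differ by (1, 1) for opposite ones. -/
theorem isConvPair_of_bp {a b : Bool} {F G : C → C → k} (g h : ℤ × ℤ)
    (hgh : h = if a = b then g else g + (1, 1)) (hF : ∀ x y, F x y = Q.bp g x y)
    (hG : ∀ x y, G x y = Q.bn h x y) : IsConvPair a b F G := by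
  rw [show F = Q.bp g from funext fun x => funext (hF x),
    show G = Q.bn h from funext fun x => funext (hG x), hgh]
  by_cases hab : a = b
  · rw [if_pos hab, hab]
    exact Q.isConvPair_bp_bn b g
  · rw [if_neg hab]
    have : b = !a := by cases a <;> cases b <;> simp_all
    rw [this]
    exact Q.isConvPair_bp_bn_not a g

/-- This is the algebraic content of cancelling two crossings. For opposite orientations the pairs
of exponents, such as (0, -1) and (1, 0), differ by exactly (1, 1). -/
theorem isConvPair_crossForm (a b s : Bool) :
    IsConvPair a b (Q.crossForm a b s) (fun x y => Q.crossForm b a (!s) y x) := by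
  have key : ∀ a b, IsConvPair a b (Q.crossForm a b true)
      (fun x y => Q.crossForm b a false y x) := by
    intro a b
    cases a <;> cases b
    · exact Q.isConvPair_of_bp (0, 0) (0, 0) rfl (fun x y => by simp [crossForm_true])
        (fun x y => by simp [crossForm_false])
    · exact (Q.isConvPair_of_bp (0, -1) (1, 0) rfl (fun x y => by simp [crossForm_false])
        (fun x y => by simp [crossForm_true])).symm
    · exact (Q.isConvPair_of_bp (-1, 0) (0, 1) rfl (fun x y => by simp [crossForm_false])
        (fun x y => by simp [crossForm_true])).symm
    · exact Q.isConvPair_of_bp (0, 0) (0, 0) rfl (fun x y => by simp [crossForm_true])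
        (fun x y => by simp [crossForm_false])
  cases s
  · exact (key b a).flip.symm
  · exact key a b

/-- Makes `BraidRel.reverse_right` applicable: the twist of the right variable by T_d or T_u is what
is missing for the form with the right strand reversed to be the inverse relative to the reversed
coproduct. -/
theorem isConvPair_reverse_right (a c s : Bool) : IsConvPair a (!c)
    (fun x z => Q.crossForm a c s x (Q.pw (if c then (1, 0) else (0, 1)) z))
    (Q.crossForm a (!c) s) := by
  cases s
  · have key : ∀ a c, IsConvPair (!c) a
        (fun z x => Q.crossForm a c false x (Q.pw (if c then (1, 0) else (0, 1)) z))
        (fun z x => Q.crossForm a (!c) false x z) := by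
      intro a c
      cases a <;> cases c
      · refine (Q.isConvPair_of_bp (-1, 0) (0, 1) rfl ?_ ?_).symm <;>
          simp [crossForm_false, bn_pw_left, ← Prod.mk_zero_zero]
      · refine Q.isConvPair_of_bp (0, 0) (0, 0) rfl ?_ ?_ <;>
          simp [crossForm_false, bp_pw_left, ← Prod.mk_zero_zero]
      · refine Q.isConvPair_of_bp (0, 0) (0, 0) rfl ?_ ?_ <;>
          simp [crossForm_false, bp_pw_left, ← Prod.mk_zero_zero]
      · refine (Q.isConvPair_of_bp (0, -1) (1, 0) rfl ?_ ?_).symm <;>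
          simp [crossForm_false, bn_pw_left, ← Prod.mk_zero_zero]
    exact (key a c).flip
  · cases a <;> cases c
    · refine Q.isConvPair_of_bp (0, -1) (1, 0) rfl ?_ ?_ <;>
        simp [crossForm_true, bp_pw_right, ← Prod.mk_zero_zero]
    · refine (Q.isConvPair_of_bp (0, 0) (0, 0) rfl ?_ ?_).symm <;>
        simp [crossForm_true, bn_pw_right, ← Prod.mk_zero_zero]
    · refine (Q.isConvPair_of_bp (0, 0) (0, 0) rfl ?_ ?_).symm <;>
        simp [crossForm_true, bn_pw_right, ← Prod.mk_zero_zero]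
    · refine Q.isConvPair_of_bp (-1, 0) (0, 1) rfl ?_ ?_ <;>
        simp [crossForm_true, bp_pw_right, ← Prod.mk_zero_zero]

/-- Counterpart for the left strand; collecting powers at the other variable changes their sign, so
that here T_u⁻¹ or T_d⁻¹ occurs. -/
theorem isConvPair_reverse_left (a b s : Bool) : IsConvPair (!a) b
    (fun x y => Q.crossForm a b s (Q.pw (if a then (0, -1) else (-1, 0)) x) y)
    (Q.crossForm (!a) b s) := by
  cases s
  · have key : ∀ a b, IsConvPair b (!a)
        (fun y x => Q.crossForm a b false (Q.pw (if a then (0, -1) else (-1, 0)) x) y)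
        (fun y x => Q.crossForm (!a) b false x y) := by
      intro a b
      cases a <;> cases b
      · refine (Q.isConvPair_of_bp (0, -1) (1, 0) rfl ?_ ?_).symm <;>
          simp [crossForm_false, bn_pw_right, ← Prod.mk_zero_zero]
      · refine Q.isConvPair_of_bp (0, 0) (0, 0) rfl ?_ ?_ <;>
          simp [crossForm_false, bp_pw_right, ← Prod.mk_zero_zero]
      · refine Q.isConvPair_of_bp (0, 0) (0, 0) rfl ?_ ?_ <;>
          simp [crossForm_false, bp_pw_right, ← Prod.mk_zero_zero]
      · refine (Q.isConvPair_of_bp (-1, 0) (0, 1) rfl ?_ ?_).symm <;>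
          simp [crossForm_false, bn_pw_right, ← Prod.mk_zero_zero]
    exact (key a b).flip
  · cases a <;> cases b
    · refine Q.isConvPair_of_bp (-1, 0) (0, 1) rfl ?_ ?_ <;>
        simp [crossForm_true, bp_pw_left, ← Prod.mk_zero_zero]
    · refine (Q.isConvPair_of_bp (0, 0) (0, 0) rfl ?_ ?_).symm <;>
        simp [crossForm_true, bn_pw_left, ← Prod.mk_zero_zero]
    · refine (Q.isConvPair_of_bp (0, 0) (0, 0) rfl ?_ ?_).symm <;>
        simp [crossForm_true, bn_pw_left, ← Prod.mk_zero_zero]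
    · refine Q.isConvPair_of_bp (0, -1) (1, 0) rfl ?_ ?_ <;>
        simp [crossForm_true, bp_pw_left, ← Prod.mk_zero_zero]

/-- The braid relation for crossings with arbitrary orientations. -/
theorem braidRel_crossForm (a b c s : Bool) :
    BraidRel a b c (Q.crossForm a b s) (Q.crossForm a c s) (Q.crossForm b c s) := by
  have h1 : BraidRel true true true (fun x y => Q.b x y) (fun x y => Q.b x y)
      (fun x y => Q.b x y) := fun x y z => by
    refine (Q.qc3 x y z (ℛ k x) (ℛ k y) (ℛ k z)).trans ?_
    refine Finset.sum_congr rfl fun _ _ => Finset.sum_congr rfl fun _ _ =>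
      Finset.sum_congr rfl fun _ _ => ?_
    ring
  have h2 : ∀ s, BraidRel true true true (Q.crossForm true true s) (Q.crossForm true true s)
      (Q.crossForm true true s) := by
    intro s
    cases s
    · have hb := Q.b.isBilin
      have hi := Q.bInv.isBilin
      -- The other type of upward crossing has the form b⁻¹ with its variables exchanged.
      exact (BraidRel.inverse hb hb hb hi hi hi h1 Q.isConvPair_b Q.isConvPair_b
        Q.isConvPair_b).flip
    · exact h1
  have h3 : ∀ b, BraidRel b b b (Q.crossForm b b s) (Q.crossForm b b s) (Q.crossForm b b s) := by
    intro b
    cases b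
    · have e : Q.crossForm false false s = Q.crossForm true true s := by cases s <;> rfl
      rw [e]
      exact (h2 s).not
    · exact h2 s
  have hB := Q.crossForm_isBilin
  have h4 : ∀ b c, BraidRel b b c (Q.crossForm b b s) (Q.crossForm b c s) (Q.crossForm b c s) := by
    intro b c
    by_cases hc : c = b
    · rw [hc]; exact h3 b
    · rw [show c = !b by cases b <;> cases c <;> simp_all]
      -- Starting from three parallel strands, the right one is reversed; the same twist serves both
      -- crossings with this strand.
      refine ((h3 b).twist_right (hB _ _ _) (hB _ _ _) (Q.pw_isCoalgMap _)).reverse_right (hB _ _ _)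
        ((hB _ _ _).comp LinearMap.id _) ((hB _ _ _).comp LinearMap.id _) (hB _ _ _) (hB _ _ _)
        (Q.isConvPair_reverse_right b b s) (Q.isConvPair_reverse_right b b s)
  by_cases ha : a = b
  · rw [ha]; exact h4 b c
  · rw [show a = !b by cases a <;> cases b <;> simp_all]
    -- Likewise the left strand is reversed, for either direction of the right one.
    refine ((h4 b c).twist_left (hB _ _ _) (hB _ _ _) (Q.pw_isCoalgMap _)).reverse_left
      ((hB _ _ _).comp _ LinearMap.id) ((hB _ _ _).comp _ LinearMap.id) (hB _ _ _) (hB _ _ _)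
      (hB _ _ _) (Q.isConvPair_reverse_left b c s) (Q.isConvPair_reverse_left b b s)

/-- Only the difference of the exponents of the two lines of a crossing matters. This is why
exponents may be altered by a common pair throughout a diagram. -/
theorem base_pw (e : ℤ × ℤ) (p : Piece) (x y : C) :
    Q.base p (Q.pw e x) (Q.pw e y) = Q.base p x y := by
  cases p with
  | cross a b s =>
    have h : ∀ x y, Q.crossForm a b s (Q.pw e x) (Q.pw e y) = Q.crossForm a b s x y := by
      intro x y
      cases s
      · simp only [crossForm_false, bp_pw_left, bn_pw_left, bp_pw_right, bn_pw_right,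
          sub_add_cancel]
      · simp only [crossForm_true]
        split_ifs <;>
        simp only [bp_pw_left, bn_pw_left, bp_pw_right, bn_pw_right, sub_add_cancel]
    cases s
    · exact h y x
    · exact h x y
  | max a => rfl
  | min a => rfl

end StrictOrientedQuantumCoalgebra

end Forms

/-! ## The functional of a path -/

section PathFunctional

open Coalgebra Diag

universe u v

variable {k : Type u} {C : Type v} [Field k] [AddCommGroup C] [Module k C] [Coalgebra k C]

/-- Replaces numbered variables by named letters. The condition on K says that it depends only on
the letters of w and is M there, which makes the initial family y irrelevant. -/
theorem sweedler_eq_ev {α : Type*} [DecidableEq α] {w : List α} (hw : w.Nodup) {m : ℕ}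
    (hm : w.length = m) (M : MultilinearMap k (fun _ : Fin m => C) k) (K : (α → C) → k)
    (hK : ∀ z v, (∀ i : Fin m, z (w[(i : ℕ)]'(by omega)) = v i) → K z = M v) (y : α → C) (c : C) :
    sweedler m M c = ev w K y c := by
  induction w generalizing m K y c with
  | nil =>
    obtain rfl : m = 0 := hm.symm
    change M ![] * counit c = _
    rw [ev, mul_comm, hK y ![] (fun i => i.elim0)]
  | cons a w ih =>
    obtain ⟨m, rfl⟩ : ∃ m', m = m' + 1 := ⟨w.length, hm.symm⟩
    rw [List.nodup_cons] at hw
    have e : sweedler (m + 1) M c = TensorProduct.lift (sweedler m ∘ₗ M.curryLeft) (comul c) := rfl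
    rw [e, ← (ℛ k c).eq, map_sum]
    refine Finset.sum_congr rfl fun i _ => ?_
    refine Eq.trans ?_ (ev_update w K hw.1 y _ _).symm
    refine ih hw.2 (by simpa using hm) (M.curryLeft _) _ (fun z v hv => ?_) y _
    rw [MultilinearMap.curryLeft_apply]
    refine hK _ _ fun j => ?_
    refine Fin.cases ?_ (fun j => ?_) j
    · exact Function.update_self _ _ _
    · have h1 : w[(j : ℕ)]'(by simp at hm; omega) ≠ a := fun h => hw.1 (h ▸ List.getElem_mem _)
      simpa [Function.update_of_ne h1] using hv j

/-! ### Counts of extrema and exponents along a path -/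

namespace Diag

/-- The counts of local extrema of types `d` and `u` in a path. -/
def cnt (l : List Arc) : ℤ × ℤ :=
  ((l.map fun x => x.kind.countD).sum, (l.map fun x => x.kind.countU).sum)

theorem cnt_nil : cnt [] = 0 := rfl

theorem cnt_append (l m : List Arc) : cnt (l ++ m) = cnt l + cnt m := by
  simp [cnt]

theorem cnt_cons (x : Arc) (l : List Arc) : cnt (x :: l) = cnt [x] + cnt l := cnt_append [x] l

theorem cnt_perm {l m : List Arc} (h : l.Perm m) : cnt l = cnt m := by
  rw [cnt, cnt, (h.map _).sum_eq, (h.map _).sum_eq]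

/-- The pair of exponents of the crossing line `a` in a path. -/
def expo : List Arc → ℕ × Bool → ℤ × ℤ
  | [], _ => 0
  | x :: l, a => if x.kind.line = some a then cnt l else expo l a

theorem crossingLines_append (l m : List Arc) :
    crossingLines (l ++ m) = crossingLines l ++ crossingLines m := List.filterMap_append

theorem crossingLines_cons_none {x : Arc} (hx : x.kind.line = none) (l : List Arc) :
    crossingLines (x :: l) = crossingLines l := List.filterMap_cons_none hx

theorem crossingLines_cons_some {x : Arc} {a : ℕ × Bool} (hx : x.kind.line = some a) (l : List Arc) :
    crossingLines (x :: l) = a :: crossingLines l := List.filterMap_cons_some hx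

/-- Exponents count what follows a crossing line; prolonging the path adds the extrema of the
prolongation. -/
theorem expo_append_of_mem {l : List Arc} {a : ℕ × Bool} (h : a ∈ crossingLines l) (m : List Arc) :
    expo (l ++ m) a = expo l a + cnt m := by
  induction l with
  | nil => simp [crossingLines] at h
  | cons x l ih =>
    rw [List.cons_append, expo, expo]
    split_ifs with hx
    · exact cnt_append l m
    · refine ih ?_
      rcases hx' : x.kind.line with _ | b
      · rwa [crossingLines_cons_none hx'] at h
      · rw [crossingLines_cons_some hx', List.mem_cons] at h
        rcases h with rfl | h
        · exact absurd hx' hx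
        · exact h

theorem expo_append_of_not_mem {l : List Arc} {a : ℕ × Bool} (h : a ∉ crossingLines l)
    (m : List Arc) : expo (l ++ m) a = expo m a := by
  induction l with
  | nil => rfl
  | cons x l ih =>
    rw [List.cons_append, expo]
    rcases hx' : x.kind.line with _ | b
    · rw [crossingLines_cons_none hx'] at h
      simpa using ih h
    · rw [crossingLines_cons_some hx', List.mem_cons, not_or] at h
      rw [if_neg (by simpa using Ne.symm h.1)]
      exact ih h.2

theorem exponents_getElem {l : List Arc} (h : (crossingLines l).Nodup) (i : ℕ)
    (hi : i < (crossingLines l).length) :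
    (exponents l)[i]'(by rwa [length_exponents]) = expo l (crossingLines l)[i] := by
  induction l generalizing i with
  | nil => simp [crossingLines] at hi
  | cons x l ih =>
    rcases hx' : x.kind.line with _ | b
    · have e1 := crossingLines_cons_none hx' l
      have e2 : exponents (x :: l) = exponents l := by simp [exponents, hx']
      simp only [e1, e2] at h hi ⊢
      rw [expo, if_neg (by simp [hx'])]
      exact ih h i hi
    · have e1 := crossingLines_cons_some hx' l
      have e2 : exponents (x :: l) = cnt l :: exponents l := by simp [exponents, hx', cnt]
      simp only [e1, e2] at h hi ⊢
      rw [List.nodup_cons] at h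
      cases i with
      | zero => simp [expo, hx']
      | succ i =>
        have hi' : i < (crossingLines l).length := by simpa using hi
        have hne : b ≠ (crossingLines l)[i] := fun e => h.1 (e ▸ List.getElem_mem _)
        simp only [List.getElem_cons_succ]
        rw [expo, if_neg (by simpa [hx'] using hne)]
        exact ih h.2 i hi'

end Diag

/-! ### The product of the crossing factors -/

namespace StrictOrientedQuantumCoalgebra

variable (Q : StrictOrientedQuantumCoalgebra k C)

/-- The factor of a slice, as a function of the elements at the crossing lines. -/
noncomputable def fac (n : ℕ) (p : Piece) (y : ℕ × Bool → C) : k :=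
  if p.isCross then Q.base p (y (n, true)) (y (n, false)) else 1

/-- The product of the factors of the slices. -/
noncomputable def prodFrom : ℕ → List Slice → (ℕ × Bool → C) → k
  | _, [], _ => 1
  | n, x :: D, y => Q.fac n x.piece y * prodFrom (n + 1) D y

theorem prodFrom_eq_prod (n : ℕ) (D : List Slice) (y : ℕ × Bool → C) :
    Q.prodFrom n D y = ∏ i : Fin D.length, Q.fac (n + i) D[i].piece y := by
  induction D generalizing n with
  | nil => rfl
  | cons x D ih =>
    rw [prodFrom, ih]
    refine Eq.trans ?_ (Fin.prod_univ_succ (n := D.length) fun i : Fin (x :: D).length =>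
      Q.fac (n + i) (x :: D)[i].piece y).symm
    refine congrArg₂ _ rfl (Finset.prod_congr rfl fun i _ => ?_)
    rw [show n + 1 + (i : ℕ) = n + (i.succ : ℕ) by rw [Fin.val_succ]; omega]
    rfl

theorem prodFrom_append (n : ℕ) (A B : List Slice) (y : ℕ × Bool → C) :
    Q.prodFrom n (A ++ B) y = Q.prodFrom n A y * Q.prodFrom (n + A.length) B y := by
  induction A generalizing n with
  | nil => simp [prodFrom]
  | cons x A ih =>
    simp only [List.cons_append, prodFrom, ih, List.length_cons, mul_assoc]
    rw [add_assoc, add_comm 1]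

theorem prodFrom_congr {n n' : ℕ} {D D' : List Slice} {y z : ℕ × Bool → C}
    (h : List.Forall₂ (fun s s' => s.piece = s'.piece) D D')
    (hyz : ∀ m o, m < D.length → y (n + m, o) = z (n' + m, o)) :
    Q.prodFrom n D y = Q.prodFrom n' D' z := by
  induction h generalizing n n' with
  | nil => rfl
  | @cons s s' D D' hs _ ih =>
    rw [prodFrom, prodFrom, hs]
    have e := hyz 0
    simp only [add_zero, List.length_cons, Nat.zero_lt_succ, forall_const] at e
    rw [fac, fac, e, e, ih]
    intro m o hm
    rw [add_assoc, add_assoc]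
    refine hyz _ o ?_
    rw [List.length_cons]
    omega

theorem prodFrom_congr' {n n' : ℕ} {D : List Slice} {y z : ℕ × Bool → C}
    (hyz : ∀ m o, m < D.length → y (n + m, o) = z (n' + m, o)) :
    Q.prodFrom n D y = Q.prodFrom n' D z :=
  Q.prodFrom_congr (List.forall₂_same.2 fun _ _ => rfl) hyz

theorem prodFrom_pw (n : ℕ) (D : List Slice) (e : ℤ × ℤ) (y : ℕ × Bool → C) :
    Q.prodFrom n D (fun a => Q.pw e (y a)) = Q.prodFrom n D y := by
  induction D generalizing n with
  | nil => rfl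
  | cons x D ih => simp only [prodFrom, ih, fac, base_pw]

theorem fac_indepAt {n m : ℕ} (o : Bool) (h : m ≠ n) (p : Piece) :
    IndepAt (Q.fac n p) (m, o) := by
  intro y x
  rw [fac, fac, Function.update_of_ne (by simp [Ne.symm h]),
    Function.update_of_ne (by simp [Ne.symm h])]

theorem prodFrom_indepAt {n m : ℕ} {D : List Slice} (o : Bool) (h : m < n ∨ n + D.length ≤ m) :
    IndepAt (Q.prodFrom n D) (m, o) := by
  intro y x
  refine Q.prodFrom_congr' fun i o' hi => Function.update_of_ne ?_ _ _
  intro e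
  have := congrArg Prod.fst e
  simp only at this
  omega

theorem fac_linearAt (n : ℕ) (o : Bool) {p : Piece} (hp : p.isCross = true) :
    LinearAt (Q.fac n p) (n, o) := by
  intro y
  simp only [fac, hp, if_true]
  cases o
  · simpa using (Q.base_isBilin p).right _
  · simpa using (Q.base_isBilin p).left _

theorem prodFrom_linearAt {n m : ℕ} {o : Bool} {D : List Slice}
    (h : (m, o) ∈ crossingLines (arcsFrom n D)) : LinearAt (Q.prodFrom n D) (m, o) := by
  induction D generalizing n with
  | nil => simp [arcsFrom, crossingLines] at h
  | cons x D ih =>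
    rw [crossingLines_arcsFrom_cons, List.mem_append, mem_crossingLines_slice] at h
    intro y
    simp only [prodFrom]
    rcases h with ⟨rfl, h⟩ | h
    · simp only [Q.prodFrom_indepAt (n := m + 1) (D := D) o (Or.inl (Nat.lt_succ_self m)) y]
      exact (Q.fac_linearAt m o h y).mul_const _
    · have hm : m ≠ n := by
        rw [mem_crossingLines_arcsFrom] at h
        obtain ⟨i, h, -⟩ := h
        omega
      simp only [Q.fac_indepAt o hm x.piece y]
      exact (ih h y).const_mul _

/-- The functional of a path in a diagram. -/
noncomputable def pathForm (D : List Slice) (l : List Arc) (c : C) : k :=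
  ev (crossingLines l) (fun y => Q.prodFrom 0 D fun a => Q.pw (expo l a) (y a)) 0 c

theorem functional_eq_pathForm {D : List Slice} {P P' : Point} (τ : Traversal D P P') (c : C) :
    Q.functional τ c = Q.pathForm D τ.path c := by
  refine sweedler_eq_ev τ.nodup rfl _ _ (fun z v hv => ?_) _ c
  rw [prodFrom_eq_prod]
  have key : ∀ (χ : Crossing D) (o : Bool), (crossingLines τ.path)[(τ.label (χ, o) : ℕ)]'
      (τ.label (χ, o)).2 = ((χ.1 : ℕ), o) := fun χ o => by
    change (crossingLines τ.path)[(crossingLines τ.path).idxOf ((χ.1 : ℕ), o)]'_ = _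
    exact List.getElem_idxOf _
  have e : ∀ χ : Crossing D, Q.factor (τ.exponent (τ.label (χ, true)))
      (τ.exponent (τ.label (χ, false))) D[χ.1].piece (v (τ.label (χ, true)))
      (v (τ.label (χ, false))) =
      Q.fac (0 + χ.1) D[χ.1].piece fun a => Q.pw (expo τ.path a) (z a) := by
    intro χ
    have h : ∀ o, Q.pw (τ.exponent (τ.label (χ, o))) (v (τ.label (χ, o))) =
        Q.pw (expo τ.path (χ.1, o)) (z (χ.1, o)) := fun o => by
      have hz : z (χ.1, o) = v (τ.label (χ, o)) :=
        (congrArg z (key χ o)).symm.trans (hv (τ.label (χ, o)))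
      rw [hz, Traversal.exponent, exponents_getElem τ.nodup _ (τ.label (χ, o)).2, key]
    rw [fac, if_pos χ.2, factor_eq_base, h, h, zero_add]
  change _ = ∏ χ : Crossing D, Q.factor (τ.exponent (τ.label (χ, true)))
    (τ.exponent (τ.label (χ, false))) D[χ.1].piece (v (τ.label (χ, true)))
    (v (τ.label (χ, false)))
  rw [Finset.prod_congr rfl fun χ _ => e χ]
  -- Slices without crossing have factor 1, so the product over the crossings equals that over all
  -- slices.
  refine Eq.trans ?_ (Finset.prod_subtype (Finset.univ.filter fun i : Fin D.length =>
    D[i].piece.isCross = true) (by simp) fun i =>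
      Q.fac (0 + i) D[i].piece fun a => Q.pw (expo τ.path a) (z a))
  refine (Finset.prod_subset (Finset.subset_univ _) fun i _ hi => ?_).symm
  rw [fac, if_neg]
  simpa using hi

end StrictOrientedQuantumCoalgebra

end PathFunctional

/-! ## Points, arcs and paths -/

namespace Diag

set_option linter.unusedSectionVars false

/-! ### The arcs which start or end at a point -/

/-- The points number `p`, `p + 1`, … on line number `n` at which strands with prescribed
orientations are oriented according to `b`. -/
def pts (n p : ℕ) : List Bool → Bool → List Point
  | [], _ => []
  | a :: s, b => if a = b then (n, p) :: pts n (p + 1) s b else pts n (p + 1) s b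

theorem pts_append (n p : ℕ) (s t : List Bool) (b : Bool) :
    pts n p (s ++ t) b = pts n p s b ++ pts n (p + s.length) t b := by
  induction s generalizing p with
  | nil => rfl
  | cons a s ih =>
    have e : p + 1 + s.length = p + (s.length + 1) := by omega
    simp only [List.cons_append, pts, ih, List.length_cons, e]
    split_ifs <;> simp

theorem mem_pts {n p : ℕ} {s : List Bool} {b : Bool} {P : Point} (h : P ∈ pts n p s b) :
    P.1 = n ∧ p ≤ P.2 ∧ P.2 < p + s.length ∧ s.getD (P.2 - p) false = b := by
  induction s generalizing p with
  | nil => simp [pts] at h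
  | cons a s ih =>
    rw [pts] at h
    have key : P ∈ pts n (p + 1) s b →
        P.1 = n ∧ p ≤ P.2 ∧ P.2 < p + (a :: s).length ∧ (a :: s).getD (P.2 - p) false = b := by
      intro h
      obtain ⟨h1, h2, h3, h4⟩ := ih h
      refine ⟨h1, by omega, by simp; omega, ?_⟩
      rw [show P.2 - p = (P.2 - (p + 1)) + 1 by omega, List.getD_cons_succ, h4]
    split_ifs at h with hab
    · rcases List.mem_cons.1 h with rfl | h
      · simp [hab]
      · exact key h
    · exact key h

theorem nodup_pts (n p : ℕ) (s : List Bool) (b : Bool) : (pts n p s b).Nodup := by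
  induction s generalizing p with
  | nil => exact List.nodup_nil
  | cons a s ih =>
    rw [pts]
    split_ifs
    · refine List.nodup_cons.2 ⟨fun h => ?_, ih _⟩
      have := (mem_pts h).2.1
      simp only at this
      omega
    · exact ih _

/-- The start of an arc if `b = true`, and its end otherwise. -/
def Arc.pt (b : Bool) (x : Arc) : Point := if b then x.src else x.tgt

theorem pt_orient (b a : Bool) (P Q : Point) (t : ArcKind) :
    (orient a P Q t).pt b = if a = b then P else Q := by
  cases a <;> cases b <;> rfl

theorem verticals_pts (n p q : ℕ) (l : List Bool) (b : Bool) :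
    ((verticals n p q l).map (Arc.pt b)).Perm (pts n p l b ++ pts (n + 1) q l (!b)) := by
  induction l generalizing p q with
  | nil => exact List.Perm.nil
  | cons a l ih =>
    have h := ih (p + 1) (q + 1)
    simp only [verticals, List.map_cons, pt_orient, pts]
    by_cases hab : a = b
    · have hab' : a ≠ !b := by subst hab; cases a <;> simp
      simp only [hab, if_true, if_neg (hab ▸ hab' : b ≠ !b), List.cons_append]
      exact h.cons _
    · have hab' : a = !b := by cases a <;> cases b <;> simp_all
      simp only [if_neg hab, if_pos hab']
      exact (h.cons _).trans List.perm_middle.symm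

theorem piece_pts (n p : ℕ) (x : Piece) (b : Bool) :
    ((x.arcs n p).map (Arc.pt b)).Perm (pts n p x.lower b ++ pts (n + 1) p x.upper (!b)) := by
  rcases x with ⟨a, c, s⟩ | a | a
  · cases a <;> cases b <;> cases c <;>
      first
      | exact List.Perm.refl _
      | exact List.Perm.swap _ _ _
  · cases a <;> cases b <;> exact List.Perm.refl _
  · cases a <;> cases b <;> exact List.Perm.refl _

theorem slice_pts (n : ℕ) (x : Slice) (b : Bool) :
    ((x.arcs n).map (Arc.pt b)).Perm (pts n 0 x.lower b ++ pts (n + 1) 0 x.upper (!b)) := by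
  have h1 := verticals_pts n 0 0 x.left b
  have h2 := piece_pts n x.left.length x.piece b
  have h3 := verticals_pts n (x.left.length + x.piece.lower.length)
    (x.left.length + x.piece.upper.length) x.right b
  simp only [Slice.arcs, List.map_append, Slice.lower, Slice.upper, pts_append, List.length_append,
    zero_add]
  refine ((h1.append h2).append h3).trans ?_
  rw [← Multiset.coe_eq_coe]
  simp only [← Multiset.coe_add]
  abel

/-- The points of a diagram. -/
def allPts : ℕ → List Bool → List Slice → List Point
  | n, s, [] => pts n 0 s false ++ pts n 0 s true
  | n, s, x :: D => pts n 0 s false ++ pts n 0 s true ++ allPts (n + 1) x.upper D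

theorem le_of_mem_allPts {n : ℕ} {s : List Bool} {D : List Slice} {P : Point}
    (h : P ∈ allPts n s D) : n ≤ P.1 := by
  induction D generalizing n s with
  | nil =>
    rw [allPts, List.mem_append] at h
    rcases h with h | h <;> exact (mem_pts h).1.ge
  | cons x D ih =>
    rw [allPts, List.mem_append, List.mem_append] at h
    rcases h with (h | h) | h
    · exact (mem_pts h).1.ge
    · exact (mem_pts h).1.ge
    · have := ih h
      omega

theorem nodup_pts_append (n : ℕ) (s : List Bool) : (pts n 0 s false ++ pts n 0 s true).Nodup := by
  refine List.nodup_append.2 ⟨nodup_pts _ _ _ _, nodup_pts _ _ _ _, fun P h Q h' e => ?_⟩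
  subst e
  exact Bool.false_ne_true ((mem_pts h).2.2.2.symm.trans (mem_pts h').2.2.2)

theorem nodup_allPts (n : ℕ) (s : List Bool) (D : List Slice) : (allPts n s D).Nodup := by
  induction D generalizing n s with
  | nil => exact nodup_pts_append n s
  | cons x D ih =>
    refine List.nodup_append.2 ⟨nodup_pts_append n s, ih _ _, fun P h Q h' e => ?_⟩
    subst e
    have h1 := le_of_mem_allPts h'
    rw [List.mem_append] at h
    rcases h with h | h <;> have := (mem_pts h).1 <;> omega

/-- Every point of the diagram is the start of exactly one arc, except for points on the bottom with
a downward strand and points on the top with an upward strand; for ends of arcs the orientations are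
interchanged. -/
theorem arcsFrom_pts (n : ℕ) {s t : List Bool} {D : List Slice} (h : Composable s D t) (b : Bool) :
    ((arcsFrom n D).map (Arc.pt b) ++ pts n 0 s (!b) ++ pts (n + D.length) 0 t b).Perm
      (allPts n s D) := by
  induction D generalizing n s with
  | nil =>
    cases h
    cases b
    · exact List.perm_append_comm
    · exact List.Perm.refl _
  | cons x D ih =>
    have h1 := ih (n + 1) h.2
    have h2 := slice_pts n x b
    rw [← h.1] at h2
    rw [← Multiset.coe_eq_coe] at h1 h2 ⊢
    have e : n + (x :: D).length = n + 1 + D.length := by simp; omega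
    simp only [arcsFrom, allPts, List.map_append, ← Multiset.coe_add, e] at h1 h2 ⊢
    rw [h2, ← h1]
    cases b <;> simp only [Bool.not_true, Bool.not_false] <;> abel

theorem arcs_pts {D : List Slice} (h : Composable [] D []) (b : Bool) :
    ((arcs D).map (Arc.pt b)).Perm (allPts 0 [] D) := by
  simpa [pts, arcs] using arcsFrom_pts 0 h b

theorem nodup_src {D : List Slice} (h : Composable [] D []) : ((arcs D).map Arc.src).Nodup :=
  (arcs_pts h true).nodup_iff.2 (nodup_allPts _ _ _)

theorem nodup_tgt {D : List Slice} (h : Composable [] D []) : ((arcs D).map Arc.tgt).Nodup :=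
  (arcs_pts h false).nodup_iff.2 (nodup_allPts _ _ _)

theorem arcsFrom_append (n : ℕ) (A B : List Slice) :
    arcsFrom n (A ++ B) = arcsFrom n A ++ arcsFrom (n + A.length) B := by
  induction A generalizing n with
  | nil => rfl
  | cons x A ih =>
    rw [List.cons_append, arcsFrom, ih, arcsFrom, List.append_assoc, List.length_cons,
      show n + 1 + A.length = n + (A.length + 1) by omega]

/-! ### Paths -/

theorem IsPath.split {P R : Point} {l m : List Arc} (h : IsPath P (l ++ m) R) :
    ∃ Q, IsPath P l Q ∧ IsPath Q m R := by
  induction l generalizing P with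
  | nil => exact ⟨P, rfl, h⟩
  | cons x l ih =>
    obtain ⟨Q, h1, h2⟩ := ih h.2
    exact ⟨Q, ⟨h.1, h1⟩, h2⟩

theorem IsPath.tgt_unique {P Q Q' : Point} {l : List Arc} (h : IsPath P l Q) (h' : IsPath P l Q') :
    Q = Q' := by
  induction l generalizing P with
  | nil => exact (Eq.symm h).trans h'
  | cons x l ih => exact ih h.2 h'.2

/-- The end of a non-empty path is the end of one of its arcs. -/
theorem IsPath.exists_tgt {P Q : Point} {l : List Arc} (h : IsPath P l Q) (hl : l ≠ []) :
    ∃ x ∈ l, x.tgt = Q := by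
  induction l generalizing P with
  | nil => exact absurd rfl hl
  | cons x l ih =>
    rcases l with _ | ⟨y, l⟩
    · exact ⟨x, by simp, h.2⟩
    · obtain ⟨z, hz, e⟩ := ih h.2 (by simp)
      exact ⟨z, List.mem_cons_of_mem _ hz, e⟩

theorem eq_of_map_eq {β : Type*} {f : Arc → β} {l : List Arc} (h : (l.map f).Nodup) {x y : Arc}
    (hx : x ∈ l) (hy : y ∈ l) (e : f x = f y) : x = y :=
  List.inj_on_of_nodup_map h hx hy e

/-- Paths are determined by their starting points. -/
theorem IsPath.prefix {E : List Arc} (hE : (E.map Arc.src).Nodup) {P Q R : Point} {l m : List Arc}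
    (hl : IsPath P l Q) (hm : IsPath P m R) (hlE : ∀ x ∈ l, x ∈ E) (hmE : ∀ x ∈ m, x ∈ E)
    (h : l.length ≤ m.length) : ∃ m', m = l ++ m' := by
  induction l generalizing P m with
  | nil => exact ⟨m, rfl⟩
  | cons x l ih =>
    rcases m with _ | ⟨y, m⟩
    · simp at h
    · rw [List.forall_mem_cons] at hlE hmE
      obtain rfl : x = y := eq_of_map_eq hE hlE.1 hmE.1 (hl.1.trans hm.1.symm)
      obtain ⟨m', rfl⟩ := ih hl.2 hm.2 hlE.2 hmE.2 (by simpa using h)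
      exact ⟨m', rfl⟩

/-- Decomposition of a path into chains. -/
theorem exists_chains {σ : Type*} (F : σ → List Arc) {l : List Arc} {c : List σ} {P Q : Point}
    (hl : IsPath P l Q) (hsrc : (l.map Arc.src).Nodup) (htgt : (l.map Arc.tgt).Nodup)
    (hperm : (c.flatMap F).Perm l) (hne : ∀ t ∈ c, F t ≠ [])
    (hF : ∀ t ∈ c, ∃ P Q, IsPath P (F t) Q) (hP : P ∉ l.map Arc.tgt) :
    ∃ c' : List σ, c'.Perm c ∧ l = c'.flatMap F := by
  induction hn : c.length generalizing c l P with
  | zero =>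
    obtain rfl := List.length_eq_zero_iff.1 hn
    exact ⟨[], List.Perm.nil, by simpa using hperm.symm⟩
  | succ n ih =>
    rcases l with _ | ⟨x, l⟩
    · exfalso
      rcases c with _ | ⟨t, c⟩
      · simp at hn
      · rw [List.flatMap_cons] at hperm
        exact hne t (by simp) (List.append_eq_nil_iff.1 hperm.eq_nil).1
    · obtain ⟨t, ht, hxt⟩ := List.mem_flatMap.1 (hperm.mem_iff.2 (List.mem_cons_self (a := x)))
      obtain ⟨P', Q', hp⟩ := hF t ht
      obtain ⟨u, v, huv⟩ := List.append_of_mem hxt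
      have hsub : ∀ y ∈ F t, y ∈ x :: l := fun y hy =>
        hperm.mem_iff.1 (List.mem_flatMap.2 ⟨t, ht, hy⟩)
      rw [huv] at hp
      obtain ⟨R, h1, h2⟩ := hp.split
      -- The first arc of l is also the first arc of its chain: otherwise P would be the end of the
      -- preceding arc of the chain, and no arc of l ends at P.
      obtain rfl : u = [] := by
        by_contra hu
        obtain ⟨y, hy, e⟩ := h1.exists_tgt hu
        refine hP (List.mem_map.2 ⟨y, hsub y (by rw [huv]; simp [hy]), ?_⟩)
        rw [e, ← hl.1, h2.1]
      obtain ⟨c1, c2, rfl⟩ := List.append_of_mem ht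
      have hperm' : (F t ++ (c1 ++ c2).flatMap F).Perm (x :: l) := by
        refine List.Perm.trans ?_ hperm
        rw [← List.flatMap_cons]
        exact (List.perm_middle (l₁ := c1)).symm.flatMap_right F
      have hp' : IsPath P (F t) Q' := by
        rw [huv]
        exact ⟨hl.1, h2.2⟩
      -- Both paths start at P, and each point is the start of at most one arc; therefore the whole
      -- chain is an initial segment of l.
      obtain ⟨m, hm⟩ := IsPath.prefix hsrc hp' hl hsub (fun _ h => h) (by
        rw [← hperm'.length_eq, List.length_append]; omega)
      rw [hm] at hperm' hl hsrc htgt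
      have hperm'' := (List.perm_append_left_iff _).1 hperm'
      obtain ⟨R', h3, h4⟩ := hl.split
      rw [List.map_append, List.nodup_append] at hsrc htgt
      obtain ⟨c', hc', e⟩ := ih h4 hsrc.2.1 htgt.2.1 hperm''
        (fun s hs => hne s (by simp at hs ⊢; tauto)) (fun s hs => hF s (by simp at hs ⊢; tauto))
        (fun h => by
          obtain ⟨y, hy, e⟩ := h3.exists_tgt (hne t ht)
          exact htgt.2.2 _ (List.mem_map.2 ⟨y, hy, e⟩) _ h rfl)
        (by simp at hn ⊢; omega)
      refine ⟨t :: c', (hc'.cons t).trans List.perm_middle.symm, ?_⟩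
      rw [hm, e, List.flatMap_cons]

/-- Decomposition of a closed path into chains, after a rotation. -/
theorem exists_chains_closed {σ : Type*} (F : σ → List Arc) {l : List Arc} {c : List σ} {P : Point}
    (hl : IsPath P l P) (hsrc : (l.map Arc.src).Nodup) (htgt : (l.map Arc.tgt).Nodup)
    (hperm : (c.flatMap F).Perm l) (hne : ∀ t ∈ c, F t ≠ [])
    (hF : ∀ t ∈ c, ∃ P Q, IsPath P (F t) Q) :
    ∃ (c' : List σ) (Q : Point), c'.Perm c ∧ (c'.flatMap F).Perm l ∧ IsPath Q (c'.flatMap F) Q := by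
  rcases c with _ | ⟨t, c⟩
  · exact ⟨[], P, List.Perm.nil, hperm, rfl⟩
  rw [List.flatMap_cons] at hperm
  rw [List.forall_mem_cons] at hne hF
  obtain ⟨x, v, hv⟩ := List.exists_cons_of_ne_nil hne.1
  obtain ⟨P', Q', hp⟩ := hF.1
  obtain ⟨l1, l2, rfl⟩ := List.append_of_mem (hperm.mem_iff.1 (by rw [hv]; simp : x ∈ _))
  -- The closed path is rotated so as to begin with the first arc of the chain t. Then t is split
  -- off, and the rest is a path whose initial point is not the end of any of its arcs.
  have hrot : (x :: l2 ++ l1).Perm (l1 ++ x :: l2) := List.perm_append_comm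
  obtain ⟨R, h1, h2⟩ := hl.split
  have h3 : IsPath R (x :: l2 ++ l1) R := h2.append h1
  have hperm' := hperm.trans hrot.symm
  have hsrc' := (hrot.map Arc.src).nodup_iff.2 hsrc
  have htgt' := (hrot.map Arc.tgt).nodup_iff.2 htgt
  have hp' : IsPath R (F t) Q' := by
    rw [hv] at hp ⊢
    exact ⟨h2.1, hp.2⟩
  obtain ⟨m, hm⟩ := IsPath.prefix hsrc' hp' h3
    (fun y hy => hperm'.mem_iff.1 (List.mem_append_left _ hy)) (fun _ h => h) (by
      rw [← hperm'.length_eq, List.length_append]; omega)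
  rw [hm] at hperm' h3 hsrc' htgt' hrot
  obtain ⟨R', h4, h5⟩ := h3.split
  rw [List.map_append, List.nodup_append] at hsrc' htgt'
  obtain ⟨c', hc', e⟩ := exists_chains F h5 hsrc'.2.1 htgt'.2.1
    ((List.perm_append_left_iff _).1 hperm') hne.2 hF.2 (fun h => by
      obtain ⟨y, hy, e⟩ := h4.exists_tgt hne.1
      exact htgt'.2.2 _ (List.mem_map.2 ⟨y, hy, e⟩) _ h rfl)
  refine ⟨t :: c', R, hc'.cons t, ?_, ?_⟩
  · rw [List.flatMap_cons, ← e]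
    exact hrot
  · rw [List.flatMap_cons, ← e]
    exact h3

/-- Two closed paths through the same arcs differ by a rotation. -/
theorem closed_path_rotation {E l l' : List Arc} (hE : (E.map Arc.src).Nodup) {P P' : Point}
    (hl : IsPath P l P) (hl' : IsPath P' l' P') (h : l.Perm E) (h' : l'.Perm E) :
    ∃ u v, l = u ++ v ∧ l' = v ++ u := by
  rcases l' with _ | ⟨x, l'⟩
  · obtain rfl := (h.trans h'.symm).eq_nil
    exact ⟨[], [], rfl, rfl⟩
  · obtain ⟨u, v, rfl⟩ := List.append_of_mem (h.mem_iff.2 (h'.mem_iff.1 (List.mem_cons_self (a := x))))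
    refine ⟨u, x :: v, rfl, ?_⟩
    obtain ⟨R, h1, h2⟩ := hl.split
    have h3 : IsPath P' (x :: v ++ u) R := by
      refine IsPath.append (Q := P) ⟨hl'.1, h2.2⟩ h1
    have hp : (x :: v ++ u).Perm E := List.perm_append_comm.trans h
    -- Both paths start at the source of x and have equal length, so being a prefix means being
    -- equal.
    obtain ⟨m, hm⟩ := IsPath.prefix hE h3 hl' (fun y hy => hp.mem_iff.1 hy)
      (fun y hy => h'.mem_iff.1 hy) (hp.trans h'.symm).length_eq.le
    have hlen := congrArg List.length hm
    rw [List.length_append, (hp.trans h'.symm).length_eq] at hlen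
    obtain rfl : m = [] := List.length_eq_zero_iff.1 (by omega)
    rw [hm, List.append_nil]

theorem isPath_flatMap {σ : Type*} (F G : σ → List Arc) (φ : Point → Point) {c : List σ}
    {P Q : Point} (h : IsPath P (c.flatMap F) Q)
    (hF : ∀ t ∈ c, ∀ P Q, IsPath P (F t) Q → IsPath (φ P) (G t) (φ Q)) :
    IsPath (φ P) (c.flatMap G) (φ Q) := by
  induction c generalizing P with
  | nil => exact congrArg φ h
  | cons t c ih =>
    rw [List.flatMap_cons] at h ⊢
    rw [List.forall_mem_cons] at hF
    obtain ⟨R, h1, h2⟩ := h.split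
    exact (hF.1 _ _ h1).append (ih h2 hF.2)

/-! ### The orientation of the points of a diagram -/

/-- The orientations of the strands at line number `m`. -/
def level : List Bool → List Slice → ℕ → List Bool
  | s, _, 0 => s
  | _, [], _ + 1 => []
  | _, x :: D, m + 1 => level x.upper D m

/-- Compatibility of an arc with orientations of the points. -/
def Arc.Compat (o : Point → Bool) (x : Arc) : Prop :=
  match x.kind with
  | .vertical => o x.src = o x.tgt
  | .cross _ _ => o x.src = o x.tgt
  | .max _ => o x.src = true ∧ o x.tgt = false
  | .min _ => o x.src = false ∧ o x.tgt = true

/-- Is the given strand of a crossing oriented upwards? -/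
def Piece.lineDir : Piece → Bool → Bool
  | .cross a b s, i => if i = s then a else b
  | _, _ => false

theorem verticals_compat {o : Point → Bool} {n p q : ℕ} {l : List Bool}
    (h1 : ∀ i, i < l.length → o (n, p + i) = l.getD i false)
    (h2 : ∀ i, i < l.length → o (n + 1, q + i) = l.getD i false) :
    ∀ x ∈ verticals n p q l, x.Compat o ∧ x.kind.line = none := by
  induction l generalizing p q with
  | nil => simp [verticals]
  | cons a l ih =>
    rw [verticals, List.forall_mem_cons]
    refine ⟨?_, ih (fun i hi => ?_) (fun i hi => ?_)⟩
    · have e1 := h1 0 (by simp)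
      have e2 := h2 0 (by simp)
      simp only [add_zero, List.getD_cons_zero] at e1 e2
      cases a <;> exact ⟨by simp [Arc.Compat, orient, e1, e2], rfl⟩
    · have := h1 (i + 1) (by simpa using hi)
      rwa [List.getD_cons_succ, show p + (i + 1) = p + 1 + i by omega] at this
    · have := h2 (i + 1) (by simpa using hi)
      rwa [List.getD_cons_succ, show q + (i + 1) = q + 1 + i by omega] at this

theorem slice_compat {o : Point → Bool} {n : ℕ} {x : Slice}
    (h1 : ∀ i, i < x.lower.length → o (n, i) = x.lower.getD i false)
    (h2 : ∀ i, i < x.upper.length → o (n + 1, i) = x.upper.getD i false) :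
    ∀ y ∈ x.arcs n, y.Compat o ∧ ∀ i, y.kind.line = some i → i.1 = n ∧
      o y.src = x.piece.lineDir i.2 := by
  have key : ∀ {l : List Arc}, (∀ y ∈ l, y.Compat o ∧ y.kind.line = none) → ∀ y ∈ l,
      y.Compat o ∧ ∀ i, y.kind.line = some i → i.1 = n ∧ o y.src = x.piece.lineDir i.2 :=
    fun h y hy => ⟨(h y hy).1, fun i hi => by simp [(h y hy).2] at hi⟩
  rcases x with ⟨l, p, r⟩
  simp only [Slice.lower, Slice.upper] at h1 h2
  have g1 : ∀ i, i < p.lower.length → o (n, l.length + i) = p.lower.getD i false := by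
    intro i hi
    rw [h1 _ (by simp; omega), List.append_assoc, List.getD_append_right _ _ _ _ (by omega),
      Nat.add_sub_cancel_left, List.getD_append _ _ _ _ hi]
  have g2 : ∀ i, i < p.upper.length → o (n + 1, l.length + i) = p.upper.getD i false := by
    intro i hi
    rw [h2 _ (by simp; omega), List.append_assoc, List.getD_append_right _ _ _ _ (by omega),
      Nat.add_sub_cancel_left, List.getD_append _ _ _ _ hi]
  intro y hy
  rw [Slice.arcs, List.mem_append, List.mem_append] at hy
  rcases hy with (hy | hy) | hy
  · refine key (verticals_compat (fun i hi => ?_) fun i hi => ?_) y hy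
    · replace hi : i < l.length := hi
      rw [zero_add, h1 _ (by simp; omega), List.append_assoc, List.getD_append _ _ _ _ hi]
    · replace hi : i < l.length := hi
      rw [zero_add, h2 _ (by simp; omega), List.append_assoc, List.getD_append _ _ _ _ hi]
  · rcases p with ⟨a, b, s⟩ | a | a
    · have e1 := g1 0 (by simp [Piece.lower])
      have e2 := g1 1 (by simp [Piece.lower])
      have e3 := g2 0 (by simp [Piece.upper])
      have e4 := g2 1 (by simp [Piece.upper])
      simp only [Piece.lower, Piece.upper, add_zero, List.getD_cons_zero, List.getD_cons_succ]
        at e1 e2 e3 e4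
      simp only [Piece.arcs, List.mem_cons, List.not_mem_nil, or_false] at hy
      rcases hy with rfl | rfl
      · cases a <;> simp [Arc.Compat, orient, ArcKind.line, Piece.lineDir, e1, e4]
      · cases b <;> simp [Arc.Compat, orient, ArcKind.line, Piece.lineDir, e2, e3]
    · have e1 := g1 0 (by simp [Piece.lower])
      have e2 := g1 1 (by simp [Piece.lower])
      simp only [Piece.lower, add_zero, List.getD_cons_zero, List.getD_cons_succ] at e1 e2
      simp only [Piece.arcs, List.mem_cons, List.not_mem_nil, or_false] at hy
      subst hy
      cases a <;> simp [Arc.Compat, orient, ArcKind.line, e1, e2]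
    · have e1 := g2 0 (by simp [Piece.upper])
      have e2 := g2 1 (by simp [Piece.upper])
      simp only [Piece.upper, add_zero, List.getD_cons_zero, List.getD_cons_succ] at e1 e2
      simp only [Piece.arcs, List.mem_cons, List.not_mem_nil, or_false] at hy
      subst hy
      cases a <;> simp [Arc.Compat, orient, ArcKind.line, e1, e2]
  · refine key (verticals_compat (fun i hi => ?_) fun i hi => ?_) y hy
    · replace hi : i < r.length := hi
      rw [h1 _ (by simp; omega), List.getD_append_right _ _ _ _ (by simp)]
      congr 1; simp
    · replace hi : i < r.length := hi
      rw [h2 _ (by simp; omega), List.getD_append_right _ _ _ _ (by simp)]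
      congr 1; simp

theorem arcsFrom_compat {o : Point → Bool} {n : ℕ} {s t : List Bool} {D : List Slice}
    (h : Composable s D t) (ho : ∀ m i, o (n + m, i) = (level s D m).getD i false) :
    ∀ y ∈ arcsFrom n D, y.Compat o ∧ ∀ i, y.kind.line = some i → ∃ x, n ≤ i.1 ∧
      D[i.1 - n]? = some x ∧ o y.src = x.piece.lineDir i.2 := by
  induction D generalizing n s with
  | nil => simp [arcsFrom]
  | cons x D ih =>
    intro y hy
    have ho' : ∀ m i, o (n + 1 + m, i) = (level x.upper D m).getD i false := fun m i => by
      rw [add_assoc, add_comm 1 m, ho]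
      rfl
    rw [arcsFrom, List.mem_append] at hy
    rcases hy with hy | hy
    · obtain ⟨h1, h2⟩ := slice_compat (o := o) (fun i _ => by rw [← h.1]; exact ho 0 i)
        (fun i _ => by rw [ho' 0 i]; cases D <;> rfl) y hy
      refine ⟨h1, fun i hi => ⟨x, ?_, ?_, (h2 i hi).2⟩⟩
      · exact (h2 i hi).1.ge
      · rw [(h2 i hi).1]; simp
    · obtain ⟨h1, h2⟩ := ih h.2 ho' y hy
      refine ⟨h1, fun i hi => ?_⟩
      obtain ⟨z, h3, h4, h5⟩ := h2 i hi
      refine ⟨z, by omega, ?_, h5⟩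
      rw [show i.1 - n = (i.1 - (n + 1)) + 1 by omega, List.getElem?_cons_succ, h4]

/-- Every composable diagram has orientations of its points. -/
theorem exists_compat {s t : List Bool} {D : List Slice} (h : Composable s D t) :
    ∃ o : Point → Bool, ∀ y ∈ arcs D, y.Compat o ∧ ∀ i, y.kind.line = some i → ∃ x,
      D[i.1]? = some x ∧ o y.src = x.piece.lineDir i.2 := by
  refine ⟨fun P => (level s D P.1).getD P.2 false, fun y hy => ?_⟩
  obtain ⟨h1, h2⟩ := arcsFrom_compat (n := 0)
    (o := fun P => (level s D P.1).getD P.2 false) h (fun m i => by rw [zero_add]) y hy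
  refine ⟨h1, fun i hi => ?_⟩
  obtain ⟨x, -, h3, h4⟩ := h2 i hi
  exact ⟨x, h3, h4⟩

/-- Each extremum changes the vertical direction: a maximum from upward to downward, a minimum the
other way. In either sense of traversal a maximum contributes 1 and a minimum -1 to the difference
of the counts. -/
theorem cnt_sub_of_isPath {o : Point → Bool} {l : List Arc} (h : ∀ x ∈ l, x.Compat o) {P Q : Point}
    (hl : IsPath P l Q) : (cnt l).1 - (cnt l).2 = (o P).toNat - (o Q).toNat := by
  induction l generalizing P with
  | nil => cases hl; simp [cnt]
  | cons x l ih =>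
    rw [List.forall_mem_cons] at h
    have h1 := ih h.2 hl.2
    have h2 : (cnt [x]).1 - (cnt [x]).2 = ((o x.src).toNat : ℤ) - (o x.tgt).toNat := by
      have hx := h.1
      rcases x with ⟨S, T, t⟩
      rcases t with _ | ⟨n, i⟩ | t | t <;> simp only [Arc.Compat] at hx
      · simp [cnt, ArcKind.countD, ArcKind.countU, hx]
      · simp [cnt, ArcKind.countD, ArcKind.countU, hx]
      · cases t <;> simp [cnt, ArcKind.countD, ArcKind.countU, hx]
      · cases t <;> simp [cnt, ArcKind.countD, ArcKind.countU, hx]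
    rw [cnt_cons, Prod.fst_add, Prod.snd_add, ← hl.1]
    linarith

/-- The extrema of types d₊ and u₊ are the counterclockwise ones, those of types d₋ and u₋ the
clockwise ones. -/
theorem clockwiseSum_eq (D : List Slice) :
    clockwiseSum D = -((cnt (arcs D)).1 + (cnt (arcs D)).2) := by
  have h : ∀ l : List Arc, (l.map fun x => x.kind.clockwise).sum = -((cnt l).1 + (cnt l).2) := by
    intro l
    induction l with
    | nil => rfl
    | cons x l ih =>
      rw [List.map_cons, List.sum_cons, ih, cnt_cons]
      have h2 : x.kind.clockwise = -((cnt [x]).1 + (cnt [x]).2) := by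
        rcases x with ⟨S, T, t⟩
        rcases t with _ | ⟨n, i⟩ | t | t
        · rfl
        · rfl
        · cases t <;> rfl
        · cases t <;> rfl
      rw [h2, Prod.fst_add, Prod.snd_add]
      ring
  exact h _

/-- The counts of extrema in a closed traversal. -/
theorem cnt_closed (L : LinkDiagram) {P : Point} {l : List Arc} (h : l.Perm (arcs L.slices))
    (hl : IsPath P l P) : cnt l = (-L.whitneyDegree, -L.whitneyDegree) := by
  obtain ⟨o, ho⟩ := exists_compat L.composable
  have h1 := cnt_sub_of_isPath (fun x hx => (ho x (h.mem_iff.1 hx)).1) hl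
  have h2 := L.two_mul_whitneyDegree
  rw [clockwiseSum_eq, ← cnt_perm h] at h2
  -- The two counts have difference zero, as the path is closed, and sum -2d.
  ext <;> simp only <;> omega

end Diag

/-! ## The change of the starting point -/

section StartingPoint

open Coalgebra Diag

universe u v

set_option linter.unusedSectionVars false

variable {k : Type u} {C : Type v} [Field k] [AddCommGroup C] [Module k C] [Coalgebra k C]

/-! ### The actions of the dual algebra -/

theorem dsum_hitRight (g : WithConv (C →ₗ[k] k)) {h : C → k} (hh : IsLinearMap k h) (c : C) :
    dsum k (fun x y => g x * h y) c = h (hitRight c g) := by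
  rw [hitRight_eq_sum g (ℛ k c)]
  have e := map_sum hh.mk' (fun i => g ((ℛ k c).left i) • (ℛ k c).right i) (ℛ k c).index
  refine Eq.trans (Finset.sum_congr rfl fun i _ => ?_) e.symm
  rw [map_smul]
  rfl

theorem dsum_hitLeft (g : WithConv (C →ₗ[k] k)) {h : C → k} (hh : IsLinearMap k h) (c : C) :
    dsum k (fun x y => h x * g y) c = h (hitLeft g c) := by
  rw [hitLeft_eq_sum g (ℛ k c)]
  have e := map_sum hh.mk' (fun i => g ((ℛ k c).right i) • (ℛ k c).left i) (ℛ k c).index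
  refine Eq.trans (Finset.sum_congr rfl fun i _ => ?_) e.symm
  rw [map_smul]
  exact mul_comm _ _

theorem convMul_eq_dsum (f g : WithConv (C →ₗ[k] k)) (c : C) :
    (f * g) c = dsum k (fun x y => f x * g y) c := (ℛ k c).convMul_apply f g

/-- The left action of the dual algebra, as a linear map. -/
noncomputable def hitLeftLin (f : WithConv (C →ₗ[k] k)) : C →ₗ[k] C :=
  (TensorProduct.rid k C).toLinearMap ∘ₗ f.ofConv.lTensor C ∘ₗ comul

/-- The right action of the dual algebra, as a linear map. -/
noncomputable def hitRightLin (f : WithConv (C →ₗ[k] k)) : C →ₗ[k] C :=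
  (TensorProduct.lid k C).toLinearMap ∘ₗ f.ofConv.rTensor C ∘ₗ comul

/-- Linear forms on a vector space separate its elements. -/
theorem eq_of_forall_isLinearMap {x y : C} (h : ∀ f : C → k, IsLinearMap k f → f x = f y) :
    x = y := by
  rw [← sub_eq_zero, ← Module.forall_dual_apply_eq_zero_iff k]
  intro f
  rw [map_sub, h f f.isLinearMap', sub_self]

theorem hitLeft_hitLeft (f g : WithConv (C →ₗ[k] k)) (c : C) :
    hitLeft f (hitLeft g c) = hitLeft (f * g) c := by
  refine eq_of_forall_isLinearMap (k := k) fun h hh => ?_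
  have e1 : ∀ z, h (hitLeft f z) = dsum k (fun x y => h x * f y) z := fun z =>
    (dsum_hitLeft f hh z).symm
  have hf : IsLinearMap k fun x : C => f x := f.ofConv.isLinearMap'
  have hg : IsLinearMap k fun x : C => g x := g.ofConv.isLinearMap'
  have hh' : IsLinearMap k fun x => h (hitLeft f x) := hh.comp' (hitLeftLin f)
  rw [← dsum_hitLeft g hh', ← dsum_hitLeft (f * g) hh]
  simp only [e1, ← dsum_mul_const, convMul_eq_dsum, ← dsum_const_mul]
  rw [dsum_assoc (g := fun x y z => h x * f y * g z)
    (fun y z => (hh.mul_const _).mul_const _) (fun x z => (hf.const_mul _).mul_const _)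
    (fun x y => hg.const_mul _)]
  simp only [mul_assoc]

theorem hitRight_hitRight (f g : WithConv (C →ₗ[k] k)) (c : C) :
    hitRight (hitRight c f) g = hitRight c (f * g) := by
  refine eq_of_forall_isLinearMap (k := k) fun h hh => ?_
  have e1 : ∀ z, h (hitRight z g) = dsum k (fun x y => g x * h y) z := fun z =>
    (dsum_hitRight g hh z).symm
  have hf : IsLinearMap k fun x : C => f x := f.ofConv.isLinearMap'
  have hg : IsLinearMap k fun x : C => g x := g.ofConv.isLinearMap'
  have hh' : IsLinearMap k fun x => h (hitRight x g) := hh.comp' (hitRightLin g)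
  rw [← dsum_hitRight f hh', ← dsum_hitRight (f * g) hh]
  simp only [e1, ← dsum_mul_const, convMul_eq_dsum, ← dsum_const_mul]
  rw [← dsum_assoc (g := fun x y z => f x * (g y * h z)) (fun y z => hf.mul_const _)
    (fun x z => (hg.mul_const _).const_mul _) (fun x y => (hh.const_mul _).const_mul _)]
  simp only [mul_assoc]

theorem hitLeft_one (c : C) : hitLeft (1 : WithConv (C →ₗ[k] k)) c = c := by
  refine eq_of_forall_isLinearMap (k := k) fun h hh => ?_
  rw [← dsum_hitLeft _ hh]
  exact dsum_counit_right hh c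

theorem hitRight_one (c : C) : hitRight c (1 : WithConv (C →ₗ[k] k)) = c := by
  refine eq_of_forall_isLinearMap (k := k) fun h hh => ?_
  rw [← dsum_hitRight _ hh]
  exact dsum_counit_left hh c

theorem ev_singleton {α : Type*} [DecidableEq α] {M : (α → C) → k} {a : α} (h : LinearAt M a)
    (y : α → C) (c : C) : ev [a] M y c = M (Function.update y a c) := by
  rw [← dsum_counit_right (h y) c]
  exact dsum_congr (fun u v => mul_comm _ _) c

/-! ### Powers of G and of T_d T_u -/

namespace TwistOrientedQuantumCoalgebra

variable (Q : TwistOrientedQuantumCoalgebra k C)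

theorem Gpow_add (d e : ℤ) : Q.Gpow (d + e) = Q.Gpow d * Q.Gpow e := by
  rw [Gpow, zpow_add, Units.val_mul]
  rfl

theorem Gpow_zero : Q.Gpow 0 = 1 := by
  rw [Gpow, zpow_zero, Units.val_one]

theorem Gpow_one : Q.Gpow 1 = (Q.G : WithConv (C →ₗ[k] k)) := by
  rw [Gpow, zpow_one]

theorem Gpow_neg_one : Q.Gpow (-1) = ((Q.G⁻¹ : (WithConv (C →ₗ[k] k))ˣ) : WithConv (C →ₗ[k] k)) := by
  rw [Gpow, zpow_neg_one]

theorem pw_one_one (c : C) : Q.pw (1, 1) c = hitLeft (Q.Gpow (-1)) (hitRight c (Q.Gpow 1)) := by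
  rw [Gpow_one, Gpow_neg_one, ← Q.twist]
  simp [StrictOrientedQuantumCoalgebra.pw, StrictOrientedQuantumCoalgebra.power]

/-- The twist axiom raised to the power d. The left and right actions of the dual algebra commute,
so both sides are multiplicative in d, and the cases d = 1 and d = -1 suffice. -/
theorem pw_diag (d : ℤ) (c : C) :
    Q.pw (d, d) c = hitLeft (Q.Gpow (-d)) (hitRight c (Q.Gpow d)) := by
  have step : ∀ e : ℤ, (∀ z, Q.pw (e, e) z = hitLeft (Q.Gpow (-e)) (hitRight z (Q.Gpow e))) →
      ∀ e', (∀ z, Q.pw (e', e') z = hitLeft (Q.Gpow (-e')) (hitRight z (Q.Gpow e'))) →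
      ∀ z, Q.pw (e + e', e + e') z = hitLeft (Q.Gpow (-(e + e'))) (hitRight z (Q.Gpow (e + e'))) := by
    intro e h e' h' z
    rw [show ((e + e', e + e') : ℤ × ℤ) = (e', e') + (e, e) by ext <;> simp [add_comm], Q.pw_add,
      h', h, ← hitLeft_hitRight_comm, hitLeft_hitLeft, hitRight_hitRight, ← Gpow_add, ← Gpow_add]
    congr 2
    omega
  have hneg : ∀ z, Q.pw (-1, -1) z = hitLeft (Q.Gpow (-(-1))) (hitRight z (Q.Gpow (-1))) := by
    intro z
    -- A preimage of z under T_d T_u is G ⇀ z ↼ G⁻¹, which settles d = -1.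
    have e : z = Q.pw (1, 1) (hitLeft (Q.Gpow 1) (hitRight z (Q.Gpow (-1)))) := by
      rw [pw_one_one, ← hitLeft_hitRight_comm, hitLeft_hitLeft, hitRight_hitRight, ← Gpow_add,
        neg_add_cancel]
      simp [Gpow_zero, hitLeft_one, hitRight_one]
    conv_lhs => rw [e]
    rw [← Q.pw_add, neg_neg]
    exact Q.pw_zero _
  induction d using Int.induction_on generalizing c with
  | zero => simp [Gpow_zero, hitLeft_one, hitRight_one, show ((0, 0) : ℤ × ℤ) = 0 from rfl, Q.pw_zero]
  | succ i ih => exact step i ih 1 Q.pw_one_one c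
  | pred i ih => exact step _ ih (-1) hneg c

/-- The value of the product of a power of `G` and the functional of a path. -/
noncomputable def pathValue (d : ℤ) (D : List Slice) (l : List Arc) (c : C) : k :=
  dsum k (fun x y => Q.Gpow d x * Q.pathForm D l y) c

end TwistOrientedQuantumCoalgebra

namespace StrictOrientedQuantumCoalgebra

variable (Q : StrictOrientedQuantumCoalgebra k C)

theorem prodFrom_congr_mem {n : ℕ} {D : List Slice} {y z : ℕ × Bool → C}
    (h : ∀ a ∈ crossingLines (arcsFrom n D), y a = z a) : Q.prodFrom n D y = Q.prodFrom n D z := by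
  induction D generalizing n with
  | nil => rfl
  | cons x D ih =>
    rw [crossingLines_arcsFrom_cons] at h
    rw [prodFrom, prodFrom, ih fun a ha => h a (List.mem_append_right _ ha), fac, fac]
    split_ifs with hx
    · have h1 : ∀ o, y (n, o) = z (n, o) := fun o =>
        h _ (List.mem_append_left _ ((mem_crossingLines_slice n n o x).2 ⟨rfl, hx⟩))
      rw [h1, h1]
    · rfl

theorem update_pw (e : ℕ × Bool → ℤ × ℤ) (y : ℕ × Bool → C) (a : ℕ × Bool) (x : C) :
    (fun b => Q.pw (e b) (Function.update y a x b)) =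
      Function.update (fun b => Q.pw (e b) (y b)) a (Q.pw (e a) x) := by
  funext b
  by_cases hb : b = a
  · subst hb; simp
  · simp [Function.update_of_ne hb]

theorem linearAt_pw {M : (ℕ × Bool → C) → k} {a : ℕ × Bool} (h : LinearAt M a)
    (e : ℕ × Bool → ℤ × ℤ) : LinearAt (fun y => M fun b => Q.pw (e b) (y b)) a := by
  intro y
  simp only [update_pw]
  exact (h _).comp' _

theorem indepAt_pw {M : (ℕ × Bool → C) → k} {a : ℕ × Bool} (h : IndepAt M a)
    (e : ℕ × Bool → ℤ × ℤ) : IndepAt (fun y => M fun b => Q.pw (e b) (y b)) a := by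
  intro y x
  simp only [update_pw]
  exact h _ _

theorem pathForm_linearAt {D : List Slice} {l : List Arc} (h : l.Perm (arcs D))
    (e : ℕ × Bool → ℤ × ℤ) : ∀ a ∈ crossingLines l,
      LinearAt (fun y => Q.prodFrom 0 D fun b => Q.pw (e b) (y b)) a := fun _ ha =>
  Q.linearAt_pw (Q.prodFrom_linearAt ((h.filterMap _).mem_iff.1 ha)) e

end StrictOrientedQuantumCoalgebra

theorem Diag.nodup_of_perm {D : List Slice} {l : List Arc} (h : l.Perm (arcs D)) :
    (crossingLines l).Nodup := (h.filterMap _).nodup_iff.2 (nodup_crossingLines_arcsFrom 0 D)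

theorem Diag.mem_of_perm {D : List Slice} {l : List Arc} (h : l.Perm (arcs D)) (a : ℕ × Bool) :
    a ∈ crossingLines (arcsFrom 0 D) ↔ a ∈ crossingLines l := (h.filterMap _).mem_iff.symm

namespace TwistOrientedQuantumCoalgebra

variable (Q : TwistOrientedQuantumCoalgebra k C)

/-- The word does not change, and every exponent grows by the count of x, which is a common pair and
has no effect by `prodFrom_pw`. -/
theorem pathForm_rotate_none {D : List Slice} {x : Arc} {l : List Arc}
    (h : (x :: l).Perm (arcs D)) (hx : x.kind.line = none) (c : C) :
    Q.pathForm D (l ++ [x]) c = Q.pathForm D (x :: l) c := by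
  have e1 : crossingLines (l ++ [x]) = crossingLines (x :: l) := by
    rw [crossingLines_append, crossingLines_cons_none hx, crossingLines_cons_none hx]
    simp [crossingLines]
  rw [StrictOrientedQuantumCoalgebra.pathForm, StrictOrientedQuantumCoalgebra.pathForm, e1]
  refine ev_congr (fun y => ?_) _ _ _
  rw [← Q.prodFrom_pw 0 D (cnt [x]) fun a => Q.pw (expo (x :: l) a) (y a)]
  refine Q.prodFrom_congr_mem fun a ha => ?_
  rw [mem_of_perm h, crossingLines_cons_none hx] at ha
  rw [expo_append_of_mem ha, expo, if_neg (by simp [hx]), add_comm, Q.pw_add]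

/-- The line a is the first letter with exponents (-d, -d) before the rotation and the last letter
with exponents zero after it. The factor G^d and the cocommutativity of c compensate for this
change. -/
theorem pathValue_rotate_some {L : LinkDiagram} {x : Arc} {l : List Arc} {P : Point}
    (h : (x :: l).Perm (arcs L.slices)) (hl : IsPath P (x :: l) P) {a : ℕ × Bool}
    (hx : x.kind.line = some a) {c : C} (hc : IsCocommutativeElement k c) :
    Q.pathValue L.whitneyDegree L.slices (l ++ [x]) c =
      Q.pathValue L.whitneyDegree L.slices (x :: l) c := by
  set d := L.whitneyDegree
  have hcnt : cnt [x] = 0 := by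
    rcases x with ⟨S, T, t⟩
    cases t <;> first | rfl | simp [ArcKind.line] at hx
  have hcl : cnt l = (-d, -d) := by
    have := cnt_closed L h hl
    rwa [cnt_cons, hcnt, zero_add] at this
  have hnd := nodup_of_perm h
  have e1 := crossingLines_cons_some hx l
  have e2 : crossingLines (l ++ [x]) = crossingLines l ++ [a] := by
    rw [crossingLines_append, crossingLines_cons_some hx]
    rfl
  have ha : a ∉ crossingLines l := by
    rw [e1, List.nodup_cons] at hnd
    exact hnd.1
  have hnd' : (crossingLines l).Nodup := by
    rw [e1, List.nodup_cons] at hnd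
    exact hnd.2
  -- The exponents after the rotation. Before it they differ only at a, since the crossing line x
  -- contains no extremum.
  let E : ℕ × Bool → ℤ × ℤ := fun b => if b = a then 0 else expo l b
  let M : (ℕ × Bool → C) → k := fun y => Q.prodFrom 0 L.slices fun b => Q.pw (E b) (y b)
  have hM : ∀ b ∈ a :: crossingLines l, LinearAt M b := by
    rw [← e1]
    exact Q.pathForm_linearAt h E
  -- The letter a receives u, and the remaining word is evaluated at v.
  let Φ : C → C → k := fun u v => ev (crossingLines l) (fun y => M (Function.update y a u)) 0 v
  have hΦ1 : ∀ v, IsLinearMap k fun u => Φ u v := fun v =>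
    ev_param _ (fun y => hM a (by simp) y) 0 v
  have hΦ2 : ∀ u, IsLinearMap k fun v => Φ u v := fun u => by
    refine ev_isLinearMap hnd' (fun b hb => ?_) 0
    intro y
    have hba : b ≠ a := fun e => ha (e ▸ hb)
    simp only [Function.update_comm hba]
    exact hM b (List.mem_cons_of_mem _ hb) _
  have f1 : ∀ z, Q.pathForm L.slices (x :: l) z = dsum k (fun u v => Φ (Q.pw (-d, -d) u) v) z := by
    intro z
    rw [StrictOrientedQuantumCoalgebra.pathForm, e1]
    refine dsum_congr (fun u v => ?_) z
    refine (ev_update _ _ ha _ _ _).trans (ev_congr (fun y => ?_) _ _ _)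
    refine Q.prodFrom_congr' fun m o _ => ?_
    rw [expo, hx]
    by_cases hb : (0 + m, o) = a
    · subst hb
      simp [E, hcl, Q.pw_zero]
    · have hb' : some a ≠ some (0 + m, o) := fun e => hb (Option.some.inj e).symm
      simp only [E, if_neg hb, if_neg hb', Function.update_of_ne hb]
  have f2 : ∀ z, Q.pathForm L.slices (l ++ [x]) z = dsum k (fun v u => Φ u v) z := by
    intro z
    have hp : (l ++ [x]).Perm (arcs L.slices) := List.perm_append_comm.trans h
    rw [StrictOrientedQuantumCoalgebra.pathForm, e2, ev_append (by rw [← e2]; exact nodup_of_perm hp)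
      (by rw [← e2]; exact Q.pathForm_linearAt hp _)]
    refine dsum_congr (fun v u => ev_congr (fun y => ?_) _ _ _) z
    refine (ev_singleton (Q.pathForm_linearAt hp _ a (by rw [e2]; simp)) y u).trans ?_
    refine Q.prodFrom_congr_mem fun b hb => ?_
    rw [mem_of_perm hp, e2, List.mem_append, List.mem_singleton] at hb
    by_cases hba : b = a
    · subst hba
      rw [expo_append_of_not_mem ha]
      simp [E, expo, hx, cnt_nil]
    · rw [expo_append_of_mem (by tauto), hcnt, add_zero]
      simp [E, hba]
  have hg : IsLinearMap k fun x : C => Q.Gpow d x := (Q.Gpow d).ofConv.isLinearMap'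
  -- The twist axiom in the form which lets G^d pass from the left to the right of the component at
  -- a.
  have hT : ∀ z, Q.pw (-d, -d) (hitRight z (Q.Gpow d)) = hitLeft (Q.Gpow d) z := fun z => by
    rw [pw_diag, hitRight_hitRight, ← Gpow_add, neg_neg, add_neg_cancel, Gpow_zero, hitRight_one]
  -- In Sweedler notation: G^d(c₁) Φ(T_d^(-d) T_u^(-d) c₂, c₃) = Φ(c₁, c₃) G^d(c₂).
  have s1 : Q.pathValue d L.slices (x :: l) c =
      dsum k (fun z v => dsum k (fun u w => Φ u v * Q.Gpow d w) z) c := by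
    have e3 : ∀ z v, dsum k (fun w u => Q.Gpow d w * Φ (Q.pw (-d, -d) u) v) z =
        dsum k (fun u w => Φ u v * Q.Gpow d w) z := fun z v => by
      rw [dsum_hitRight _ ((hΦ1 v).comp' _), hT, dsum_hitLeft _ (hΦ1 v)]
    simp only [← e3]
    rw [dsum_assoc (fun _ _ => hg.mul_const _) (fun _ z => ((hΦ1 z).comp' _).const_mul _)
      (fun _ u => (hΦ2 _).const_mul _)]
    simp only [pathValue, f1, dsum_const_mul]
  have hB : IsBilin k fun u a => dsum k (fun w v => Φ u v * Q.Gpow d w) a :=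
    ⟨fun a => dsum_isLinearMap_param (fun w v => (hΦ1 v).mul_const _) a,
      fun u => dsum_isLinearMap ⟨fun v => hg.const_mul _, fun w => (hΦ2 u).mul_const _⟩⟩
  -- Cocommutativity, applied to the splitting of c into c₁ and the rest, permits a cyclic
  -- permutation and yields G^d(c₁) Φ(c₃, c₂), the value of the rotated path.
  rw [s1, dsum_assoc (fun w v => (hΦ1 v).mul_const _) (fun u v => hg.const_mul _)
    (fun u w => (hΦ2 u).mul_const _), hc.dsum_comm hB,
    dsum_assoc (fun v u => hg.const_mul _) (fun w u => (hΦ2 u).mul_const _)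
    (fun w v => (hΦ1 v).mul_const _)]
  simp only [pathValue, f2, ← dsum_const_mul, mul_comm]

theorem pathValue_rotate {L : LinkDiagram} {u v : List Arc} {P : Point}
    (h : (u ++ v).Perm (arcs L.slices)) (hl : IsPath P (u ++ v) P) {c : C}
    (hc : IsCocommutativeElement k c) :
    Q.pathValue L.whitneyDegree L.slices (v ++ u) c =
      Q.pathValue L.whitneyDegree L.slices (u ++ v) c := by
  induction u generalizing v P with
  | nil => rw [List.append_nil, List.nil_append]
  | cons x u ih =>
    rw [List.cons_append] at h hl
    have h' : (u ++ v ++ [x]).Perm (arcs L.slices) := List.perm_append_comm.trans h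
    have hl' : IsPath x.tgt (u ++ v ++ [x]) x.tgt := hl.2.append ⟨hl.1, rfl⟩
    rw [List.append_assoc] at h' hl'
    have e := ih h' hl'
    rw [List.append_assoc, List.singleton_append] at e
    rw [e, ← List.append_assoc]
    rcases hx : x.kind.line with _ | a
    · exact dsum_congr (fun y z => by rw [Q.pathForm_rotate_none h hx]; rfl) c
    · exact Q.pathValue_rotate_some h hl hx hc

/-- The value of a closed path does not depend on the starting point. -/
theorem pathValue_closed_unique {L : LinkDiagram} {P P' : Point} (τ : Traversal L.slices P P)
    (τ' : Traversal L.slices P' P') {c : C} (hc : IsCocommutativeElement k c) :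
    Q.pathValue L.whitneyDegree L.slices τ.path c =
      Q.pathValue L.whitneyDegree L.slices τ'.path c := by
  obtain ⟨u, v, e, e'⟩ := closed_path_rotation (nodup_src L.composable) τ.isPath τ'.isPath τ.perm
    τ'.perm
  have h := τ.perm
  have hl := τ.isPath
  rw [e] at h hl
  rw [e, e', Q.pathValue_rotate h hl hc]

theorem mul_functional_apply (d : ℤ) {D : List Slice} {P P' : Point} (τ : Traversal D P P') (c : C) :
    (Q.Gpow d * WithConv.toConv (Q.functional τ)) c = Q.pathValue d D τ.path c := by
  rw [convMul_eq_dsum]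
  exact dsum_congr (fun x y => congrArg _ (Q.functional_eq_pathForm τ y)) c

end TwistOrientedQuantumCoalgebra

end StartingPoint

/-! ## Comparison of the functionals of two diagrams -/

section Comparison

open Coalgebra Diag

universe u v

set_option linter.unusedSectionVars false

variable {k : Type u} {C : Type v} [Field k] [AddCommGroup C] [Module k C] [Coalgebra k C]

/-! ### Paths which consist of corresponding chains -/

namespace Diag

theorem crossingLines_flatMap {σ : Type*} (F : σ → List Arc) (c : List σ) :
    crossingLines (c.flatMap F) = c.flatMap fun t => crossingLines (F t) := by
  induction c with
  | nil => rfl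
  | cons t c ih => rw [List.flatMap_cons, List.flatMap_cons, crossingLines_append, ih]

/-- Exponents in paths which consist of chains, in terms of the exponents in the chains. -/
theorem exists_expo_flatMap {σ : Type*} [DecidableEq σ] (F G : σ → List Arc) {c : List σ}
    (hc : c.Nodup) (hF : (crossingLines (c.flatMap F)).Nodup)
    (hG : (crossingLines (c.flatMap G)).Nodup) (hcnt : ∀ t ∈ c, cnt (F t) = cnt (G t)) :
    cnt (c.flatMap F) = cnt (c.flatMap G) ∧
    ∃ E : σ → ℤ × ℤ, ∀ t ∈ c,
      (∀ a ∈ crossingLines (F t), expo (c.flatMap F) a = expo (F t) a + E t) ∧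
      (∀ a ∈ crossingLines (G t), expo (c.flatMap G) a = expo (G t) a + E t) := by
  induction c with
  | nil => exact ⟨rfl, 0, by simp⟩
  | cons t c ih =>
    rw [List.forall_mem_cons] at hcnt
    rw [List.nodup_cons] at hc
    simp only [List.flatMap_cons, crossingLines_append] at hF hG ⊢
    obtain ⟨h1, E, h2⟩ := ih hc.2 (List.nodup_append.1 hF).2.1 (List.nodup_append.1 hG).2.1 hcnt.2
    -- The offset of the first chain is the count of everything behind it. It is the same on both
    -- sides, because corresponding chains have equal counts.
    refine ⟨by rw [cnt_append, cnt_append, hcnt.1, h1],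
      Function.update E t (cnt (c.flatMap F)), ?_⟩
    rw [List.forall_mem_cons]
    refine ⟨⟨fun a ha => ?_, fun a ha => ?_⟩, fun s hs => ⟨fun a ha => ?_, fun a ha => ?_⟩⟩
    · rw [expo_append_of_mem ha, Function.update_self]
    · rw [expo_append_of_mem ha, Function.update_self, h1]
    · rw [expo_append_of_not_mem, (h2 s hs).1 a ha,
        Function.update_of_ne (show s ≠ t from fun e => hc.1 (e ▸ hs))]
      intro ha'
      refine (List.nodup_append.1 hF).2.2 a ha' a ?_ rfl
      rw [crossingLines_flatMap]
      exact List.mem_flatMap.2 ⟨s, hs, ha⟩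
    · rw [expo_append_of_not_mem, (h2 s hs).2 a ha,
        Function.update_of_ne (show s ≠ t from fun e => hc.1 (e ▸ hs))]
      intro ha'
      refine (List.nodup_append.1 hG).2.2 a ha' a ?_ rfl
      rw [crossingLines_flatMap]
      exact List.mem_flatMap.2 ⟨s, hs, ha⟩

/-- Pairs of corresponding chains of arcs of two diagrams. -/
abbrev ChainPair : Type := List Arc × List Arc

noncomputable instance : DecidableEq ChainPair := Classical.decEq _

/-- The crossing lines of the first chain. -/
def ChainPair.word₁ (t : ChainPair) : List (ℕ × Bool) := crossingLines t.1

/-- The crossing lines of the second chain. -/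
def ChainPair.word₂ (t : ChainPair) : List (ℕ × Bool) := crossingLines t.2

end Diag

namespace StrictOrientedQuantumCoalgebra

variable (Q : StrictOrientedQuantumCoalgebra k C)

/-- The functional of a path which consists of chains, in terms of the exponents in the chains. -/
theorem pathForm_flatMap {σ : Type*} [DecidableEq σ] (F : σ → List Arc) {D : List Slice} {c : List σ}
    (hc : c.Nodup) (h : (c.flatMap F).Perm (arcs D)) {E : σ → ℤ × ℤ} {loc : ℕ × Bool → ℤ × ℤ}
    (hE : ∀ t ∈ c, ∀ a ∈ crossingLines (F t), expo (c.flatMap F) a = loc a + E t) (x : C) :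
    Q.pathForm D (c.flatMap F) x =
      ev c (fun s => bigev (fun t => crossingLines (F t)) c
        (fun y => Q.prodFrom 0 D fun a => Q.pw (loc a) (y a)) 0 fun t => Q.pw (E t) (s t)) 0 x := by
  have hn := nodup_of_perm h
  have e := crossingLines_flatMap F c
  rw [pathForm, e, ev_flatMap (fun t => crossingLines (F t)) hc (by rwa [← e])
    (by rw [← e]; exact Q.pathForm_linearAt h _) 0 0 x]
  refine ev_congr (fun s => ?_) _ _ _
  -- The offset E t is common to all letters of the chain t; the corresponding power is a coalgebra
  -- map and can be moved onto the element s t.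
  refine bigev_sim (ρ := id) Function.injective_id
    (g := fun a => Q.pw (expo (c.flatMap F) a - loc a)) (fun t _ => Q.pw_isCoalgMap (E t))
    (fun t _ => (List.map_id _).symm) (by rwa [← e])
    (by rw [← e]; exact Q.pathForm_linearAt h _) (fun t ht a ha => ?_) (fun y z hyz => ?_) 0 0
    (fun b => by simp) s
  · rw [hE t ht a ha, add_sub_cancel_left]
  · refine Q.prodFrom_congr' fun m o _ => ?_
    rw [hyz, ← Q.pw_add, add_sub_cancel]
    rfl

/-- Comparison of the functionals of two paths which consist of corresponding chains. -/
theorem pathForm_eq_of_bigev_eq {D D' : List Slice} {c c' : List ChainPair} (hc : c.Nodup)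
    (hcc : c'.Perm c) (h : (c.flatMap Prod.fst).Perm (arcs D))
    (h' : (c.flatMap Prod.snd).Perm (arcs D')) (hcnt : ∀ t ∈ c, cnt t.1 = cnt t.2)
    {loc loc' : ℕ × Bool → ℤ × ℤ} (hl : ∀ t ∈ c, ∀ a ∈ crossingLines t.1, expo t.1 a = loc a)
    (hl' : ∀ t ∈ c, ∀ a ∈ crossingLines t.2, expo t.2 a = loc' a)
    (H : ∀ s, bigev ChainPair.word₁ c (fun y => Q.prodFrom 0 D fun a => Q.pw (loc a) (y a)) 0 s =
      bigev ChainPair.word₂ c (fun y => Q.prodFrom 0 D' fun a => Q.pw (loc' a) (y a)) 0 s) (x : C) :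
    Q.pathForm D (c'.flatMap Prod.fst) x = Q.pathForm D' (c'.flatMap Prod.snd) x := by
  have hp := (hcc.flatMap_right Prod.fst).trans h
  have hp' := (hcc.flatMap_right Prod.snd).trans h'
  have hn := nodup_of_perm hp
  have hn' := nodup_of_perm hp'
  have hc' := hcc.nodup_iff.2 hc
  obtain ⟨-, E, hE⟩ := exists_expo_flatMap Prod.fst Prod.snd hc' hn hn'
    fun t ht => hcnt t (hcc.mem_iff.1 ht)
  rw [Q.pathForm_flatMap Prod.fst hc' hp (E := E) (loc := loc) fun t ht a ha => by
      rw [(hE t ht).1 a ha, hl t (hcc.mem_iff.1 ht) a ha],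
    Q.pathForm_flatMap Prod.snd hc' hp' (E := E) (loc := loc') fun t ht a ha => by
      rw [(hE t ht).2 a ha, hl' t (hcc.mem_iff.1 ht) a ha]]
  refine ev_congr (fun s => ?_) _ _ _
  rw [crossingLines_flatMap] at hn hn'
  -- The order c' in which the path meets the chains governs only the outer evaluation; for the
  -- inner one the fixed order c of the hypothesis is as good.
  refine (bigev_perm ChainPair.word₁ hcc hn _ _ _).trans ((H _).trans ?_)
  exact (bigev_perm ChainPair.word₂ hcc hn' _ _ _).symm

end StrictOrientedQuantumCoalgebra

/-! ### Translations of diagrams -/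

namespace Diag

/-- Translation of points. -/
def shiftPt (i j : ℕ) (P : Point) : Point := (P.1 + i, P.2 + j)

/-- Translation of the numbers of slices in kinds of arcs. -/
def ArcKind.shift (i : ℕ) : ArcKind → ArcKind
  | vertical => vertical
  | cross n o => cross (n + i) o
  | max t => max t
  | min t => min t

/-- Translation of arcs. -/
def Arc.shift (i j : ℕ) (x : Arc) : Arc := ⟨shiftPt i j x.src, shiftPt i j x.tgt, x.kind.shift i⟩

theorem orient_shift (i j : ℕ) (a : Bool) (P Q : Point) (t : ArcKind) :
    (orient a P Q t).shift i j = orient a (shiftPt i j P) (shiftPt i j Q) (t.shift i) := by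
  cases a <;> rfl

theorem verticals_shift (i j n p q : ℕ) (l : List Bool) :
    verticals (n + i) (p + j) (q + j) l = (verticals n p q l).map (Arc.shift i j) := by
  induction l generalizing p q with
  | nil => rfl
  | cons a l ih =>
    rw [verticals, verticals, List.map_cons, orient_shift, ← ih, shiftPt, shiftPt]
    simp only [add_right_comm, ArcKind.shift]

theorem piece_shift (i j n p : ℕ) (x : Piece) :
    x.arcs (n + i) (p + j) = (x.arcs n p).map (Arc.shift i j) := by
  cases x <;> simp [Piece.arcs, orient_shift, shiftPt, ArcKind.shift, add_right_comm]

theorem slice_shift (i n : ℕ) (x : Slice) : x.arcs (n + i) = (x.arcs n).map (Arc.shift i 0) := by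
  simp only [Slice.arcs, List.map_append, ← verticals_shift, ← piece_shift, add_zero]

theorem arcsFrom_shift (i n : ℕ) (D : List Slice) :
    arcsFrom (n + i) D = (arcsFrom n D).map (Arc.shift i 0) := by
  induction D generalizing n with
  | nil => rfl
  | cons x D ih => rw [arcsFrom, arcsFrom, List.map_append, ← ih, slice_shift, add_right_comm]

theorem slice_addLeft (a : Bool) (n : ℕ) (x : Slice) : (x.addLeft a).arcs n =
    orient a (n, 0) (n + 1, 0) .vertical :: (x.arcs n).map (Arc.shift 0 1) := by
  have e1 := verticals_shift 0 1 n 0 0 x.left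
  have e2 := piece_shift 0 1 n x.left.length x.piece
  have e3 := verticals_shift 0 1 n (x.left.length + x.piece.lower.length)
    (x.left.length + x.piece.upper.length) x.right
  simp only [Slice.arcs, Slice.addLeft, List.map_append, ← e1, ← e2, ← e3, verticals,
    List.length_cons, List.cons_append, add_zero, add_right_comm]

theorem cnt_shift (i j : ℕ) (l : List Arc) : cnt (l.map (Arc.shift i j)) = cnt l := by
  have h1 : ∀ x : Arc, (x.shift i j).kind.countD = x.kind.countD := by
    rintro ⟨P, Q, t⟩; cases t <;> rfl
  have h2 : ∀ x : Arc, (x.shift i j).kind.countU = x.kind.countU := by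
    rintro ⟨P, Q, t⟩; cases t <;> rfl
  simp only [cnt, List.map_map, Function.comp_def, h1, h2]

theorem line_shift (i j : ℕ) (x : Arc) :
    (x.shift i j).kind.line = x.kind.line.map fun a => (a.1 + i, a.2) := by
  rcases x with ⟨P, Q, t⟩
  cases t <;> rfl

theorem crossingLines_shift (i j : ℕ) (l : List Arc) :
    crossingLines (l.map (Arc.shift i j)) = (crossingLines l).map fun a => (a.1 + i, a.2) := by
  rw [crossingLines, List.filterMap_map, crossingLines, List.map_filterMap]
  exact congrArg (List.filterMap · l) (funext fun x => line_shift i j x)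

theorem expo_shift (i j : ℕ) (l : List Arc) (a : ℕ × Bool) :
    expo (l.map (Arc.shift i j)) (a.1 + i, a.2) = expo l a := by
  induction l with
  | nil => rfl
  | cons x l ih =>
    rw [List.map_cons, expo, expo, line_shift, ih, cnt_shift]
    rcases x.kind.line with _ | b
    · simp
    · rcases a with ⟨a1, a2⟩
      rcases b with ⟨b1, b2⟩
      simp

theorem isPath_shift (i j : ℕ) {P Q : Point} {l : List Arc} (h : IsPath P l Q) :
    IsPath (shiftPt i j P) (l.map (Arc.shift i j)) (shiftPt i j Q) := by
  induction l generalizing P with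
  | nil => exact congrArg _ h
  | cons x l ih => exact ⟨congrArg (shiftPt i j) h.1, ih h.2⟩

theorem level_of_mem_verticals {n p q : ℕ} {l : List Bool} {x : Arc} (h : x ∈ verticals n p q l) :
    (x.src.1 = n ∨ x.src.1 = n + 1) ∧ (x.tgt.1 = n ∨ x.tgt.1 = n + 1) := by
  induction l generalizing p q with
  | nil => simp [verticals] at h
  | cons a l ih =>
    rw [verticals, List.mem_cons] at h
    rcases h with rfl | h
    · cases a <;> simp [orient]
    · exact ih h

theorem level_of_mem_slice {n : ℕ} {s : Slice} {x : Arc} (h : x ∈ s.arcs n) :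
    (x.src.1 = n ∨ x.src.1 = n + 1) ∧ (x.tgt.1 = n ∨ x.tgt.1 = n + 1) := by
  rw [Slice.arcs, List.mem_append, List.mem_append] at h
  rcases h with (h | h) | h
  · exact level_of_mem_verticals h
  · rcases s with ⟨l, ⟨a, b, t⟩ | a | a, r⟩ <;>
      simp only [Piece.arcs, List.mem_cons, List.not_mem_nil, or_false] at h
    · rcases h with rfl | rfl
      · cases a <;> simp [orient]
      · cases b <;> simp [orient]
    · subst h; cases a <;> simp [orient]
    · subst h; cases a <;> simp [orient]
  · exact level_of_mem_verticals h

theorem level_of_mem_arcsFrom {n : ℕ} {D : List Slice} {x : Arc} (h : x ∈ arcsFrom n D) :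
    (n ≤ x.src.1 ∧ x.src.1 ≤ n + D.length) ∧ n ≤ x.tgt.1 ∧ x.tgt.1 ≤ n + D.length := by
  induction D generalizing n with
  | nil => simp [arcsFrom] at h
  | cons s D ih =>
    rw [arcsFrom, List.mem_append] at h
    rw [List.length_cons]
    rcases h with h | h
    · obtain ⟨h1, h2⟩ := level_of_mem_slice h
      omega
    · have := ih h
      omega

end Diag

end Comparison

/-! ## Local replacements -/

section LocalReplacement

open Coalgebra Diag

universe u v

set_option linter.unusedSectionVars false

variable {k : Type u} {C : Type v} [Field k] [AddCommGroup C] [Module k C] [Coalgebra k C]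

namespace Diag

/-- The correspondence of points if `j` slices above line number `N` are removed. -/
def lowerPt (N j : ℕ) (P : Point) : Point := if P.1 ≤ N then P else (P.1 - j, P.2)

theorem lowerPt_zero (N : ℕ) (P : Point) : lowerPt N 0 P = P := by
  rw [lowerPt]
  split_ifs <;> rfl

/-- A correspondence between the arcs of two parts of diagrams, which start at line number `N`: the
verticals `vs` are common, and the other arcs belong to corresponding chains. The first part has `j`
slices more than the second one. -/
structure ChainCorr (N j : ℕ) (X Y : List Slice) (vs : List Arc) (mid : List ChainPair) : Prop where
  length_eq : X.length = Y.length + j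
  perm₁ : (vs ++ mid.flatMap Prod.fst).Perm (arcsFrom N X)
  perm₂ : (vs ++ mid.flatMap Prod.snd).Perm (arcsFrom N Y)
  line_eq : ∀ x ∈ vs, x.kind.line = none
  lower_vs : vs = [] ∨ j = 0
  ne_nil : ∀ t ∈ mid, t.1 ≠ []
  cnt_eq : ∀ t ∈ mid, cnt t.1 = cnt t.2
  isPath : ∀ t ∈ mid, ∃ P Q, IsPath P t.1 Q ∧ IsPath (lowerPt N j P) t.2 (lowerPt N j Q)

namespace ChainCorr

variable {N j : ℕ} {X Y : List Slice} {vs : List Arc} {mid : List ChainPair}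

/-- The pairs of corresponding arcs outside of the part which is replaced, and of the common vertical
lines. -/
def outer (j n : ℕ) (A B : List Slice) (vs : List Arc) : List ChainPair :=
  (arcs A ++ vs).map (fun x => ([x], [x])) ++ (arcsFrom n B).map fun x => ([x.shift j 0], [x])

theorem outer_flatMap_fst (j n : ℕ) (A B : List Slice) (vs : List Arc) :
    (outer j n A B vs).flatMap Prod.fst = arcs A ++ vs ++ arcsFrom (n + j) B := by
  rw [outer, List.flatMap_append, List.flatMap_map, List.flatMap_map, arcsFrom_shift]
  simp [← List.map_eq_flatMap]

theorem outer_flatMap_snd (j n : ℕ) (A B : List Slice) (vs : List Arc) :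
    (outer j n A B vs).flatMap Prod.snd = arcs A ++ vs ++ arcsFrom n B := by
  rw [outer, List.flatMap_append, List.flatMap_map, List.flatMap_map]
  simp

theorem arcs_perm (N : ℕ) {A B X : List Slice} {vs m : List Arc} (hA : A.length = N)
    (h : (vs ++ m).Perm (arcsFrom N X)) :
    (arcs A ++ vs ++ arcsFrom (N + X.length) B ++ m).Perm (arcs (A ++ X ++ B)) := by
  rw [arcs, arcs, arcsFrom_append, arcsFrom_append, List.length_append, zero_add, zero_add, hA]
  rw [← Multiset.coe_eq_coe] at h ⊢
  simp only [← Multiset.coe_add] at h ⊢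
  rw [← h]
  abel

theorem perm_fst (H : ChainCorr N j X Y vs mid) {A : List Slice} (B : List Slice)
    (hA : A.length = N) :
    ((outer j (N + Y.length) A B vs ++ mid).flatMap Prod.fst).Perm (arcs (A ++ X ++ B)) := by
  rw [List.flatMap_append, outer_flatMap_fst, add_assoc, ← H.length_eq]
  exact arcs_perm N hA H.perm₁

theorem perm_snd (H : ChainCorr N j X Y vs mid) {A : List Slice} (B : List Slice)
    (hA : A.length = N) :
    ((outer j (N + Y.length) A B vs ++ mid).flatMap Prod.snd).Perm (arcs (A ++ Y ++ B)) := by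
  rw [List.flatMap_append, outer_flatMap_snd]
  exact arcs_perm N hA H.perm₂

theorem forall_outer {p : ChainPair → Prop} {n : ℕ} {A B : List Slice}
    (h1 : ∀ x ∈ arcs A, p ([x], [x])) (h2 : ∀ x ∈ vs, p ([x], [x]))
    (h3 : ∀ x ∈ arcsFrom n B, p ([x.shift j 0], [x])) : ∀ t ∈ outer j n A B vs, p t := by
  intro t ht
  simp only [outer, List.mem_append, List.mem_map] at ht
  rcases ht with ⟨x, hx | hx, rfl⟩ | ⟨x, hx, rfl⟩
  exacts [h1 x hx, h2 x hx, h3 x hx]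

theorem ne_nil' (H : ChainCorr N j X Y vs mid) (A B : List Slice) (n : ℕ) :
    ∀ t ∈ outer j n A B vs ++ mid, t.1 ≠ [] := by
  intro t ht
  rcases List.mem_append.1 ht with ht | ht
  · exact forall_outer (p := fun t => t.1 ≠ []) (fun _ _ => List.cons_ne_nil _ _)
      (fun _ _ => List.cons_ne_nil _ _) (fun _ _ => List.cons_ne_nil _ _) t ht
  · exact H.ne_nil t ht

theorem cnt_eq' (H : ChainCorr N j X Y vs mid) (A B : List Slice) (n : ℕ) :
    ∀ t ∈ outer j n A B vs ++ mid, cnt t.1 = cnt t.2 := by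
  intro t ht
  rcases List.mem_append.1 ht with ht | ht
  · exact forall_outer (p := fun t => cnt t.1 = cnt t.2) (fun _ _ => rfl) (fun _ _ => rfl)
      (fun x _ => cnt_shift j 0 [x]) t ht
  · exact H.cnt_eq t ht

theorem isPath' (H : ChainCorr N j X Y vs mid) {A B : List Slice} (hA : A.length = N) :
    ∀ t ∈ outer j (N + Y.length) A B vs ++ mid,
      ∃ P Q, IsPath P t.1 Q ∧ IsPath (lowerPt N j P) t.2 (lowerPt N j Q) := by
  intro t ht
  rcases List.mem_append.1 ht with ht | ht
  · refine forall_outer (p := fun t => ∃ P Q, IsPath P t.1 Q ∧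
      IsPath (lowerPt N j P) t.2 (lowerPt N j Q)) (fun x hx => ?_) (fun x hx => ?_)
      (fun x hx => ?_) t ht
    · have h := level_of_mem_arcsFrom hx
      refine ⟨x.src, x.tgt, ⟨rfl, rfl⟩, ?_, ?_⟩
      · rw [lowerPt, if_pos (by omega)]
      · change x.tgt = _
        rw [lowerPt, if_pos (by omega)]
    · rcases H.lower_vs with e | e
      · simp [e] at hx
      · subst e
        refine ⟨x.src, x.tgt, ⟨rfl, rfl⟩, ?_, ?_⟩
        · rw [lowerPt_zero]
        · rw [lowerPt_zero]; rfl
    · have h := level_of_mem_arcsFrom hx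
      -- Above the replaced part, lowering undoes the shift by j. The exceptional case of a shifted
      -- point not above line N forces j = 0.
      have key : ∀ P : Point, N ≤ P.1 → P = lowerPt N j (shiftPt j 0 P) := by
        rintro ⟨m, p⟩ hm
        simp only at hm
        by_cases hmj : m + j ≤ N
        · obtain rfl : j = 0 := by omega
          rw [lowerPt_zero]
          rfl
        · rw [lowerPt, shiftPt, if_neg hmj, Nat.add_sub_cancel]
          rfl
      exact ⟨shiftPt j 0 x.src, shiftPt j 0 x.tgt, ⟨rfl, rfl⟩, key _ (by omega), key _ (by omega)⟩
  · exact H.isPath t ht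

/-- A closed path in one diagram gives a closed path in the other one. -/
theorem exists_closed (H : ChainCorr N j X Y vs mid) {A B : List Slice} (hA : A.length = N)
    (hD : Composable [] (A ++ X ++ B) []) {P : Point} (τ : Traversal (A ++ X ++ B) P P) :
    ∃ (c' : List ChainPair) (R R' : Point), c'.Perm (outer j (N + Y.length) A B vs ++ mid) ∧
      (c'.flatMap Prod.fst).Perm (arcs (A ++ X ++ B)) ∧ IsPath R (c'.flatMap Prod.fst) R ∧
      (c'.flatMap Prod.snd).Perm (arcs (A ++ Y ++ B)) ∧ IsPath R' (c'.flatMap Prod.snd) R' := by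
  have hp := H.perm_fst B hA
  have hpath := H.isPath' (B := B) hA
  obtain ⟨c', R, h1, h2, h3⟩ := exists_chains_closed Prod.fst τ.isPath
    ((τ.perm.map _).nodup_iff.2 (nodup_src hD)) ((τ.perm.map _).nodup_iff.2 (nodup_tgt hD))
    (hp.trans τ.perm.symm) (H.ne_nil' A B _) (fun t ht => by
      obtain ⟨P, Q, h, -⟩ := hpath t ht
      exact ⟨P, Q, h⟩)
  refine ⟨c', R, lowerPt N j R, h1, h2.trans τ.perm, h3,
    (h1.flatMap_right Prod.snd).trans (H.perm_snd B hA), ?_⟩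
  -- Paths through the first members of the pairs are carried to paths through the second members; a
  -- non-empty chain determines its starting point and its end, so the given ends are the ones of
  -- `H.isPath'`.
  refine isPath_flatMap Prod.fst Prod.snd _ h3 fun t ht P Q hPQ => ?_
  have ht' := h1.mem_iff.1 ht
  obtain ⟨P', Q', h4, h5⟩ := hpath t ht'
  have hne := H.ne_nil' A B _ t ht'
  obtain ⟨x, l, e⟩ := List.exists_cons_of_ne_nil hne
  have hPP : P = P' := by
    rw [e] at hPQ h4
    exact hPQ.1.symm.trans h4.1
  subst hPP
  rwa [hPQ.tgt_unique h4]

theorem clockwiseSum_eq (H : ChainCorr N j X Y vs mid) {A B : List Slice} (hA : A.length = N) :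
    clockwiseSum (A ++ X ++ B) = clockwiseSum (A ++ Y ++ B) := by
  have h : ∀ c : List ChainPair, (∀ t ∈ c, cnt t.1 = cnt t.2) →
      cnt (c.flatMap Prod.fst) = cnt (c.flatMap Prod.snd) := by
    intro c hc
    induction c with
    | nil => rfl
    | cons t c ih =>
      rw [List.forall_mem_cons] at hc
      rw [List.flatMap_cons, List.flatMap_cons, cnt_append, cnt_append, hc.1, ih hc.2]
  rw [Diag.clockwiseSum_eq, Diag.clockwiseSum_eq, ← cnt_perm (H.perm_fst B hA),
    ← cnt_perm (H.perm_snd B hA), h _ (H.cnt_eq' A B _)]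

/-- The chains are non-empty and partition the arcs, which are pairwise distinct; hence no pair
occurs twice. -/
theorem nodup_pairs (H : ChainCorr N j X Y vs mid) {A B : List Slice} (hA : A.length = N)
    (hD : Composable [] (A ++ X ++ B) []) : (outer j (N + Y.length) A B vs ++ mid).Nodup := by
  have h1 : ((outer j (N + Y.length) A B vs ++ mid).flatMap Prod.fst).Nodup :=
    (H.perm_fst B hA).nodup_iff.2 (List.Nodup.of_map _ (nodup_src hD))
  have h2 := H.ne_nil' A B (N + Y.length)
  generalize outer j (N + Y.length) A B vs ++ mid = c at h1 h2
  induction c with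
  | nil => exact List.nodup_nil
  | cons t c ih =>
    rw [List.forall_mem_cons] at h2
    rw [List.flatMap_cons, List.nodup_append] at h1
    refine List.nodup_cons.2 ⟨fun ht => ?_, ih h1.2.1 h2.2⟩
    obtain ⟨x, l, e⟩ := List.exists_cons_of_ne_nil h2.1
    have hx : x ∈ t.1 := by rw [e]; simp
    exact h1.2.2 x hx x (List.mem_flatMap.2 ⟨t, ht, hx⟩) rfl

end ChainCorr

end Diag

namespace StrictOrientedQuantumCoalgebra

variable (Q : StrictOrientedQuantumCoalgebra k C)

/-- The product of the factors splits into crossings outside and inside of the replaced part, and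
the letters split accordingly. The inner evaluations agree by hypothesis, the outer ones up to
renumbering. -/
theorem bigev_chainCorr {N j : ℕ} {X Y : List Slice} {vs : List Arc} {mid : List ChainPair}
    (H : ChainCorr N j X Y vs mid) {A B : List Slice} (hA : A.length = N)
    {loc loc' : ℕ × Bool → ℤ × ℤ}
    (hl : ∀ a : ℕ × Bool, a.1 < N ∨ N + X.length ≤ a.1 → loc a = 0)
    (hl' : ∀ a : ℕ × Bool, a.1 < N ∨ N + Y.length ≤ a.1 → loc' a = 0)
    (hmid : ∀ s, bigev ChainPair.word₁ mid (fun y => Q.prodFrom N X fun a => Q.pw (loc a) (y a)) 0 s =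
      bigev ChainPair.word₂ mid (fun y => Q.prodFrom N Y fun a => Q.pw (loc' a) (y a)) 0 s)
    (s : ChainPair → C) :
    bigev ChainPair.word₁ (ChainCorr.outer j (N + Y.length) A B vs ++ mid)
      (fun y => Q.prodFrom 0 (A ++ X ++ B) fun a => Q.pw (loc a) (y a)) 0 s =
    bigev ChainPair.word₂ (ChainCorr.outer j (N + Y.length) A B vs ++ mid)
      (fun y => Q.prodFrom 0 (A ++ Y ++ B) fun a => Q.pw (loc' a) (y a)) 0 s := by
  have split : ∀ (Z : List Slice) (e : ℕ × Bool → ℤ × ℤ),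
      (∀ a : ℕ × Bool, a.1 < N ∨ N + Z.length ≤ a.1 → e a = 0) → ∀ y : ℕ × Bool → C,
      Q.prodFrom 0 (A ++ Z ++ B) (fun a => Q.pw (e a) (y a)) =
        (Q.prodFrom 0 A y * Q.prodFrom (N + Z.length) B y) *
          Q.prodFrom N Z fun a => Q.pw (e a) (y a) := by
    intro Z e he y
    rw [prodFrom_append, prodFrom_append, List.length_append, hA, zero_add, zero_add,
      Q.prodFrom_congr' (n := 0) (D := A) (z := y) (n' := 0) (fun m o hm => by
        rw [he _ (Or.inl (by simp only; omega)), Q.pw_zero]),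
      Q.prodFrom_congr' (n := N + Z.length) (D := B) (z := y) (n' := N + Z.length) (fun m o hm => by
        rw [he _ (Or.inr (by simp only; omega)), Q.pw_zero])]
    ring
  have indep : ∀ (Z : List Slice) (e : ℕ × Bool → ℤ × ℤ) (W : ChainPair → List (ℕ × Bool)),
      (∀ t ∈ mid, ∀ a ∈ W t, a ∈ crossingLines (arcsFrom N Z)) →
      (∀ t ∈ ChainCorr.outer j (N + Y.length) A B vs, ∀ a ∈ W t,
        a.1 < N ∨ N + Z.length ≤ a.1) → ∀ s,
      bigev W (ChainCorr.outer j (N + Y.length) A B vs ++ mid)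
        (fun y => (Q.prodFrom 0 A y * Q.prodFrom (N + Z.length) B y) *
          Q.prodFrom N Z fun a => Q.pw (e a) (y a)) 0 s =
      bigev W (ChainCorr.outer j (N + Y.length) A B vs)
        (fun y => Q.prodFrom 0 A y * Q.prodFrom (N + Z.length) B y) 0 s *
      bigev W mid (fun y => Q.prodFrom N Z fun a => Q.pw (e a) (y a)) 0 s := by
    intro Z e W h1 h2 s
    refine bigev_append_mul W (M := fun y => Q.prodFrom 0 A y * Q.prodFrom (N + Z.length) B y)
      (fun a ha => ?_) (fun a ha => ?_) 0 s
    · obtain ⟨t, ht, ha⟩ := List.mem_flatMap.1 ha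
      exact Q.indepAt_pw (Q.prodFrom_indepAt a.2 (h2 t ht a ha)) e
    · obtain ⟨t, ht, ha⟩ := List.mem_flatMap.1 ha
      have h3 := h1 t ht a ha
      rw [mem_crossingLines_arcsFrom] at h3
      obtain ⟨i, h3, -⟩ := h3
      have hi := i.2
      intro y x
      show Q.prodFrom 0 A _ * Q.prodFrom _ B _ = _
      rw [Q.prodFrom_indepAt a.2 (Or.inr (by omega)) y x,
        Q.prodFrom_indepAt a.2 (Or.inl (by omega)) y x]
  have hN : ∀ x ∈ arcs A, ∀ a ∈ crossingLines [x], a.1 < N := fun x hx a ha => by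
    have h : a ∈ crossingLines (arcs A) := by
      rw [← List.singleton_sublist] at hx
      exact (hx.filterMap _).subset ha
    rw [arcs, mem_crossingLines_arcsFrom] at h
    obtain ⟨i, h, -⟩ := h
    have hi := i.2
    omega
  have hvs : ∀ x ∈ vs, ∀ a ∈ crossingLines [x], a.1 < N := fun x hx a ha => by
    rw [crossingLines_cons_none (H.line_eq x hx)] at ha
    simp [crossingLines] at ha
  have hB : ∀ (n : ℕ), ∀ x ∈ arcsFrom n B, ∀ a ∈ crossingLines [x], n ≤ a.1 := fun n x hx a ha => by
    have h : a ∈ crossingLines (arcsFrom n B) := by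
      rw [← List.singleton_sublist] at hx
      exact (hx.filterMap _).subset ha
    rw [mem_crossingLines_arcsFrom] at h
    obtain ⟨i, h, -⟩ := h
    omega
  have hsub : ∀ {Z : List Slice} (f : ChainPair → List Arc),
      (vs ++ mid.flatMap f).Perm (arcsFrom N Z) →
      ∀ t ∈ mid, ∀ a ∈ crossingLines (f t), a ∈ crossingLines (arcsFrom N Z) := by
    intro Z f hp t ht a ha
    refine (hp.filterMap _).mem_iff.1 ?_
    have e : crossingLines (vs ++ mid.flatMap f) = _ := crossingLines_append _ _
    refine (congrArg (a ∈ ·) e).mpr (List.mem_append_right _ ?_)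
    rw [crossingLines_flatMap]
    exact List.mem_flatMap.2 ⟨t, ht, ha⟩
  simp only [split X loc hl, split Y loc' hl']
  rw [indep X loc ChainPair.word₁ (hsub Prod.fst H.perm₁) (ChainCorr.forall_outer
      (fun x hx a ha => Or.inl (hN x hx a ha)) (fun x hx a ha => Or.inl (hvs x hx a ha))
      (fun x hx a ha => Or.inr (hB _ (x.shift j 0) (by
        rw [H.length_eq, ← add_assoc, arcsFrom_shift]; exact List.mem_map_of_mem hx) a ha))),
    indep Y loc' ChainPair.word₂ (hsub Prod.snd H.perm₂) (ChainCorr.forall_outer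
      (fun x hx a ha => Or.inl (hN x hx a ha)) (fun x hx a ha => Or.inl (hvs x hx a ha))
      (fun x hx a ha => Or.inr (hB _ x hx a ha))), hmid s]
  congr 1
  -- From crossings of the second diagram to those of the first one: above the replaced part the
  -- first diagram has j additional slices.
  let ρ : ℕ × Bool → ℕ × Bool := fun a => if a.1 < N then a else (a.1 + j, a.2)
  have hρ : Function.Injective ρ := by
    rintro ⟨m, o⟩ ⟨m', o'⟩ h
    simp only [ρ] at h
    split_ifs at h <;> simp only [Prod.mk.injEq] at h ⊢ <;> exact ⟨by omega, h.2⟩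
  have hw : (ChainCorr.outer j (N + Y.length) A B vs).flatMap ChainPair.word₂ =
      crossingLines (arcsFrom 0 A) ++ crossingLines (arcsFrom (N + Y.length) B) := by
    have e : crossingLines vs = [] := List.filterMap_eq_nil_iff.2 H.line_eq
    refine (crossingLines_flatMap Prod.snd _).symm.trans ?_
    rw [ChainCorr.outer_flatMap_snd, crossingLines_append, crossingLines_append, e, List.append_nil]
    rfl
  have hlt : ∀ a ∈ crossingLines (arcsFrom 0 A), a.1 < N := fun a ha => by
    rw [mem_crossingLines_arcsFrom] at ha
    obtain ⟨i, h, -⟩ := ha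
    have hi := i.2
    omega
  have hge : ∀ a ∈ crossingLines (arcsFrom (N + Y.length) B), N ≤ a.1 := fun a ha => by
    rw [mem_crossingLines_arcsFrom] at ha
    obtain ⟨i, h, -⟩ := ha
    omega
  have hlin : ∀ a ∈ (ChainCorr.outer j (N + Y.length) A B vs).flatMap ChainPair.word₂,
      LinearAt (fun y : ℕ × Bool → C => Q.prodFrom 0 A y * Q.prodFrom (N + Y.length) B y) a := by
    rw [hw]
    intro a ha y
    rcases List.mem_append.1 ha with ha | ha
    · have e : IndepAt (Q.prodFrom (N + Y.length) B) a := Q.prodFrom_indepAt a.2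
        (Or.inl (Nat.lt_add_right _ (hlt a ha)))
      simp only [e y]
      exact (Q.prodFrom_linearAt ha y).mul_const _
    · have e : IndepAt (Q.prodFrom 0 A) a := Q.prodFrom_indepAt a.2
        (Or.inr (by have := hge a ha; omega))
      simp only [e y]
      exact (Q.prodFrom_linearAt ha y).const_mul _
  refine bigev_sim hρ (g := fun _ => LinearMap.id) (τ := fun _ => LinearMap.id)
    (fun _ _ => IsCoalgMap.id) ?_ ?_ hlin (fun _ _ _ _ => rfl) (fun y z hyz => ?_) 0 0
    (fun _ => rfl) s
  · refine ChainCorr.forall_outer (fun x hx => ?_) (fun x hx => ?_) (fun x hx => ?_)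
    · refine (List.map_id _).symm.trans (List.map_congr_left fun a ha => ?_)
      exact (if_pos (hN x hx a ha)).symm
    · refine (List.map_id _).symm.trans (List.map_congr_left fun a ha => ?_)
      exact (if_pos (hvs x hx a ha)).symm
    · refine (crossingLines_shift j 0 [x]).trans (List.map_congr_left fun a ha => ?_)
      have := hB _ x hx a ha
      exact (if_neg (by omega)).symm
  · rw [hw]
    refine List.nodup_append.2 ⟨nodup_crossingLines_arcsFrom _ _, nodup_crossingLines_arcsFrom _ _,
      fun a ha b hb e => ?_⟩
    have h1 := hlt a ha
    have h2 := hge b hb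
    rw [e] at h1
    omega
  · have e1 : Q.prodFrom 0 A y = Q.prodFrom 0 A z := Q.prodFrom_congr' fun m o hm => by
      rw [hyz]
      simp only [ρ, LinearMap.id_apply]
      rw [if_pos (by omega)]
    have e2 : Q.prodFrom (N + X.length) B y = Q.prodFrom (N + Y.length) B z :=
      Q.prodFrom_congr' fun m o hm => by
        rw [hyz]
        simp only [ρ, LinearMap.id_apply]
        rw [if_neg (by omega), H.length_eq]
        congr 2
        omega
    rw [e1, e2]

end StrictOrientedQuantumCoalgebra

end LocalReplacement

/-! ## Diagrams with equal values -/

section EqualValues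

open Coalgebra Diag

universe u v

set_option linter.unusedSectionVars false

variable {k : Type u} {C : Type v} [Field k] [AddCommGroup C] [Module k C] [Coalgebra k C]

/-- Two parts of diagrams, starting at line number `N`, correspond to each other in such a way that
replacing one by the other does not change the values of the functionals. -/
def StrictOrientedQuantumCoalgebra.Replaceable (Q : StrictOrientedQuantumCoalgebra k C) (N j : ℕ)
    (X Y : List Slice) : Prop :=
  ∃ (vs : List Arc) (mid : List ChainPair) (loc loc' : ℕ × Bool → ℤ × ℤ),
    ChainCorr N j X Y vs mid ∧ (j = 0 → ∀ t ∈ mid, t.2 ≠ []) ∧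
    (∀ a : ℕ × Bool, a.1 < N ∨ N + X.length ≤ a.1 → loc a = 0) ∧
    (∀ a : ℕ × Bool, a.1 < N ∨ N + Y.length ≤ a.1 → loc' a = 0) ∧
    (∀ t ∈ mid, ∀ a ∈ crossingLines t.1, expo t.1 a = loc a) ∧
    (∀ t ∈ mid, ∀ a ∈ crossingLines t.2, expo t.2 a = loc' a) ∧
    ∀ s, bigev ChainPair.word₁ mid (fun y => Q.prodFrom N X fun a => Q.pw (loc a) (y a)) 0 s =
      bigev ChainPair.word₂ mid (fun y => Q.prodFrom N Y fun a => Q.pw (loc' a) (y a)) 0 s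

theorem bigev_map {α σ τ : Type*} [DecidableEq α] (W : σ → List α) (f : τ → σ) (l : List τ)
    (M : (α → C) → k) (y : α → C) (s : σ → C) :
    bigev W (l.map f) M y s = bigev (fun t => W (f t)) l M y fun t => s (f t) := by
  induction l generalizing y with
  | nil => rfl
  | cons t l ih =>
    simp only [List.map_cons, bigev]
    exact ev_congr (fun y => ih y) _ _ _

namespace StrictOrientedQuantumCoalgebra

variable {Q : StrictOrientedQuantumCoalgebra k C}

/-- Restricted to j = 0: then points correspond identically and the second chains are non-empty. If
slices are removed, some second chains are empty and cannot be recognized in a path. -/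
theorem Replaceable.symm {N : ℕ} {X Y : List Slice} (h : Q.Replaceable N 0 X Y) :
    Q.Replaceable N 0 Y X := by
  obtain ⟨vs, mid, loc, loc', H, h1, h2, h3, h4, h5, h6⟩ := h
  have forall_swap : ∀ {p : ChainPair → Prop}, (∀ t ∈ mid, p (Prod.swap t)) →
      ∀ t ∈ mid.map Prod.swap, p t := by
    intro p hp t ht
    obtain ⟨t', ht', rfl⟩ := List.mem_map.1 ht
    exact hp t' ht'
  have e1 : (mid.map Prod.swap).flatMap Prod.fst = mid.flatMap Prod.snd := List.flatMap_map _ _ _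
  have e2 : (mid.map Prod.swap).flatMap Prod.snd = mid.flatMap Prod.fst := List.flatMap_map _ _ _
  refine ⟨vs, mid.map Prod.swap, loc', loc, ⟨H.length_eq.symm, by rw [e1]; exact H.perm₂,
    by rw [e2]; exact H.perm₁, H.line_eq, Or.inr rfl, forall_swap (h1 rfl),
    forall_swap fun t ht => (H.cnt_eq t ht).symm, forall_swap fun t ht => ?_⟩,
    fun _ => forall_swap H.ne_nil, h3, h2, forall_swap h5, forall_swap h4, fun s => ?_⟩
  · obtain ⟨P, R, h7, h8⟩ := H.isPath t ht
    rw [lowerPt_zero, lowerPt_zero] at h8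
    exact ⟨P, R, h8, by rwa [lowerPt_zero, lowerPt_zero]⟩
  · rw [bigev_map, bigev_map]
    exact (h6 _).symm

/-- A closed path in a diagram gives a closed path in the diagram in which a part is replaced; the
functionals of these paths are equal. -/
theorem Replaceable.exists_closed {N j : ℕ} {X Y : List Slice} (h : Q.Replaceable N j X Y)
    {A B : List Slice} (hA : A.length = N) (hD : Composable [] (A ++ X ++ B) []) {P : Point}
    (τ : Traversal (A ++ X ++ B) P P) :
    clockwiseSum (A ++ X ++ B) = clockwiseSum (A ++ Y ++ B) ∧
    ∃ (R R' : Point) (τ₁ : Traversal (A ++ X ++ B) R R) (τ₂ : Traversal (A ++ Y ++ B) R' R'),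
      ∀ x, Q.pathForm (A ++ X ++ B) τ₁.path x = Q.pathForm (A ++ Y ++ B) τ₂.path x := by
  obtain ⟨vs, mid, loc, loc', H, -, h2, h3, h4, h5, h6⟩ := h
  refine ⟨H.clockwiseSum_eq hA, ?_⟩
  obtain ⟨c', R, R', g1, g2, g3, g4, g5⟩ := H.exists_closed hA hD τ
  refine ⟨R, R', ⟨_, g2, g3⟩, ⟨_, g4, g5⟩, Q.pathForm_eq_of_bigev_eq (H.nodup_pairs hA hD) g1
    (H.perm_fst B hA) (H.perm_snd B hA) (H.cnt_eq' A B _) (loc := loc) (loc' := loc')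
    ?_ ?_ (Q.bigev_chainCorr H hA h2 h3 h6)⟩
  all_goals
    have single : ∀ (x : Arc), ∀ a ∈ crossingLines [x], expo [x] a = 0 := by
      intro x a ha
      rcases hx : x.kind.line with _ | b
      · rw [crossingLines_cons_none hx] at ha
        simp [crossingLines] at ha
      · rw [crossingLines_cons_some hx] at ha
        obtain rfl : a = b := by simpa [crossingLines] using ha
        rw [expo, if_pos hx, cnt_nil]
    have hN : ∀ x ∈ arcs A, ∀ a ∈ crossingLines [x], a.1 < N := fun x hx a ha => by
      have h : a ∈ crossingLines (arcs A) := by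
        rw [← List.singleton_sublist] at hx
        exact (hx.filterMap _).subset ha
      rw [arcs, mem_crossingLines_arcsFrom] at h
      obtain ⟨i, h, -⟩ := h
      have hi := i.2
      omega
    have hvs : ∀ x ∈ vs, ∀ a ∈ crossingLines [x], a.1 < N := fun x hx a ha => by
      rw [crossingLines_cons_none (H.line_eq x hx)] at ha
      simp [crossingLines] at ha
    have hB : ∀ (n : ℕ), ∀ x ∈ arcsFrom n B, ∀ a ∈ crossingLines [x], n ≤ a.1 :=
      fun n x hx a ha => by
        have h : a ∈ crossingLines (arcsFrom n B) := by
          rw [← List.singleton_sublist] at hx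
          exact (hx.filterMap _).subset ha
        rw [mem_crossingLines_arcsFrom] at h
        obtain ⟨i, h, -⟩ := h
        omega
    intro t ht
    rcases List.mem_append.1 ht with ht | ht
  · refine ChainCorr.forall_outer (p := fun t => ∀ a ∈ crossingLines t.1, expo t.1 a = loc a)
      (fun x hx a ha => ?_) (fun x hx a ha => ?_) (fun x hx a ha => ?_) t ht
    · rw [single x a ha, h2 a (Or.inl (hN x hx a ha))]
    · rw [single x a ha, h2 a (Or.inl (hvs x hx a ha))]
    · rw [single _ a ha, h2 a (Or.inr (hB _ (x.shift j 0) (by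
        rw [H.length_eq, ← add_assoc, arcsFrom_shift]; exact List.mem_map_of_mem hx) a ha))]
  · exact h4 t ht
  · refine ChainCorr.forall_outer (p := fun t => ∀ a ∈ crossingLines t.2, expo t.2 a = loc' a)
      (fun x hx a ha => ?_) (fun x hx a ha => ?_) (fun x hx a ha => ?_) t ht
    · rw [single x a ha, h3 a (Or.inl (hN x hx a ha))]
    · rw [single x a ha, h3 a (Or.inl (hvs x hx a ha))]
    · rw [single _ a ha, h3 a (Or.inr (hB _ x hx a ha))]
  · exact h5 t ht

end StrictOrientedQuantumCoalgebra

/-- A diagram which can be traversed in one closed path. -/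
def Diag.HasClosed (D : List Slice) : Prop := ∃ P, Nonempty (Traversal D P P)

namespace TwistOrientedQuantumCoalgebra

variable (Q : TwistOrientedQuantumCoalgebra k C)

/-- Two link diagrams have equal Whitney degrees, and, provided that they have one component, equal
values at `c`. -/
structure SameValue (c : C) (L L' : LinkDiagram) : Prop where
  hasClosed_iff : HasClosed L.slices ↔ HasClosed L'.slices
  whitneyDegree_eq : HasClosed L.slices → L.whitneyDegree = L'.whitneyDegree
  value_eq : ∀ {P P' : Point} (τ : Traversal L.slices P P) (τ' : Traversal L'.slices P' P'),
    Q.pathValue L.whitneyDegree L.slices τ.path c =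
      Q.pathValue L'.whitneyDegree L'.slices τ'.path c

variable {Q} {c : C}

theorem SameValue.refl (hc : IsCocommutativeElement k c) (L : LinkDiagram) : Q.SameValue c L L :=
  ⟨Iff.rfl, fun _ => rfl, fun τ τ' => Q.pathValue_closed_unique τ τ' hc⟩

theorem SameValue.symm {L L' : LinkDiagram} (h : Q.SameValue c L L') : Q.SameValue c L' L :=
  ⟨h.hasClosed_iff.symm, fun h' => (h.whitneyDegree_eq (h.hasClosed_iff.2 h')).symm,
    fun τ τ' => (h.value_eq τ' τ).symm⟩

theorem SameValue.trans {L L' L'' : LinkDiagram} (h : Q.SameValue c L L')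
    (h' : Q.SameValue c L' L'') : Q.SameValue c L L'' := by
  refine ⟨h.hasClosed_iff.trans h'.hasClosed_iff, fun hL => (h.whitneyDegree_eq hL).trans
    (h'.whitneyDegree_eq (h.hasClosed_iff.1 hL)), fun {P P'} τ τ' => ?_⟩
  -- The intermediate diagram need not be given as a knot diagram; a closed traversal of it has to
  -- be supplied.
  obtain ⟨R, ⟨τ₁⟩⟩ := h.hasClosed_iff.1 ⟨P, ⟨τ⟩⟩
  exact (h.value_eq τ τ₁).trans (h'.value_eq τ₁ τ')

/-- Independence of the starting point reduces arbitrary traversals to the matching pair produced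
from chains. Only the existence of a closed path in the direction from Y back to X must be given
separately. -/
theorem SameValue.of_replaceable (hc : IsCocommutativeElement k c) {L L' : LinkDiagram} {j : ℕ}
    {A B X Y : List Slice}
    (h : Q.toStrictOrientedQuantumCoalgebra.Replaceable A.length j X Y)
    (hL : L.slices = A ++ X ++ B) (hL' : L'.slices = A ++ Y ++ B)
    (hrev : HasClosed (A ++ Y ++ B) → HasClosed (A ++ X ++ B)) : Q.SameValue c L L' := by
  rcases L with ⟨D, hD⟩
  rcases L' with ⟨D', hD'⟩
  simp only at hL hL'
  subst hL hL'
  have key := fun {P : Point} (τ : Traversal (A ++ X ++ B) P P) => h.exists_closed rfl hD τ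
  have hw : HasClosed (A ++ X ++ B) → LinkDiagram.whitneyDegree ⟨A ++ X ++ B, hD⟩ =
      LinkDiagram.whitneyDegree ⟨A ++ Y ++ B, hD'⟩ := by
    rintro ⟨P, ⟨τ⟩⟩
    exact congrArg (· / 2) (key τ).1
  refine ⟨⟨?_, hrev⟩, hw, fun {P P'} τ τ' => ?_⟩
  · rintro ⟨P, ⟨τ⟩⟩
    obtain ⟨-, R, R', -, τ₂, -⟩ := key τ
    exact ⟨R', ⟨τ₂⟩⟩
  · obtain ⟨-, R, R', τ₁, τ₂, e⟩ := key τ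
    rw [Q.pathValue_closed_unique (L := ⟨A ++ X ++ B, hD⟩) τ τ₁ hc,
      Q.pathValue_closed_unique (L := ⟨A ++ Y ++ B, hD'⟩) τ' τ₂ hc, ← hw ⟨P, ⟨τ⟩⟩]
    exact dsum_congr (fun x y => congrArg _ (e y)) c

end TwistOrientedQuantumCoalgebra

end EqualValues

/-! ## Strands, and the moves which preserve the number of slices -/

section Moves

open Coalgebra Diag

universe u v

set_option linter.unusedSectionVars false

variable {k : Type u} {C : Type v} [Field k] [AddCommGroup C] [Module k C] [Coalgebra k C]

namespace Diag

/-- The arcs which lead through given points, starting at `P`, if `a = true`, and the arcs which lead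
through these points in the opposite direction otherwise. -/
def strand (a : Bool) : Point → List (Point × ArcKind) → List Arc
  | _, [] => []
  | P, (Q, t) :: l =>
    if a then orient a P Q t :: strand a Q l else strand a Q l ++ [orient a P Q t]

theorem strand_perm_cons (a : Bool) (P Q : Point) (t : ArcKind) (l : List (Point × ArcKind)) :
    (strand a P ((Q, t) :: l)).Perm (orient a P Q t :: strand a Q l) := by
  cases a
  · exact List.perm_append_comm
  · exact List.Perm.refl _

theorem strand_two (a : Bool) (P Q R : Point) (t u : ArcKind) :
    (strand a P [(Q, t), (R, u)]).Perm [orient a P Q t, orient a Q R u] := by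
  cases a
  · exact List.perm_append_comm (l₁ := [orient false Q R u])
  · exact List.Perm.refl _

theorem strand_three (a : Bool) (P Q R S : Point) (t u v : ArcKind) :
    (strand a P [(Q, t), (R, u), (S, v)]).Perm
      [orient a P Q t, orient a Q R u, orient a R S v] :=
  (strand_perm_cons _ _ _ _ _).trans ((strand_two _ _ _ _ _ _).cons _)

theorem strand_four (a : Bool) (P Q R S T : Point) (t u v w : ArcKind) :
    (strand a P [(Q, t), (R, u), (S, v), (T, w)]).Perm
      [orient a P Q t, orient a Q R u, orient a R S v, orient a S T w] :=
  (strand_perm_cons _ _ _ _ _).trans ((strand_three _ _ _ _ _ _ _ _).cons _)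

theorem orient_not (a : Bool) (P Q : Point) (t : ArcKind) :
    orient (!a) P Q t = orient a Q P t := by
  cases a <;> rfl

theorem verticals_append (n p q : ℕ) (l m : List Bool) : verticals n p q (l ++ m) =
    verticals n p q l ++ verticals n (p + l.length) (q + l.length) m := by
  induction l generalizing p q with
  | nil => rfl
  | cons a l ih =>
    have e1 : p + 1 + l.length = p + (l.length + 1) := by omega
    have e2 : q + 1 + l.length = q + (l.length + 1) := by omega
    simp only [List.cons_append, verticals, ih, List.length_cons, e1, e2]

theorem line_eq_of_mem_verticals {n p q : ℕ} {l : List Bool} {x : Arc}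
    (h : x ∈ verticals n p q l) : x.kind.line = none := by
  induction l generalizing p q with
  | nil => simp [verticals] at h
  | cons a l ih =>
    rw [verticals, List.mem_cons] at h
    rcases h with rfl | h
    · rw [orient_kind]; rfl
    · exact ih h

end Diag

/-- A strand which meets a below b reads them in this order if it goes up and in the opposite order
if it goes down; the latter is a sum in the opposite coalgebra, with the same role for u and v. -/
theorem ev_pair {α : Type*} [DecidableEq α] {M : (α → C) → k} {a b : α} (hab : a ≠ b)
    (ha : LinearAt M a) (hb : LinearAt M b) (o : Bool) (y : α → C) (c : C) :
    ev (if o then [a, b] else [b, a]) M y c =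
      dsumO o (fun u v => M (Function.update (Function.update y a u) b v)) c := by
  cases o
  · simp only [Bool.false_eq_true, if_false, dsumO]
    refine dsum_congr (fun u v => ?_) c
    rw [ev_singleton ha, Function.update_comm hab]
  · simp only [if_true, dsumO]
    exact dsum_congr (fun u v => ev_singleton hb _ _) c

theorem bigev_cons_pair {α σ : Type*} [DecidableEq α] {W : σ → List α} {t : σ} {l : List σ}
    {M : (α → C) → k} {a b : α} {o : Bool} (hW : W t = if o then [a, b] else [b, a]) (hab : a ≠ b)
    (ha : LinearAt M a) (hb : LinearAt M b) (ha' : a ∉ l.flatMap W) (hb' : b ∉ l.flatMap W)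
    (y : α → C) (s : σ → C) :
    bigev W (t :: l) M y s =
      dsumO o (fun u v => bigev W l M (Function.update (Function.update y a u) b v) s) (s t) := by
  rw [bigev, hW]
  exact ev_pair hab (ha.bigev W ha' s) (hb.bigev W hb' s) o y (s t)

theorem Diag.expo_strand_eq_zero (a : Bool) (P : Point) {l : List (Point × ArcKind)}
    (h : ∀ q ∈ l, q.2.countD = 0 ∧ q.2.countU = 0) (x : ℕ × Bool) : expo (strand a P l) x = 0 := by
  have h1 : ∀ m : List Arc, (∀ x ∈ m, x.kind.countD = 0 ∧ x.kind.countU = 0) →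
      cnt m = 0 ∧ expo m x = 0 := by
    intro m hm
    induction m with
    | nil => exact ⟨rfl, rfl⟩
    | cons z m ih =>
      rw [List.forall_mem_cons] at hm
      have e : cnt [z] = 0 := by simp [cnt, hm.1]
      rw [cnt_cons, e, (ih hm.2).1, expo, (ih hm.2).1, (ih hm.2).2]
      simp
  refine (h1 _ ?_).2
  induction l generalizing P with
  | nil => simp [strand]
  | cons q l ih =>
    rw [List.forall_mem_cons] at h
    intro z hz
    rw [(strand_perm_cons a P q.1 q.2 l).mem_iff, List.mem_cons] at hz
    rcases hz with rfl | hz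
    · rw [orient_kind]
      exact h.1
    · exact ih q.1 h.2 z hz

namespace StrictOrientedQuantumCoalgebra

variable (Q : StrictOrientedQuantumCoalgebra k C)

theorem fac_cross (n : ℕ) (a b s : Bool) (y : ℕ × Bool → C) :
    Q.fac n (.cross a b s) y = Q.crossForm a b s (y (n, s)) (y (n, !s)) := by
  cases s <;> rfl

theorem fac_max (n : ℕ) (a : Bool) (y : ℕ × Bool → C) : Q.fac n (.max a) y = 1 := rfl

theorem fac_min (n : ℕ) (a : Bool) (y : ℕ × Bool → C) : Q.fac n (.min a) y = 1 := rfl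

/-- Three strands without extrema, each with two crossings on either side of the move. With one
element for each strand, the two evaluations are the two sides of `braidRel_crossForm`. -/
theorem replaceable_braid (N : ℕ) (l r : List Bool) (a b c s : Bool) :
    Q.Replaceable N 0
      [⟨l, .cross a b s, c :: r⟩, ⟨l ++ [b], .cross a c s, r⟩, ⟨l, .cross b c s, a :: r⟩]
      [⟨l ++ [a], .cross b c s, r⟩, ⟨l, .cross a c s, b :: r⟩, ⟨l ++ [c], .cross a b s, r⟩] := by
  obtain ⟨p, hp⟩ : ∃ p, l.length = p := ⟨_, rfl⟩
  let tA : ChainPair :=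
    (strand a (N, p) [((N + 1, p + 1), .cross N s), ((N + 2, p + 2), .cross (N + 1) s),
      ((N + 3, p + 2), .vertical)],
    strand a (N, p) [((N + 1, p), .vertical), ((N + 2, p + 1), .cross (N + 1) s),
      ((N + 3, p + 2), .cross (N + 2) s)])
  let tB : ChainPair :=
    (strand b (N, p + 1) [((N + 1, p), .cross N !s), ((N + 2, p), .vertical),
      ((N + 3, p + 1), .cross (N + 2) s)],
    strand b (N, p + 1) [((N + 1, p + 2), .cross N s), ((N + 2, p + 2), .vertical),
      ((N + 3, p + 1), .cross (N + 2) !s)])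
  let tC : ChainPair :=
    (strand c (N, p + 2) [((N + 1, p + 2), .vertical), ((N + 2, p + 1), .cross (N + 1) !s),
      ((N + 3, p), .cross (N + 2) !s)],
    strand c (N, p + 2) [((N + 1, p + 1), .cross N !s), ((N + 2, p), .cross (N + 1) !s),
      ((N + 3, p), .vertical)])
  have hmid : ∀ {q : ChainPair → Prop}, q tA → q tB → q tC → ∀ t ∈ [tA, tB, tC], q t := by
    intro q hA hB hC
    simp [hA, hB, hC]
  -- The common verticals are those to the left and to the right of the three strands. No extremum
  -- occurs inside, so all local exponents vanish.
  refine ⟨verticals N 0 0 l ++ verticals N (p + 3) (p + 3) r ++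
    (verticals (N + 1) 0 0 l ++ verticals (N + 1) (p + 3) (p + 3) r) ++
    (verticals (N + 2) 0 0 l ++ verticals (N + 2) (p + 3) (p + 3) r), [tA, tB, tC], 0, 0,
    ⟨rfl, ?_, ?_, ?_, Or.inr rfl, ?_, ?_, ?_⟩, fun _ => ?_, fun _ _ => rfl, fun _ _ => rfl,
    ?_, ?_, fun y => ?_⟩
  · have hA := strand_three a (N, p) (N + 1, p + 1) (N + 2, p + 2) (N + 3, p + 2) (.cross N s)
      (.cross (N + 1) s) .vertical
    have hB := strand_three b (N, p + 1) (N + 1, p) (N + 2, p) (N + 3, p + 1) (.cross N !s)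
      .vertical (.cross (N + 2) s)
    have hC := strand_three c (N, p + 2) (N + 1, p + 2) (N + 2, p + 1) (N + 3, p) .vertical
      (.cross (N + 1) !s) (.cross (N + 2) !s)
    simp only [arcsFrom, Slice.arcs, Piece.arcs, verticals_append, verticals, List.length_append,
      List.length_cons, List.length_nil, Piece.lower, Piece.upper, List.flatMap_cons,
      List.flatMap_nil, add_assoc, zero_add, hp, Nat.reduceAdd, tA, tB, tC]
    rw [← Multiset.coe_eq_coe] at hA hB hC ⊢
    simp only [← Multiset.coe_add, ← Multiset.cons_coe, ← Multiset.singleton_add,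
      Multiset.coe_nil, List.append_assoc, add_zero, hA, hB, hC]
    abel
  · have hA := strand_three a (N, p) (N + 1, p) (N + 2, p + 1) (N + 3, p + 2) .vertical
      (.cross (N + 1) s) (.cross (N + 2) s)
    have hB := strand_three b (N, p + 1) (N + 1, p + 2) (N + 2, p + 2) (N + 3, p + 1) (.cross N s)
      .vertical (.cross (N + 2) !s)
    have hC := strand_three c (N, p + 2) (N + 1, p + 1) (N + 2, p) (N + 3, p) (.cross N !s)
      (.cross (N + 1) !s) .vertical
    simp only [arcsFrom, Slice.arcs, Piece.arcs, verticals_append, verticals, List.length_append,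
      List.length_cons, List.length_nil, Piece.lower, Piece.upper, List.flatMap_cons,
      List.flatMap_nil, add_assoc, zero_add, hp, Nat.reduceAdd, tA, tB, tC]
    rw [← Multiset.coe_eq_coe] at hA hB hC ⊢
    simp only [← Multiset.coe_add, ← Multiset.cons_coe, ← Multiset.singleton_add,
      Multiset.coe_nil, List.append_assoc, add_zero, hA, hB, hC]
    abel
  · intro x hx
    simp only [List.mem_append] at hx
    rcases hx with ((hx | hx) | (hx | hx)) | (hx | hx) <;> exact line_eq_of_mem_verticals hx
  · refine hmid ?_ ?_ ?_ <;> simp [tA, tB, tC, strand] <;> split_ifs <;> simp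
  · refine hmid ?_ ?_ ?_
    · cases a <;> rfl
    · cases b <;> rfl
    · cases c <;> rfl
  · simp only [lowerPt_zero]
    refine hmid ?_ ?_ ?_
    · cases a
      exacts [⟨(N + 3, p + 2), (N, p), by simp [tA, IsPath, strand, orient]⟩,
        ⟨(N, p), (N + 3, p + 2), by simp [tA, IsPath, strand, orient]⟩]
    · cases b
      exacts [⟨(N + 3, p + 1), (N, p + 1), by simp [tB, IsPath, strand, orient]⟩,
        ⟨(N, p + 1), (N + 3, p + 1), by simp [tB, IsPath, strand, orient]⟩]
    · cases c
      exacts [⟨(N + 3, p), (N, p + 2), by simp [tC, IsPath, strand, orient]⟩,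
        ⟨(N, p + 2), (N + 3, p), by simp [tC, IsPath, strand, orient]⟩]
  · refine hmid ?_ ?_ ?_ <;> simp [tA, tB, tC, strand] <;> split_ifs <;> simp
  · refine hmid ?_ ?_ ?_ <;>
      exact fun _ _ => expo_strand_eq_zero _ _ (by simp [ArcKind.countD, ArcKind.countU]) _
  · refine hmid ?_ ?_ ?_ <;>
      exact fun _ _ => expo_strand_eq_zero _ _ (by simp [ArcKind.countD, ArcKind.countU]) _
  -- The name of a letter records the slice of its crossing, and s or its negation according to
  -- whether the strand runs there from lower left or from lower right.
  · have hA : tA.word₁ = if a then [(N, s), (N + 1, s)] else [(N + 1, s), (N, s)] := by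
      cases a <;> rfl
    have hB : tB.word₁ = if b then [(N, !s), (N + 2, s)] else [(N + 2, s), (N, !s)] := by
      cases b <;> rfl
    have hC : tC.word₁ = if c then [(N + 1, !s), (N + 2, !s)] else [(N + 2, !s), (N + 1, !s)] := by
      cases c <;> rfl
    have hA' : tA.word₂ = if a then [(N + 1, s), (N + 2, s)] else [(N + 2, s), (N + 1, s)] := by
      cases a <;> rfl
    have hB' : tB.word₂ = if b then [(N, s), (N + 2, !s)] else [(N + 2, !s), (N, s)] := by
      cases b <;> rfl
    have hC' : tC.word₂ = if c then [(N, !s), (N + 1, !s)] else [(N + 1, !s), (N, !s)] := by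
      cases c <;> rfl
    have lin : ∀ (D : List Slice) (i : Fin D.length) (o : Bool), D[i].piece.isCross = true →
        LinearAt (fun y => Q.prodFrom N D fun a => Q.pw ((0 : ℕ × Bool → ℤ × ℤ) a) (y a))
          (N + i, o) := fun D i o h =>
      Q.linearAt_pw (Q.prodFrom_linearAt ((mem_crossingLines_arcsFrom _ _ _ _).2 ⟨i, rfl, h⟩)) 0
    rw [bigev_cons_pair hA (by simp) (lin _ 0 _ rfl) (lin _ 1 _ rfl)
        (by simp [hB, hC]; split_ifs <;> simp) (by simp [hB, hC]; split_ifs <;> simp),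
      bigev_cons_pair hA' (by simp) (lin _ 1 _ rfl) (lin _ 2 _ rfl)
        (by simp [hB', hC']; split_ifs <;> simp) (by simp [hB', hC']; split_ifs <;> simp)]
    let X : List Slice :=
      [⟨l, .cross a b s, c :: r⟩, ⟨l ++ [b], .cross a c s, r⟩, ⟨l, .cross b c s, a :: r⟩]
    let Y : List Slice :=
      [⟨l ++ [a], .cross b c s, r⟩, ⟨l, .cross a c s, b :: r⟩, ⟨l ++ [c], .cross a b s, r⟩]
    let M : List Slice → (ℕ × Bool → C) → k := fun D y =>
      Q.prodFrom N D fun a => Q.pw ((0 : ℕ × Bool → ℤ × ℤ) a) (y a)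
    have h1 : ∀ z, bigev ChainPair.word₁ [tB, tC] (M X) z y = _ := fun z =>
      bigev_cons_pair hB (by simp) (lin X 0 _ rfl) (lin X 2 _ rfl)
        (by simp [hC]; split_ifs <;> simp) (by simp [hC]; split_ifs <;> simp) z y
    have h2 : ∀ z, bigev ChainPair.word₂ [tB, tC] (M Y) z y = _ := fun z =>
      bigev_cons_pair hB' (by simp) (lin Y 0 _ rfl) (lin Y 2 _ rfl)
        (by simp [hC']; split_ifs <;> simp) (by simp [hC']; split_ifs <;> simp) z y
    have h3 : ∀ z, bigev ChainPair.word₁ [tC] (M X) z y = _ := fun z =>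
      bigev_cons_pair hC (by simp) (lin X 1 _ rfl) (lin X 2 _ rfl) (by simp) (by simp) z y
    have h4 : ∀ z, bigev ChainPair.word₂ [tC] (M Y) z y = _ := fun z =>
      bigev_cons_pair hC' (by simp) (lin Y 0 _ rfl) (lin Y 1 _ rfl) (by simp) (by simp) z y
    refine (dsumO_congr _ (fun u v => (h1 _).trans (dsumO_congr _ (fun u v => h3 _) _)) _).trans
      (Eq.trans ?_ (dsumO_congr _ (fun u v => (h2 _).trans
        (dsumO_congr _ (fun u v => h4 _) _)) _).symm)
    refine Eq.trans ?_ ((Q.braidRel_crossForm a b c s (y tA) (y tB) (y tC)).trans ?_)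
    · refine dsumO_congr _ (fun u v => dsumO_congr _ (fun u v => dsumO_congr _ (fun u v => ?_) _) _) _
      simp [X, bigev, prodFrom, fac_cross, Q.pw_zero, Function.update_apply, mul_assoc]
    · refine dsumO_congr _ (fun u v => dsumO_congr _ (fun u v => dsumO_congr _ (fun u v => ?_) _) _) _
      simp [Y, bigev, prodFrom, fac_cross, Q.pw_zero, Function.update_apply, add_assoc]
      ring

/-- Sliding a strand across a crossing line which bends, on the level of forms. -/
theorem crossForm_slide (a b s : Bool) (x y : C) :
    Q.crossForm a b s (Q.pw (if a then (0, -1) else 0) x) y =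
      Q.crossForm b (!a) (!s) y (Q.pw (if a then 0 else (1, 0)) x) := by
  have h1 : ∀ z, Q.pw 0 z = z := fun _ => rfl
  cases a <;> cases b <;> cases s <;>
    simp [crossForm_true, crossForm_false, bp_pw_left, bp_pw_right, bn_pw_left, bn_pw_right, h1]
      <;> rfl

/-- There is only one crossing on each side, so each strand contributes a one-letter word, and
`crossForm_slide` is all that is needed. The crossing moves to the other leg of the maximum. -/
theorem replaceable_slide_max (N : ℕ) (l r : List Bool) (a b s : Bool) :
    Q.Replaceable N 0
      [⟨l, .cross a b s, (!a) :: r⟩, ⟨l ++ [b], .max a, r⟩]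
      [⟨l ++ [a], .cross b (!a) (!s), r⟩, ⟨l, .max a, b :: r⟩] := by
  obtain ⟨p, hp⟩ : ∃ p, l.length = p := ⟨_, rfl⟩
  let tA : ChainPair :=
    (strand a (N, p) [((N + 1, p + 1), .cross N s), ((N + 1, p + 2), .max a),
      ((N, p + 2), .vertical)],
    strand a (N, p) [((N + 1, p), .vertical), ((N + 1, p + 1), .max a),
      ((N, p + 2), .cross N s)])
  let tB : ChainPair :=
    (strand b (N, p + 1) [((N + 1, p), .cross N !s), ((N + 2, p), .vertical)],
    strand b (N, p + 1) [((N + 1, p + 2), .cross N !s), ((N + 2, p), .vertical)])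
  have hmid : ∀ {q : ChainPair → Prop}, q tA → q tB → ∀ t ∈ [tA, tB], q t := by
    intro q hA hB
    simp [hA, hB]
  -- The exponents of the bent strand at the crossing count the maximum only if it comes afterwards:
  -- before the move this happens for the direction from left to right, contributing (0, -1), and
  -- after the move for the other direction, contributing (1, 0).
  let loc : ℕ × Bool → ℤ × ℤ := fun x => if x = (N, s) then (if a then (0, -1) else 0) else 0
  let loc' : ℕ × Bool → ℤ × ℤ := fun x => if x = (N, s) then (if a then 0 else (1, 0)) else 0
  refine ⟨verticals N 0 0 l ++ verticals N (p + 3) (p + 3) r ++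
    (verticals (N + 1) 0 0 l ++ verticals (N + 1) (p + 3) (p + 1) r), [tA, tB], loc, loc',
    ⟨rfl, ?_, ?_, ?_, Or.inr rfl, ?_, ?_, ?_⟩, fun _ => ?_, fun x hx => ?_, fun x hx => ?_,
    ?_, ?_, fun y => ?_⟩
  · have hA := strand_three a (N, p) (N + 1, p + 1) (N + 1, p + 2) (N, p + 2) (.cross N s)
      (.max a) .vertical
    have hB := strand_two b (N, p + 1) (N + 1, p) (N + 2, p) (.cross N !s) .vertical
    simp only [arcsFrom, Slice.arcs, Piece.arcs, verticals_append, verticals, List.length_append,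
      List.length_cons, List.length_nil, Piece.lower, Piece.upper, List.flatMap_cons,
      List.flatMap_nil, add_assoc, zero_add, add_zero, hp, Nat.reduceAdd, tA, tB, orient_not]
    rw [← Multiset.coe_eq_coe] at hA hB ⊢
    simp only [← Multiset.coe_add, ← Multiset.cons_coe, ← Multiset.singleton_add,
      Multiset.coe_nil, List.append_assoc, add_zero, hA, hB]
    abel
  · have hA := strand_three a (N, p) (N + 1, p) (N + 1, p + 1) (N, p + 2) .vertical (.max a)
      (.cross N s)
    have hB := strand_two b (N, p + 1) (N + 1, p + 2) (N + 2, p) (.cross N !s) .vertical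
    simp only [arcsFrom, Slice.arcs, Piece.arcs, verticals_append, verticals, List.length_append,
      List.length_cons, List.length_nil, Piece.lower, Piece.upper, List.flatMap_cons,
      List.flatMap_nil, add_assoc, zero_add, add_zero, hp, Nat.reduceAdd, tA, tB, orient_not,
      Bool.not_not]
    rw [← Multiset.coe_eq_coe] at hA hB ⊢
    simp only [← Multiset.coe_add, ← Multiset.cons_coe, ← Multiset.singleton_add,
      Multiset.coe_nil, List.append_assoc, add_zero, hA, hB]
    abel
  · intro x hx
    simp only [List.mem_append] at hx
    rcases hx with (hx | hx) | (hx | hx) <;> exact line_eq_of_mem_verticals hx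
  · refine hmid ?_ ?_ <;> simp [tA, tB, strand] <;> split_ifs <;> simp
  · refine hmid ?_ ?_
    · cases a <;> rfl
    · cases b <;> rfl
  · simp only [lowerPt_zero]
    refine hmid ?_ ?_
    · cases a
      exacts [⟨(N, p + 2), (N, p), by simp [tA, IsPath, strand, orient]⟩,
        ⟨(N, p), (N, p + 2), by simp [tA, IsPath, strand, orient]⟩]
    · cases b
      exacts [⟨(N + 2, p), (N, p + 1), by simp [tB, IsPath, strand, orient]⟩,
        ⟨(N, p + 1), (N + 2, p), by simp [tB, IsPath, strand, orient]⟩]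
  · refine hmid ?_ ?_ <;> simp [tA, tB, strand] <;> split_ifs <;> simp
  · exact if_neg fun e => by simp [e] at hx
  · exact if_neg fun e => by simp [e] at hx
  · refine hmid ?_ ?_
    · cases a <;> simp [tA, loc, strand, orient, crossingLines, ArcKind.line, expo, cnt,
        ArcKind.countD, ArcKind.countU]
    · cases b <;> simp [tB, loc, strand, orient, crossingLines, ArcKind.line, expo, cnt,
        ArcKind.countD, ArcKind.countU]
  · refine hmid ?_ ?_
    · cases a <;> simp [tA, loc', strand, orient, crossingLines, ArcKind.line, expo, cnt,
        ArcKind.countD, ArcKind.countU]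
    · cases b <;> simp [tB, loc', strand, orient, crossingLines, ArcKind.line, expo, cnt,
        ArcKind.countD, ArcKind.countU]
  · have hA : tA.word₁ = [(N, s)] := by cases a <;> rfl
    have hB : tB.word₁ = [(N, !s)] := by cases b <;> rfl
    have hA' : tA.word₂ = [(N, s)] := by cases a <;> rfl
    have hB' : tB.word₂ = [(N, !s)] := by cases b <;> rfl
    simp only [bigev, hA, hB, hA', hB']
    refine ev_congr (fun z => ev_congr (fun z => ?_) _ _ _) _ _ _
    have e := Q.crossForm_slide a b s (z (N, s)) (z (N, !s))
    simpa [prodFrom, fac_cross, fac_max, fac_min, loc, loc', Q.pw_zero] using e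

theorem replaceable_slide_min (N : ℕ) (l r : List Bool) (a b s : Bool) :
    Q.Replaceable N 0
      [⟨l ++ [b], .min a, r⟩, ⟨l, .cross b a (!s), (!a) :: r⟩]
      [⟨l, .min a, b :: r⟩, ⟨l ++ [a], .cross (!a) b s, r⟩] := by
  obtain ⟨p, hp⟩ : ∃ p, l.length = p := ⟨_, rfl⟩
  let tA : ChainPair :=
    (strand (!a) (N + 2, p) [((N + 1, p + 1), .cross (N + 1) s), ((N + 1, p + 2), .min !a),
      ((N + 2, p + 2), .vertical)],
    strand (!a) (N + 2, p) [((N + 1, p), .vertical), ((N + 1, p + 1), .min !a),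
      ((N + 2, p + 2), .cross (N + 1) s)])
  let tB : ChainPair :=
    (strand b (N, p) [((N + 1, p), .vertical), ((N + 2, p + 1), .cross (N + 1) !s)],
    strand b (N, p) [((N + 1, p + 2), .vertical), ((N + 2, p + 1), .cross (N + 1) !s)])
  have hmid : ∀ {q : ChainPair → Prop}, q tA → q tB → ∀ t ∈ [tA, tB], q t := by
    intro q hA hB
    simp [hA, hB]
  -- The minimum follows the crossing before the move if it is traversed from left to right,
  -- contributing (0, 1), and after the move if it is traversed from right to left, contributing
  -- (-1, 0).
  let loc : ℕ × Bool → ℤ × ℤ := fun x => if x = (N + 1, s) then (if a then 0 else (0, 1)) else 0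
  let loc' : ℕ × Bool → ℤ × ℤ := fun x => if x = (N + 1, s) then (if a then (-1, 0) else 0) else 0
  refine ⟨verticals N 0 0 l ++ verticals N (p + 1) (p + 3) r ++
    (verticals (N + 1) 0 0 l ++ verticals (N + 1) (p + 3) (p + 3) r), [tA, tB], loc, loc',
    ⟨rfl, ?_, ?_, ?_, Or.inr rfl, ?_, ?_, ?_⟩, fun _ => ?_, fun x hx => ?_, fun x hx => ?_,
    ?_, ?_, fun y => ?_⟩
  · have hA := strand_three (!a) (N + 2, p) (N + 1, p + 1) (N + 1, p + 2) (N + 2, p + 2)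
      (.cross (N + 1) s) (.min !a) .vertical
    have hB := strand_two b (N, p) (N + 1, p) (N + 2, p + 1) .vertical (.cross (N + 1) !s)
    simp only [arcsFrom, Slice.arcs, Piece.arcs, verticals_append, verticals, List.length_append,
      List.length_cons, List.length_nil, Piece.lower, Piece.upper, List.flatMap_cons,
      List.flatMap_nil, add_assoc, zero_add, add_zero, hp, Nat.reduceAdd, tA, tB, Bool.not_not]
    rw [← Multiset.coe_eq_coe] at hA hB ⊢
    simp only [← Multiset.coe_add, ← Multiset.cons_coe, ← Multiset.singleton_add,
      Multiset.coe_nil, List.append_assoc, add_zero, hA, hB, orient_not]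
    abel
  · have hA := strand_three (!a) (N + 2, p) (N + 1, p) (N + 1, p + 1) (N + 2, p + 2) .vertical
      (.min !a) (.cross (N + 1) s)
    have hB := strand_two b (N, p) (N + 1, p + 2) (N + 2, p + 1) .vertical (.cross (N + 1) !s)
    simp only [arcsFrom, Slice.arcs, Piece.arcs, verticals_append, verticals, List.length_append,
      List.length_cons, List.length_nil, Piece.lower, Piece.upper, List.flatMap_cons,
      List.flatMap_nil, add_assoc, zero_add, add_zero, hp, Nat.reduceAdd, tA, tB]
    rw [← Multiset.coe_eq_coe] at hA hB ⊢
    simp only [← Multiset.coe_add, ← Multiset.cons_coe, ← Multiset.singleton_add,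
      Multiset.coe_nil, List.append_assoc, add_zero, hA, hB, orient_not]
    abel
  · intro x hx
    simp only [List.mem_append] at hx
    rcases hx with (hx | hx) | (hx | hx) <;> exact line_eq_of_mem_verticals hx
  · refine hmid ?_ ?_ <;> simp [tA, tB, strand] <;> split_ifs <;> simp
  · refine hmid ?_ ?_
    · cases a <;> rfl
    · cases b <;> rfl
  · simp only [lowerPt_zero]
    refine hmid ?_ ?_
    · cases a
      exacts [⟨(N + 2, p), (N + 2, p + 2), by simp [tA, IsPath, strand, orient]⟩,
        ⟨(N + 2, p + 2), (N + 2, p), by simp [tA, IsPath, strand, orient]⟩]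
    · cases b
      exacts [⟨(N + 2, p + 1), (N, p), by simp [tB, IsPath, strand, orient]⟩,
        ⟨(N, p), (N + 2, p + 1), by simp [tB, IsPath, strand, orient]⟩]
  · refine hmid ?_ ?_ <;> simp [tA, tB, strand] <;> split_ifs <;> simp
  · exact if_neg fun e => by simp [e] at hx
  · exact if_neg fun e => by simp [e] at hx
  · refine hmid ?_ ?_
    · cases a <;> simp [tA, loc, strand, orient, crossingLines, ArcKind.line, expo, cnt,
        ArcKind.countD, ArcKind.countU]
    · cases b <;> simp [tB, loc, strand, orient, crossingLines, ArcKind.line, expo, cnt,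
        ArcKind.countD, ArcKind.countU]
  · refine hmid ?_ ?_
    · cases a <;> simp [tA, loc', strand, orient, crossingLines, ArcKind.line, expo, cnt,
        ArcKind.countD, ArcKind.countU]
    · cases b <;> simp [tB, loc', strand, orient, crossingLines, ArcKind.line, expo, cnt,
        ArcKind.countD, ArcKind.countU]
  · have hA : tA.word₁ = [(N + 1, s)] := by cases a <;> rfl
    have hB : tB.word₁ = [(N + 1, !s)] := by cases b <;> rfl
    have hA' : tA.word₂ = [(N + 1, s)] := by cases a <;> rfl
    have hB' : tB.word₂ = [(N + 1, !s)] := by cases b <;> rfl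
    simp only [bigev, hA, hB, hA', hB']
    refine ev_congr (fun z => ev_congr (fun z => ?_) _ _ _) _ _ _
    have e : Q.crossForm b a (!s) (z (N + 1, !s)) (Q.pw (if a then 0 else (0, 1)) (z (N + 1, s))) =
        Q.crossForm (!a) b s (Q.pw (if a then (-1, 0) else 0) (z (N + 1, s))) (z (N + 1, !s)) := by
      have h1 : ∀ z, Q.pw 0 z = z := fun _ => rfl
      cases a <;> cases b <;> cases s <;>
        simp [crossForm_true, crossForm_false, bp_pw_left, bp_pw_right, bn_pw_left, bn_pw_right, h1]
          <;> rfl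
    simpa [prodFrom, fac_cross, fac_max, fac_min, loc, loc', Q.pw_zero] using e

end StrictOrientedQuantumCoalgebra

end Moves

/-! ## Interchanging the heights of distant pieces -/

section Interchange

open Coalgebra Diag

universe u v

set_option linter.unusedSectionVars false

variable {k : Type u} {C : Type v} [Field k] [AddCommGroup C] [Module k C] [Coalgebra k C]

namespace Diag

/-- Interchanging the lines number `N` and `N + 1`. -/
def swapLine (N : ℕ) (a : ℕ × Bool) : ℕ × Bool := (Equiv.swap N (N + 1) a.1, a.2)

theorem swapLine_swapLine (N : ℕ) (a : ℕ × Bool) : swapLine N (swapLine N a) = a := by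
  simp [swapLine]

theorem swapLine_left (N : ℕ) (o : Bool) : swapLine N (N, o) = (N + 1, o) := by
  simp [swapLine]

theorem swapLine_right (N : ℕ) (o : Bool) : swapLine N (N + 1, o) = (N, o) := by
  simp [swapLine]

/-- A pair of chains which correspond to each other if the pieces of two successive slices are
interchanged. -/
structure InterchangePair (N : ℕ) (t : ChainPair) : Prop where
  ne_nil₁ : t.1 ≠ []
  ne_nil₂ : t.2 ≠ []
  cnt_eq : cnt t.1 = cnt t.2
  isPath : ∃ P Q, IsPath P t.1 Q ∧ IsPath P t.2 Q
  expo₁ : ∀ a ∈ crossingLines t.1, expo t.1 a = 0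
  expo₂ : ∀ a ∈ crossingLines t.2, expo t.2 a = 0
  word : t.word₁ = t.word₂.map (swapLine N)

theorem InterchangePair.swap {N : ℕ} {t : ChainPair} (h : InterchangePair N t) :
    InterchangePair N t.swap := by
  obtain ⟨P, Q, h1, h2⟩ := h.isPath
  refine ⟨h.ne_nil₂, h.ne_nil₁, h.cnt_eq.symm, ⟨P, Q, h2, h1⟩, h.expo₂, h.expo₁, ?_⟩
  change t.word₂ = t.word₁.map _
  rw [h.word, List.map_map]
  refine (List.map_id _).symm.trans (List.map_congr_left fun a _ => ?_)
  exact (swapLine_swapLine N a).symm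

/-- Vertical lines in two successive slices, leading from position `p` to position `t` through
position `q` or `q'`. -/
def verticalPairs (N p q q' t : ℕ) : List Bool → List ChainPair
  | [] => []
  | a :: l =>
    (strand a (N, p) [((N + 1, q), .vertical), ((N + 2, t), .vertical)],
      strand a (N, p) [((N + 1, q'), .vertical), ((N + 2, t), .vertical)]) ::
      verticalPairs N (p + 1) (q + 1) (q' + 1) (t + 1) l

theorem verticalPairs_fst (N p q q' t : ℕ) (l : List Bool) :
    ((verticalPairs N p q q' t l).flatMap Prod.fst).Perm
      (verticals N p q l ++ verticals (N + 1) q t l) := by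
  induction l generalizing p q q' t with
  | nil => exact List.Perm.nil
  | cons a l ih =>
    have h1 := strand_two a (N, p) (N + 1, q) (N + 2, t) .vertical .vertical
    have h2 := ih (p + 1) (q + 1) (q' + 1) (t + 1)
    simp only [verticalPairs, verticals, List.flatMap_cons]
    rw [← Multiset.coe_eq_coe] at h1 h2 ⊢
    simp only [← Multiset.coe_add, ← Multiset.cons_coe, ← Multiset.singleton_add,
      Multiset.coe_nil, add_zero, h1, h2]
    abel

theorem verticalPairs_snd (N p q q' t : ℕ) (l : List Bool) :
    ((verticalPairs N p q q' t l).flatMap Prod.snd).Perm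
      (verticals N p q' l ++ verticals (N + 1) q' t l) := by
  induction l generalizing p q q' t with
  | nil => exact List.Perm.nil
  | cons a l ih =>
    have h1 := strand_two a (N, p) (N + 1, q') (N + 2, t) .vertical .vertical
    have h2 := ih (p + 1) (q + 1) (q' + 1) (t + 1)
    simp only [verticalPairs, verticals, List.flatMap_cons]
    rw [← Multiset.coe_eq_coe] at h1 h2 ⊢
    simp only [← Multiset.coe_add, ← Multiset.cons_coe, ← Multiset.singleton_add,
      Multiset.coe_nil, add_zero, h1, h2]
    abel

theorem interchangePair_verticalPairs (N p q q' t : ℕ) (l : List Bool) :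
    ∀ x ∈ verticalPairs N p q q' t l, InterchangePair N x := by
  induction l generalizing p q q' t with
  | nil => simp [verticalPairs]
  | cons a l ih =>
    rw [verticalPairs, List.forall_mem_cons]
    refine ⟨?_, ih _ _ _ _⟩
    cases a
    · exact ⟨by simp [strand], by simp [strand], rfl,
        ⟨(N + 2, t), (N, p), by simp [IsPath, strand, orient]⟩,
        by simp [strand, orient, crossingLines, ArcKind.line],
        by simp [strand, orient, crossingLines, ArcKind.line], rfl⟩
    · exact ⟨by simp [strand], by simp [strand], rfl,
        ⟨(N, p), (N + 2, t), by simp [IsPath, strand, orient]⟩,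
        by simp [strand, orient, crossingLines, ArcKind.line],
        by simp [strand, orient, crossingLines, ArcKind.line], rfl⟩

/-- A piece in the lower or in the upper one of two successive slices, with vertical lines above or
below of it, leading from position `p` to position `q`. -/
def piecePairs (N p q : ℕ) : Piece → List ChainPair
  | .cross a b s =>
    [(strand a (N, p) [((N + 1, p + 1), .cross N s), ((N + 2, q + 1), .vertical)],
      strand a (N, p) [((N + 1, q), .vertical), ((N + 2, q + 1), .cross (N + 1) s)]),
    (strand b (N, p + 1) [((N + 1, p), .cross N !s), ((N + 2, q), .vertical)],
      strand b (N, p + 1) [((N + 1, q + 1), .vertical), ((N + 2, q), .cross (N + 1) !s)])]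
  | .max a =>
    [([orient a (N, p) (N, p + 1) (.max a)],
      strand a (N, p) [((N + 1, q), .vertical), ((N + 1, q + 1), .max a),
        ((N, p + 1), .vertical)])]
  | .min a =>
    [(strand (!a) (N + 2, q) [((N + 1, p), .vertical), ((N + 1, p + 1), .min !a),
        ((N + 2, q + 1), .vertical)],
      [orient (!a) (N + 2, q) (N + 2, q + 1) (.min !a)])]

theorem piecePairs_fst (N p q : ℕ) (x : Piece) :
    ((piecePairs N p q x).flatMap Prod.fst).Perm (x.arcs N p ++ verticals (N + 1) p q x.upper) := by
  rcases x with ⟨a, b, s⟩ | a | a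
  · have h1 := strand_two a (N, p) (N + 1, p + 1) (N + 2, q + 1) (.cross N s) .vertical
    have h2 := strand_two b (N, p + 1) (N + 1, p) (N + 2, q) (.cross N !s) .vertical
    simp only [piecePairs, verticals, List.flatMap_cons, Piece.arcs, Piece.upper, List.flatMap_nil]
    rw [← Multiset.coe_eq_coe] at h1 h2 ⊢
    simp only [← Multiset.coe_add, ← Multiset.cons_coe, ← Multiset.singleton_add,
      Multiset.coe_nil, add_zero, h1, h2]
    abel
  · exact List.Perm.refl _
  · have h1 := strand_three (!a) (N + 2, q) (N + 1, p) (N + 1, p + 1) (N + 2, q + 1) .vertical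
      (.min !a) .vertical
    simp only [piecePairs, verticals, List.flatMap_cons, Piece.arcs, Piece.upper, List.flatMap_nil]
    rw [← Multiset.coe_eq_coe] at h1 ⊢
    simp only [← Multiset.coe_add, ← Multiset.cons_coe, ← Multiset.singleton_add,
      Multiset.coe_nil, add_zero, h1, orient_not]
    abel

theorem piecePairs_snd (N p q : ℕ) (x : Piece) :
    ((piecePairs N p q x).flatMap Prod.snd).Perm (x.arcs (N + 1) q ++ verticals N p q x.lower) := by
  rcases x with ⟨a, b, s⟩ | a | a
  · have h1 := strand_two a (N, p) (N + 1, q) (N + 2, q + 1) .vertical (.cross (N + 1) s)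
    have h2 := strand_two b (N, p + 1) (N + 1, q + 1) (N + 2, q) .vertical (.cross (N + 1) !s)
    simp only [piecePairs, verticals, List.flatMap_cons, Piece.arcs, Piece.lower, List.flatMap_nil]
    rw [← Multiset.coe_eq_coe] at h1 h2 ⊢
    simp only [← Multiset.coe_add, ← Multiset.cons_coe, ← Multiset.singleton_add,
      Multiset.coe_nil, add_zero, h1, h2]
    abel
  · have h1 := strand_three a (N, p) (N + 1, q) (N + 1, q + 1) (N, p + 1) .vertical
      (.max a) .vertical
    simp only [piecePairs, verticals, List.flatMap_cons, Piece.arcs, Piece.lower, List.flatMap_nil]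
    rw [← Multiset.coe_eq_coe] at h1 ⊢
    simp only [← Multiset.coe_add, ← Multiset.cons_coe, ← Multiset.singleton_add,
      Multiset.coe_nil, add_zero, h1, orient_not]
    abel
  · exact List.Perm.refl _

theorem interchangePair_piecePairs (N p q : ℕ) (x : Piece) :
    ∀ t ∈ piecePairs N p q x, InterchangePair N t := by
  have expo_zero : ∀ (a : Bool) (P : Point) (l : List (Point × ArcKind)),
      (∀ q ∈ l, q.2.countD = 0 ∧ q.2.countU = 0) → ∀ x ∈ crossingLines (strand a P l),
      expo (strand a P l) x = 0 := fun a P l h x _ => expo_strand_eq_zero a P h x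
  rcases x with ⟨a, b, s⟩ | a | a
  · simp only [piecePairs, List.forall_mem_cons, List.not_mem_nil, false_imp_iff, implies_true,
      and_true]
    constructor
    · refine ⟨?_, ?_, ?_, ?_, expo_zero _ _ _ (by simp [ArcKind.countD, ArcKind.countU]),
        expo_zero _ _ _ (by simp [ArcKind.countD, ArcKind.countU]), ?_⟩
      · cases a <;> simp [strand]
      · cases a <;> simp [strand]
      · cases a <;> rfl
      · cases a
        exacts [⟨(N + 2, q + 1), (N, p), by simp [IsPath, strand, orient]⟩,
          ⟨(N, p), (N + 2, q + 1), by simp [IsPath, strand, orient]⟩]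
      · cases a <;> simp [ChainPair.word₁, ChainPair.word₂, strand, orient, crossingLines,
          ArcKind.line, swapLine_right]
    · refine ⟨?_, ?_, ?_, ?_, expo_zero _ _ _ (by simp [ArcKind.countD, ArcKind.countU]),
        expo_zero _ _ _ (by simp [ArcKind.countD, ArcKind.countU]), ?_⟩
      · cases b <;> simp [strand]
      · cases b <;> simp [strand]
      · cases b <;> rfl
      · cases b
        exacts [⟨(N + 2, q), (N, p + 1), by simp [IsPath, strand, orient]⟩,
          ⟨(N, p + 1), (N + 2, q), by simp [IsPath, strand, orient]⟩]
      · cases b <;> simp [ChainPair.word₁, ChainPair.word₂, strand, orient, crossingLines,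
          ArcKind.line, swapLine_right]
  · simp only [piecePairs, List.forall_mem_cons, List.not_mem_nil, false_imp_iff, implies_true,
      and_true]
    cases a
    · exact ⟨by simp, by simp [strand], rfl,
        ⟨(N, p + 1), (N, p), by simp [IsPath, strand, orient]⟩,
        by simp [orient, crossingLines, ArcKind.line],
        by simp [strand, orient, crossingLines, ArcKind.line], rfl⟩
    · exact ⟨by simp, by simp [strand], rfl,
        ⟨(N, p), (N, p + 1), by simp [IsPath, strand, orient]⟩,
        by simp [orient, crossingLines, ArcKind.line],
        by simp [strand, orient, crossingLines, ArcKind.line], rfl⟩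
  · simp only [piecePairs, List.forall_mem_cons, List.not_mem_nil, false_imp_iff, implies_true,
      and_true]
    cases a
    · exact ⟨by simp [strand], by simp, rfl,
        ⟨(N + 2, q), (N + 2, q + 1), by simp [IsPath, strand, orient]⟩,
        by simp [strand, orient, crossingLines, ArcKind.line],
        by simp [orient, crossingLines, ArcKind.line], rfl⟩
    · exact ⟨by simp [strand], by simp, rfl,
        ⟨(N + 2, q + 1), (N + 2, q), by simp [IsPath, strand, orient]⟩,
        by simp [strand, orient, crossingLines, ArcKind.line],
        by simp [orient, crossingLines, ArcKind.line], rfl⟩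

end Diag

namespace StrictOrientedQuantumCoalgebra

variable (Q : StrictOrientedQuantumCoalgebra k C)

/-- The two sides have the same strands, extrema and crossings; only the numbers of the two slices
are exchanged. The evaluations agree after renaming the letters by `swapLine`, and the two factors
commute. -/
theorem replaceable_interchange (N : ℕ) (l m r : List Bool) (x y : Piece) :
    Q.Replaceable N 0 [⟨l, x, m ++ y.lower ++ r⟩, ⟨l ++ x.upper ++ m, y, r⟩]
      [⟨l ++ x.lower ++ m, y, r⟩, ⟨l, x, m ++ y.upper ++ r⟩] := by
  obtain ⟨p, hp⟩ : ∃ p, l.length = p := ⟨_, rfl⟩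
  obtain ⟨n, hn⟩ : ∃ n, m.length = n := ⟨_, rfl⟩
  obtain ⟨xl, hxl⟩ : ∃ n, x.lower.length = n := ⟨_, rfl⟩
  obtain ⟨xu, hxu⟩ : ∃ n, x.upper.length = n := ⟨_, rfl⟩
  obtain ⟨yl, hyl⟩ : ∃ n, y.lower.length = n := ⟨_, rfl⟩
  obtain ⟨yu, hyu⟩ : ∃ n, y.upper.length = n := ⟨_, rfl⟩
  -- The piece x goes from the lower to the upper slice and y the other way, whence the swapped
  -- pairs for y. A vertical line is joined with its continuation in the other slice, since its
  -- middle point may move sideways.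
  let mid : List ChainPair := verticalPairs N 0 0 0 0 l ++ piecePairs N p p x ++
    verticalPairs N (p + xl) (p + xu) (p + xl) (p + xu) m ++
    (piecePairs N (p + xl + n) (p + xu + n) y).map Prod.swap ++
    verticalPairs N (p + xl + n + yl) (p + xu + n + yl) (p + xl + n + yu) (p + xu + n + yu) r
  have hmid : ∀ t ∈ mid, InterchangePair N t := by
    intro t ht
    simp only [mid, List.mem_append, List.mem_map] at ht
    rcases ht with (((ht | ht) | ht) | ⟨t, ht, rfl⟩) | ht
    · exact interchangePair_verticalPairs _ _ _ _ _ _ t ht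
    · exact interchangePair_piecePairs _ _ _ _ t ht
    · exact interchangePair_verticalPairs _ _ _ _ _ _ t ht
    · exact (interchangePair_piecePairs _ _ _ _ t ht).swap
    · exact interchangePair_verticalPairs _ _ _ _ _ _ t ht
  have swap_fst : ∀ c : List ChainPair, (c.map Prod.swap).flatMap Prod.fst = c.flatMap Prod.snd :=
    fun c => List.flatMap_map _ _ _
  have swap_snd : ∀ c : List ChainPair, (c.map Prod.swap).flatMap Prod.snd = c.flatMap Prod.fst :=
    fun c => List.flatMap_map _ _ _
  have perm₂ : (mid.flatMap Prod.snd).Perm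
      (arcsFrom N [⟨l ++ x.lower ++ m, y, r⟩, ⟨l, x, m ++ y.upper ++ r⟩]) := by
    have h1 := verticalPairs_snd N 0 0 0 0 l
    have h2 := piecePairs_snd N p p x
    have h3 := verticalPairs_snd N (p + xl) (p + xu) (p + xl) (p + xu) m
    have h4 := piecePairs_fst N (p + xl + n) (p + xu + n) y
    have h5 := verticalPairs_snd N (p + xl + n + yl) (p + xu + n + yl) (p + xl + n + yu)
      (p + xu + n + yu) r
    simp only [mid, List.flatMap_append, swap_snd]
    simp only [arcsFrom, Slice.arcs, verticals_append, List.length_append, hp, hn, hxl, hxu, hyl,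
      hyu, zero_add, ← add_assoc, List.append_nil]
    rw [← Multiset.coe_eq_coe] at h1 h2 h3 h4 h5 ⊢
    simp only [← Multiset.coe_add] at h1 h2 h3 h4 h5 ⊢
    rw [h1, h2, h3, h4, h5]
    abel
  refine ⟨[], mid, 0, 0, ⟨rfl, ?_, perm₂, by simp, Or.inl rfl, fun t ht => (hmid t ht).ne_nil₁,
    fun t ht => (hmid t ht).cnt_eq, fun t ht => ?_⟩, fun _ t ht => (hmid t ht).ne_nil₂,
    fun _ _ => rfl, fun _ _ => rfl, fun t ht => (hmid t ht).expo₁, fun t ht => (hmid t ht).expo₂,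
    fun s => ?_⟩
  · have h1 := verticalPairs_fst N 0 0 0 0 l
    have h2 := piecePairs_fst N p p x
    have h3 := verticalPairs_fst N (p + xl) (p + xu) (p + xl) (p + xu) m
    have h4 := piecePairs_snd N (p + xl + n) (p + xu + n) y
    have h5 := verticalPairs_fst N (p + xl + n + yl) (p + xu + n + yl) (p + xl + n + yu)
      (p + xu + n + yu) r
    simp only [mid, List.flatMap_append, swap_fst, List.nil_append]
    simp only [arcsFrom, Slice.arcs, verticals_append, List.length_append, hp, hn, hxl, hxu, hyl,
      hyu, zero_add, ← add_assoc, List.append_nil]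
    rw [← Multiset.coe_eq_coe] at h1 h2 h3 h4 h5 ⊢
    simp only [← Multiset.coe_add] at h1 h2 h3 h4 h5 ⊢
    rw [h1, h2, h3, h4, h5]
    abel
  · obtain ⟨P, R, h1, h2⟩ := (hmid t ht).isPath
    exact ⟨P, R, h1, by rwa [lowerPt_zero, lowerPt_zero]⟩
  · have hw : (mid.flatMap ChainPair.word₂).Perm (crossingLines
        (arcsFrom N [⟨l ++ x.lower ++ m, y, r⟩, ⟨l, x, m ++ y.upper ++ r⟩])) := by
      have e : mid.flatMap ChainPair.word₂ = crossingLines (mid.flatMap Prod.snd) :=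
        (crossingLines_flatMap Prod.snd mid).symm
      rw [e]
      exact perm₂.filterMap _
    refine bigev_sim (ρ := swapLine N) (fun a b h => ?_) (g := fun _ => LinearMap.id)
      (τ := fun _ => LinearMap.id) (fun _ _ => IsCoalgMap.id) (fun t ht => (hmid t ht).word)
      (hw.nodup_iff.2 (nodup_crossingLines_arcsFrom _ _)) (fun b hb => ?_) (fun _ _ _ _ => rfl)
      (fun u z hz => ?_) 0 0 (fun _ => rfl) s
    · rw [← swapLine_swapLine N a, h, swapLine_swapLine]
    · exact Q.linearAt_pw (Q.prodFrom_linearAt (hw.mem_iff.1 hb)) 0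
    · have e1 : ∀ o, z (N, o) = u (N + 1, o) := fun o => by rw [hz, swapLine_left]; rfl
      have e2 : ∀ o, z (N + 1, o) = u (N, o) := fun o => by rw [hz, swapLine_right]; rfl
      simp only [Pi.zero_apply, Q.pw_zero, prodFrom, fac, e1, e2]
      ring

end StrictOrientedQuantumCoalgebra

end Interchange

/-! ## Straightening and cancellation -/

section Removal

open Coalgebra Diag

universe u v

set_option linter.unusedSectionVars false

variable {k : Type u} {C : Type v} [Field k] [AddCommGroup C] [Module k C] [Coalgebra k C]

namespace Diag

/-- The lower end, if `b = true`, and the upper end of a strand in position `p` of two slices. -/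
def strandEnd (N p : ℕ) (b : Bool) : Point := if b then (N, p) else (N + 2, p)

/-- The given lists of arcs lead from one end of two slices to the other, at successive positions
starting with `p`, with the prescribed orientations. -/
def Strands (N : ℕ) : ℕ → List Bool → List (List Arc) → Prop
  | _, [], [] => True
  | p, a :: s, c :: cs =>
    (IsPath (strandEnd N p a) c (strandEnd N p !a) ∧ cnt c = 0 ∧
      ∀ x ∈ crossingLines c, expo c x = 0) ∧ Strands N (p + 1) s cs
  | _, _, _ => False

theorem Strands.append {N p : ℕ} {s t : List Bool} {c d : List (List Arc)} (h : Strands N p s c)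
    (h' : Strands N (p + s.length) t d) : Strands N p (s ++ t) (c ++ d) := by
  induction s generalizing p c with
  | nil =>
    rcases c with _ | ⟨x, c⟩
    · exact h'
    · exact h.elim
  | cons a s ih =>
    rcases c with _ | ⟨x, c⟩
    · exact h.elim
    · refine ⟨h.1, ih h.2 ?_⟩
      rwa [add_assoc, add_comm 1]

theorem Strands.length_eq {N p : ℕ} {s : List Bool} {c : List (List Arc)} (h : Strands N p s c) :
    c.length = s.length := by
  induction s generalizing p c with
  | nil =>
    rcases c with _ | ⟨x, c⟩
    · rfl
    · exact h.elim
  | cons a s ih =>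
    rcases c with _ | ⟨x, c⟩
    · exact h.elim
    · simp [ih h.2]

theorem Strands.getD {N p : ℕ} {s : List Bool} {c : List (List Arc)} (h : Strands N p s c) {i : ℕ}
    (hi : i < s.length) : IsPath (strandEnd N (p + i) (s.getD i false)) (c.getD i [])
      (strandEnd N (p + i) !(s.getD i false)) := by
  induction s generalizing p c i with
  | nil => simp at hi
  | cons a s ih =>
    rcases c with _ | ⟨x, c⟩
    · exact h.elim
    · rcases i with _ | i
      · exact h.1.1
      · have := ih h.2 (i := i) (by simpa using hi)
        rw [add_assoc, add_comm 1] at this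
        simpa using this

theorem Strands.of_mem {N p : ℕ} {s : List Bool} {c : List (List Arc)} (h : Strands N p s c)
    {x : List Arc} (hx : x ∈ c) : (∃ q a, IsPath (strandEnd N q a) x (strandEnd N q !a)) ∧
      cnt x = 0 ∧ ∀ y ∈ crossingLines x, expo x y = 0 := by
  induction s generalizing p c with
  | nil =>
    rcases c with _ | ⟨z, c⟩
    · simp at hx
    · exact h.elim
  | cons a s ih =>
    rcases c with _ | ⟨z, c⟩
    · exact h.elim
    · rcases List.mem_cons.1 hx with rfl | hx
      · exact ⟨⟨p, a, h.1.1⟩, h.1.2⟩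
      · exact ih h.2 hx

theorem lowerPt_strandEnd (N p : ℕ) (b : Bool) : lowerPt N 2 (strandEnd N p b) = (N, p) := by
  cases b <;> simp [lowerPt, strandEnd]

theorem strandEnd_ne (N p : ℕ) (b : Bool) : strandEnd N p b ≠ strandEnd N p !b := by
  cases b <;> simp [strandEnd]

/-- Two slices which consist of strands leading from the bottom to the top correspond to the empty
list of slices. -/
theorem Strands.chainCorr {N : ℕ} {s : List Bool} {c : List (List Arc)} (h : Strands N 0 s c)
    {X : List Slice} (hX : X.length = 2) (hperm : c.flatten.Perm (arcsFrom N X)) :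
    ChainCorr N 2 X [] [] (c.map fun x => (x, [])) := by
  have forall_map : ∀ {p : ChainPair → Prop}, (∀ x ∈ c, p (x, [])) →
      ∀ t ∈ c.map fun x => (x, []), p t := by
    intro p hp t ht
    obtain ⟨x, hx, rfl⟩ := List.mem_map.1 ht
    exact hp x hx
  refine ⟨hX, ?_, ?_, by simp, Or.inl rfl, forall_map fun x hx e => ?_,
    forall_map fun x hx => (h.of_mem hx).2.1, forall_map fun x hx => ?_⟩
  · rw [List.nil_append, List.flatMap_map]
    simpa [List.flatMap_id'] using hperm
  · rw [List.nil_append, List.flatMap_map]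
    simp [arcsFrom]
  · obtain ⟨q, a, hp⟩ := (h.of_mem hx).1
    simp only at e
    rw [e] at hp
    exact strandEnd_ne N q a hp
  · obtain ⟨q, a, hp⟩ := (h.of_mem hx).1
    exact ⟨_, _, hp, by rw [lowerPt_strandEnd, lowerPt_strandEnd]; rfl⟩

/-! ### Inserting strands into closed paths -/

theorem mem_pts_of_mem_allPts {n : ℕ} {s t : List Bool} {D : List Slice} (h : Composable s D t)
    {P : Point} (hP : P ∈ allPts n s D) (hn : P.1 = n + D.length) :
    P ∈ pts P.1 0 t false ∨ P ∈ pts P.1 0 t true := by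
  induction D generalizing n s with
  | nil =>
    cases h
    rw [hn]
    exact List.mem_append.1 hP
  | cons x D ih =>
    rw [List.length_cons] at hn
    rw [allPts, List.mem_append] at hP
    rcases hP with hP | hP
    · rw [List.mem_append] at hP
      rcases hP with hP | hP <;> have := (mem_pts hP).1 <;> omega
    · exact ih h.2 hP (by omega)

theorem mem_pts_of_mem_allPts' {n : ℕ} {s t : List Bool} {D : List Slice} (h : Composable s D t)
    {P : Point} (hP : P ∈ allPts n s D) (hn : P.1 = n) :
    P ∈ pts n 0 s false ∨ P ∈ pts n 0 s true := by
  rcases D with _ | ⟨x, D⟩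
  · exact List.mem_append.1 hP
  · rw [allPts, List.mem_append] at hP
    rcases hP with hP | hP
    · exact List.mem_append.1 hP
    · have := le_of_mem_allPts hP
      omega

/-- The orientation of the ends of the arcs at the top of a diagram. -/
theorem getD_of_mem_lower {A : List Slice} {s : List Bool} (hA : Composable [] A s) {x : Arc}
    (hx : x ∈ arcs A) (b : Bool) (h : (x.pt b).1 = A.length) :
    (x.pt b).2 < s.length ∧ s.getD (x.pt b).2 false = !b := by
  have h1 := arcsFrom_pts 0 hA b
  have h2 : x.pt b ∈ (arcsFrom 0 A).map (Arc.pt b) := List.mem_map_of_mem hx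
  have h3 : x.pt b ∈ allPts 0 [] A := h1.mem_iff.1 (by simp only [List.mem_append]; tauto)
  have h4 := h1.nodup_iff.2 (nodup_allPts _ _ _)
  rw [List.nodup_append] at h4
  have h5 : x.pt b ∉ pts (0 + A.length) 0 s b := fun h =>
    h4.2.2 _ (List.mem_append_left _ h2) _ h rfl
  have h6 := mem_pts_of_mem_allPts hA h3 (by omega)
  rw [h] at h6
  rw [zero_add] at h5
  cases b
  · rcases h6 with h6 | h6
    · exact absurd h6 h5
    · obtain ⟨-, -, h7, h8⟩ := mem_pts h6
      exact ⟨by omega, by simpa using h8⟩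
  · rcases h6 with h6 | h6
    · obtain ⟨-, -, h7, h8⟩ := mem_pts h6
      exact ⟨by omega, by simpa using h8⟩
    · exact absurd h6 h5

/-- The orientation of the ends of the arcs at the bottom of a diagram. -/
theorem getD_of_mem_upper {n : ℕ} {B : List Slice} {s : List Bool} (hB : Composable s B [])
    {x : Arc} (hx : x ∈ arcsFrom n B) (b : Bool) (h : (x.pt b).1 = n) :
    (x.pt b).2 < s.length ∧ s.getD (x.pt b).2 false = b := by
  have h1 := arcsFrom_pts n hB b
  have h2 : x.pt b ∈ (arcsFrom n B).map (Arc.pt b) := List.mem_map_of_mem hx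
  have h3 : x.pt b ∈ allPts n s B := h1.mem_iff.1 (by simp only [List.mem_append]; tauto)
  have h4 := h1.nodup_iff.2 (nodup_allPts _ _ _)
  rw [List.nodup_append] at h4
  have h5 : x.pt b ∉ pts n 0 s !b := fun h =>
    (List.nodup_append.1 h4.1).2.2 _ h2 _ h rfl
  have h6 := mem_pts_of_mem_allPts' hB h3 h
  cases b
  · rcases h6 with h6 | h6
    · obtain ⟨-, -, h7, h8⟩ := mem_pts h6
      exact ⟨by omega, by simpa using h8⟩
    · exact absurd h6 h5
  · rcases h6 with h6 | h6
    · exact absurd h6 h5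
    · obtain ⟨-, -, h7, h8⟩ := mem_pts h6
      exact ⟨by omega, by simpa using h8⟩

theorem pts_flatMap_perm (n p : ℕ) (s : List Bool) (f : ℕ → List Arc) :
    ((pts n p s false ++ pts n p s true).flatMap fun P => f P.2).Perm
      ((List.range' p s.length).flatMap f) := by
  induction s generalizing p with
  | nil => exact List.Perm.refl _
  | cons a s ih =>
    have h := ih (p + 1)
    simp only [List.length_cons, List.range'_succ, List.flatMap_cons]
    cases a
    · simp only [pts, if_true, Bool.false_eq_true, if_false, List.cons_append, List.flatMap_cons]
      exact h.append_left _
    · simp only [pts, if_true, Bool.true_eq_false, if_false]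
      refine (List.perm_middle.flatMap_right _).trans ?_
      rw [List.flatMap_cons]
      exact h.append_left _

/-- Isolates the points on the line between A and B, where strands are to be inserted. -/
theorem allPts_append_perm {n : ℕ} {r s : List Bool} {A B : List Slice} (hA : Composable r A s) :
    ∃ l : List Point, (∀ P ∈ l, P.1 ≠ n + A.length) ∧ (allPts n r (A ++ B)).Perm
      (l ++ (pts (n + A.length) 0 s false ++ pts (n + A.length) 0 s true)) := by
  induction A generalizing n r with
  | nil =>
    cases hA
    rcases B with _ | ⟨y, B⟩
    · exact ⟨[], by simp, List.Perm.refl _⟩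
    · refine ⟨allPts (n + 1) y.upper B, fun P hP => ?_, List.perm_append_comm⟩
      have := le_of_mem_allPts hP
      simp only [List.length_nil]
      omega
  | cons x A ih =>
    obtain ⟨l, h1, h2⟩ := ih (n := n + 1) hA.2
    have e : n + (x :: A).length = n + 1 + A.length := by simp; omega
    rw [e]
    refine ⟨pts n 0 r false ++ pts n 0 r true ++ l, fun P hP => ?_, ?_⟩
    · rw [List.mem_append, List.mem_append] at hP
      rcases hP with (hP | hP) | hP
      · have := (mem_pts hP).1; omega
      · have := (mem_pts hP).1; omega
      · exact h1 P hP
    · rw [List.cons_append, allPts, List.append_assoc _ l]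
      exact h2.append_left _

/-- Insert into a closed path, in front of every arc which starts on the line between A and B, the
strand at its starting point. Each point is the start of exactly one arc, so each strand is used
exactly once. -/
theorem HasClosed.insert {A B X : List Slice} {s : List Bool} {c : List (List Arc)}
    (hA : Composable [] A s) (hB : Composable s B []) (h : Strands A.length 0 s c)
    (hX : X.length = 2) (hperm : c.flatten.Perm (arcsFrom A.length X))
    (hAB : HasClosed (A ++ B)) : HasClosed (A ++ X ++ B) := by
  obtain ⟨P, ⟨τ⟩⟩ := hAB
  obtain ⟨N, hN⟩ : ∃ N, A.length = N := ⟨_, rfl⟩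
  have hD : Composable [] (A ++ B) [] := hA.append hB
  have hout : ((ChainCorr.outer 2 N A B []).flatMap Prod.snd).Perm (arcs (A ++ B)) := by
    rw [ChainCorr.outer_flatMap_snd, List.append_nil, arcs, arcs, arcsFrom_append, zero_add, hN]
  obtain ⟨d, R, h1, h2, h3⟩ := exists_chains_closed Prod.snd τ.isPath
    ((τ.perm.map _).nodup_iff.2 (nodup_src hD)) ((τ.perm.map _).nodup_iff.2 (nodup_tgt hD))
    (hout.trans τ.perm.symm) (ChainCorr.forall_outer (fun _ _ => by simp) (fun _ _ => by simp)
      (fun _ _ => by simp)) (ChainCorr.forall_outer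
        (p := fun t => ∃ P Q, IsPath P t.2 Q) (fun x _ => ⟨x.src, x.tgt, rfl, rfl⟩)
        (fun x _ => ⟨x.src, x.tgt, rfl, rfl⟩) (fun x _ => ⟨x.src, x.tgt, rfl, rfl⟩))
  let f : Point → List Arc := fun P => if P.1 = N then c.getD P.2 [] else []
  -- A point on line N is replaced by a strand; the value `true` selects the end where the strand is
  -- entered, `false` the end where it is left. Points above are shifted by the two new slices.
  let φ : Bool → Point → Point := fun b P =>
    if P.1 < N then P else if N < P.1 then (P.1 + 2, P.2) else
      strandEnd N P.2 (if b then s.getD P.2 false else !s.getD P.2 false)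
  have hφ : ∀ P : Point, (P.1 = N → P.2 < s.length) → IsPath (φ true P) (f P) (φ false P) := by
    rintro ⟨m, p⟩ hp
    rcases lt_trichotomy m N with hm | rfl | hm
    · simp [φ, f, hm, hm.ne, IsPath]
    · rw [hN] at h
      simpa [φ, f] using h.getD (hp rfl)
    · simp [φ, f, hm, hm.ne', hm.not_gt, IsPath]
  -- An arc of the old diagram is replaced by the strand inserted at its source, if there is one,
  -- followed by the corresponding arc of the new diagram.
  let G : ChainPair → List Arc := fun t => (t.2.map Arc.src).flatMap f ++ t.1
  have hpath : IsPath (φ true R) (d.flatMap G) (φ true R) := by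
    refine isPath_flatMap Prod.snd G (φ true) h3 fun t ht => ?_
    refine ChainCorr.forall_outer (p := fun t => ∀ P Q, IsPath P t.2 Q →
      IsPath (φ true P) (G t) (φ true Q)) (fun x hx => ?_) (fun x hx => ?_) (fun x hx => ?_) t
      (h1.mem_iff.1 ht)
    · rintro _ _ ⟨rfl, rfl⟩
      have hl := level_of_mem_arcsFrom hx
      have h4 := getD_of_mem_lower hA hx true
      have h5 := getD_of_mem_lower hA hx false
      rw [hN] at h4 h5
      simp only [Arc.pt, if_true, Bool.false_eq_true, if_false] at h4 h5
      -- An arc below line N which starts on this line goes down and leaves the inserted strand at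
      -- its lower end; one which ends there goes up and enters the strand at its lower end.
      refine IsPath.append (by simpa using hφ x.src fun e => (h4 e).1) ⟨?_, ?_⟩
      · simp only [φ, Bool.false_eq_true, if_false]
        split_ifs with g1 g2
        · rfl
        · omega
        · rw [(h4 (by omega)).2]
          exact Prod.ext (by simp [strandEnd]; omega) rfl
      · show x.tgt = _
        simp only [φ, if_true]
        split_ifs with g1 g2
        · rfl
        · omega
        · rw [(h5 (by omega)).2]
          exact Prod.ext (by simp [strandEnd]; omega) rfl
    · simp at hx
    · rintro _ _ ⟨rfl, rfl⟩
      have hl := level_of_mem_arcsFrom hx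
      have h4 := getD_of_mem_upper hB hx true
      have h5 := getD_of_mem_upper hB hx false
      simp only [Arc.pt, if_true, Bool.false_eq_true, if_false] at h4 h5
      -- Above the line it is the upper end of the strand, two levels higher, at which these arcs
      -- start or end.
      refine IsPath.append (by simpa using hφ x.src fun e => (h4 e).1) ⟨?_, ?_⟩
      · show shiftPt 2 0 x.src = _
        simp only [φ, Bool.false_eq_true, if_false]
        split_ifs with g1 g2
        · omega
        · rfl
        · rw [(h4 (by omega)).2]
          exact Prod.ext (by simp [strandEnd, shiftPt]; omega) rfl
      · show shiftPt 2 0 x.tgt = _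
        simp only [φ, if_true]
        split_ifs with g1 g2
        · omega
        · rfl
        · rw [(h5 (by omega)).2]
          exact Prod.ext (by simp [strandEnd, shiftPt]; omega) rfl
  refine ⟨_, ⟨⟨d.flatMap G, ?_, hpath⟩⟩⟩
  have hsplit : (d.flatMap G).Perm
      (((d.flatMap Prod.snd).map Arc.src).flatMap f ++ d.flatMap Prod.fst) := by
    clear h1 h2 h3 hpath
    induction d with
    | nil => exact List.Perm.nil
    | cons t d ih =>
      simp only [List.flatMap_cons, List.map_append, List.flatMap_append, G]
      rw [← Multiset.coe_eq_coe] at ih ⊢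
      simp only [← Multiset.coe_add] at ih ⊢
      rw [ih]
      abel
  refine hsplit.trans ?_
  have hf : (((d.flatMap Prod.snd).map Arc.src).flatMap f).Perm c.flatten := by
    have e1 : ((d.flatMap Prod.snd).map Arc.src).Perm (allPts 0 [] (A ++ B)) :=
      ((h2.trans τ.perm).map _).trans (arcs_pts hD true)
    obtain ⟨l, hl, e2⟩ := allPts_append_perm (n := 0) (B := B) hA
    rw [zero_add, hN] at hl e2
    refine ((e1.trans e2).flatMap_right f).trans ?_
    have e3 : l.flatMap f = [] := List.flatMap_eq_nil_iff.2 fun P hP => if_neg (hl P hP)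
    have e4 : (pts N 0 s false ++ pts N 0 s true).flatMap f =
        (pts N 0 s false ++ pts N 0 s true).flatMap fun P => c.getD P.2 [] := by
      refine List.flatMap_congr fun P hP => if_pos ?_
      rcases List.mem_append.1 hP with hP | hP <;> exact (mem_pts hP).1
    rw [List.flatMap_append, e3, List.nil_append, e4]
    refine (pts_flatMap_perm N 0 s fun i => c.getD i []).trans ?_
    rw [← h.length_eq, ← List.range_eq_range', List.flatMap_def]
    refine List.Perm.of_eq (congrArg List.flatten ?_)
    refine List.ext_getElem (by simp) fun i h5 h6 => ?_
    simp [h6]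
  have hfst : (d.flatMap Prod.fst).Perm (arcs A ++ arcsFrom (N + 2) B) := by
    refine (h1.flatMap_right _).trans ?_
    rw [ChainCorr.outer_flatMap_fst, List.append_nil]
  refine ((hf.trans hperm).append hfst).trans ?_
  rw [arcs, arcs, arcsFrom_append, arcsFrom_append, List.length_append, zero_add, zero_add, hX, hN]
  rw [← Multiset.coe_eq_coe]
  simp only [← Multiset.coe_add]
  abel

/-! ### Strands made of vertical lines -/

/-- Vertical lines in two successive slices, leading from position `p` to position `p` through
position `q`. -/
def verticalStrands (N p q : ℕ) : List Bool → List (List Arc)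
  | [] => []
  | a :: l => strand a (N, p) [((N + 1, q), .vertical), ((N + 2, p), .vertical)] ::
    verticalStrands N (p + 1) (q + 1) l

theorem verticalStrands_perm (N p q : ℕ) (l : List Bool) :
    (verticalStrands N p q l).flatten.Perm (verticals N p q l ++ verticals (N + 1) q p l) := by
  induction l generalizing p q with
  | nil => exact List.Perm.nil
  | cons a l ih =>
    have h1 := strand_two a (N, p) (N + 1, q) (N + 2, p) .vertical .vertical
    have h2 := ih (p + 1) (q + 1)
    simp only [verticalStrands, verticals, List.flatten_cons]
    rw [← Multiset.coe_eq_coe] at h1 h2 ⊢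
    simp only [← Multiset.coe_add, ← Multiset.cons_coe, ← Multiset.singleton_add,
      Multiset.coe_nil, add_zero, h1, h2]
    abel

theorem crossingLines_verticalStrands (N p q : ℕ) (l : List Bool) :
    ∀ x ∈ verticalStrands N p q l, crossingLines x = [] := by
  induction l generalizing p q with
  | nil => simp [verticalStrands]
  | cons a l ih =>
    rw [verticalStrands, List.forall_mem_cons]
    exact ⟨by cases a <;> rfl, ih _ _⟩

theorem strands_verticalStrands (N p q : ℕ) (l : List Bool) :
    Strands N p l (verticalStrands N p q l) := by
  induction l generalizing p q with
  | nil => trivial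
  | cons a l ih =>
    refine ⟨⟨?_, ?_, fun _ _ => expo_strand_eq_zero _ _ (by simp [ArcKind.countD,
      ArcKind.countU]) _⟩, ih _ _⟩
    · cases a <;> simp [IsPath, strand, orient, strandEnd]
    · cases a <;> rfl

end Diag

end Removal

/-! ## Invariance of the values under regular isotopy -/

section RegularIsotopy

open Coalgebra Diag

universe u v

set_option linter.unusedSectionVars false

variable {k : Type u} {C : Type v} [Field k] [AddCommGroup C] [Module k C] [Coalgebra k C]

theorem bigev_of_forall_eq_nil {α σ : Type*} [DecidableEq α] {W : σ → List α} {l : List σ}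
    (h : ∀ t ∈ l, W t = []) (M : (α → C) → k) (y : α → C) (s : σ → C) :
    bigev W l M y s = (l.map fun t => counit (R := k) (s t)).prod * M y := by
  induction l generalizing y with
  | nil => simp [bigev]
  | cons t l ih =>
    rw [List.forall_mem_cons] at h
    rw [bigev, h.1, List.map_cons, List.prod_cons, mul_assoc, ← ih h.2]
    rfl

theorem dsumO_mul_const (a : Bool) (r : k) (f : C → C → k) (c : C) :
    dsumO a (fun x y => f x y * r) c = dsumO a f c * r := by
  cases a
  · exact dsum_mul_const r (fun x y => f y x) c
  · exact dsum_mul_const r f c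

theorem Diag.Composable.split {s t : List Bool} {D E : List Slice} (h : Composable s (D ++ E) t) :
    ∃ u, Composable s D u ∧ Composable u E t := by
  induction D generalizing s with
  | nil => exact ⟨s, rfl, h⟩
  | cons x D ih =>
    obtain ⟨u, h1, h2⟩ := ih h.2
    exact ⟨u, ⟨h.1, h1⟩, h2⟩

/-! ### Removable pairs of slices -/

namespace StrictOrientedQuantumCoalgebra

variable (Q : StrictOrientedQuantumCoalgebra k C)

/-- Two slices which consist of strands leading from the bottom to the top, and which do not
contribute to the functionals. -/
def Removable (N : ℕ) (s : List Bool) (X : List Slice) : Prop :=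
  ∃ c : List (List Arc), Strands N 0 s c ∧ X.length = 2 ∧ c.flatten.Perm (arcsFrom N X) ∧
    ∀ s : List Arc → C, bigev crossingLines c (Q.prodFrom N X) 0 s =
      (c.map fun x => counit (R := k) (s x)).prod

variable {Q}

/-- The product of counits is what the empty words contribute after the removal, since an empty word
is evaluated by the counit. -/
theorem Removable.replaceable {N : ℕ} {s : List Bool} {X : List Slice} (h : Q.Removable N s X) :
    Q.Replaceable N 2 X [] := by
  obtain ⟨c, h1, h2, h3, h4⟩ := h
  refine ⟨[], _, 0, 0, h1.chainCorr h2 h3, fun e => by simp at e, fun _ _ => rfl, fun _ _ => rfl,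
    fun t ht => ?_, fun t ht => ?_, fun s => ?_⟩
  · obtain ⟨x, hx, rfl⟩ := List.mem_map.1 ht
    exact (h1.of_mem hx).2.2
  · obtain ⟨x, hx, rfl⟩ := List.mem_map.1 ht
    exact fun _ ha => by simp [crossingLines] at ha
  · rw [bigev_of_forall_eq_nil (W := ChainPair.word₂) fun t ht => by
      obtain ⟨x, hx, rfl⟩ := List.mem_map.1 ht
      rfl, bigev_map]
    simp only [Pi.zero_apply, Q.pw_zero]
    refine (h4 _).trans ?_
    rw [List.map_map, prodFrom, mul_one]
    rfl

variable (Q)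

/-- Used for straightening, where no crossing is involved; the equality of counts, contained in
`Strands`, is the only condition with content there. -/
theorem removable_of_forall_eq_nil {N : ℕ} {s : List Bool} {X : List Slice} {c : List (List Arc)}
    (h : Strands N 0 s c) (hX : X.length = 2) (hperm : c.flatten.Perm (arcsFrom N X))
    (hc : ∀ x ∈ c, crossingLines x = []) (h1 : Q.prodFrom N X 0 = 1) : Q.Removable N s X :=
  ⟨c, h, hX, hperm, fun s => by rw [bigev_of_forall_eq_nil hc, h1, mul_one]⟩

theorem removable_straighten_right (N : ℕ) (l r : List Bool) (a : Bool) :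
    Q.Removable N (l ++ [a] ++ r) [⟨l ++ [a], .min (!a), r⟩, ⟨l, .max a, a :: r⟩] := by
  obtain ⟨p, hp⟩ : ∃ p, l.length = p := ⟨_, rfl⟩
  have hs : Strands N (0 + l.length) [a]
      -- The maximum and the minimum are traversed in the same horizontal direction, so their
      -- contributions to the counts cancel.
      [strand a (N, p) [((N + 1, p), .vertical), ((N + 1, p + 1), .max a),
      ((N + 1, p + 2), .min a), ((N + 2, p), .vertical)]] := by
    refine ⟨⟨?_, ?_, ?_⟩, trivial⟩
    · rw [hp]
      cases a <;> simp [IsPath, strand, orient, strandEnd]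
    · cases a <;> rfl
    · cases a <;> simp [strand, orient, crossingLines, ArcKind.line]
  have hr : Strands N (0 + (l ++ [a]).length) r (verticalStrands N (p + 1) (p + 3) r) := by
    simpa [hp] using strands_verticalStrands N (p + 1) (p + 3) r
  refine Q.removable_of_forall_eq_nil
    (((strands_verticalStrands N 0 0 l).append hs).append hr) rfl ?_ ?_ ?_
  · have h1 := verticalStrands_perm N 0 0 l
    have h2 := verticalStrands_perm N (p + 1) (p + 3) r
    have h3 := strand_four a (N, p) (N + 1, p) (N + 1, p + 1) (N + 1, p + 2) (N + 2, p) .vertical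
      (.max a) (.min a) .vertical
    simp only [arcsFrom, Slice.arcs, Piece.arcs, verticals_append, verticals, List.length_append,
      List.length_cons, List.length_nil, Piece.lower, Piece.upper, List.flatten_append,
      List.flatten_cons, List.flatten_nil, add_assoc, zero_add, add_zero, hp, Nat.reduceAdd,
      Bool.not_not]
    rw [← Multiset.coe_eq_coe] at h1 h2 h3 ⊢
    simp only [← Multiset.coe_add, ← Multiset.cons_coe, ← Multiset.singleton_add,
      Multiset.coe_nil, List.append_assoc, add_zero, h1, h2, h3]
    abel
  · intro x hx
    simp only [List.mem_append, List.mem_singleton] at hx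
    rcases hx with (hx | rfl) | hx
    · exact crossingLines_verticalStrands _ _ _ _ x hx
    · cases a <;> rfl
    · exact crossingLines_verticalStrands _ _ _ _ x hx
  · simp [prodFrom, fac_max, fac_min]

theorem removable_straighten_left (N : ℕ) (l r : List Bool) (a : Bool) :
    Q.Removable N (l ++ [a] ++ r) [⟨l, .min a, a :: r⟩, ⟨l ++ [a], .max (!a), r⟩] := by
  obtain ⟨p, hp⟩ : ∃ p, l.length = p := ⟨_, rfl⟩
  have hs : Strands N (0 + l.length) [a]
      [strand a (N, p) [((N + 1, p + 2), .vertical), ((N + 1, p + 1), .max !a),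
      ((N + 1, p), .min !a), ((N + 2, p), .vertical)]] := by
    refine ⟨⟨?_, ?_, ?_⟩, trivial⟩
    · rw [hp]
      cases a <;> simp [IsPath, strand, orient, strandEnd]
    · cases a <;> rfl
    · cases a <;> simp [strand, orient, crossingLines, ArcKind.line]
  have hr : Strands N (0 + (l ++ [a]).length) r (verticalStrands N (p + 1) (p + 3) r) := by
    simpa [hp] using strands_verticalStrands N (p + 1) (p + 3) r
  refine Q.removable_of_forall_eq_nil
    (((strands_verticalStrands N 0 0 l).append hs).append hr) rfl ?_ ?_ ?_
  · have h1 := verticalStrands_perm N 0 0 l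
    have h2 := verticalStrands_perm N (p + 1) (p + 3) r
    have h3 := strand_four a (N, p) (N + 1, p + 2) (N + 1, p + 1) (N + 1, p) (N + 2, p) .vertical
      (.max !a) (.min !a) .vertical
    simp only [arcsFrom, Slice.arcs, Piece.arcs, verticals_append, verticals, List.length_append,
      List.length_cons, List.length_nil, Piece.lower, Piece.upper, List.flatten_append,
      List.flatten_cons, List.flatten_nil, add_assoc, zero_add, add_zero, hp, Nat.reduceAdd]
    rw [← Multiset.coe_eq_coe] at h1 h2 h3 ⊢
    simp only [← Multiset.coe_add, ← Multiset.cons_coe, ← Multiset.singleton_add,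
      Multiset.coe_nil, List.append_assoc, add_zero, h1, h2, h3, orient_not]
    abel
  · intro x hx
    simp only [List.mem_append, List.mem_singleton] at hx
    rcases hx with (hx | rfl) | hx
    · exact crossingLines_verticalStrands _ _ _ _ x hx
    · cases a <;> rfl
    · exact crossingLines_verticalStrands _ _ _ _ x hx
  · simp [prodFrom, fac_max, fac_min]

/-- The two strands meet twice, and the evaluation at the elements x, y of the strands is the
convolution product of two inverse forms, that is, ε(x) ε(y). -/
theorem removable_cancel (N : ℕ) (l r : List Bool) (a b s : Bool) :
    Q.Removable N (l ++ [a, b] ++ r) [⟨l, .cross a b s, r⟩, ⟨l, .cross b a (!s), r⟩] := by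
  obtain ⟨p, hp⟩ : ∃ p, l.length = p := ⟨_, rfl⟩
  let X : List Slice := [⟨l, .cross a b s, r⟩, ⟨l, .cross b a (!s), r⟩]
  let cA : List Arc := strand a (N, p) [((N + 1, p + 1), .cross N s), ((N + 2, p), .cross (N + 1) s)]
  let cB : List Arc :=
    strand b (N, p + 1) [((N + 1, p), .cross N !s), ((N + 2, p + 1), .cross (N + 1) !s)]
  let vl := verticalStrands N 0 0 l
  let vr := verticalStrands N (p + 2) (p + 2) r
  have hperm : (vl ++ [cA, cB] ++ vr).flatten.Perm (arcsFrom N X) := by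
    have h1 := verticalStrands_perm N 0 0 l
    have h2 := verticalStrands_perm N (p + 2) (p + 2) r
    have h3 := strand_two a (N, p) (N + 1, p + 1) (N + 2, p) (.cross N s) (.cross (N + 1) s)
    have h4 := strand_two b (N, p + 1) (N + 1, p) (N + 2, p + 1) (.cross N !s) (.cross (N + 1) !s)
    simp only [X, vl, vr, cA, cB, arcsFrom, Slice.arcs, Piece.arcs, List.length_cons,
      List.length_nil, Piece.lower, Piece.upper, List.flatten_append, List.flatten_cons,
      List.flatten_nil, add_assoc, zero_add, hp, Nat.reduceAdd, Bool.not_not]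
    rw [← Multiset.coe_eq_coe] at h1 h2 h3 h4 ⊢
    simp only [← Multiset.coe_add, ← Multiset.cons_coe, ← Multiset.singleton_add,
      Multiset.coe_nil, List.append_assoc, add_zero, h1, h2, h3, h4]
    abel
  have hn : ((vl ++ [cA, cB] ++ vr).flatMap crossingLines).Nodup := by
    have e : (vl ++ [cA, cB] ++ vr).flatMap crossingLines =
        crossingLines (vl ++ [cA, cB] ++ vr).flatten := by
      have h := crossingLines_flatMap (fun x : List Arc => x) (vl ++ [cA, cB] ++ vr)
      rw [List.flatMap_id'] at h
      exact h.symm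
    rw [e]
    exact (hperm.filterMap _).nodup_iff.2 (nodup_crossingLines_arcsFrom _ _)
  have hs : Strands N (0 + l.length) [a, b] [cA, cB] := by
    refine
      ⟨⟨?_, ?_, fun _ _ => expo_strand_eq_zero _ _ (by simp [ArcKind.countD, ArcKind.countU]) _⟩,
      ⟨?_, ?_, fun _ _ => expo_strand_eq_zero _ _ (by simp [ArcKind.countD, ArcKind.countU]) _⟩,
      trivial⟩
    · rw [hp]
      cases a <;> simp [cA, IsPath, strand, orient, strandEnd]
    · cases a <;> rfl
    · rw [hp]
      cases b <;> simp [cB, IsPath, strand, orient, strandEnd]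
    · cases b <;> rfl
  have hr : Strands N (0 + (l ++ [a, b]).length) r vr := by
    simpa [hp] using strands_verticalStrands N (p + 2) (p + 2) r
  refine ⟨vl ++ [cA, cB] ++ vr, ((strands_verticalStrands N 0 0 l).append hs).append hr, rfl, hperm,
    fun y => ?_⟩
  -- The two crossing strands are evaluated first; the vertical ones contribute only counits.
  · have hp' : (vl ++ [cA, cB] ++ vr).Perm (cA :: cB :: (vl ++ vr)) := by
      rw [← Multiset.coe_eq_coe]
      simp only [← Multiset.coe_add, ← Multiset.cons_coe, ← Multiset.singleton_add,
        Multiset.coe_nil, add_zero]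
      abel
    have hv : ∀ x ∈ vl ++ vr, crossingLines x = [] := by
      intro x hx
      rcases List.mem_append.1 hx with hx | hx <;>
        exact crossingLines_verticalStrands _ _ _ _ x hx
    have hv' : (vl ++ vr).flatMap crossingLines = [] := List.flatMap_eq_nil_iff.2 hv
    have hA : crossingLines cA = if a then [(N, s), (N + 1, s)] else [(N + 1, s), (N, s)] := by
      cases a <;> rfl
    have hB : crossingLines cB = if b then [(N, !s), (N + 1, !s)] else [(N + 1, !s), (N, !s)] := by
      cases b <;> rfl
    have lin : ∀ (i : Fin X.length) (o : Bool), X[i].piece.isCross = true →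
        LinearAt (Q.prodFrom N X) (N + i, o) := fun i o h =>
      Q.prodFrom_linearAt ((mem_crossingLines_arcsFrom _ _ _ _).2 ⟨i, rfl, h⟩)
    rw [bigev_perm _ hp' hn, (hp'.map _).prod_eq, List.map_cons, List.map_cons, List.prod_cons,
      List.prod_cons, ← mul_assoc, bigev_cons_pair hA (by simp) (lin 0 _ rfl) (lin 1 _ rfl)
        (by rw [List.flatMap_cons, hB, hv']; split_ifs <;> simp)
        (by rw [List.flatMap_cons, hB, hv']; split_ifs <;> simp)]
    refine (dsumO_congr _ (fun u v => bigev_cons_pair hB (by simp) (lin 0 _ rfl) (lin 1 _ rfl)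
      (by rw [hv']; simp) (by rw [hv']; simp) _ _) _).trans ?_
    rw [← (Q.isConvPair_crossForm a b s).1, ← dsumO_mul_const]
    refine dsumO_congr _ (fun u v => ?_) _
    rw [← dsumO_mul_const]
    refine dsumO_congr _ (fun u' v' => ?_) _
    rw [bigev_of_forall_eq_nil hv, mul_comm]
    simp [X, prodFrom, fac_cross]

end StrictOrientedQuantumCoalgebra

/-! ### From local moves to regular isotopy -/

namespace TwistOrientedQuantumCoalgebra

variable {Q : TwistOrientedQuantumCoalgebra k C} {c : C}

/-- Removing the slices shortens a closed path by `Removable.replaceable`; conversely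
`HasClosed.insert` provides a closed path in the longer diagram. The condition on X ensures that the
strands on the two sides of the cut match. -/
theorem SameValue.of_removable (hc : IsCocommutativeElement k c) {L L' : LinkDiagram}
    {A B X : List Slice} {s : List Bool}
    (h : Q.toStrictOrientedQuantumCoalgebra.Removable A.length s X)
    (hX : ∀ u B, Composable u (X ++ B) [] → u = s ∧ Composable s B [])
    (hL : L.slices = A ++ X ++ B) (hL' : L'.slices = A ++ [] ++ B) : Q.SameValue c L L' := by
  refine SameValue.of_replaceable hc h.replaceable hL hL' fun hAB => ?_
  have hD := L.composable
  rw [hL, List.append_assoc] at hD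
  obtain ⟨u, hA, hB⟩ := hD.split
  obtain ⟨rfl, hB⟩ := hX u B hB
  obtain ⟨cs, h1, h2, h3, -⟩ := h
  rw [List.append_nil] at hAB
  exact hAB.insert hA hB h1 h2 h3

theorem SameValue.of_replaceable_zero (hc : IsCocommutativeElement k c) {L L' : LinkDiagram}
    {A B X Y : List Slice}
    (h : Q.toStrictOrientedQuantumCoalgebra.Replaceable A.length 0 X Y)
    (hL : L.slices = A ++ X ++ B) (hL' : L'.slices = A ++ Y ++ B) : Q.SameValue c L L' := by
  refine SameValue.of_replaceable hc h hL hL' ?_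
  rintro ⟨P, ⟨τ⟩⟩
  obtain ⟨-, R, R', -, τ₂, -⟩ := h.symm.exists_closed rfl (hL' ▸ L'.composable) τ
  exact ⟨R', ⟨τ₂⟩⟩

theorem SameValue.of_move (hc : IsCocommutativeElement k c) {L L' : LinkDiagram} (h : Move L L') :
    Q.SameValue c L L' := by
  obtain ⟨A, B, X, Y, h, hL, hL'⟩ := h
  cases h with
  | straighten_right l r a =>
    refine SameValue.of_removable hc (StrictOrientedQuantumCoalgebra.removable_straighten_right _ A.length l r a) ?_ hL hL'
    rintro u B ⟨h1, h2, h3⟩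
    simp only [Slice.lower, Slice.upper, Piece.lower, Piece.upper, List.append_nil] at h1 h3
    exact ⟨h1, by simpa using h3⟩
  | straighten_left l r a =>
    refine SameValue.of_removable hc (StrictOrientedQuantumCoalgebra.removable_straighten_left _ A.length l r a) ?_ hL hL'
    rintro u B ⟨h1, h2, h3⟩
    simp only [Slice.lower, Slice.upper, Piece.lower, Piece.upper, List.append_nil] at h1 h3
    exact ⟨by simpa using h1, by simpa using h3⟩
  | cancel l r a b s =>
    refine SameValue.of_removable hc (StrictOrientedQuantumCoalgebra.removable_cancel _ A.length l r a b s) ?_ hL hL'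
    rintro u B ⟨h1, h2, h3⟩
    exact ⟨h1, h3⟩
  | braid l r a b c s =>
    exact of_replaceable_zero hc
      (StrictOrientedQuantumCoalgebra.replaceable_braid _ _ l r a b c s) hL hL'
  | slide_max l r a b s =>
    exact of_replaceable_zero hc
      (StrictOrientedQuantumCoalgebra.replaceable_slide_max _ _ l r a b s) hL hL'
  | slide_min l r a b s =>
    exact of_replaceable_zero hc
      (StrictOrientedQuantumCoalgebra.replaceable_slide_min _ _ l r a b s) hL hL'
  | interchange l m r x y =>
    exact of_replaceable_zero hc
      (StrictOrientedQuantumCoalgebra.replaceable_interchange _ _ l m r x y) hL hL'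

theorem SameValue.of_regularlyIsotopic (hc : IsCocommutativeElement k c) {L L' : LinkDiagram}
    (h : RegularlyIsotopic L L') : Q.SameValue c L L' := by
  induction h with
  | rel L L' h => exact of_move hc h
  | refl L => exact SameValue.refl hc L
  | symm L L' _ ih => exact ih.symm
  | trans L L' L'' _ _ ih ih' => exact ih.trans ih'

end TwistOrientedQuantumCoalgebra

end RegularIsotopy

/-! ## The closure of a 1-1 tangle diagram -/

section Closure

open Coalgebra Diag

universe u v

set_option linter.unusedSectionVars false

variable {k : Type u} {C : Type v} [Field k] [AddCommGroup C] [Module k C] [Coalgebra k C]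

namespace Diag

/-- A vertical line which passes through `j` slices, starting with slice number `n`, at the left
side of a diagram. -/
def column (a : Bool) : ℕ → ℕ → List Arc
  | _, 0 => []
  | n, j + 1 =>
    if a then orient a (n, 0) (n + 1, 0) .vertical :: column a (n + 1) j
    else column a (n + 1) j ++ [orient a (n, 0) (n + 1, 0) .vertical]

theorem column_perm_succ (a : Bool) (n j : ℕ) : (column a n (j + 1)).Perm
    (orient a (n, 0) (n + 1, 0) .vertical :: column a (n + 1) j) := by
  cases a
  · exact List.perm_append_comm
  · exact List.Perm.refl _

theorem isPath_column (a : Bool) (n j : ℕ) : IsPath (if a then (n, 0) else (n + j, 0)) (column a n j)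
    (if a then (n + j, 0) else (n, 0)) := by
  induction j generalizing n with
  | zero => cases a <;> rfl
  | succ j ih =>
    have h := ih (n + 1)
    rw [add_assoc, add_comm 1 j] at h
    cases a
    · exact IsPath.append h ⟨rfl, rfl⟩
    · exact ⟨rfl, h⟩

theorem column_kind (a : Bool) (n j : ℕ) : ∀ x ∈ column a n j, x.kind = .vertical := by
  induction j generalizing n with
  | zero => simp [column]
  | succ j ih =>
    intro x hx
    rw [(column_perm_succ a n j).mem_iff, List.mem_cons] at hx
    rcases hx with rfl | hx
    · exact orient_kind _ _ _ _
    · exact ih _ x hx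

theorem cnt_column (a : Bool) (n j : ℕ) : cnt (column a n j) = 0 := by
  have h : ∀ l : List Arc, (∀ x ∈ l, x.kind = .vertical) → cnt l = 0 := by
    intro l hl
    induction l with
    | nil => rfl
    | cons x l ih =>
      rw [List.forall_mem_cons] at hl
      rw [cnt_cons, ih hl.2, cnt, List.map_singleton, List.map_singleton, hl.1]
      rfl
  exact h _ (column_kind a n j)

theorem crossingLines_column (a : Bool) (n j : ℕ) : crossingLines (column a n j) = [] :=
  List.filterMap_eq_nil_iff.2 fun x hx => by rw [column_kind a n j x hx]; rfl

theorem arcsFrom_addLeft (a : Bool) (n : ℕ) (D : List Slice) :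
    (arcsFrom n (D.map (Slice.addLeft a))).Perm
      (column a n D.length ++ (arcsFrom n D).map (Arc.shift 0 1)) := by
  induction D generalizing n with
  | nil => exact List.Perm.refl _
  | cons x D ih =>
    have h1 := ih (n + 1)
    have h2 := column_perm_succ a n D.length
    simp only [List.map_cons, arcsFrom, List.length_cons, slice_addLeft, List.map_append]
    rw [← Multiset.coe_eq_coe] at h1 h2 ⊢
    simp only [← Multiset.coe_add, ← Multiset.cons_coe, ← Multiset.singleton_add,
      h1, h2, List.cons_append]
    abel

/-- The path which joins the ends of a tangle diagram with `n` slices in its closure. -/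
def closingPath (up : Bool) (n : ℕ) : List Arc :=
  if up then
    orient (!up) (n + 1, 0) (n + 1, 1) (.max !up) :: (column (!up) 1 n ++
      [orient up (1, 0) (1, 1) (.min up)])
  else
    orient up (1, 0) (1, 1) (.min up) :: (column (!up) 1 n ++
      [orient (!up) (n + 1, 0) (n + 1, 1) (.max !up)])

theorem closingPath_perm (up : Bool) (n : ℕ) : (closingPath up n).Perm
    ([orient up (1, 0) (1, 1) (.min up)] ++ column (!up) 1 n ++
      [orient (!up) (n + 1, 0) (n + 1, 1) (.max !up)]) := by
  rw [closingPath]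
  split_ifs
  · rw [← Multiset.coe_eq_coe]
    simp only [← Multiset.coe_add, ← Multiset.cons_coe, ← Multiset.singleton_add, Multiset.coe_nil,
      add_zero]
    abel
  · exact List.Perm.refl _

theorem isPath_closingPath (up : Bool) (n : ℕ) :
    IsPath (if up then (n + 1, 1) else (1, 1)) (closingPath up n)
      (if up then (1, 1) else (n + 1, 1)) := by
  have h := isPath_column (!up) 1 n
  rw [add_comm 1 n] at h
  cases up
  · exact ⟨rfl, IsPath.append h ⟨rfl, rfl⟩⟩
  · exact ⟨rfl, IsPath.append h ⟨rfl, rfl⟩⟩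

theorem crossingLines_closingPath (up : Bool) (n : ℕ) : crossingLines (closingPath up n) = [] := by
  rw [← List.perm_nil]
  refine ((closingPath_perm up n).filterMap _).trans (List.Perm.of_eq ?_)
  refine (crossingLines_append _ _).trans ?_
  rw [crossingLines_append, crossingLines_column]
  cases up <;> rfl

/-- The closing line contains one maximum and one minimum with the same sense of rotation, one
counted in each component. -/
theorem cnt_closingPath (up : Bool) (n : ℕ) :
    ∃ e : ℤ, cnt (closingPath up n) = (e, e) := by
  rw [cnt_perm (closingPath_perm up n), cnt_append, cnt_append, cnt_column]
  cases up
  · exact ⟨-1, rfl⟩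
  · exact ⟨1, rfl⟩

theorem arcs_closure (T : TangleDiagram) : (arcs T.closure.slices).Perm
    ((arcs T.slices).map (Arc.shift 1 1) ++ closingPath T.up T.slices.length) := by
  have h1 := arcsFrom_addLeft (!T.up) 1 T.slices
  have h2 := closingPath_perm T.up T.slices.length
  have e1 : arcs T.closure.slices = [orient T.up (1, 0) (1, 1) (.min T.up)] ++
      (arcsFrom 1 (T.slices.map (Slice.addLeft !T.up)) ++
        [orient (!T.up) (T.slices.length + 1, 0) (T.slices.length + 1, 1) (.max !T.up)]) := by
    rw [arcs, TangleDiagram.closure, arcsFrom, arcsFrom_append, List.length_map, zero_add,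
      add_comm 1 T.slices.length]
    simp [Slice.arcs, Piece.arcs, verticals, arcsFrom]
  have e2 : (arcsFrom 1 T.slices).map (Arc.shift 0 1) = (arcs T.slices).map (Arc.shift 1 1) := by
    have h := arcsFrom_shift 1 0 T.slices
    rw [zero_add] at h
    rw [h, List.map_map]
    refine List.map_congr_left fun x _ => ?_
    rcases x with ⟨P, Q, t⟩
    cases t <;> rfl
  rw [e2] at h1
  rw [e1]
  rw [← Multiset.coe_eq_coe] at h1 h2 ⊢
  simp only [← Multiset.coe_add] at h1 h2 ⊢
  rw [h1, h2]
  abel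

/-- The closed path in the closure of a tangle diagram which starts at the base point of the tangle
diagram. -/
def closureTraversal (T : TangleDiagram) :
    Traversal T.closure.slices (shiftPt 1 1 (endPoint T.up T.slices.length))
      (shiftPt 1 1 (endPoint T.up T.slices.length)) where
  path := T.traversal.path.map (Arc.shift 1 1) ++ closingPath T.up T.slices.length
  perm := ((T.traversal.perm.map _).append_right _).trans (arcs_closure T).symm
  isPath := by
    refine (isPath_shift 1 1 T.traversal.isPath).append ?_
    have h := isPath_closingPath T.up T.slices.length
    cases hu : T.up <;> rw [hu] at h <;> simpa [endPoint, shiftPt] using h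

end Diag

namespace StrictOrientedQuantumCoalgebra

variable (Q : StrictOrientedQuantumCoalgebra k C)

/-- The closing line is traversed last and has no crossing. It keeps the word, up to renumbering,
and adds (e, e) to all exponents, which `prodFrom_pw` removes. -/
theorem pathForm_closureTraversal (T : TangleDiagram) (c : C) :
    Q.pathForm T.closure.slices (closureTraversal T).path c =
      Q.pathForm T.slices T.traversal.path c := by
  obtain ⟨e, he⟩ := cnt_closingPath T.up T.slices.length
  let w := T.traversal.path
  let ρ : ℕ × Bool → ℕ × Bool := fun a => (a.1 + 1, a.2)
  have hρ : Function.Injective ρ := by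
    rintro ⟨m, o⟩ ⟨m', o'⟩ h
    simpa [ρ] using h
  have hw : crossingLines (closureTraversal T).path = (crossingLines w).map ρ := by
    refine (crossingLines_append _ _).trans ?_
    rw [crossingLines_closingPath, List.append_nil]
    exact crossingLines_shift 1 1 w
  have hexpo : ∀ a ∈ crossingLines w, expo (closureTraversal T).path (ρ a) = (e, e) + expo w a := by
    intro a ha
    refine (expo_append_of_mem ?_ _).trans ?_
    · rw [crossingLines_shift]
      exact List.mem_map_of_mem ha
    · rw [he, add_comm]
      exact congrArg _ (expo_shift 1 1 w a)
  have hmem : ∀ a, a ∈ crossingLines (arcsFrom 0 T.slices) → a ∈ crossingLines w := fun a ha =>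
    (T.traversal.perm.filterMap _).mem_iff.2 ha
  rw [pathForm, pathForm, hw]
  refine ev_sim hρ (g := fun _ => LinearMap.id) (τ := LinearMap.id) IsCoalgMap.id
    (nodup_of_perm T.traversal.perm) (Q.pathForm_linearAt T.traversal.perm _) (fun _ _ => rfl)
    (fun y z hz => ?_) 0 0 (fun _ => rfl) c
  have e1 : ∀ x, Q.prodFrom 0 T.closure.slices x =
      Q.prodFrom 1 (T.slices.map (Slice.addLeft !T.up)) x := fun x => by
    rw [TangleDiagram.closure, prodFrom, prodFrom_append]
    simp [prodFrom, fac_max, fac_min]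
  have e2 : ∀ x, Q.prodFrom 1 (T.slices.map (Slice.addLeft !T.up)) x =
      Q.prodFrom 0 T.slices fun a => x (ρ a) := fun x => by
    refine Q.prodFrom_congr ?_ fun m o _ => ?_
    · rw [List.forall₂_map_left_iff]
      exact List.forall₂_same.2 fun _ _ => rfl
    · simp [ρ, add_comm]
  rw [e1, e2, ← Q.prodFrom_pw 0 T.slices (e, e) fun a => Q.pw (expo w a) (z a)]
  refine Q.prodFrom_congr_mem fun a ha => ?_
  rw [hexpo a (hmem a ha), pw_add, hz]
  rfl

end StrictOrientedQuantumCoalgebra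

end Closure

/-! ## Reversing the orientation -/

section Reversal

open Coalgebra Diag

universe u v

set_option linter.unusedSectionVars false

variable {k : Type u} {C : Type v} [Field k] [AddCommGroup C] [Module k C] [Coalgebra k C]

/-! ### Sweedler sums in the opposite coalgebra -/

/-- In the opposite coalgebra the first letter receives the last component of the iterated
coproduct, and so on, hence the word is read backwards. -/
theorem ev_cop {α : Type*} [DecidableEq α] {w : List α} (hw : w.Nodup) {M : (α → C) → k}
    (hM : ∀ a ∈ w, LinearAt M a) (y : α → C) (c : C) :
    ev (C := Cop C) w M y c = ev w.reverse M y c := by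
  induction w generalizing y c with
  | nil => rfl
  | cons a w ih =>
    have hw' := hw
    have hM' := hM
    rw [List.nodup_cons] at hw
    rw [List.forall_mem_cons] at hM
    have e1 : ∀ (x c' : C), ev (C := Cop C) w M (Function.update y a x) c' =
        ev w.reverse M (Function.update y a x) c' := fun x c' => ih hw.2 hM.2 _ c'
    have hlin : IsBilin k fun x c' : C => ev w.reverse M (Function.update y a x) c' :=
      ⟨fun c' => (hM.1.ev (by simpa using hw.1) c') y,
        fun x => ev_isLinearMap (List.nodup_reverse.2 hw.2)
          (fun b hb => hM.2 b (List.mem_reverse.1 hb)) _⟩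
    have e2 : ev (C := Cop C) (a :: w) M y c =
        dsum (C := Cop C) k (fun x c' => ev w.reverse M (Function.update y a x) c') c :=
      dsum_congr (C := Cop C) e1 c
    rw [e2]
    refine (dsum_cop hlin c).trans ?_
    rw [List.reverse_cons, ev_append (by rw [← List.reverse_cons]; exact List.nodup_reverse.2 hw')
      (fun b hb => hM' b (by simpa [or_comm] using hb))]
    refine dsum_congr (fun x c' => ?_) c
    rw [ev_update _ _ (by simpa using hw.1)]
    exact ev_congr (fun z => (ev_singleton hM.1 z c').symm) _ _ _

namespace Diag

/-! ### Paths in the opposite direction -/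

/-- An extremum traversed from right to left becomes one traversed from left to right: types d₊ and
u₋ are interchanged, as are d₋ and u₊. -/
theorem cnt_op (l : List Arc) : cnt (l.map Arc.op).reverse = -(cnt l).swap := by
  have h : ∀ x : Arc, x.op.kind.countD = -x.kind.countU ∧ x.op.kind.countU = -x.kind.countD := by
    rintro ⟨P, Q, t⟩
    rcases t with _ | _ | t | t
    · exact ⟨rfl, rfl⟩
    · exact ⟨rfl, rfl⟩
    · cases t <;> exact ⟨rfl, rfl⟩
    · cases t <;> exact ⟨rfl, rfl⟩
  rw [cnt_perm (List.reverse_perm _)]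
  induction l with
  | nil => rfl
  | cons x l ih =>
    rw [List.map_cons, cnt_cons, ih, cnt_cons x l]
    ext
    · simp [cnt, (h x).1]; ring
    · simp [cnt, (h x).2]; ring

theorem line_op (x : Arc) : x.op.kind.line = x.kind.line := by
  rcases x with ⟨P, Q, t⟩
  cases t <;> rfl

theorem crossingLines_op (l : List Arc) :
    crossingLines (l.map Arc.op).reverse = (crossingLines l).reverse := by
  rw [crossingLines, List.filterMap_reverse, List.filterMap_map]
  exact congrArg List.reverse (congrArg (List.filterMap · l) (funext line_op))

/-- The exponents of a closed path and of its opposite. -/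
theorem expo_op {L : LinkDiagram} {l : List Arc} {P : Point} (h : l.Perm (arcs L.slices))
    (hl : IsPath P l P) : ∃ f : ℤ × ℤ, ∀ a ∈ crossingLines l, ∃ x, L.slices[a.1]? = some x ∧
      expo (l.map Arc.op).reverse a =
        f + ((-((x.piece.lineDir a.2).toNat : ℤ), ((x.piece.lineDir a.2).toNat : ℤ)) + expo l a) := by
  obtain ⟨o, ho⟩ := exists_compat L.composable
  let d := L.whitneyDegree
  -- What follows a line in the opposite path is what precedes it in l, reversed. With counts (p, q)
  -- behind the line in l this gives (d + q, d + p), and p - q is the direction of the line minus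
  -- that at P.
  refine ⟨(d + (o P).toNat, d - (o P).toNat), fun a ha => ?_⟩
  obtain ⟨x, hx, hxa⟩ := List.mem_filterMap.1 ha
  obtain ⟨l1, l2, rfl⟩ := List.append_of_mem hx
  obtain ⟨z, hz, hz'⟩ := (ho x (h.mem_iff.1 hx)).2 a hxa
  refine ⟨z, hz, ?_⟩
  have hnd := (h.filterMap _).nodup_iff.2 (nodup_crossingLines_arcsFrom 0 L.slices)
  have e0 : crossingLines (l1 ++ x :: l2) = crossingLines l1 ++ a :: crossingLines l2 := by
    rw [crossingLines_append, crossingLines_cons_some hxa]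
  have hnd' : (crossingLines l1 ++ a :: crossingLines l2).Nodup := e0 ▸ hnd
  have h1 : a ∉ crossingLines l1 := fun h' =>
    (List.nodup_append.1 hnd').2.2 a h' a (by simp) rfl
  have h2 : a ∉ crossingLines l2 := (List.nodup_cons.1 (List.nodup_append.1 hnd').2.1).1
  have e1 : expo (l1 ++ x :: l2) a = cnt l2 := by
    rw [expo_append_of_not_mem h1, expo, if_pos hxa]
  have e2 : expo ((l1 ++ x :: l2).map Arc.op).reverse a = -(cnt l1).swap := by
    rw [List.map_append, List.map_cons, List.reverse_append, List.reverse_cons, List.append_assoc,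
      expo_append_of_not_mem (by rw [crossingLines_op]; simpa using h2), List.singleton_append,
      expo, if_pos (by rw [line_op, hxa]), cnt_op]
  have hcnt : cnt [x] = 0 := by
    rcases x with ⟨S, T, t⟩
    cases t <;> first | rfl | simp [ArcKind.line] at hxa
  have e3 := cnt_closed L h hl
  rw [cnt_append, cnt_cons, hcnt, zero_add] at e3
  obtain ⟨R, -, hR⟩ := hl.split
  have e4 := cnt_sub_of_isPath (fun y hy => (ho y (h.mem_iff.1
    (List.mem_append_right _ (List.mem_cons_of_mem _ hy)))).1) hR.2
  have hc := (ho x (h.mem_iff.1 hx)).1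
  have e5 : o x.src = o x.tgt := by
    rcases x with ⟨S, T, t⟩
    rcases t with _ | _ | t | t
    · simp [ArcKind.line] at hxa
    · exact hc
    · simp [ArcKind.line] at hxa
    · simp [ArcKind.line] at hxa
  rw [← e5, hz'] at e4
  rw [e1, e2]
  have e6 := congrArg Prod.fst e3
  have e7 := congrArg Prod.snd e3
  simp only [Prod.fst_add, Prod.snd_add] at e6 e7
  ext
  · simp only [Prod.fst_neg, Prod.fst_swap, Prod.fst_add]
    omega
  · simp only [Prod.snd_neg, Prod.snd_swap, Prod.snd_add]
    omega

theorem clockwiseSum_op (D : List Slice) : clockwiseSum (D.map Slice.op) = -clockwiseSum D := by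
  have h := cnt_op (arcs D)
  rw [cnt_perm (List.reverse_perm _), arcs, ← arcsFrom_op] at h
  rw [clockwiseSum_eq, clockwiseSum_eq, arcs, h]
  simp only [Prod.fst_neg, Prod.snd_neg, Prod.fst_swap, Prod.snd_swap, arcs]
  ring

theorem KnotDiagram.whitneyDegree_op (K : KnotDiagram) : K.op.whitneyDegree = -K.whitneyDegree := by
  have h1 := K.toLinkDiagram.two_mul_whitneyDegree
  have h2 := K.op.toLinkDiagram.two_mul_whitneyDegree
  have h3 : clockwiseSum K.op.slices = -clockwiseSum K.slices := clockwiseSum_op K.slices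
  omega

end Diag

namespace StrictOrientedQuantumCoalgebra

variable (Q : StrictOrientedQuantumCoalgebra k C)

/-- Reversal of the orientation, on the level of forms. -/
theorem crossForm_op (a b s : Bool) (x y : C) :
    Q.crossForm (!a) (!b) s (Q.pw (-a.toNat, a.toNat) x) (Q.pw (-b.toNat, b.toNat) y) =
      Q.crossForm a b s x y := by
  cases a <;> cases b <;> cases s <;>
    simp [crossForm_true, crossForm_false, bp_pw_left, bp_pw_right, bn_pw_left, bn_pw_right]

/-- Slice by slice application of `crossForm_op`: for upward lines the correction T_d⁻¹ T_u accounts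
for the reversal of the crossing. -/
theorem prodFrom_op {n : ℕ} {D : List Slice} {y z : ℕ × Bool → C}
    (h : ∀ a ∈ crossingLines (arcsFrom n D), ∃ x, n ≤ a.1 ∧ D[a.1 - n]? = some x ∧
      z a = Q.pw (-((x.piece.lineDir a.2).toNat : ℤ), ((x.piece.lineDir a.2).toNat : ℤ)) (y a)) :
    Q.prodFrom n (D.map Slice.op) z = Q.prodFrom n D y := by
  induction D generalizing n with
  | nil => rfl
  | cons x D ih =>
    rw [crossingLines_arcsFrom_cons] at h
    rw [List.map_cons, prodFrom, prodFrom, ih fun a ha => ?_]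
    · congr 1
      rcases x with ⟨l, ⟨a, b, s⟩ | a | a, r⟩
      · have h1 : ∀ o, z (n, o) = Q.pw (-((Piece.cross a b s).lineDir o).toNat,
            ((Piece.cross a b s).lineDir o).toNat) (y (n, o)) := fun o => by
          obtain ⟨x, -, hx, e⟩ := h (n, o) (List.mem_append_left _
            ((mem_crossingLines_slice n n o _).2 ⟨rfl, rfl⟩))
          simp only [Nat.sub_self, List.getElem?_cons_zero, Option.some.injEq] at hx
          rw [e, ← hx]
        change Q.fac n (.cross (!a) (!b) s) z = Q.fac n (.cross a b s) y
        rw [fac_cross, fac_cross, h1, h1]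
        simpa [Piece.lineDir] using Q.crossForm_op a b s (y (n, s)) (y (n, !s))
      · rfl
      · rfl
    · obtain ⟨x', h1, h2, h3⟩ := h a (List.mem_append_right _ ha)
      obtain ⟨i, hi, -⟩ := (mem_crossingLines_arcsFrom _ _ a.2 _).1 ha
      refine ⟨x', by omega, ?_, h3⟩
      rwa [show a.1 - n = (a.1 - (n + 1)) + 1 by omega, List.getElem?_cons_succ] at h2

end StrictOrientedQuantumCoalgebra

namespace TwistOrientedQuantumCoalgebra

variable (Q : TwistOrientedQuantumCoalgebra k C)

theorem cop_prodFrom (n : ℕ) (D : List Slice) (y : ℕ × Bool → C) :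
    Q.cop.prodFrom n D y = Q.prodFrom n D y := by
  induction D generalizing n with
  | nil => rfl
  | cons x D ih =>
    refine congrArg₂ (· * ·) ?_ (ih (n + 1))
    rcases x with ⟨l, ⟨a, b, s⟩ | a | a, r⟩
    · cases a <;> cases b <;> cases s <;> rfl
    · rfl
    · rfl

/-- The opposite structure uses G⁻¹; passing to the opposite coalgebra reverses products, which is
harmless for powers of one element. -/
theorem cop_Gpow (d : ℤ) : Q.cop.Gpow d = Cop.form (Q.Gpow (-d)) := by
  have h1 : Q.cop.Gpow 1 = Cop.form (Q.Gpow (-1)) := by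
    rw [Gpow_one, Gpow_neg_one]
    rfl
  have h2 : Q.cop.Gpow (-1) = Cop.form (Q.Gpow 1) := by
    rw [Gpow_one, Gpow_neg_one]
    rfl
  induction d with
  | zero => rw [neg_zero, Gpow_zero, Gpow_zero, Cop.form_one]
  | succ n ih => rw [Gpow_add, ih, h1, Cop.form_mul, ← Gpow_add, neg_add_rev]
  | pred n ih => rw [sub_eq_add_neg, Gpow_add, ih, h2, Cop.form_mul, ← Gpow_add, neg_add_rev,
    neg_neg 1]

/-- The opposite coalgebra reads the word backwards, as the opposite path does, and the crossing
forms match by `prodFrom_op` once the common offset f of the exponents is removed. -/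
theorem cop_pathForm {L : LinkDiagram} {l : List Arc} {P : Point} (h : l.Perm (arcs L.slices))
    (hl : IsPath P l P) (x : C) : Q.cop.pathForm L.slices l x =
      Q.pathForm (L.slices.map Slice.op) (l.map Arc.op).reverse x := by
  obtain ⟨f, hf⟩ := expo_op h hl
  have e : (fun y : ℕ × Bool → C => Q.cop.prodFrom 0 L.slices fun a => Q.cop.pw (expo l a) (y a)) =
      fun y => Q.prodFrom 0 L.slices fun a => Q.pw (expo l a) (y a) :=
    funext fun y => Q.cop_prodFrom 0 L.slices _
  change _ = ev (crossingLines (l.map Arc.op).reverse) _ 0 x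
  rw [crossingLines_op]
  refine Eq.trans ?_ ((ev_cop (nodup_of_perm h) (Q.pathForm_linearAt h (expo l)) 0 x).trans
    (ev_congr (fun y => ?_) _ _ _))
  · exact congrArg (fun M : (ℕ × Bool → C) → k => ev (C := Cop C) (crossingLines l) M 0 x) e
  · let z : ℕ × Bool → C := fun a => Q.pw (-f) (Q.pw (expo (l.map Arc.op).reverse a) (y a))
    rw [← Q.prodFrom_pw 0 (L.slices.map Slice.op) (-f)]
    refine (Q.prodFrom_op fun a ha => ?_).symm
    obtain ⟨s, hs, e⟩ := hf a ((h.filterMap _).mem_iff.2 ha)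
    refine ⟨s, Nat.zero_le _, hs, ?_⟩
    rw [e, Q.pw_add f, ← Q.pw_add (-f), neg_add_cancel, Q.pw_zero, Q.pw_add]

/-- In the opposite coalgebra the power of G receives the second component of c instead of the first
one; cocommutativity exchanges them. -/
theorem cop_pathValue {L : LinkDiagram} {l : List Arc} {P : Point} (h : l.Perm (arcs L.slices))
    (hl : IsPath P l P) {c : C} (hc : IsCocommutativeElement k c) (d : ℤ) :
    Q.cop.pathValue d L.slices l c =
      Q.pathValue (-d) (L.slices.map Slice.op) (l.map Arc.op).reverse c := by
  have hp : ((l.map Arc.op).reverse).Perm (arcs (L.slices.map Slice.op)) := by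
    rw [arcs, arcsFrom_op]
    exact (List.reverse_perm _).trans (h.map _)
  have hlin : IsBilin k fun x y : C =>
      Q.Gpow (-d) x * Q.pathForm (L.slices.map Slice.op) (l.map Arc.op).reverse y :=
    ⟨fun y => (Q.Gpow (-d)).ofConv.isLinearMap'.mul_const _,
      fun x => (ev_isLinearMap (nodup_of_perm hp) (Q.pathForm_linearAt hp _) 0).const_mul _⟩
  refine (dsum_congr (C := Cop C) (fun x y => ?_) c).trans
    ((dsum_cop hlin c).trans (hc.dsum_comm hlin).symm)
  exact congrArg₂ (· * ·) (congrArg (fun g : WithConv (Cop C →ₗ[k] k) => g x) (Q.cop_Gpow d))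
    (Q.cop_pathForm h hl y)

/-- The value at a closed path in the diagram with the opposite orientation. -/
theorem cop_knotValue (K : KnotDiagram) {P : Point} (τ : Traversal K.slices P P) {c : C}
    (hc : IsCocommutativeElement k c) :
    Q.knotValue c K.op τ.op = Q.cop.knotValue (Cop.equiv k C c) K τ := by
  refine (Q.mul_functional_apply _ τ.op c).trans (Eq.trans ?_
    (Q.cop.mul_functional_apply _ τ (Cop.equiv k C c)).symm)
  rw [K.whitneyDegree_op]
  exact (Q.cop_pathValue τ.perm τ.isPath hc _).symm

end TwistOrientedQuantumCoalgebra

end Reversal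

/-! ### The assertions for knot diagrams -/

section Invariance

open Coalgebra Diag

universe u v

variable {k : Type u} {C : Type v} [Field k] [AddCommGroup C] [Module k C] [Coalgebra k C]

theorem IsCocommutativeElement.cop {c : C} (hc : IsCocommutativeElement k c) :
    IsCocommutativeElement k (Cop.equiv k C c) :=
  congrArg (TensorProduct.comm k C C) hc

namespace TwistOrientedQuantumCoalgebra

variable (Q : TwistOrientedQuantumCoalgebra k C)

theorem knotValue_eq_knotInvariant {c : C} (hc : IsCocommutativeElement k c) (K : KnotDiagram)
    {P : Point} (τ : Traversal K.slices P P) : Q.knotValue c K τ = Q.knotInvariant c K :=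
  (Q.mul_functional_apply _ τ c).trans ((Q.pathValue_closed_unique τ _ hc).trans
    (Q.mul_functional_apply _ _ c).symm)

theorem SameValue.knotValue_eq {Q : TwistOrientedQuantumCoalgebra k C} {c : C} {K K' : KnotDiagram}
    (h : Q.SameValue c K.toLinkDiagram K'.toLinkDiagram) {P P' : Point}
    (τ : Traversal K.slices P P) (τ' : Traversal K'.slices P' P') :
    Q.knotValue c K τ = Q.knotValue c K' τ' :=
  (Q.mul_functional_apply _ τ c).trans ((h.value_eq τ τ').trans
    (Q.mul_functional_apply _ τ' c).symm)

/-- The closure need not be packaged as a knot diagram: its traversal starting at the base point of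
T suffices, and the functional of this traversal is that of T. -/
theorem knotInvariant_of_regularlyIsotopic_closure {c : C} (hc : IsCocommutativeElement k c)
    (K : KnotDiagram) (T : TangleDiagram) (h : RegularlyIsotopic K.toLinkDiagram T.closure) :
    Q.knotInvariant c K = (Q.Gpow K.whitneyDegree * Q.inv T) c := by
  obtain ⟨P, ⟨τ⟩⟩ := K.connected
  have hs : Q.SameValue c K.toLinkDiagram T.closure := SameValue.of_regularlyIsotopic hc h
  rw [← Q.knotValue_eq_knotInvariant hc K τ]
  refine (Q.mul_functional_apply _ τ c).trans ((hs.value_eq τ (closureTraversal T)).trans ?_)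
  rw [← hs.whitneyDegree_eq ⟨P, ⟨τ⟩⟩]
  refine Eq.trans ?_ (Q.mul_functional_apply K.whitneyDegree T.traversal c).symm
  exact dsum_congr (fun x y => congrArg _ (Q.pathForm_closureTraversal T y)) c

end TwistOrientedQuantumCoalgebra

end Invariance

/-! The hypothesis `T_d (T_u c) = c` of the theorem is not used below: by the axiom for `G` it holds for
every cocommutative element. -/

open Diag in
theorem mainTheorem3 {k C : Type*} [Field k] [AddCommGroup C] [Module k C] [Coalgebra k C]
    (Q : TwistOrientedQuantumCoalgebra k C) (c : C) (hc : IsCocommutativeElement k c)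
    (hT : Q.Td (Q.Tu c) = c) :
    (∀ (K : KnotDiagram) (P : Point) (τ : Traversal K.slices P P),
      Q.knotValue c K τ = Q.knotInvariant c K) ∧
    (∀ K K' : KnotDiagram, RegularlyIsotopic K.toLinkDiagram K'.toLinkDiagram →
      Q.knotInvariant c K = Q.knotInvariant c K') ∧
    (∀ (K : KnotDiagram) (T : TangleDiagram), RegularlyIsotopic K.toLinkDiagram T.closure →
      Q.knotInvariant c K = (Q.Gpow K.whitneyDegree * Q.inv T) c) ∧
    (∀ K : KnotDiagram,
      Q.knotInvariant c K.op = Q.cop.knotInvariant (Cop.equiv k C c) K) := by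
  refine ⟨fun K P τ => Q.knotValue_eq_knotInvariant hc K τ, fun K K' h => ?_,
    fun K T h => Q.knotInvariant_of_regularlyIsotopic_closure hc K T h, fun K => ?_⟩
  · exact (TwistOrientedQuantumCoalgebra.SameValue.of_regularlyIsotopic hc h).knotValue_eq _ _
  -- Independence of the starting point allows both values to be computed from τ and its reversal.
  · obtain ⟨P, ⟨τ⟩⟩ := K.connected
    rw [← Q.knotValue_eq_knotInvariant hc K.op τ.op,
      ← Q.cop.knotValue_eq_knotInvariant hc.cop K τ, Q.cop_knotValue K τ hc]
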